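/- Let $q\ge 3$ be a prime such that $p=2q+1$ is also prime, and let $N=C_p\rtimes C_q$ be the non-abelian group of order $pq$. Here $A\rtimes B$ always denotes a semidirect product with $B$ acting faithfully on $A$. Conventions. A permutation group $G$ of degree $n$ is a group acting faithfully and transitively on a set of $n$ elements; $G'$ denotes the stabiliser of a point, and $\mathrm{Aut}(G,G')$ is the group of automorphisms $\theta$ of $G$ with $\theta(G')=G'$. A finite separable field extension $L/K$ with normal closure $E/K$ *realises* $G$ if there is an isomorphism $G\to\mathrm{Gal}(E/K)$ mapping $G'$ onto $\mathrm{Gal}(E/L)$. A *Hopf-Galois structure* on $L/K$ is a cocommutative $K$-Hopf algebra $H$ acting on $L$, making $L$ an $H$-module algebra for which the map $L\otimes_K H\to \mathrm{End}_K(L)$, $x\otimes h\mapsto (y\mapsto x(h\cdot y))$, is bijective; such structures are counted up to isomorphism of Hopf algebras compatible with the actions. It has *type* $N$ if $E\otimes_K H\cong E[N]$ as Hopf algebras over $E$. The group $G$ is *realised by a Hopf-Galois structure of type $N$* if an extension $L/K$ realising $G$ admits a Hopf-Galois structure of type $N$. The extension $L/K$ is *almost classically Galois* if $\mathrm{Gal}(E/L)$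 has a normal complement in $\mathrm{Gal}(E/K)$. Let $\mathrm{Hol}(N)=N\rtimes\mathrm{Aut}(N)$, acting on $N$ by $[\eta,\alpha]\cdot\mu=\eta\,\alpha(\mu)$. For $0\le u\le\frac12(q-1)$, let $\mathbb F_p^2\rtimes_u C_q$ and $\mathbb F_p^2\rtimes_u C_{2q}$ be the semidirect products of $\mathbb F_p^2$ with the group of matrices $\mathrm{diag}(z^{u+1},z^u)$, $z\in\mathbb F_p^\times$, $z^q=1$, and with the group generated by these matrices and $-I$; thus $\mathbb F_p^2\rtimes_0 C_q\cong C_p\times(C_p\rtimes C_q)$. **Theorem.** There are exactly $q+9$ isomorphism types of permutation groups $G$ of degree $pq$ that are realised by Hopf-Galois structures of type $N$. They are the ones in the following table: each realised $G$ has, as an abstract group, exactly one of the listed structures; each listed structure (for each listed $u$) occurs; and two realised permutation groups of the same structure are isomorphic as permutation groups. For each of them the table gives the number of transitive subgroups of $\mathrm{Hol}(N)$ isomorphic to $G$ as permutation groups, the order of $\mathrm{Aut}(G,G')$, and the number of Hopf-Galois structures of type $N$ on any extension $L/K$ realising $G$. $$\begin{array}{llccc} \text{order} & \text{structure} & \#\text{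 subgroups} & |\mathrm{Aut}(G,G')| & \#\text{ HGS}\\ \hline p^2q^2 & \mathbb F_p^2\rtimes(C_q\times C_q) & 1 & 2p(p-1) & 2\\ 2p^2q^2 & \mathrm{Hol}(N) & 1 & 2p(p-1) & 2\\ p^2q & C_p\times(C_p\rtimes C_q)=\mathbb F_p^2\rtimes_0 C_q & 2 & p(p-1) & 2\\ p^2q & \mathbb F_p^2\rtimes_u C_q,\ 1\le u\le\frac12(q-3) & 2 & p^2(p-1) & 2p\\ p^2q & \mathbb F_p^2\rtimes_{\frac12(q-1)} C_q & 1 & 2p^2(p-1) & 2p\\ 2p^2q & (C_p\times(C_p\rtimes C_q))\rtimes C_2=\mathbb F_p^2\rtimes_0 C_{2q} & 2 & p(p-1) & 2\\ 2p^2q & \mathbb F_p^2\rtimes_u C_{2q},\ 1\le u\le\frac12(q-3) & 2 & p(p-1) & 2\\ 2p^2q & \mathbb F_p^2\rtimes_{\frac12(q-1)} C_{2q} & 1 & 2p(p-1) & 2\\ pq^2 & C_q\times(C_p\rtimes C_q) & 2p & (p-1)(q-1) & 2(q-1)\\ 2pq^2 & C_q\times(C_p\rtimes C_{2q}) & 2p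 & (p-1)(q-1) & 2(q-1)\\ pq & C_p\rtimes C_q & 2p(q-2)+2 & p(p-1) & 2p(q-2)+2\\ pq & C_{pq} & 2p & (p-1)(q-1) & 2(q-1)\\ 2pq & C_p\rtimes C_{2q} & 2p(q-1) & p-1 & 2(q-1)\\ 2pq & D_{2p}\times C_q & 2p & (p-1)(q-1) & 2(q-1) \end{array}$$ These groups include the two regular groups, the cyclic and the non-abelian group of order $pq$; Galois extensions with these Galois groups have respectively $2(q-1)$ and $2p(q-2)+2$ Hopf-Galois structures of type $N$. For $q-1$ of the $q+9$ permutation groups $G$, namely all but one ($u=0$) of the $\frac12(q+1)$ groups of each of the orders $p^2q$ and $2p^2q$, no extension realising $G$ is almost classically Galois. For each of the remaining $10$ groups, every extension realising it is almost classically Galois. -/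

import Mathlib

open scoped TensorProduct

universe u

noncomputable section

/-! ### Permutation groups -/

/-- An isomorphism of permutation groups from `(G, X)` to `(H, Y)`: an isomorphism of groups
together with a bijection of the underlying sets that is compatible with the two actions. -/
def PermIso (G X H Y : Type*) [Group G] [MulAction G X] [Group H] [MulAction H Y] : Prop :=
  ∃ (φ : G ≃* H) (e : X ≃ Y), ∀ (g : G) (x : X), e (g • x) = φ g • e x

/-- Transitive permutation groups of degree `n`, acting on the standard set with `n` elements. -/
def PermGroup (n : ℕ) : Type :=
  {G : Subgroup (Equiv.Perm (Fin n)) // MulAction.IsPretransitive G (Fin n)}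

namespace PermGroup

/-- The underlying subgroup of the symmetric group. -/
abbrev grp {n : ℕ} (G : PermGroup n) : Subgroup (Equiv.Perm (Fin n)) := G.1

/-- Isomorphism of permutation groups of degree `n`. -/
def Iso {n : ℕ} (G H : PermGroup n) : Prop := PermIso G.grp (Fin n) H.grp (Fin n)

/-- Isomorphism of permutation groups, as an equivalence relation. -/
def isoSetoid (n : ℕ) : Setoid (PermGroup n) where
  r := Iso
  iseqv :=
    { refl := fun _ => ⟨MulEquiv.refl _, Equiv.refl _, fun _ _ => rfl⟩
      symm := by
        rintro G H ⟨φ, e, h⟩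
        refine ⟨φ.symm, e.symm, fun g x => ?_⟩
        rw [Equiv.symm_apply_eq, h]
        simp
      trans := by
        rintro G H J ⟨φ, e, h⟩ ⟨ψ, f, k⟩
        refine ⟨φ.trans ψ, e.trans f, fun g x => ?_⟩
        simp only [Equiv.trans_apply, MulEquiv.trans_apply, h, k] }

/-- The number of isomorphism types of permutation groups of degree `n` that contain a
permutation group with the property `Q`. -/
def numTypes (n : ℕ) (Q : PermGroup n → Prop) : ℕ :=
  Nat.card {c : Quotient (isoSetoid n) // ∃ G : PermGroup n, Quotient.mk (isoSetoid n) G = c ∧ Q G}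

end PermGroup

/-- `|Aut(G, G')|`, where `G'` is the stabiliser of the point `x`: the number of automorphisms
of the group `G` that map `G'` onto itself. -/
def cardAutStab (G : Type*) {X : Type*} [Group G] [MulAction G X] (x : X) : ℕ :=
  Nat.card {θ : G ≃* G //
    (MulAction.stabilizer G x).map θ.toMonoidHom = MulAction.stabilizer G x}

/-! ### The holomorph -/

/-- The holomorph `N ⋊ Aut(N)`. -/
abbrev Hol (N : Type*) [Group N] : Type _ := N ⋊[MonoidHom.id (MulAut N)] MulAut N

/-- The action `[η, α] • μ = η α(μ)` of the holomorph of `N` on `N`. -/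
instance Hol.instMulAction (N : Type*) [Group N] : MulAction (Hol N) N where
  smul h μ := h.left * h.right μ
  one_smul μ := by
    change (1 : Hol N).left * (1 : Hol N).right μ = μ
    simp
  mul_smul g h μ := by
    change (g * h).left * (g * h).right μ = g.left * g.right (h.left * h.right μ)
    simp [mul_assoc]

/-- The number of subgroups of the holomorph of `N` that are transitive on `N` and isomorphic, as
permutation groups of the set `N`, to `G`. -/
def numTransitiveInHol (N : Type*) [Group N] {n : ℕ} (G : PermGroup n) : ℕ :=
  Nat.card {M : Subgroup (Hol N) //
    MulAction.IsPretransitive M N ∧ PermIso M N G.grp (Fin n)}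

/-! ### Hopf-Galois structures -/

/-- A Hopf-Galois structure on `L/K`: a cocommutative `K`-Hopf algebra `H` acting `K`-linearly on
`L`, such that `L` is an `H`-module algebra and the map `L ⊗ H → End_K(L)`,
`x ⊗ h ↦ (y ↦ x (h • y))`, is bijective. -/
structure HopfGaloisStructure (K L : Type u) [Field K] [Field L] [Algebra K L] :
    Type (u + 1) where
  /-- the underlying Hopf algebra -/
  H : Type u
  [ring : Ring H]
  [hopf : HopfAlgebra K H]
  [cocomm : Coalgebra.IsCocomm K H]
  /-- the action of `H` on `L` by `K`-linear endomorphisms -/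
  act : H →ₐ[K] Module.End K L
  /-- `h • (x y) = ∑ (h₁ • x) (h₂ • y)` -/
  act_mul : ∀ (h : H) (x y : L), act h (x * y) =
    LinearMap.mul' K L (TensorProduct.map (act.toLinearMap.flip x) (act.toLinearMap.flip y)
      (Coalgebra.comul (R := K) h))
  /-- `h • k = ε(h) k` -/
  act_algebraMap : ∀ (h : H) (k : K),
    act h (algebraMap K L k) = algebraMap K L (Coalgebra.counit (R := K) h * k)
  bijective : Function.Bijective
    (LinearMap.mul' K (Module.End K L) ∘ₗ
      TensorProduct.map (LinearMap.mul K L) act.toLinearMap)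

namespace HopfGaloisStructure

attribute [instance] ring hopf cocomm

variable {K L : Type u} [Field K] [Field L] [Algebra K L]

/-- Two Hopf-Galois structures on `L/K` are identified if there is an isomorphism of Hopf algebras
between them that is compatible with the actions on `L`. -/
def Iso (S T : HopfGaloisStructure K L) : Prop :=
  ∃ e : S.H ≃ₐc[K] T.H, ∀ h : S.H, T.act (e h) = S.act h

/-- Isomorphism of Hopf-Galois structures on `L/K`, as an equivalence relation. -/
def isoSetoid (K L : Type u) [Field K] [Field L] [Algebra K L] :
    Setoid (HopfGaloisStructure K L) where
  r := Iso
  iseqv :=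
    { refl := fun S => ⟨BialgEquiv.refl K S.H, fun _ => rfl⟩
      symm := by
        rintro S T ⟨e, he⟩
        refine ⟨e.symm, fun h => ?_⟩
        rw [← he]
        congr 1
        exact e.toEquiv.apply_symm_apply h
      trans := by
        rintro S T U ⟨e, he⟩ ⟨f, hf⟩
        refine ⟨e.trans f, fun h => ?_⟩
        rw [← he, ← hf]
        rfl }

/-- A Hopf-Galois structure on `L/K` has type `N` if its Hopf algebra becomes isomorphic to the
group algebra `E[N]`, as a Hopf algebra, after base change to the normal closure `E` of `L/K`. -/
def HasType (E : Type u) [Field E] [Algebra K E] (S : HopfGaloisStructure K L)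
    (N : Type) [Group N] : Prop :=
  Nonempty ((E ⊗[K] S.H) ≃ₐc[E] MonoidAlgebra E N)

end HopfGaloisStructure

/-! ### Separable extensions -/

/-- A finite separable field extension `L/K` together with a normal closure `E/K` of it. -/
structure SeparableExtension : Type (u + 1) where
  K : Type u
  L : Type u
  E : Type u
  [fieldK : Field K]
  [fieldL : Field L]
  [fieldE : Field E]
  [algKL : Algebra K L]
  [algKE : Algebra K E]
  [algLE : Algebra L E]
  [tower : IsScalarTower K L E]
  [finite : FiniteDimensional K L]
  [separable : Algebra.IsSeparable K L]
  [normalClosure : IsNormalClosure K L E]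

namespace SeparableExtension

attribute [instance] fieldK fieldL fieldE algKL algKE algLE tower finite separable normalClosure

/-- The group `Gal(E/K)`. -/
abbrev gal (F : SeparableExtension.{u}) : Type u := F.E ≃ₐ[F.K] F.E

/-- The subgroup `Gal(E/L)` of `Gal(E/K)`. -/
def galSub (F : SeparableExtension.{u}) : Subgroup F.gal :=
  (IsScalarTower.toAlgHom F.K F.L F.E).fieldRange.fixingSubgroup

/-- `L/K` realises the permutation group `G`: there is an isomorphism of `G` with `Gal(E/K)`
that maps the stabiliser of a point onto `Gal(E/L)`. -/
def Realises (F : SeparableExtension.{u}) {n : ℕ} (G : PermGroup n) : Prop :=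
  ∃ (x : Fin n) (θ : G.grp ≃* F.gal),
    (MulAction.stabilizer G.grp x).map θ.toMonoidHom = F.galSub

/-- `L/K` is almost classically Galois: `Gal(E/L)` has a normal complement in `Gal(E/K)`. -/
def IsAlmostClassicallyGalois (F : SeparableExtension.{u}) : Prop :=
  ∃ C : Subgroup F.gal, C.Normal ∧ C.IsComplement' F.galSub

/-- The number of Hopf-Galois structures of type `N` on `L/K` (up to isomorphism). -/
def numHGS (F : SeparableExtension.{u}) (N : Type) [Group N] : ℕ :=
  Nat.card {c : Quotient (HopfGaloisStructure.isoSetoid F.K F.L) //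
    ∃ S : HopfGaloisStructure F.K F.L,
      Quotient.mk (HopfGaloisStructure.isoSetoid F.K F.L) S = c ∧ S.HasType F.E N}

end SeparableExtension

/-- The permutation group `G` is realised by a Hopf-Galois structure of type `N`: some extension
`L/K` that realises `G` admits a Hopf-Galois structure of type `N`. -/
def PermGroup.IsRealisedBy {n : ℕ} (G : PermGroup n) (N : Type) [Group N] : Prop :=
  ∃ F : SeparableExtension.{u}, F.Realises G ∧
    ∃ S : HopfGaloisStructure F.K F.L, S.HasType F.E N

/-! ### The groups in the table -/

/-- Units modulo `p` as automorphisms of the cyclic group of order `p`, by multiplication. -/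
def unitsAct (p : ℕ) : (ZMod p)ˣ →* MulAut (Multiplicative (ZMod p)) :=
  (MulAutMultiplicative (ZMod p)).symm.toMonoidHom.comp AddAut.mulLeft

/-- Pairs of units modulo `p` as diagonal automorphisms of `C_p × C_p`. -/
def diagAct (p : ℕ) : (ZMod p)ˣ × (ZMod p)ˣ →*
    MulAut (Multiplicative (ZMod p) × Multiplicative (ZMod p)) where
  toFun a := MulEquiv.prodCongr (unitsAct p a.1) (unitsAct p a.2)
  map_one' := MulEquiv.ext fun x => Prod.ext
    (by change unitsAct p 1 x.1 = x.1; simp) (by change unitsAct p 1 x.2 = x.2; simp)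
  map_mul' a b := MulEquiv.ext fun x => Prod.ext
    (by change unitsAct p (a.1 * b.1) x.1 = unitsAct p a.1 (unitsAct p b.1 x.1); simp)
    (by change unitsAct p (a.2 * b.2) x.2 = unitsAct p a.2 (unitsAct p b.2 x.2); simp)

/-- `C_p ⋊ C_k`, for a divisor `k` of `p - 1` (`p` prime), where `C_k` is the group of `k`-th roots
of unity modulo `p`, acting by multiplication. -/
abbrev CpSemi (p k : ℕ) : Type :=
  Multiplicative (ZMod p) ⋊[(unitsAct p).comp (rootsOfUnity k (ZMod p)).subtype]
    rootsOfUnity k (ZMod p)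

/-- `F_p² ⋊ D`, for a group `D` of invertible diagonal matrices. -/
abbrev DiagSemi (p : ℕ) (D : Subgroup ((ZMod p)ˣ × (ZMod p)ˣ)) : Type :=
  (Multiplicative (ZMod p) × Multiplicative (ZMod p)) ⋊[(diagAct p).comp D.subtype] D

/-- The group of the matrices `diag(z^(u+1), z^u)` with `z^q = 1`. -/
def diagU (p q u : ℕ) : Subgroup ((ZMod p)ˣ × (ZMod p)ˣ) :=
  (rootsOfUnity q (ZMod p)).map ((powMonoidHom (u + 1)).prod (powMonoidHom u))

/-- The group generated by the matrices `diag(z^(u+1), z^u)` with `z^q = 1` and by `-I`. -/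
def diagUNeg (p q u : ℕ) : Subgroup ((ZMod p)ˣ × (ZMod p)ˣ) :=
  diagU p q u ⊔ Subgroup.zpowers (-1, -1)

/-- Labels for the `q + 9` isomorphism types of permutation groups; the name of a label shows the
order of the group. The parameter `u` runs through `0, 1, …, (q - 1) / 2`. -/
inductive TableRow (q : ℕ) : Type
  | p2q2
  | two_p2q2
  | p2q (u : Fin ((q + 1) / 2))
  | two_p2q (u : Fin ((q + 1) / 2))
  | pq2
  | two_pq2
  | pq_nonabelian
  | pq_cyclic
  | two_pq_frobenius
  | two_pq_dihedral

namespace TableRow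

/-- The group `G` has the structure listed in the given row. -/
def HasStructure (p : ℕ) {q : ℕ} (G : Type) [Group G] : TableRow q → Prop
  | p2q2 =>
      Nonempty (G ≃* DiagSemi p ((rootsOfUnity q (ZMod p)).prod (rootsOfUnity q (ZMod p))))
  | two_p2q2 => Nonempty (G ≃* Hol (CpSemi p q))
  | p2q u => Nonempty (G ≃* DiagSemi p (diagU p q u))
  | two_p2q u => Nonempty (G ≃* DiagSemi p (diagUNeg p q u))
  | pq2 => Nonempty (G ≃* Multiplicative (ZMod q) × CpSemi p q)
  | two_pq2 => Nonempty (G ≃* Multiplicative (ZMod q) × CpSemi p (2 * q))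
  | pq_nonabelian => Nonempty (G ≃* CpSemi p q)
  | pq_cyclic => Nonempty (G ≃* Multiplicative (ZMod (p * q)))
  | two_pq_frobenius => Nonempty (G ≃* CpSemi p (2 * q))
  | two_pq_dihedral => Nonempty (G ≃* DihedralGroup p × Multiplicative (ZMod q))

/-- The order of the group. -/
def order (p : ℕ) {q : ℕ} : TableRow q → ℕ
  | p2q2 => p ^ 2 * q ^ 2
  | two_p2q2 => 2 * p ^ 2 * q ^ 2
  | p2q _ => p ^ 2 * q
  | two_p2q _ => 2 * p ^ 2 * q
  | pq2 => p * q ^ 2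
  | two_pq2 => 2 * p * q ^ 2
  | pq_nonabelian => p * q
  | pq_cyclic => p * q
  | two_pq_frobenius => 2 * p * q
  | two_pq_dihedral => 2 * p * q

/-- The number of transitive subgroups of the holomorph of `C_p ⋊ C_q` in the row. -/
def numGroups (p : ℕ) {q : ℕ} : TableRow q → ℕ
  | p2q2 => 1
  | two_p2q2 => 1
  | p2q u => if u.val = (q - 1) / 2 then 1 else 2
  | two_p2q u => if u.val = (q - 1) / 2 then 1 else 2
  | pq2 => 2 * p
  | two_pq2 => 2 * p
  | pq_nonabelian => 2 * p * (q - 2) + 2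
  | pq_cyclic => 2 * p
  | two_pq_frobenius => 2 * p * (q - 1)
  | two_pq_dihedral => 2 * p

/-- The number of automorphisms of the group that preserve a given point stabiliser. -/
def numAut (p : ℕ) {q : ℕ} : TableRow q → ℕ
  | p2q2 => 2 * p * (p - 1)
  | two_p2q2 => 2 * p * (p - 1)
  | p2q u =>
      if u.val = 0 then p * (p - 1)
      else if u.val = (q - 1) / 2 then 2 * p ^ 2 * (p - 1) else p ^ 2 * (p - 1)
  | two_p2q u => if u.val = (q - 1) / 2 then 2 * p * (p - 1) else p * (p - 1)
  | pq2 => (p - 1) * (q - 1)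
  | two_pq2 => (p - 1) * (q - 1)
  | pq_nonabelian => p * (p - 1)
  | pq_cyclic => (p - 1) * (q - 1)
  | two_pq_frobenius => p - 1
  | two_pq_dihedral => (p - 1) * (q - 1)

/-- The number of Hopf-Galois structures of type `C_p ⋊ C_q`. -/
def numHGS (p : ℕ) {q : ℕ} : TableRow q → ℕ
  | p2q2 => 2
  | two_p2q2 => 2
  | p2q u => if u.val = 0 then 2 else 2 * p
  | two_p2q _ => 2
  | pq2 => 2 * (q - 1)
  | two_pq2 => 2 * (q - 1)
  | pq_nonabelian => 2 * p * (q - 2) + 2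
  | pq_cyclic => 2 * (q - 1)
  | two_pq_frobenius => 2 * (q - 1)
  | two_pq_dihedral => 2 * (q - 1)

/-- The rows in which the extensions are almost classically Galois. -/
def IsACG {q : ℕ} : TableRow q → Prop
  | p2q u => u.val = 0
  | two_p2q u => u.val = 0
  | _ => True

end TableRow

end

/-! ### Permutation groups -/

section PermGroups

variable {G X H Y J Z : Type*} [Group G] [MulAction G X] [Group H] [MulAction H Y]
  [Group J] [MulAction J Z]

/-! Hopf-Galois structures are translated into group theory, and the group theory into affine
geometry over `F_p`.

Let `Γ = Gal(E/K)` act on the set `X` of `K`-embeddings `L → E`. The action is faithful and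
transitive, and `Gal(E/L)` is a point stabiliser. By Galois descent `L` is the algebra of
`Γ`-equivariant functions `X → E`. A regular group `R` of permutations of `X` that `Γ` normalises
gives the Hopf algebra of `Γ`-fixed elements of `E[R]`, which acts on `L`. Conversely, if `E ⊗ H ≅
E[N]`, the group-like elements permute the embeddings regularly. This is the correspondence of
Greither and Pareigis, `card_hgs_eq`.

Byott's translation, `card_regularNormalised_mul`, counts in two ways the bijections `N ≃ X` that
carry `Γ` into `Hol(N)`: the number of structures times `|Aut(N)|` is the number of transitive
subgroups of `Hol(N)` isomorphic to `G` times `|Aut(G, G')|`. Every permutation group is realised by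
some extension, since it permutes the variables of a rational function field; so a group is realised
by a structure of type `N` exactly if it is isomorphic to a transitive subgroup of `Hol(N)`
(`PermGroup.isRealisedBy_iff`).

Here `N` is the group of affine maps of `F_p` with slope in `μ_q`, and its automorphisms are the
conjugations by arbitrary affine maps. Hence `Hol(N)` is the group of pairs `(g₁, g₂)` of affine
maps whose slopes have quotient in `μ_q`, acting by `n ↦ g₁ n g₂⁻¹`; the stabiliser of `1` is given
by `g₁ = g₂` (`exists_hol_embedding`). A transitive group of pairs contains a nontrivial pair of
translations, by Cauchy, and a pair with distinct slopes. Its translations therefore form an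
invariant subspace of `F_p²` that is the whole plane or a coordinate axis. As the quotients of
slopes fill `μ_q`, the group of slopes is, up to adjoining `-I`, either `μ_q²` or some
`{diag(z^(u+1), z^u)}`. In the case of an axis the slopes have order prime to `p`, so the other
coordinate has a common fixed point `v`. This is the classification `exists_of_isTransPairs`.

Exchanging coordinates, conjugating by translations and projecting to one coordinate bring each
group to a representative of its row (`stabIso_rep`). The order, the linear action on translations,
commutativity and the centre separate the rows (`rep_injective`). Automorphisms come from
conjugations by affine maps, up to the exchange of coordinates and automorphisms of a central
factor, which yields `predAut_rep`. A regular normal subgroup is excluded when some element of it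
must have both slopes nontrivial in a group containing the whole plane: its commutators with
translations would fill the plane and meet the stabiliser (`hasRegularNormalPairs_rep`). -/

theorem PermIso.symm (h : PermIso G X H Y) : PermIso H Y G X := by
  obtain ⟨φ, e, h⟩ := h
  refine ⟨φ.symm, e.symm, fun g x => ?_⟩
  rw [Equiv.symm_apply_eq, h]
  simp

theorem PermIso.trans (h : PermIso G X H Y) (k : PermIso H Y J Z) : PermIso G X J Z := by
  obtain ⟨φ, e, h⟩ := h
  obtain ⟨ψ, f, k⟩ := k
  exact ⟨φ.trans ψ, e.trans f, fun g x => by simp [h, k]⟩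

theorem PermIso.isPretransitive (h : PermIso G X H Y) (ht : MulAction.IsPretransitive G X) :
    MulAction.IsPretransitive H Y := by
  obtain ⟨φ, e, h⟩ := h
  refine ⟨fun x y => ?_⟩
  obtain ⟨g, hg⟩ := ht.exists_smul_eq (e.symm x) (e.symm y)
  refine ⟨φ g, ?_⟩
  have := h g (e.symm x)
  rw [hg] at this
  simpa using this.symm

theorem map_stabilizer_eq_iff (φ : G ≃* H) (x : X) (y : Y) :
    (MulAction.stabilizer G x).map φ.toMonoidHom = MulAction.stabilizer H y ↔
      ∀ g : G, g • x = x ↔ φ g • y = y := by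
  constructor
  · intro h g
    have : φ g ∈ (MulAction.stabilizer G x).map φ.toMonoidHom ↔ g ∈ MulAction.stabilizer G x := by
      simp [Subgroup.mem_map]
    rw [h] at this
    simpa [MulAction.mem_stabilizer_iff] using this.symm
  · intro h
    ext k
    obtain ⟨g, rfl⟩ := φ.surjective k
    have : φ g ∈ (MulAction.stabilizer G x).map φ.toMonoidHom ↔ g ∈ MulAction.stabilizer G x := by
      simp [Subgroup.mem_map]
    rw [this, MulAction.mem_stabilizer_iff, MulAction.mem_stabilizer_iff, h]

/-- A transitive action is the action on the cosets of a point stabiliser. So `φ` determines the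
bijection `g • x ↦ φ g • y`, which is well defined and injective because `φ` matches the two
stabilisers. -/
theorem permIso_of_stabilizer (hG : MulAction.IsPretransitive G X)
    (hH : MulAction.IsPretransitive H Y) (φ : G ≃* H) (x : X) (y : Y)
    (h : ∀ g : G, g • x = x ↔ φ g • y = y) : PermIso G X H Y := by
  have key : ∀ g g' : G, g • x = g' • x ↔ φ g • y = φ g' • y := by
    intro g g'
    have := h (g'⁻¹ * g)
    rw [mul_smul, inv_smul_eq_iff, map_mul, mul_smul, map_inv, inv_smul_eq_iff] at this
    exact this
  choose s hs using fun z => hG.exists_smul_eq x z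
  refine ⟨φ, Equiv.ofBijective (fun z => φ (s z) • y) ⟨fun z w hzw => ?_, fun w => ?_⟩,
    fun g z => ?_⟩
  · rw [← hs z, ← hs w]
    exact (key _ _).2 hzw
  · obtain ⟨k, hk⟩ := hH.exists_smul_eq y w
    refine ⟨φ.symm k • x, ?_⟩
    change φ (s _) • y = w
    rw [(key _ (φ.symm k)).1 (hs _)]
    simpa using hk
  · change φ (s (g • z)) • y = φ g • φ (s z) • y
    rw [← mul_smul, ← map_mul]
    apply (key _ _).1
    rw [hs, mul_smul, hs]

/-- The given bijection may send `x` elsewhere. Following it by an element of `H` repairs this, at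
the price of composing `φ` with an inner automorphism. -/
theorem PermIso.exists_pointed (h : PermIso G X H Y) (hH : MulAction.IsPretransitive H Y)
    (x : X) (y : Y) : ∃ (φ : G ≃* H) (e : X ≃ Y), (∀ (g : G) (x : X), e (g • x) = φ g • e x) ∧
      e x = y := by
  obtain ⟨φ, e, h⟩ := h
  obtain ⟨k, hk⟩ := hH.exists_smul_eq (e x) y
  refine ⟨φ.trans (MulAut.conj k), e.trans (MulAction.toPerm k), fun g z => ?_, hk⟩
  simp [h, mul_smul]

theorem cardAutStab_eq_card (x : X) : cardAutStab G x =
    Nat.card {θ : G ≃* G // ∀ g : G, g • x = x ↔ θ g • x = x} :=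
  Nat.card_congr (Equiv.subtypeEquivRight fun θ => map_stabilizer_eq_iff θ x x)

theorem cardAutStab_congr' (φ : G ≃* H) (x : X) (y : Y)
    (h : ∀ g : G, g • x = x ↔ φ g • y = y) : cardAutStab G x = cardAutStab H y := by
  rw [cardAutStab_eq_card, cardAutStab_eq_card]
  have h' : ∀ k : H, φ.symm k • x = x ↔ k • y = y := fun k => by simp [h]
  refine Nat.card_congr
    { toFun := fun θ => ⟨(φ.symm.trans θ.1).trans φ, fun g => by
        have := θ.2 (φ.symm g)
        rw [h'] at this
        simpa [h] using this⟩
      invFun := fun θ => ⟨(φ.trans θ.1).trans φ.symm, fun g => by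
        have := θ.2 (φ g)
        rw [h, this]
        simp [h']⟩
      left_inv := fun θ => by ext; simp
      right_inv := fun θ => by ext; simp }

theorem PermIso.cardAutStab_eq (h : PermIso G X H Y) (hH : MulAction.IsPretransitive H Y)
    (x : X) (y : Y) : cardAutStab G x = cardAutStab H y := by
  obtain ⟨φ, e, h, rfl⟩ := h.exists_pointed hH x y
  exact cardAutStab_congr' φ x _ fun g => by rw [← h, e.apply_eq_iff_eq]

end PermGroups

/-- The common shape of the double counting in Byott's translation: all fibres of a map are in
bijection with one and the same set. No finiteness is needed. -/
theorem Nat.card_eq_mul_of_fiber {B C D : Type*} (f : B → C)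
    (h : ∀ c, Nonempty ({b // f b = c} ≃ D)) : Nat.card B = Nat.card C * Nat.card D := by
  rw [← Nat.card_prod]
  exact Nat.card_congr ((Equiv.sigmaFiberEquiv f).symm.trans
    ((Equiv.sigmaCongrRight fun c => (h c).some).trans (Equiv.sigmaEquivProd C D)))

/-! ### The holomorph as the normaliser of the left translations -/

section Holomorph

variable {N : Type*} [Group N]

theorem Hol.smul_def (h : Hol N) (n : N) : h • n = h.left * h.right n := rfl

theorem Hol.eq_of_smul {h k : Hol N} (hk : ∀ n : N, h • n = k • n) : h = k := by
  have h1 : h.left = k.left := by simpa [Hol.smul_def] using hk 1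
  refine SemidirectProduct.ext h1 (MulEquiv.ext fun n => ?_)
  have := hk n
  rw [Hol.smul_def, Hol.smul_def, h1] at this
  exact mul_left_cancel this

/-- The hypothesis says that `f` normalises the left translations. Dividing by the translation by `f
1` leaves a bijection that fixes `1` and still normalises them, and such a bijection is an
automorphism. -/
theorem Hol.exists_of_normalises (f : N ≃ N) (hf : ∀ n, ∃ n', ∀ m, f (n * m) = n' * f m) :
    ∃ h : Hol N, ∀ m, h • m = f m := by
  have key : ∀ n m, f (n * m) = f n * (f 1)⁻¹ * f m := by
    intro n m
    obtain ⟨n', h⟩ := hf n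
    have := h 1
    rw [mul_one] at this
    rw [h, this]
    group
  let β : MulAut N :=
    { toFun := fun m => (f 1)⁻¹ * f m
      invFun := fun m => f.symm (f 1 * m)
      left_inv := fun m => by simp
      right_inv := fun m => by simp
      map_mul' := fun m n => by rw [key]; group }
  refine ⟨⟨f 1, β⟩, fun m => ?_⟩
  change f 1 * ((f 1)⁻¹ * f m) = f m
  group

end Holomorph

/-! ### Byott's translation by double counting of charts -/

section Byott

variable (G X N : Type*) [Group G] [MulAction G X] [Group N]

/-- The regular subgroups of `Perm X` that are isomorphic to `N` and normalised by `G`. -/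
def regularNormalised : Set (Subgroup (Equiv.Perm X)) :=
  {R | (∀ x y, ∃! r : R, (r : Equiv.Perm X) x = y) ∧
    (∀ g : G, ∀ r ∈ R, MulAction.toPerm g * r * (MulAction.toPerm g)⁻¹ ∈ R) ∧
    Nonempty (N ≃* R)}

/-- The transitive subgroups of the holomorph of `N` that are isomorphic to `G` as permutation
groups. -/
def transitiveInHol : Set (Subgroup (Hol N)) :=
  {M | MulAction.IsPretransitive M N ∧ PermIso M N G X}

/-- The bijections that carry the action of `G` into the holomorph of `N`. -/
def holCharts : Set (N ≃ X) := {e | ∀ g : G, ∃ h : Hol N, ∀ n, e (h • n) = g • e n}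

/-- The permutations of `X` that normalise `G`. -/
def permNormalizer : Set (X ≃ X) := {π | ∃ θ : G ≃* G, ∀ g x, π (g • x) = θ g • π x}

variable {G X N}

/-- The normalising permutations are fibred over the image of `x₀`. If `t` carries `x₀` to that
image, the permutations in the fibre are `g • x₀ ↦ t • θ g • x₀` for the automorphisms `θ` that
preserve the stabiliser of `x₀`; faithfulness makes `θ` unique. -/
theorem card_permNormalizer [FaithfulSMul G X] (ht : MulAction.IsPretransitive G X) (x₀ : X) :
    Nat.card (permNormalizer G X) = Nat.card X * cardAutStab G x₀ := by
  rw [cardAutStab_eq_card]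
  refine Nat.card_eq_mul_of_fiber (fun π => π.1 x₀) fun x => ?_
  obtain ⟨t, rfl⟩ := ht.exists_smul_eq x₀ x
  choose s hs using fun z => ht.exists_smul_eq x₀ z
  refine ⟨(Equiv.ofBijective (β := {b : permNormalizer G X // b.1 x₀ = t • x₀})
    (fun θ => ?_) ?_).symm⟩
  · have key : ∀ g g' : G, g • x₀ = g' • x₀ ↔ θ.1 g • x₀ = θ.1 g' • x₀ := by
      intro g g'
      have := θ.2 (g'⁻¹ * g)
      rwa [mul_smul, inv_smul_eq_iff, map_mul, mul_smul, map_inv, inv_smul_eq_iff] at this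
    have hb : Function.Bijective fun z => θ.1 (s z) • x₀ := by
      refine ⟨fun z w hzw => ?_, fun w => ⟨θ.1.symm (s w) • x₀, ?_⟩⟩
      · rw [← hs z, ← hs w]
        exact (key _ _).2 hzw
      · change θ.1 (s _) • x₀ = w
        rw [(key _ (θ.1.symm (s w))).1 (hs _)]
        simp [hs]
    refine ⟨⟨(Equiv.ofBijective _ hb).trans (MulAction.toPerm t), θ.1.trans (MulAut.conj t),
      fun g z => ?_⟩, ?_⟩
    · change t • θ.1 (s (g • z)) • x₀ = (t * θ.1 g * t⁻¹) • t • θ.1 (s z) • x₀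
      rw [mul_smul, inv_smul_smul, mul_smul, ← mul_smul (θ.1 g), ← map_mul]
      congr 1
      apply (key _ _).1
      rw [hs, mul_smul, hs]
    · change t • θ.1 (s x₀) • x₀ = t • x₀
      congr 1
      exact (θ.2 _).1 (hs x₀)
  · constructor
    · intro θ θ' h
      have h1 : ∀ z, θ.1 (s z) • x₀ = θ'.1 (s z) • x₀ := by
        intro z
        have := congrArg (fun b : {b : permNormalizer G X // b.1 x₀ = t • x₀} => b.1.1 z) h
        exact smul_left_cancel t this
      have key : ∀ η : {θ : G ≃* G // ∀ g : G, g • x₀ = x₀ ↔ θ g • x₀ = x₀},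
          ∀ g z, η.1 (s (g • z)) • x₀ = η.1 g • η.1 (s z) • x₀ := by
        intro η g z
        have := (η.2 ((g * s z)⁻¹ * s (g • z))).1 (by
          rw [mul_smul, hs, inv_smul_eq_iff, mul_smul, hs])
        rw [map_mul, map_inv, mul_smul, inv_smul_eq_iff] at this
        rw [this, map_mul, mul_smul]
      apply Subtype.ext
      ext g
      -- The points `θ (s z) • x₀` exhaust `X`, so it is enough to compare the actions of `θ g` and
      -- `θ' g` on them, where both are determined by the permutation.
      apply FaithfulSMul.eq_of_smul_eq_smul (α := X)
      intro w
      obtain ⟨z, rfl⟩ : ∃ z, θ.1 (s z) • x₀ = w := by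
        refine ⟨θ.1.symm (s w) • x₀, ?_⟩
        have := key θ (θ.1.symm (s w)) x₀
        rw [this, (θ.2 (s x₀)).1 (hs x₀)]
        simp [hs]
      rw [← key, h1, key, h1]
    · rintro ⟨⟨π, η, hη⟩, hπ⟩
      change π x₀ = t • x₀ at hπ
      have h1 : ∀ g : G, π (g • x₀) = t • (t⁻¹ * η g * t) • x₀ := by
        intro g
        rw [hη, hπ]
        simp [mul_smul]
      -- The permutation induces `η` on `G` and moves `x₀` to `t • x₀`. Conjugation by `t⁻¹` brings
      -- the stabiliser back to that of `x₀`.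
      refine ⟨⟨η.trans (MulAut.conj t⁻¹), fun g => ?_⟩, ?_⟩
      · have h2 := h1 g
        rw [← π.apply_eq_iff_eq, h2, hπ, smul_left_cancel_iff]
        simp
      · apply Subtype.ext
        apply Subtype.ext
        ext z
        change t • (MulAut.conj t⁻¹ (η (s z))) • x₀ = π z
        conv_rhs => rw [← hs z, h1]
        simp

/-- The holomorph acts faithfully, so the element that a chart assigns to `g` is unique and depends
multiplicatively on `g`. -/
theorem exists_transitive_of_chart [FaithfulSMul G X]
    {e : N ≃ X} (he : e ∈ holCharts G X N) :
    ∃ M : Subgroup (Hol N), ∃ φ : M ≃* G, ∀ (m : M) n, e (m • n) = φ m • e n := by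
  choose h hh using he
  let ψ : G →* Hol N :=
    { toFun := h
      map_one' := Hol.eq_of_smul fun n => e.injective (by rw [hh]; simp)
      map_mul' := fun a b => Hol.eq_of_smul fun n => e.injective (by
        rw [hh, mul_smul, mul_smul, hh, hh]) }
  have hψ : Function.Injective ψ := by
    intro a b hab
    apply FaithfulSMul.eq_of_smul_eq_smul (α := X)
    intro x
    obtain ⟨n, rfl⟩ := e.surjective x
    rw [← hh, ← hh]
    exact congrArg (fun k : Hol N => e (k • n)) hab
  refine ⟨ψ.range, (MonoidHom.ofInjective hψ).symm, fun m n => ?_⟩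
  obtain ⟨g, rfl⟩ := (MonoidHom.ofInjective hψ).surjective m
  rw [MulEquiv.symm_apply_apply]
  exact hh g n

/-- A chart pulls `G` back to a subgroup of the holomorph. Two charts with the same subgroup differ
by a permutation of `X` that normalises `G`, so each fibre is a torsor under these permutations. -/
theorem card_holCharts_eq_transitive [FaithfulSMul G X] (ht : MulAction.IsPretransitive G X) :
    Nat.card (holCharts G X N) = Nat.card (transitiveInHol G X N) *
      Nat.card (permNormalizer G X) := by
  choose M φ hφ using fun e : holCharts G X N => exists_transitive_of_chart e.2
  -- The subgroup chosen for a chart depends only on the chart, since its elements are determined by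
  -- how they act.
  have huniq : ∀ (e : holCharts G X N) (M' : Subgroup (Hol N)) (φ' : M' ≃* G),
      (∀ (m : M') n, e.1 (m • n) = φ' m • e.1 n) → M e = M' := by
    intro e M' φ' h'
    ext k
    constructor
    · intro hk
      have : ((φ'.symm (φ e ⟨k, hk⟩) : M') : Hol N) = k := by
        refine Hol.eq_of_smul fun n => e.1.injective ?_
        refine (h' (φ'.symm (φ e ⟨k, hk⟩)) n).trans ?_
        rw [MulEquiv.apply_symm_apply, ← hφ]
        rfl
      exact this ▸ SetLike.coe_mem _
    · intro hk
      have : (((φ e).symm (φ' ⟨k, hk⟩) : M e) : Hol N) = k := by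
        refine Hol.eq_of_smul fun n => e.1.injective ?_
        refine (hφ e ((φ e).symm (φ' ⟨k, hk⟩)) n).trans ?_
        rw [MulEquiv.apply_symm_apply, ← h']
        rfl
      exact this ▸ SetLike.coe_mem _
  refine Nat.card_eq_mul_of_fiber (C := transitiveInHol G X N) (fun e => ⟨M e, ?_⟩) fun M₀ => ?_
  · have : PermIso (M e) N G X := ⟨φ e, e.1, hφ e⟩
    exact ⟨this.symm.isPretransitive ht, this⟩
  · obtain ⟨M₀, -, φ₀, e₀, h₀⟩ := M₀
    refine ⟨{ toFun := fun e => ⟨e₀.symm.trans e.1.1, ?_⟩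
              invFun := fun π => ⟨⟨e₀.trans π.1, ?_⟩, ?_⟩
              left_inv := fun e => ?_
              right_inv := fun π => ?_ }⟩
    · have h1 : M e.1 = M₀ := congrArg Subtype.val e.2
      refine ⟨φ₀.symm.trans ((MulEquiv.subgroupCongr h1.symm).trans (φ e.1)), fun g x => ?_⟩
      have h2 := h₀ (φ₀.symm g) (e₀.symm x)
      rw [MulEquiv.apply_symm_apply, Equiv.apply_symm_apply] at h2
      have h3 := hφ e.1 (MulEquiv.subgroupCongr h1.symm (φ₀.symm g)) (e₀.symm x)
      change e.1.1 (e₀.symm (g • x)) = φ e.1 (MulEquiv.subgroupCongr h1.symm (φ₀.symm g)) •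
        e.1.1 (e₀.symm x)
      rw [← h3, ← h2, Equiv.symm_apply_apply]
      rfl
    · obtain ⟨π, θ, hθ⟩ := π
      intro g
      refine ⟨φ₀.symm (θ.symm g), fun n => ?_⟩
      change π (e₀ (φ₀.symm (θ.symm g) • n)) = g • π (e₀ n)
      rw [h₀, hθ]
      simp
    · obtain ⟨π, θ, hθ⟩ := π
      apply Subtype.ext
      refine huniq _ _ (φ₀.trans θ) fun m n => ?_
      change π (e₀ (m • n)) = θ (φ₀ m) • π (e₀ n)
      rw [h₀, hθ]
    · apply Subtype.ext
      apply Subtype.ext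
      ext n
      simp
    · apply Subtype.ext
      ext n
      simp

/-- The left translations of `N`, transported to `X`. -/
def chartHom (e : N ≃ X) : N →* Equiv.Perm X :=
  e.permCongrHom.toMonoidHom.comp (MulAction.toPermHom N N)

theorem chartHom_apply (e : N ≃ X) (n : N) (x : X) : chartHom e n x = e (n * e.symm x) := rfl

/-- A chart carries the left translations of `N` to a regular subgroup `R`, and `G` normalises `R`
because the holomorph normalises the left translations. Given `R` and an isomorphism `ψ : N ≃* R`,
the charts leading to `R` are `n ↦ ψ (α n) x`: one for each base point `x` and each automorphism
`α`. -/
theorem card_holCharts_eq_regular :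
    Nat.card (holCharts G X N) = Nat.card (regularNormalised G X N) *
      (Nat.card X * Nat.card (MulAut N)) := by
  have hinj : ∀ e : N ≃ X, Function.Injective (chartHom e) := by
    intro e a b hab
    have := congrArg (fun π : Equiv.Perm X => π (e 1)) hab
    simpa [chartHom_apply] using this
  rw [← Nat.card_prod]
  refine Nat.card_eq_mul_of_fiber (C := regularNormalised G X N)
    (fun e => ⟨(chartHom e.1).range, ?_, ?_, ⟨MonoidHom.ofInjective (hinj e.1)⟩⟩) fun R => ?_
  · intro x y
    refine ⟨⟨chartHom e.1 (e.1.symm y * (e.1.symm x)⁻¹), _, rfl⟩, ?_, ?_⟩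
    · change chartHom e.1 _ x = y
      rw [chartHom_apply]
      simp
    · rintro ⟨_, n, rfl⟩ h
      change chartHom e.1 n x = y at h
      rw [chartHom_apply] at h
      apply Subtype.ext
      rw [← h]
      simp
  · rintro g _ ⟨n, rfl⟩
    obtain ⟨h, hh⟩ := e.2 g
    -- Conjugation by `[η, α]` sends the left translation by `n` to that by `η α(n) η⁻¹`.
    refine ⟨h.left * h.right n * h.left⁻¹, ?_⟩
    rw [eq_mul_inv_iff_mul_eq]
    ext x
    obtain ⟨m, rfl⟩ := e.1.surjective x
    change chartHom e.1 _ (g • e.1 m) = g • chartHom e.1 n (e.1 m)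
    rw [← hh, chartHom_apply, chartHom_apply, Equiv.symm_apply_apply, Equiv.symm_apply_apply, ← hh]
    simp [Hol.smul_def, mul_assoc]
  · obtain ⟨R, hreg, hnorm, ⟨ψ⟩⟩ := R
    have hb : ∀ (x : X) (α : MulAut N), Function.Bijective fun n => (ψ (α n) : Equiv.Perm X) x := by
      intro x α
      constructor
      · intro m n hmn
        exact α.injective (ψ.injective ((hreg x _).unique rfl hmn.symm).symm) |>.symm ▸ rfl
      · intro y
        obtain ⟨r, hr, -⟩ := hreg x y
        exact ⟨α.symm (ψ.symm r), by simpa using hr⟩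
    have hch : ∀ (x : X) (α : MulAut N),
        chartHom (Equiv.ofBijective _ (hb x α)) = R.subtype.comp (ψ.toMonoidHom.comp α.toMonoidHom) := by
      intro x α
      ext n y
      obtain ⟨m, rfl⟩ := (Equiv.ofBijective _ (hb x α)).surjective y
      rw [chartHom_apply, Equiv.symm_apply_apply]
      simp
    have hrange : ∀ (x : X) (α : MulAut N),
        (chartHom (Equiv.ofBijective _ (hb x α))).range = R := by
      intro x α
      rw [hch]
      ext r
      constructor
      · rintro ⟨n, rfl⟩
        exact SetLike.coe_mem _
      · intro hr
        exact ⟨α.symm (ψ.symm ⟨r, hr⟩), by simp⟩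
    have hchart : ∀ (x : X) (α : MulAut N), Equiv.ofBijective _ (hb x α) ∈ holCharts G X N := by
      intro x α g
      set e := Equiv.ofBijective _ (hb x α) with he
      obtain ⟨h, hh⟩ := Hol.exists_of_normalises
        ((e.trans (MulAction.toPerm g)).trans e.symm) (fun n => by
          have h1 := hnorm g _ ((hrange x α).le ⟨n, rfl⟩)
          obtain ⟨n', hn'⟩ := (hrange x α).ge h1
          refine ⟨n', fun m => ?_⟩
          rw [eq_mul_inv_iff_mul_eq] at hn'
          have h2 := congrArg (fun π : Equiv.Perm X => π (e m)) hn'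
          change chartHom e n' (g • e m) = g • chartHom e n (e m) at h2
          rw [chartHom_apply, chartHom_apply, Equiv.symm_apply_apply] at h2
          change e.symm (g • e (n * m)) = n' * e.symm (g • e m)
          rw [← h2, Equiv.symm_apply_apply])
      refine ⟨h, fun n => ?_⟩
      rw [hh]
      change e (e.symm (g • e n)) = _
      rw [Equiv.apply_symm_apply]
    refine ⟨(Equiv.ofBijective (α := X × MulAut N)
      (β := {b : holCharts G X N // (⟨(chartHom b.1).range, _⟩ : regularNormalised G X N) =
        ⟨R, hreg, hnorm, ⟨ψ⟩⟩})
      (fun xα => ⟨⟨Equiv.ofBijective _ (hb xα.1 xα.2), hchart xα.1 xα.2⟩,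
        Subtype.ext (hrange xα.1 xα.2)⟩) ⟨?_, ?_⟩).symm⟩
    · rintro ⟨x, α⟩ ⟨y, β⟩ h
      have h1 : ∀ n, (ψ (α n) : Equiv.Perm X) x = (ψ (β n) : Equiv.Perm X) y := fun n =>
        congrArg (fun b => b.1.1 n) h
      have hxy : x = y := by simpa using h1 1
      subst hxy
      refine Prod.ext rfl (MulEquiv.ext fun n => ?_)
      exact ψ.injective ((hreg x _).unique (h1 n) rfl)
    · rintro ⟨⟨e, he⟩, hR⟩
      have hR' : (chartHom e).range = R := congrArg Subtype.val hR
      let α : MulAut N := (MonoidHom.ofInjective (hinj e)).trans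
        ((MulEquiv.subgroupCongr hR').trans ψ.symm)
      refine ⟨(e 1, α), ?_⟩
      apply Subtype.ext
      apply Subtype.ext
      ext n
      have : (ψ (α n) : Equiv.Perm X) = chartHom e n := by
        simp only [α, MulEquiv.trans_apply, MulEquiv.apply_symm_apply]
        rfl
      change (ψ (α n) : Equiv.Perm X) (e 1) = e n
      rw [this, chartHom_apply]
      simp

/-- Byott's translation. -/
theorem card_regularNormalised_mul [FaithfulSMul G X] [Finite X]
    (ht : MulAction.IsPretransitive G X) (x₀ : X) :
    Nat.card (regularNormalised G X N) * Nat.card (MulAut N) =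
      Nat.card (transitiveInHol G X N) * cardAutStab G x₀ := by
  have h := (card_holCharts_eq_regular (G := G) (X := X) (N := N)).symm.trans
    (card_holCharts_eq_transitive ht)
  rw [card_permNormalizer ht x₀] at h
  have : Nonempty X := ⟨x₀⟩
  have hX : 0 < Nat.card X := Nat.card_pos
  refine Nat.eq_of_mul_eq_mul_left hX ?_
  linarith

end Byott

/-! ### Galois descent for equivariant functions -/

section Descent

variable (K E : Type*) [Field K] [Field E] [Algebra K E]
variable (Y : Type*) [MulAction (E ≃ₐ[K] E) Y]

/-- The functions `Y → E` that commute with the actions of the Galois group. -/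
def equivariantMaps : Submodule K (Y → E) where
  carrier := {f | ∀ (g : E ≃ₐ[K] E) (y : Y), f (g • y) = g (f y)}
  add_mem' := fun hf hg σ y => by simp [hf σ y, hg σ y]
  zero_mem' := fun σ y => by simp
  smul_mem' := fun c f hf σ y => by simp [hf σ y]

variable {K E Y}

variable [FiniteDimensional K E] [IsGalois K E]

/-- Multiply a relation over `E` by `a` and sum its Galois conjugates: equivariance turns it into a
relation over `K` with coefficients `Tr(a e_j)`. These vanish for all `a`, and the trace form is
nondegenerate. -/
theorem equivariantMaps.linearIndependent {ι : Type*} {b : ι → Y → E}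
    (hb : ∀ i, b i ∈ equivariantMaps K E Y) (h : LinearIndependent K b) :
    LinearIndependent E b := by
  rw [linearIndependent_iff'] at h ⊢
  intro s e he i hi
  have key : ∀ a : E, ∑ j ∈ s, Algebra.trace K E (a * e j) • b j = 0 := by
    intro a
    funext y
    have h1 : ∀ g : E ≃ₐ[K] E, ∑ j ∈ s, g (a * e j) * b j y = 0 := by
      intro g
      have h2 := congrFun he (g⁻¹ • y)
      have h3 := congrArg (fun z => g (a * z)) h2
      simp only [Finset.sum_apply, Pi.smul_apply, smul_eq_mul, Finset.mul_sum, map_sum,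
        Pi.zero_apply, mul_zero, map_zero] at h3
      rw [← h3]
      refine Finset.sum_congr rfl fun j _ => ?_
      rw [← mul_assoc, map_mul g (a * e j), ← hb j g, smul_inv_smul]
    simp only [Finset.sum_apply, Pi.smul_apply, Pi.zero_apply]
    simp only [Algebra.smul_def, trace_eq_sum_automorphisms, Finset.sum_mul]
    rw [Finset.sum_comm]
    exact Finset.sum_eq_zero fun g _ => h1 g
  have h4 : ∀ a : E, Algebra.traceForm K E a (e i) = 0 := fun a => h s _ (key a) i hi
  exact (traceForm_nondegenerate K E).2 _ h4

/-- Let a functional `f` kill all equivariant functions. The functions `∑ g, g(a) δ_{g y₀}` are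
equivariant, so `∑ g, g(a) f(δ_{g y₀}) = 0` for every `a`. Dedekind's independence of automorphisms
gives `f(δ_{y₀}) = 0` for every `y₀`. -/
theorem equivariantMaps.span_eq_top [Finite Y] :
    Submodule.span E (equivariantMaps K E Y : Set (Y → E)) = ⊤ := by
  classical
  have := Fintype.ofFinite Y
  by_contra hne
  obtain ⟨f, hf0, hf⟩ := Submodule.exists_le_ker_of_lt_top _ (lt_top_iff_ne_top.2 hne)
  apply hf0
  refine LinearMap.pi_ext' fun y₀ => LinearMap.ext_ring ?_
  have hli : LinearIndependent E (fun g : E ≃ₐ[K] E => (g : E → E)) := by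
    have h1 := linearIndependent_monoidHom E E
    exact h1.comp (fun g : E ≃ₐ[K] E => ((g : E →+* E) : E →* E)) fun g g' h => by
      ext x
      exact congrArg (fun k : E →* E => k x) h
  rw [Fintype.linearIndependent_iff] at hli
  have h2 := hli (fun g => f (Pi.single (g • y₀) 1)) (by
    funext a
    have h3 : (∑ g : E ≃ₐ[K] E, g a • (Pi.single (g • y₀) 1 : Y → E)) ∈
        equivariantMaps K E Y := by
      intro τ y
      simp only [Finset.sum_apply, Pi.smul_apply, smul_eq_mul, map_sum, map_mul, Pi.single_apply,
        mul_ite, mul_one, mul_zero]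
      rw [← Equiv.sum_comp (Equiv.mulLeft τ)]
      refine Finset.sum_congr rfl fun g _ => ?_
      rw [Equiv.coe_mulLeft, mul_smul, smul_left_cancel_iff]
      split_ifs <;> simp
    have h4 := hf (Submodule.subset_span h3)
    rw [LinearMap.mem_ker, map_sum] at h4
    simp only [map_smul, smul_eq_mul] at h4
    simp only [Finset.sum_apply, Pi.smul_apply, smul_eq_mul, Pi.zero_apply]
    rw [← h4]
    exact Finset.sum_congr rfl fun g _ => mul_comm _ _) 1
  simpa using h2

theorem equivariantMaps.finrank_eq [Finite Y] :
    Module.finrank K (equivariantMaps K E Y) = Nat.card Y := by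
  classical
  have := Fintype.ofFinite Y
  let b := Module.finBasis K (equivariantMaps K E Y)
  have hb : LinearIndependent K (fun i => (b i : Y → E)) :=
    b.linearIndependent.map' (equivariantMaps K E Y).subtype (Submodule.ker_subtype _)
  have hE := equivariantMaps.linearIndependent (fun i => (b i).2) hb
  have hsp : ⊤ ≤ Submodule.span E (Set.range fun i => (b i : Y → E)) := by
    rw [← equivariantMaps.span_eq_top (K := K), Submodule.span_le]
    intro f hf
    have h1 := b.sum_repr ⟨f, hf⟩
    have h2 := congrArg Subtype.val h1
    simp only [Submodule.coe_sum, Submodule.coe_smul] at h2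
    rw [← h2]
    refine Submodule.sum_mem _ fun i _ => ?_
    rw [← algebraMap_smul E]
    exact Submodule.smul_mem _ _ (Submodule.subset_span ⟨i, rfl⟩)
  have h3 := Module.finrank_eq_card_basis (Module.Basis.mk hE hsp)
  rw [Module.finrank_pi, Fintype.card_fin] at h3
  rw [← h3, Nat.card_eq_fintype_card]

end Descent

/-! ### Descended group algebras -/

section GroupAlgebra

open MonoidAlgebra

variable (K E : Type*) [Field K] [Field E] [Algebra K E]
variable (R S : Type*) [Group R] [MulDistribMulAction (E ≃ₐ[K] E) R]
  [Group S] [MulDistribMulAction (E ≃ₐ[K] E) S]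

/-- The action of an element of the Galois group on coefficients and group elements. -/
noncomputable def galTwist (g : E ≃ₐ[K] E) : MonoidAlgebra E R →ₐ[K] MonoidAlgebra E R :=
  { (mapDomainRingHom E (MulDistribMulAction.toMonoidHom R g)).comp
      (mapRingHom R ((g : E →+* E))) with
    commutes' := fun k => by simp }

variable {K E R S}

@[simp]
theorem galTwist_single (g : E ≃ₐ[K] E) (r : R) (a : E) :
    galTwist K E R g (single r a) = single (g • r) (g a) := by
  change mapDomainRingHom E (MulDistribMulAction.toMonoidHom R g)
    (mapRingHom R (g : E →+* E) (single r a)) = _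
  simp

theorem coeff_galTwist (g : E ≃ₐ[K] E) (z : MonoidAlgebra E R) (r : R) :
    (galTwist K E R g z).coeff (g • r) = g (z.coeff r) := by
  classical
  induction z using MonoidAlgebra.induction_linear with
  | zero => simp
  | add x y hx hy => simp [hx, hy]
  | single s a =>
    rw [galTwist_single, coeff_single, coeff_single, Finsupp.single_apply, Finsupp.single_apply]
    simp only [smul_left_cancel_iff]
    split_ifs <;> simp

variable (K E R S)

/-- The fixed subalgebra of the group algebra `E[R]` under the Galois group. -/
noncomputable def descAlg : Subalgebra K (MonoidAlgebra E R) :=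
  ⨅ g : E ≃ₐ[K] E, AlgHom.equalizer (galTwist K E R g) (AlgHom.id K _)

variable {K E R S}

theorem mem_descAlg_iff {z : MonoidAlgebra E R} :
    z ∈ descAlg K E R ↔ ∀ g, galTwist K E R g z = z := by
  simp [descAlg, Algebra.mem_iInf, AlgHom.mem_equalizer]

theorem mem_descAlg_iff_coeff {z : MonoidAlgebra E R} :
    z ∈ descAlg K E R ↔ ∀ (g : E ≃ₐ[K] E) (r : R), z.coeff (g • r) = g (z.coeff r) := by
  rw [mem_descAlg_iff]
  constructor
  · intro h g r
    rw [← coeff_galTwist, h]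
  · intro h g
    ext r
    have := coeff_galTwist g z (g⁻¹ • r)
    rw [smul_inv_smul] at this
    rw [this, ← h, smul_inv_smul]

variable [Finite R] [Finite S]

/-- Elements of the group algebra as functions. -/
noncomputable def coeffFun : MonoidAlgebra E R ≃ₗ[E] (R → E) :=
  (coeffLinearEquiv E).trans (Finsupp.linearEquivFunOnFinite E E R)

theorem coeffFun_apply (z : MonoidAlgebra E R) (r : R) : coeffFun z r = z.coeff r := rfl

/-- The fixed subalgebra is given by the equivariant functions. -/
noncomputable def descAlgEquiv : descAlg K E R ≃ₗ[K] equivariantMaps K E R where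
  toFun z := ⟨coeffFun z.1, mem_descAlg_iff_coeff.1 z.2⟩
  invFun f := ⟨coeffFun.symm f.1, mem_descAlg_iff_coeff.2 fun g r => by
    rw [← coeffFun_apply, ← coeffFun_apply, LinearEquiv.apply_symm_apply]
    exact f.2 g r⟩
  left_inv z := by simp
  right_inv f := by simp
  map_add' x y := by
    apply Subtype.ext
    simp
  map_smul' c x := by
    apply Subtype.ext
    funext r
    simp [coeffFun_apply]

variable [FiniteDimensional K E] [IsGalois K E]

theorem descAlg.linearIndependent {ι : Type*} {b : ι → descAlg K E R}
    (h : LinearIndependent K b) : LinearIndependent E fun i => (b i : MonoidAlgebra E R) := by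
  have h1 : LinearIndependent K fun i => (descAlgEquiv (b i) : R → E) :=
    (h.map' descAlgEquiv.toLinearMap (LinearEquiv.ker _)).map'
      (equivariantMaps K E R).subtype (Submodule.ker_subtype _)
  have h2 := equivariantMaps.linearIndependent (fun i => (descAlgEquiv (b i)).2) h1
  exact LinearIndependent.of_comp coeffFun.toLinearMap h2

theorem descAlg.finrank_eq : Module.finrank K (descAlg K E R) = Nat.card R := by
  rw [descAlgEquiv.finrank_eq, equivariantMaps.finrank_eq]

instance : FiniteDimensional K (descAlg K E R) := descAlgEquiv.symm.finiteDimensional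

theorem descAlg.span_eq_top :
    Submodule.span E (descAlg K E R : Set (MonoidAlgebra E R)) = ⊤ := by
  rw [← (Submodule.map_injective_of_injective (coeffFun (E := E) (R := R)).injective).eq_iff,
    Submodule.map_span, Submodule.map_top, LinearEquiv.range,
    ← equivariantMaps.span_eq_top (K := K)]
  congr 1
  ext f
  constructor
  · rintro ⟨z, hz, rfl⟩
    exact (descAlgEquiv ⟨z, hz⟩).2
  · intro hf
    refine ⟨descAlgEquiv.symm ⟨f, hf⟩, SetLike.coe_mem _, ?_⟩
    exact congrArg Subtype.val (descAlgEquiv.apply_symm_apply ⟨f, hf⟩)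

omit [Finite R] [Finite S] [FiniteDimensional K E] [IsGalois K E] in
theorem coeff_inl_mul_inr (x : MonoidAlgebra E R) (y : MonoidAlgebra E S) (r : R) (s : S) :
    (mapDomainAlgHom K E (MonoidHom.inl R S) x * mapDomainAlgHom K E (MonoidHom.inr R S) y).coeff
      (r, s) = x.coeff r * y.coeff s := by
  classical
  induction x using MonoidAlgebra.induction_linear with
  | zero => simp
  | add x x' hx hx' => rw [map_add, add_mul, coeff_add, coeff_add, Finsupp.add_apply,
      Finsupp.add_apply, hx, hx', add_mul]
  | single r' a =>
    induction y using MonoidAlgebra.induction_linear with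
    | zero => simp
    | add y y' hy hy' => rw [map_add, mul_add, coeff_add, coeff_add, Finsupp.add_apply,
        Finsupp.add_apply, hy, hy', mul_add]
    | single s' b =>
      have h1 : mapDomainAlgHom K E (MonoidHom.inl R S) (single r' a) = single (r', 1) a := by simp
      have h2 : mapDomainAlgHom K E (MonoidHom.inr R S) (single s' b) = single (1, s') b := by simp
      rw [h1, h2, single_mul_single]
      simp only [coeff_single, Finsupp.single_apply, Prod.mk_mul_mk, mul_one, one_mul,
        Prod.mk.injEq]
      split_ifs <;> simp_all
end GroupAlgebra

/-! ### The Hopf algebra structure on descended group algebras -/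

section DescHopf

open MonoidAlgebra

variable {K E : Type*} [Field K] [Field E] [Algebra K E]

theorem mapDomainAlgHom_single' {R S : Type*} [Group R] [Group S] (f : R →* S) (r : R) (a : E) :
    mapDomainAlgHom K E f (single r a) = single (f r) a := by simp

variable {R S T : Type*} [Group R] [MulDistribMulAction (E ≃ₐ[K] E) R]
  [Group S] [MulDistribMulAction (E ≃ₐ[K] E) S] [Group T] [MulDistribMulAction (E ≃ₐ[K] E) T]

theorem galTwist_mapDomain (f : R →* S) (hf : ∀ (g : E ≃ₐ[K] E) r, f (g • r) = g • f r)
    (g : E ≃ₐ[K] E) (z : MonoidAlgebra E R) :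
    galTwist K E S g (mapDomainAlgHom K E f z) = mapDomainAlgHom K E f (galTwist K E R g z) := by
  induction z using MonoidAlgebra.induction_linear with
  | zero => simp
  | add x y hx hy => rw [map_add, map_add, map_add, map_add, hx, hy]
  | single r a => rw [mapDomainAlgHom_single', galTwist_single, galTwist_single,
      mapDomainAlgHom_single', hf]

variable (R S) in
/-- The exterior product of two descended group algebras. -/
noncomputable def descTensor :
    descAlg K E R ⊗[K] descAlg K E S →ₐ[K] MonoidAlgebra E (R × S) :=
  Algebra.TensorProduct.lift
    ((mapDomainAlgHom K E (MonoidHom.inl R S)).comp (descAlg K E R).val)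
    ((mapDomainAlgHom K E (MonoidHom.inr R S)).comp (descAlg K E S).val)
    fun x y => by
      suffices ∀ (x : MonoidAlgebra E R) (y : MonoidAlgebra E S),
        Commute (mapDomainAlgHom K E (MonoidHom.inl R S) x)
          (mapDomainAlgHom K E (MonoidHom.inr R S) y) from this x y
      intro x y
      induction x using MonoidAlgebra.induction_linear with
      | zero => simp
      | add x x' hx hx' => rw [map_add]; exact hx.add_left hx'
      | single r a =>
        induction y using MonoidAlgebra.induction_linear with
        | zero => simp
        | add y y' hy hy' => rw [map_add]; exact hy.add_right hy'
        | single s b =>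
          rw [mapDomainAlgHom_single', mapDomainAlgHom_single', commute_iff_eq, single_mul_single,
            single_mul_single]
          simp [mul_comm]

@[simp]
theorem descTensor_tmul (x : descAlg K E R) (y : descAlg K E S) :
    descTensor R S (x ⊗ₜ y) = mapDomainAlgHom K E (MonoidHom.inl R S) x *
      mapDomainAlgHom K E (MonoidHom.inr R S) y :=
  Algebra.TensorProduct.lift_tmul _ _ _ _ _

theorem coeff_descTensor_tmul (x : descAlg K E R) (y : descAlg K E S) (r : R) (s : S) :
    (descTensor R S (x ⊗ₜ y)).coeff (r, s) = x.1.coeff r * y.1.coeff s := by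
  rw [descTensor_tmul, coeff_inl_mul_inr]

theorem descTensor_mem (w : descAlg K E R ⊗[K] descAlg K E S) :
    descTensor R S w ∈ descAlg K E (R × S) := by
  induction w using TensorProduct.induction_on with
  | zero => rw [map_zero]; exact zero_mem _
  | add x y hx hy => rw [map_add]; exact add_mem hx hy
  | tmul x y =>
    rw [descTensor_tmul]
    refine mul_mem (mem_descAlg_iff.2 fun g => ?_) (mem_descAlg_iff.2 fun g => ?_)
    · rw [galTwist_mapDomain _ (fun g r => by ext <;> simp), mem_descAlg_iff.1 x.2]
    · rw [galTwist_mapDomain _ (fun g r => by ext <;> simp), mem_descAlg_iff.1 y.2]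

/-- Functoriality of descended group algebras. -/
noncomputable def descMap (f : R →* S) (hf : ∀ (g : E ≃ₐ[K] E) r, f (g • r) = g • f r) :
    descAlg K E R →ₐ[K] descAlg K E S :=
  ((mapDomainAlgHom K E f).comp (descAlg K E R).val).codRestrict _ fun x =>
    mem_descAlg_iff.2 fun g => by
      rw [AlgHom.comp_apply, galTwist_mapDomain f hf, Subalgebra.coe_val, mem_descAlg_iff.1 x.2]

variable [Finite R] [Finite S] [Finite T] [FiniteDimensional K E] [IsGalois K E]

/-- Expand in `K`-bases of the two factors. By descent both bases are independent over `E`, so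
vanishing of all coefficients at `(r, s)` can be cancelled in one factor after the other.
Injectivity allows identities between tensors to be checked in `E[R × S]`. -/
theorem descTensor_injective : Function.Injective (descTensor (K := K) (E := E) R S) := by
  rw [injective_iff_map_eq_zero]
  intro w hw
  let b := Module.finBasis K (descAlg K E R)
  let c := Module.finBasis K (descAlg K E S)
  set k := (b.tensorProduct c).repr w with hk
  have hsum := (b.tensorProduct c).sum_repr w
  have hb := descAlg.linearIndependent b.linearIndependent
  have hc := descAlg.linearIndependent c.linearIndependent
  rw [Fintype.linearIndependent_iff] at hb hc
  have h0 : ∀ r s, ∑ j, (∑ i, algebraMap K E (k (i, j)) * (b i).1.coeff r) * (c j).1.coeff s = 0 := by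
    intro r s
    have h1 : (descTensor R S w).coeff (r, s) = 0 := by rw [hw]; rfl
    rw [← hsum, map_sum, coeff_sum, Finsupp.finset_sum_apply, Fintype.sum_prod_type,
      Finset.sum_comm] at h1
    rw [← h1]
    refine Finset.sum_congr rfl fun j _ => ?_
    rw [Finset.sum_mul]
    refine Finset.sum_congr rfl fun i _ => ?_
    rw [Module.Basis.tensorProduct_apply, map_smul, coeff_smul_apply, coeff_descTensor_tmul,
      Algebra.smul_def, mul_assoc]
  have h1 : ∀ r j, ∑ i, algebraMap K E (k (i, j)) * (b i).1.coeff r = 0 := by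
    intro r
    refine hc _ ?_
    ext s
    rw [coeff_sum, Finsupp.finset_sum_apply]
    exact h0 r s
  have h2 : ∀ i j, k (i, j) = 0 := by
    intro i j
    have h3 := hb (fun i => algebraMap K E (k (i, j))) (by
      ext r
      rw [coeff_sum, Finsupp.finset_sum_apply]
      exact h1 r j) i
    simpa using h3
  have h4 : k = 0 := by
    ext ⟨i, j⟩
    exact h2 i j
  exact (LinearEquiv.map_eq_zero_iff _).1 h4

variable (K E R S) in
/-- The exterior product as an isomorphism. -/
noncomputable def descTensorEquiv :
    descAlg K E R ⊗[K] descAlg K E S ≃ₐ[K] descAlg K E (R × S) :=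
  AlgEquiv.ofBijective ((descTensor R S).codRestrict _ descTensor_mem) (by
    have hinj : Function.Injective
        ((descTensor (K := K) (E := E) R S).codRestrict _ descTensor_mem) :=
      fun x y h => descTensor_injective (congrArg Subtype.val h)
    have hfin : Module.finrank K (descAlg K E R ⊗[K] descAlg K E S) =
        Module.finrank K (descAlg K E (R × S)) := by
      rw [Module.finrank_tensorProduct, descAlg.finrank_eq, descAlg.finrank_eq,
        descAlg.finrank_eq, Nat.card_prod]
    refine ⟨hinj, ?_⟩
    have h2 := LinearMap.injective_iff_surjective_of_finrank_eq_finrank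
      (K := K) (V := descAlg K E R ⊗[K] descAlg K E S) (V₂ := descAlg K E (R × S)) (f := ((descTensor (K := K) (E := E) R S).codRestrict _ descTensor_mem).toLinearMap) hfin
    exact h2.1 hinj)

theorem coe_descTensorEquiv (w : descAlg K E R ⊗[K] descAlg K E S) :
    (descTensorEquiv K E R S w : MonoidAlgebra E (R × S)) = descTensor R S w := rfl

variable (K E R) in
/-- The comultiplication of a descended group algebra. -/
noncomputable def descComul : descAlg K E R →ₐ[K] descAlg K E R ⊗[K] descAlg K E R :=
  (descTensorEquiv K E R R).symm.toAlgHom.comp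
    (descMap ((MonoidHom.id R).prod (MonoidHom.id R)) fun g r => rfl)

theorem descTensor_descComul (z : descAlg K E R) :
    descTensor R R (descComul K E R z) =
      mapDomainAlgHom K E ((MonoidHom.id R).prod (MonoidHom.id R)) z := by
  rw [← coe_descTensorEquiv]
  change ((descTensorEquiv K E R R ((descTensorEquiv K E R R).symm _) :
    descAlg K E (R × R)) : MonoidAlgebra E (R × R)) = _
  rw [AlgEquiv.apply_symm_apply]
  rfl

variable (E R) in
/-- The augmentation of the group algebra. -/
noncomputable def augmentation : MonoidAlgebra E R →ₐ[E] E := MonoidAlgebra.lift E E R 1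

@[simp]
theorem augmentation_single (r : R) (a : E) : augmentation E R (single r a) = a := by
  simp [augmentation]

theorem augmentation_galTwist (g : E ≃ₐ[K] E) (z : MonoidAlgebra E R) :
    augmentation E R (galTwist K E R g z) = g (augmentation E R z) := by
  induction z using MonoidAlgebra.induction_linear with
  | zero => simp
  | add x y hx hy => simp [hx, hy]
  | single r a => simp

/-- The augmentation commutes with the Galois action, so its value at a fixed element is fixed and
lies in `K`. -/
theorem augmentation_mem_range (z : descAlg K E R) :
    augmentation E R z ∈ (Algebra.ofId K E).range := by
  have h := IsGalois.mem_bot_iff_fixed (F := K) (augmentation E R z.1)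
  rw [IntermediateField.mem_bot] at h
  obtain ⟨k, hk⟩ := h.2 fun g => by rw [← augmentation_galTwist, mem_descAlg_iff.1 z.2]
  exact ⟨k, hk⟩

variable (K E R) in
/-- The counit of a descended group algebra. -/
noncomputable def descCounit : descAlg K E R →ₐ[K] K :=
  (AlgEquiv.ofInjective (Algebra.ofId K E) (algebraMap K E).injective).symm.toAlgHom.comp
    ((((augmentation E R).restrictScalars K).comp (descAlg K E R).val).codRestrict _
      augmentation_mem_range)

theorem algebraMap_descCounit (z : descAlg K E R) :
    algebraMap K E (descCounit K E R z) = augmentation E R z := by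
  have h := (AlgEquiv.ofInjective (Algebra.ofId K E) (algebraMap K E).injective).apply_symm_apply
    ((((augmentation E R).restrictScalars K).comp (descAlg K E R).val).codRestrict _
      augmentation_mem_range z)
  exact congrArg Subtype.val h

variable (K E R S T) in
/-- The exterior product of three descended group algebras. -/
noncomputable def descTensor₃ :
    descAlg K E R ⊗[K] (descAlg K E S ⊗[K] descAlg K E T) →ₐ[K] MonoidAlgebra E (R × (S × T)) :=
  (descTensor R (S × T)).comp
    (Algebra.TensorProduct.map (AlgHom.id K _) (descTensorEquiv K E S T).toAlgHom)

theorem descTensor₃_injective : Function.Injective (descTensor₃ K E R S T) := by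
  refine descTensor_injective.comp ?_
  exact (Algebra.TensorProduct.congr (AlgEquiv.refl : descAlg K E R ≃ₐ[K] _)
    (descTensorEquiv K E S T)).injective

theorem descTensor₃_tmul (x : descAlg K E R) (w : descAlg K E S ⊗[K] descAlg K E T) :
    descTensor₃ K E R S T (x ⊗ₜ w) = mapDomainAlgHom K E (MonoidHom.inl R (S × T)) x *
      mapDomainAlgHom K E (MonoidHom.inr R (S × T)) (descTensor S T w) := by
  change descTensor R (S × T) (Algebra.TensorProduct.map (AlgHom.id K _)
    (descTensorEquiv K E S T).toAlgHom (x ⊗ₜ w)) = _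
  rw [Algebra.TensorProduct.map_tmul, descTensor_tmul]
  rfl

theorem mapDomainAlgHom_comp_apply (f : R →* S) (h : S →* T) (z : MonoidAlgebra E R) :
    mapDomainAlgHom K E h (mapDomainAlgHom K E f z) = mapDomainAlgHom K E (h.comp f) z := by
  rw [mapDomainAlgHom_comp]
  rfl

set_option synthInstance.maxHeartbeats 200000 in
theorem descTensor₃_assoc_tmul (v : descAlg K E R ⊗[K] descAlg K E S) (y : descAlg K E T) :
    descTensor₃ K E R S T (Algebra.TensorProduct.assoc K K K _ _ _ (v ⊗ₜ y)) =
      mapDomainAlgHom K E ((MulEquiv.prodAssoc (M := R) (N := S) (P := T)).toMonoidHom.comp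
        (MonoidHom.inl (R × S) T)) (descTensor R S v) *
      mapDomainAlgHom K E ((MonoidHom.inr R (S × T)).comp (MonoidHom.inr S T)) y := by
  induction v using TensorProduct.induction_on with
  | zero => rw [TensorProduct.zero_tmul, map_zero, map_zero, map_zero, map_zero, zero_mul]
  | add v v' hv hv' => rw [TensorProduct.add_tmul, map_add, map_add, map_add, map_add, hv, hv',
      add_mul]
  | tmul a b =>
    rw [Algebra.TensorProduct.assoc_tmul, descTensor₃_tmul, descTensor_tmul, descTensor_tmul,
      map_mul, map_mul]
    simp only [mapDomainAlgHom_comp_apply, mul_assoc]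
    rfl

-- After the embedding into `E[R × (R × R)]` both sides are induced by group homomorphisms applied
-- to the diagonal, and both compositions are the triple diagonal of `R`.
set_option synthInstance.maxHeartbeats 200000 in
theorem desc_coassoc :
    (Algebra.TensorProduct.assoc K K K (descAlg K E R) (descAlg K E R)
        (descAlg K E R)).toAlgHom.comp
      ((Algebra.TensorProduct.map (descComul K E R) (.id K _)).comp (descComul K E R))
      = (Algebra.TensorProduct.map (.id K _) (descComul K E R)).comp (descComul K E R) := by
  ext z
  apply descTensor₃_injective
  simp only [AlgHom.comp_apply]
  have h1 : ∀ w, descTensor₃ K E R R R ((Algebra.TensorProduct.assoc K K K (descAlg K E R)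
      (descAlg K E R) (descAlg K E R)).toAlgHom
        (Algebra.TensorProduct.map (descComul K E R) (.id K _) w)) =
      mapDomainAlgHom K E ((MonoidHom.fst R R).prod (MonoidHom.id (R × R)))
        (descTensor R R w) := by
    intro w
    induction w using TensorProduct.induction_on with
    | zero => simp
    | add v v' hv hv' => rw [map_add, map_add, map_add, hv, hv', map_add, map_add]
    | tmul a b =>
      rw [Algebra.TensorProduct.map_tmul]
      refine (descTensor₃_assoc_tmul _ _).trans ?_
      rw [descTensor_descComul, descTensor_tmul, map_mul]
      simp only [mapDomainAlgHom_comp_apply]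
      rfl
  have h2 : ∀ w, descTensor₃ K E R R R (Algebra.TensorProduct.map (.id K _) (descComul K E R) w) =
      mapDomainAlgHom K E ((MonoidHom.fst R R).prod ((MonoidHom.snd R R).prod (MonoidHom.snd R R)))
        (descTensor R R w) := by
    intro w
    induction w using TensorProduct.induction_on with
    | zero => simp
    | add v v' hv hv' => rw [map_add, map_add, hv, hv', map_add, map_add]
    | tmul a b =>
      rw [Algebra.TensorProduct.map_tmul, descTensor₃_tmul, descTensor_descComul, descTensor_tmul,
        map_mul]
      simp only [mapDomainAlgHom_comp_apply]
      rfl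
  rw [h1, h2, descTensor_descComul, mapDomainAlgHom_comp_apply, mapDomainAlgHom_comp_apply]
  rfl

/-- The counit on the left factor becomes the map induced by the second projection `R × R → R`, and
the diagonal is a section of that projection. -/
theorem desc_counit_left :
    (Algebra.TensorProduct.map (descCounit K E R) (.id K _)).comp (descComul K E R)
      = (Algebra.TensorProduct.lid K (descAlg K E R)).symm := by
  have h1 : ∀ w, ((Algebra.TensorProduct.lid K (descAlg K E R)
      (Algebra.TensorProduct.map (descCounit K E R) (.id K _) w) : descAlg K E R) :
        MonoidAlgebra E R) = mapDomainAlgHom K E (MonoidHom.snd R R) (descTensor R R w) := by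
    intro w
    induction w using TensorProduct.induction_on with
    | zero => simp
    | add v v' hv hv' => rw [map_add, map_add, map_add, map_add, ← hv, ← hv']; rfl
    | tmul a b =>
      rw [Algebra.TensorProduct.map_tmul, descTensor_tmul, map_mul, mapDomainAlgHom_comp_apply,
        mapDomainAlgHom_comp_apply]
      have h3 : mapDomainAlgHom K E ((MonoidHom.snd R R).comp (MonoidHom.inl R R)) a.1 =
          single 1 (augmentation E R a) := by
        induction a.1 using MonoidAlgebra.induction_linear with
        | zero => simp
        | add x y hx hy => rw [map_add, map_add, hx, hy, single_add]
        | single r a => rw [mapDomainAlgHom_single']; simp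
      have h4 : mapDomainAlgHom K E ((MonoidHom.snd R R).comp (MonoidHom.inr R R)) b.1 = b := by
        rw [MonoidHom.snd_comp_inr, mapDomainAlgHom_id]
        rfl
      rw [h3, h4, ← algebraMap_descCounit]
      simp only [AlgHom.id_apply, Algebra.TensorProduct.lid_tmul, Subalgebra.coe_smul]
      rw [Algebra.smul_def]
      rfl
  ext z : 1
  apply (Algebra.TensorProduct.lid K (descAlg K E R)).injective
  apply Subtype.ext
  rw [AlgHom.comp_apply, h1, descTensor_descComul, mapDomainAlgHom_comp_apply]
  have h5 := (Algebra.TensorProduct.lid K (descAlg K E R)).apply_symm_apply z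
  refine Eq.trans ?_ (congrArg Subtype.val h5).symm
  rw [MonoidHom.snd_comp_prod, mapDomainAlgHom_id]
  rfl

theorem desc_comm (w : descAlg K E R ⊗[K] descAlg K E R) :
    descTensor R R (TensorProduct.comm K _ _ w) =
      mapDomainAlgHom K E ((MonoidHom.snd R R).prod (MonoidHom.fst R R)) (descTensor R R w) := by
  induction w using TensorProduct.induction_on with
  | zero => simp
  | add v v' hv hv' => rw [map_add, map_add, hv, hv', map_add, map_add]
  | tmul a b =>
    rw [TensorProduct.comm_tmul]
    have h1 := map_mul (descTensor (K := K) (E := E) R R) (b ⊗ₜ 1) (1 ⊗ₜ a)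
    -- The tensor `b ⊗ a` is split in this order so that its image has the two factors in the order
    -- in which the exchange map produces them from `a ⊗ b`.
    have h2 := map_mul (descTensor (K := K) (E := E) R R) (1 ⊗ₜ a) (b ⊗ₜ 1)
    simp only [Algebra.TensorProduct.tmul_mul_tmul, one_mul, mul_one] at h1 h2
    rw [h2]
    simp only [descTensor_tmul, map_mul, mapDomainAlgHom_comp_apply, OneMemClass.coe_one, map_one,
      one_mul, mul_one]
    rfl

theorem comm_descComul (z : descAlg K E R) :
    TensorProduct.comm K _ _ (descComul K E R z) = descComul K E R z := by
  apply descTensor_injective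
  rw [desc_comm, descTensor_descComul, mapDomainAlgHom_comp_apply]
  rfl

/-- Cocommutativity reduces this law to the one for the left factor. -/
theorem desc_counit_right :
    (Algebra.TensorProduct.map (.id K _) (descCounit K E R)).comp (descComul K E R)
      = (Algebra.TensorProduct.rid K K (descAlg K E R)).symm := by
  ext z : 1
  have h := DFunLike.congr_fun (desc_counit_left (K := K) (E := E) (R := R)) z
  have h1 : ∀ w : descAlg K E R ⊗[K] descAlg K E R,
      TensorProduct.comm K _ _ (Algebra.TensorProduct.map (descCounit K E R) (.id K _) w) =
      Algebra.TensorProduct.map (.id K _) (descCounit K E R) (TensorProduct.comm K _ _ w) := by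
    intro w
    induction w using TensorProduct.induction_on with
    | zero => simp
    | add v v' hv hv' => rw [map_add, map_add, hv, hv', map_add, map_add]
    | tmul a b => rfl
  have h2 := congrArg (TensorProduct.comm K _ _) h
  rw [AlgHom.comp_apply, h1, comm_descComul] at h2
  exact h2

noncomputable instance descAlg.bialgebra : Bialgebra K (descAlg K E R) :=
  Bialgebra.ofAlgHom (descComul K E R) (descCounit K E R) desc_coassoc desc_counit_left
    desc_counit_right

theorem descAlg.comul_eq (z : descAlg K E R) :
    Coalgebra.comul (R := K) z = descComul K E R z := rfl

theorem descAlg.counit_eq (z : descAlg K E R) :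
    Coalgebra.counit (R := K) z = descCounit K E R z := rfl

instance descAlg.isCocomm : Coalgebra.IsCocomm K (descAlg K E R) where
  comm_comp_comul := LinearMap.ext comm_descComul

end DescHopf

/-! ### Antipode and base change of descended group algebras -/

section DescAntipode

open MonoidAlgebra

variable {K E : Type*} [Field K] [Field E] [Algebra K E]
variable {R : Type*} [Group R] [MulDistribMulAction (E ≃ₐ[K] E) R]

variable (E R) in
/-- Inversion of the group elements in the group algebra. -/
noncomputable def invMap : MonoidAlgebra E R →ₗ[E] MonoidAlgebra E R :=
  (MonoidAlgebra.basis R E).constr E fun r => single r⁻¹ 1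

@[simp]
theorem invMap_single (r : R) (a : E) : invMap E R (single r a) = single r⁻¹ a := by
  have h : (single r a : MonoidAlgebra E R) = a • MonoidAlgebra.basis R E r := by
    rw [MonoidAlgebra.basis_apply]
    simp
  rw [h, map_smul, invMap, Module.Basis.constr_basis]
  simp

theorem galTwist_invMap (g : E ≃ₐ[K] E) (z : MonoidAlgebra E R) :
    galTwist K E R g (invMap E R z) = invMap E R (galTwist K E R g z) := by
  induction z using MonoidAlgebra.induction_linear with
  | zero => simp
  | add x y hx hy => rw [map_add, map_add, map_add, map_add, hx, hy]
  | single r a => simp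

variable (K E R) in
/-- The antipode of a descended group algebra. -/
noncomputable def descAntipode : descAlg K E R →ₗ[K] descAlg K E R where
  toFun z := ⟨invMap E R z, mem_descAlg_iff.2 fun g => by
    rw [galTwist_invMap, mem_descAlg_iff.1 z.2]⟩
  map_add' x y := Subtype.ext (map_add _ _ _)
  map_smul' c x := Subtype.ext (by
    change invMap E R (c • x.1) = c • invMap E R x.1
    rw [← algebraMap_smul E, map_smul, algebraMap_smul])

/-- Multiplying after inverting the left factor is induced by `(r, s) ↦ r⁻¹ s`. This is only a map
of sets, hence the linear `mapDomain`; on the diagonal it is constantly `1`, which is the antipode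
law. -/
theorem mapDomain_divLeft (x y : MonoidAlgebra E R) :
    mapDomain (fun t : R × R => t.1⁻¹ * t.2) (mapDomainAlgHom K E (MonoidHom.inl R R) x *
      mapDomainAlgHom K E (MonoidHom.inr R R) y) = invMap E R x * y := by
  induction x using MonoidAlgebra.induction_linear with
  | zero => simp
  | add x x' hx hx' => rw [map_add, add_mul, mapDomain_add, hx, hx', map_add, add_mul]
  | single r a =>
    induction y using MonoidAlgebra.induction_linear with
    | zero => simp
    | add y y' hy hy' => rw [map_add, mul_add, mapDomain_add, hy, hy', mul_add]
    | single s b =>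
      rw [mapDomainAlgHom_single', mapDomainAlgHom_single', single_mul_single, mapDomain_single]
      simp [single_mul_single]

theorem mapDomain_divRight (x y : MonoidAlgebra E R) :
    mapDomain (fun t : R × R => t.1 * t.2⁻¹) (mapDomainAlgHom K E (MonoidHom.inl R R) x *
      mapDomainAlgHom K E (MonoidHom.inr R R) y) = x * invMap E R y := by
  induction x using MonoidAlgebra.induction_linear with
  | zero => simp
  | add x x' hx hx' => rw [map_add, add_mul, mapDomain_add, hx, hx', add_mul]
  | single r a =>
    induction y using MonoidAlgebra.induction_linear with
    | zero => simp
    | add y y' hy hy' => rw [map_add, mul_add, mapDomain_add, hy, hy', map_add, mul_add]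
    | single s b =>
      rw [mapDomainAlgHom_single', mapDomainAlgHom_single', single_mul_single, mapDomain_single]
      simp [single_mul_single]

theorem mapDomain_one_diag (f : R × R → R) (hf : ∀ r, f (r, r) = 1) (z : MonoidAlgebra E R) :
    mapDomain f (mapDomainAlgHom K E ((MonoidHom.id R).prod (MonoidHom.id R)) z) =
      algebraMap E _ (augmentation E R z) := by
  induction z using MonoidAlgebra.induction_linear with
  | zero => simp
  | add x y hx hy => rw [map_add, mapDomain_add, hx, hy, map_add, map_add]
  | single r a =>
    rw [mapDomainAlgHom_single', mapDomain_single]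
    simp [hf, augmentation]

variable [Finite R] [FiniteDimensional K E] [IsGalois K E]

theorem desc_antipode_left (w : descAlg K E R ⊗[K] descAlg K E R) :
    (LinearMap.mul' K (descAlg K E R) ((descAntipode K E R).rTensor _ w) : descAlg K E R).1 =
      mapDomain (fun t : R × R => t.1⁻¹ * t.2) (descTensor R R w) := by
  induction w using TensorProduct.induction_on with
  | zero => simp
  | add v v' hv hv' => rw [map_add, map_add, map_add, mapDomain_add, ← hv, ← hv']; rfl
  | tmul a b =>
    rw [descTensor_tmul, mapDomain_divLeft, LinearMap.rTensor_tmul, LinearMap.mul'_apply]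
    rfl

theorem desc_antipode_right (w : descAlg K E R ⊗[K] descAlg K E R) :
    (LinearMap.mul' K (descAlg K E R) ((descAntipode K E R).lTensor _ w) : descAlg K E R).1 =
      mapDomain (fun t : R × R => t.1 * t.2⁻¹) (descTensor R R w) := by
  induction w using TensorProduct.induction_on with
  | zero => simp
  | add v v' hv hv' => rw [map_add, map_add, map_add, mapDomain_add, ← hv, ← hv']; rfl
  | tmul a b =>
    rw [descTensor_tmul, mapDomain_divRight, LinearMap.lTensor_tmul, LinearMap.mul'_apply]
    rfl

noncomputable instance descAlg.hopfAlgebra : HopfAlgebra K (descAlg K E R) where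
  antipode := descAntipode K E R
  mul_antipode_rTensor_comul := by
    refine LinearMap.ext fun z => Subtype.ext ?_
    change (LinearMap.mul' K (descAlg K E R) ((descAntipode K E R).rTensor _
      (descComul K E R z))).1 = (algebraMap K (descAlg K E R) (descCounit K E R z)).1
    rw [desc_antipode_left, descTensor_descComul, mapDomain_one_diag _ (by simp),
      ← algebraMap_descCounit]
    rfl
  mul_antipode_lTensor_comul := by
    refine LinearMap.ext fun z => Subtype.ext ?_
    change (LinearMap.mul' K (descAlg K E R) ((descAntipode K E R).lTensor _
      (descComul K E R z))).1 = (algebraMap K (descAlg K E R) (descCounit K E R z)).1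
    rw [desc_antipode_right, descTensor_descComul, mapDomain_one_diag _ (by simp),
      ← algebraMap_descCounit]
    rfl

variable (K E R) in
/-- The comparison map from the base change of the descended algebra to the group algebra. -/
noncomputable def descBaseChange : E ⊗[K] descAlg K E R →ₐ[E] MonoidAlgebra E R :=
  Algebra.TensorProduct.lift (Algebra.ofId E _) (descAlg K E R).val
    fun e z => (Algebra.commutes e z.1 : Commute (algebraMap E _ e) z.1)

theorem descBaseChange_tmul (e : E) (z : descAlg K E R) :
    descBaseChange K E R (e ⊗ₜ z) = e • z.1 := by
  rw [Algebra.smul_def]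
  exact Algebra.TensorProduct.lift_tmul _ _ _ _ _

/-- The two halves of descent: a `K`-basis of the fixed elements is independent over `E`, and the
fixed elements span `E[R]`. -/
theorem descBaseChange_bijective : Function.Bijective (descBaseChange K E R) := by
  have hinj : Function.Injective (descBaseChange K E R) := by
    rw [injective_iff_map_eq_zero]
    intro w hw
    let b := Module.finBasis K (descAlg K E R)
    have hb := descAlg.linearIndependent b.linearIndependent
    rw [Fintype.linearIndependent_iff] at hb
    have hsum := (Algebra.TensorProduct.basis E b).sum_repr w
    rw [← hsum, map_sum] at hw
    simp only [map_smul, Algebra.TensorProduct.basis_apply, descBaseChange_tmul, one_smul] at hw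
    have h0 := hb _ hw
    rw [← hsum]
    exact Finset.sum_eq_zero fun i _ => by rw [h0, zero_smul]
  refine ⟨hinj, ?_⟩
  have h1 : LinearMap.range (descBaseChange K E R).toLinearMap = ⊤ := by
    rw [eq_top_iff, ← descAlg.span_eq_top (K := K), Submodule.span_le]
    intro z hz
    refine ⟨1 ⊗ₜ ⟨z, hz⟩, ?_⟩
    exact (descBaseChange_tmul _ _).trans (one_smul _ _)
  exact LinearMap.range_eq_top.1 h1

variable (K E R) in
/-- The group-like splitting of `E[R × R]`. -/
noncomputable def splitProd : MonoidAlgebra E (R × R) →ₐ[E]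
    MonoidAlgebra E R ⊗[E] MonoidAlgebra E R :=
  MonoidAlgebra.lift E _ (R × R)
    { toFun := fun t => single t.1 1 ⊗ₜ single t.2 1
      map_one' := rfl
      map_mul' := fun s t => by simp [Algebra.TensorProduct.tmul_mul_tmul, single_mul_single] }

theorem splitProd_single (t : R × R) (a : E) :
    splitProd E R (single t a) = a • (single t.1 1 ⊗ₜ single t.2 1) := by
  simp [splitProd]

-- Links the two descriptions of a tensor: through `E[R × R]`, where the comultiplication was
-- defined, and through the base change to `E`, where it has to agree with that of the group
-- algebra.
set_option synthInstance.maxHeartbeats 200000 in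
theorem splitProd_descTensor (w : descAlg K E R ⊗[K] descAlg K E R) :
    splitProd E R (descTensor R R w) =
      Algebra.TensorProduct.map (descBaseChange K E R) (descBaseChange K E R)
        (TensorProduct.AlgebraTensorModule.tensorTensorTensorComm K E K E E E _ _
          ((1 ⊗ₜ[E] 1) ⊗ₜ[K] w)) := by
  induction w using TensorProduct.induction_on with
  | zero => rw [map_zero, map_zero, TensorProduct.tmul_zero, LinearEquiv.map_zero, map_zero]
  | add v v' hv hv' => rw [map_add, map_add, hv, hv', TensorProduct.tmul_add, LinearEquiv.map_add,
      map_add]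
  | tmul a b =>
    rw [TensorProduct.AlgebraTensorModule.tensorTensorTensorComm_tmul,
      Algebra.TensorProduct.map_tmul, descBaseChange_tmul, descBaseChange_tmul, one_smul, one_smul,
      descTensor_tmul, map_mul]
    have h1 : splitProd E R (mapDomainAlgHom K E (MonoidHom.inl R R) a.1) = a.1 ⊗ₜ 1 := by
      induction a.1 using MonoidAlgebra.induction_linear with
      | zero => simp
      | add x y hx hy => rw [map_add, map_add, hx, hy, TensorProduct.add_tmul]
      | single r c =>
        rw [mapDomainAlgHom_single', splitProd_single, TensorProduct.smul_tmul']
        simp [one_def]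
    have h2 : splitProd E R (mapDomainAlgHom K E (MonoidHom.inr R R) b.1) = 1 ⊗ₜ b.1 := by
      induction b.1 using MonoidAlgebra.induction_linear with
      | zero => simp
      | add x y hx hy => rw [map_add, map_add, hx, hy, TensorProduct.tmul_add]
      | single r c =>
        rw [mapDomainAlgHom_single', splitProd_single, ← TensorProduct.tmul_smul]
        simp [one_def]
    rw [h1, h2, Algebra.TensorProduct.tmul_mul_tmul, one_mul, mul_one]

theorem splitProd_diag (z : MonoidAlgebra E R) :
    splitProd E R (mapDomainAlgHom K E ((MonoidHom.id R).prod (MonoidHom.id R)) z) =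
      Coalgebra.comul (R := E) z := by
  induction z using MonoidAlgebra.induction_linear with
  | zero => simp
  | add x y hx hy => rw [map_add, map_add, hx, hy, map_add]
  | single r c =>
    rw [mapDomainAlgHom_single', splitProd_single, MonoidAlgebra.comul_single,
      CommSemiring.comul_apply, TensorProduct.map_tmul]
    have h : (single r c : MonoidAlgebra E R) = c • single r 1 := by simp
    rw [lsingle_apply, lsingle_apply, h, TensorProduct.tmul_smul, TensorProduct.smul_tmul']
    rfl

variable (K E R) in
/-- The descended Hopf algebra is a form of the group algebra. -/
noncomputable def descBaseChangeEquiv : E ⊗[K] descAlg K E R ≃ₐc[E] MonoidAlgebra E R :=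
  BialgEquiv.ofBijective (BialgHom.ofAlgHom (descBaseChange K E R) (by
    apply Algebra.TensorProduct.ext
    · ext
    · ext z : 1
      change Coalgebra.counit (R := E) (descBaseChange K E R (1 ⊗ₜ z)) =
        Coalgebra.counit (R := E) ((1 : E) ⊗ₜ[K] z)
      rw [descBaseChange_tmul, one_smul, TensorProduct.counit_tmul, descAlg.counit_eq,
        Algebra.smul_def, algebraMap_descCounit]
      simp only [CommSemiring.counit_apply, mul_one]
      induction z.1 using MonoidAlgebra.induction_linear with
      | zero => simp
      | add x y hx hy => rw [map_add, map_add, hx, hy]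
      | single r c => simp) (by
    apply Algebra.TensorProduct.ext
    · ext
    · ext z : 1
      change Algebra.TensorProduct.map (descBaseChange K E R) (descBaseChange K E R)
        (Coalgebra.comul (R := E) ((1 : E) ⊗ₜ[K] z)) =
        Coalgebra.comul (R := E) (descBaseChange K E R (1 ⊗ₜ z))
      rw [descBaseChange_tmul, one_smul, TensorProduct.comul_tmul, descAlg.comul_eq,
        CommSemiring.comul_apply, ← splitProd_descTensor, descTensor_descComul, splitProd_diag]))
    descBaseChange_bijective

end DescAntipode

/-! ### Hopf-Galois structures from regular subgroups -/

section Embeddings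

variable {K L E : Type*} [Field K] [Field L] [Field E] [Algebra K L] [Algebra K E]

/-- The Galois group acts on the embeddings by composition. -/
instance embeddingAction : MulAction (E ≃ₐ[K] E) (L →ₐ[K] E) where
  smul g σ := (g : E →ₐ[K] E).comp σ
  one_smul σ := by ext; rfl
  mul_smul g h σ := by ext; rfl

variable (K L E) in
/-- Elements of `L` as functions on the embeddings. -/
def evalMap : L →ₗ[K] equivariantMaps K E (L →ₐ[K] E) where
  toFun y := ⟨fun σ => σ y, fun g σ => rfl⟩
  map_add' x y := by
    apply Subtype.ext
    funext σ
    simp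
  map_smul' c x := by
    apply Subtype.ext
    funext σ
    simp

/-- A single embedding already gives injectivity, and by descent both sides have dimension the
number of embeddings. -/
theorem evalMap_bijective [FiniteDimensional K L] [FiniteDimensional K E] [IsGalois K E]
    (hX : Nat.card (L →ₐ[K] E) = Module.finrank K L) : Function.Bijective (evalMap K L E) := by
  have hpos : 0 < Nat.card (L →ₐ[K] E) := hX ▸ Module.finrank_pos
  obtain ⟨⟨σ⟩, hfin⟩ := Nat.card_pos_iff.1 hpos
  have hinj : Function.Injective (evalMap K L E) := fun x y h =>
    σ.injective (congrArg (fun f : equivariantMaps K E (L →ₐ[K] E) => f.1 σ) h)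
  exact ⟨hinj, (LinearMap.injective_iff_surjective_of_finrank_eq_finrank
    (by rw [equivariantMaps.finrank_eq, hX])).1 hinj⟩

end Embeddings

/-! ### Linear functionals on group algebras -/

section Functional

open MonoidAlgebra

variable {K E : Type*} [Field K] [Field E] [Algebra K E] {R S : Type*} [Group R] [Group S]

/-- The linear functional on `E[R]` with the given values on the elements of `R`. -/
noncomputable def evalFun (c : R → E) : MonoidAlgebra E R →ₗ[E] E :=
  (MonoidAlgebra.basis R E).constr E c

@[simp]
theorem evalFun_single (c : R → E) (r : R) (a : E) : evalFun c (single r a) = a * c r := by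
  have h : (single r a : MonoidAlgebra E R) = a • MonoidAlgebra.basis R E r := by
    rw [MonoidAlgebra.basis_apply]
    simp
  rw [h, map_smul, evalFun, Module.Basis.constr_basis, smul_eq_mul]

theorem evalFun_eq_sum [Fintype R] (c : R → E) (z : MonoidAlgebra E R) :
    evalFun c z = ∑ r, z.coeff r * c r := by
  classical
  induction z using MonoidAlgebra.induction_linear with
  | zero => simp
  | add x y hx hy => simp [hx, hy, add_mul, Finset.sum_add_distrib]
  | single r a => simp [Finsupp.single_apply]

theorem evalFun_inl_mul_inr (c : R → E) (d : S → E) (x : MonoidAlgebra E R)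
    (y : MonoidAlgebra E S) :
    evalFun (fun t : R × S => c t.1 * d t.2) (mapDomainAlgHom K E (MonoidHom.inl R S) x *
      mapDomainAlgHom K E (MonoidHom.inr R S) y) = evalFun c x * evalFun d y := by
  induction x using MonoidAlgebra.induction_linear with
  | zero => simp
  | add x x' hx hx' => rw [map_add, add_mul, map_add, hx, hx', map_add, add_mul]
  | single r a =>
    induction y using MonoidAlgebra.induction_linear with
    | zero => simp
    | add y y' hy hy' => rw [map_add, mul_add, map_add, hy, hy', map_add, mul_add]
    | single s b =>
      rw [mapDomainAlgHom_single', mapDomainAlgHom_single', single_mul_single]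
      simp
      ring

theorem evalFun_mapDomain (f : R →* S) (c : S → E) (x : MonoidAlgebra E R) :
    evalFun c (mapDomainAlgHom K E f x) = evalFun (fun r => c (f r)) x := by
  induction x using MonoidAlgebra.induction_linear with
  | zero => simp
  | add x x' hx hx' => rw [map_add, map_add, hx, hx', map_add]
  | single r a => rw [mapDomainAlgHom_single']; simp

end Functional

/-! ### The action of a descended group algebra on `L` -/

section DescAction

open MonoidAlgebra

variable {K L E : Type*} [Field K] [Field L] [Field E] [Algebra K L] [Algebra K E]
variable {R : Type*} [Group R] [MulDistribMulAction (E ≃ₐ[K] E) R] [MulAction R (L →ₐ[K] E)]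

/-- The action of `E[R]` on functions on the embeddings. -/
noncomputable def permOp (z : MonoidAlgebra E R) (f : (L →ₐ[K] E) → E) (σ : L →ₐ[K] E) : E :=
  evalFun (fun r => f (r⁻¹ • σ)) z

theorem permOp_mul (z w : MonoidAlgebra E R) (f : (L →ₐ[K] E) → E) :
    permOp (z * w) f = permOp z (permOp w f) := by
  funext σ
  induction z using MonoidAlgebra.induction_linear with
  | zero => simp [permOp]
  | add x y hx hy => simp only [permOp, add_mul, map_add] at *; rw [hx, hy]
  | single r a =>
    induction w using MonoidAlgebra.induction_linear with
    | zero => simp [permOp]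
    | add x y hx hy => simp only [permOp, mul_add, map_add, evalFun_single] at *; rw [hx, hy]
    | single s b => simp [permOp, single_mul_single, mul_smul, mul_assoc]

/-- Twisting the operator and moving the embedding amount to applying `g` to the value. For a
Galois-fixed `z` the operator therefore preserves equivariant functions, that is, it acts on `L`. -/
theorem permOp_galTwist (hc : ∀ (g : E ≃ₐ[K] E) (r : R) (σ : L →ₐ[K] E), g • r • σ = (g • r) • g • σ)
    {f : (L →ₐ[K] E) → E} (hf : f ∈ equivariantMaps K E (L →ₐ[K] E))
    (z : MonoidAlgebra E R) (g : E ≃ₐ[K] E) (σ : L →ₐ[K] E) :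
    permOp (galTwist K E R g z) f (g • σ) = g (permOp z f σ) := by
  induction z using MonoidAlgebra.induction_linear with
  | zero => simp [permOp]
  | add x y hx hy => simp only [permOp, map_add] at *; rw [hx, hy]
  | single r a =>
    simp only [permOp, galTwist_single, evalFun_single, map_mul]
    rw [← hf, hc, smul_inv']

-- The embeddings `r⁻¹ • σ` are distinct, hence linearly independent over `E`. So an element of
-- `E[R]` is determined by its operator at one embedding.
omit [MulDistribMulAction (E ≃ₐ[K] E) R] in
theorem permOp_eq_zero [Finite R] [FiniteDimensional K L]
    {σ : L →ₐ[K] E} (hσ : ∀ r s : R, r • σ = s • σ → r = s)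
    {z : MonoidAlgebra E R} (hz : ∀ y : L, permOp z (fun τ : L →ₐ[K] E => τ y) σ = 0) : z = 0 := by
  have := Fintype.ofFinite R
  have hli : LinearIndependent E (fun r : R => (r⁻¹ • σ : L →ₐ[K] E).toLinearMap) :=
    (linearIndependent_toLinearMap K L E).comp (fun r : R => r⁻¹ • σ) fun r s h =>
      inv_injective (hσ _ _ h)
  rw [Fintype.linearIndependent_iff] at hli
  ext r
  refine hli (fun r => z.coeff r) ?_ r
  ext y
  have := hz y
  rw [permOp, evalFun_eq_sum] at this
  simpa using this

variable [Finite R] [FiniteDimensional K L] [FiniteDimensional K E] [IsGalois K E]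

variable (K L E R) in
/-- The data from which a Hopf-Galois structure is descended. -/
structure DescData : Prop where
  card : Nat.card (L →ₐ[K] E) = Module.finrank K L
  equivariant : ∀ (g : E ≃ₐ[K] E) (r : R) (σ : L →ₐ[K] E), g • r • σ = (g • r) • g • σ
  regular : ∀ σ τ : L →ₐ[K] E, ∃! r : R, r • σ = τ

omit [Finite R] [FiniteDimensional K E] [IsGalois K E] in
theorem DescData.nonempty (D : DescData K L E R) : Nonempty (L →ₐ[K] E) := by
  have hpos : 0 < Nat.card (L →ₐ[K] E) := D.card ▸ Module.finrank_pos
  exact (Nat.card_pos_iff.1 hpos).1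

omit [Finite R] [FiniteDimensional K E] [IsGalois K E] [FiniteDimensional K L] in
theorem DescData.free (D : DescData K L E R) (σ : L →ₐ[K] E) (r s : R) (h : r • σ = s • σ) :
    r = s :=
  (D.regular σ (s • σ)).unique h rfl

omit [Finite R] [FiniteDimensional K E] [IsGalois K E] in
theorem DescData.card_group (D : DescData K L E R) : Nat.card R = Module.finrank K L := by
  obtain ⟨σ⟩ := D.nonempty
  rw [← D.card]
  exact Nat.card_congr (Equiv.ofBijective (fun r : R => r • σ)
    ⟨fun r s h => D.free σ r s h, fun τ => (D.regular σ τ).exists⟩)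

/-- `L` as the space of equivariant functions on the embeddings. -/
noncomputable def DescData.evalEquiv (D : DescData K L E R) :
    L ≃ₗ[K] equivariantMaps K E (L →ₐ[K] E) :=
  LinearEquiv.ofBijective (evalMap K L E) (evalMap_bijective D.card)

omit [Finite R] in
theorem DescData.permOp_mem (D : DescData K L E R) (z : descAlg K E R) (y : L) :
    permOp z.1 (fun τ : L →ₐ[K] E => τ y) ∈ equivariantMaps K E (L →ₐ[K] E) := fun g σ => by
  have := permOp_galTwist D.equivariant (evalMap K L E y).2 z.1 g σ
  rw [mem_descAlg_iff.1 z.2] at this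
  exact this

/-- The underlying function of the action. -/
noncomputable def DescData.actFun (D : DescData K L E R) (z : descAlg K E R) (y : L) : L :=
  D.evalEquiv.symm ⟨_, D.permOp_mem z y⟩

omit [Finite R] in
theorem DescData.apply_actFun (D : DescData K L E R) (z : descAlg K E R) (y : L)
    (σ : L →ₐ[K] E) : σ (D.actFun z y) = permOp z.1 (fun τ : L →ₐ[K] E => τ y) σ := by
  have h := D.evalEquiv.apply_symm_apply ⟨_, D.permOp_mem z y⟩
  exact congrArg (fun f : equivariantMaps K E (L →ₐ[K] E) => f.1 σ) h

omit [Finite R] [FiniteDimensional K E] [IsGalois K E] in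
theorem DescData.ext (D : DescData K L E R) {x y : L} (h : ∀ σ : L →ₐ[K] E, σ x = σ y) : x = y := by
  obtain ⟨σ⟩ := D.nonempty
  exact σ.injective (h σ)

/-- The action of the descended group algebra on `L`. -/
noncomputable def DescData.act (D : DescData K L E R) : descAlg K E R →ₐ[K] Module.End K L where
  toFun z :=
    { toFun := D.actFun z
      map_add' := fun x y => D.ext fun σ => by
        have := Fintype.ofFinite R
        simp [D.apply_actFun, permOp, evalFun_eq_sum, mul_add, Finset.sum_add_distrib]
      map_smul' := fun c x => D.ext fun σ => by
        have := Fintype.ofFinite R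
        simp only [D.apply_actFun, permOp, evalFun_eq_sum, map_smul, RingHom.id_apply,
          Finset.smul_sum, mul_smul_comm] }
  map_one' := LinearMap.ext fun y => D.ext fun σ => by
    refine (D.apply_actFun 1 y σ).trans ?_
    simp [permOp, one_def]
  map_mul' z w := LinearMap.ext fun y => D.ext fun σ => by
    refine (D.apply_actFun _ y σ).trans ?_
    refine Eq.trans ?_ (D.apply_actFun z (D.actFun w y) σ).symm
    have h : (fun τ : L →ₐ[K] E => τ (D.actFun w y)) = permOp w.1 (fun τ : L →ₐ[K] E => τ y) :=
      funext fun τ => D.apply_actFun w y τ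
    rw [h, ← permOp_mul]
    rfl
  map_zero' := LinearMap.ext fun y => D.ext fun σ => by
    refine (D.apply_actFun 0 y σ).trans ?_
    simp [permOp]
  map_add' z w := LinearMap.ext fun y => D.ext fun σ => by
    refine (D.apply_actFun _ y σ).trans ?_
    rw [LinearMap.add_apply, map_add]
    refine Eq.trans ?_ (congrArg₂ (· + ·) (D.apply_actFun z y σ) (D.apply_actFun w y σ)).symm
    simp [permOp]
  commutes' k := LinearMap.ext fun y => D.ext fun σ => by
    refine (D.apply_actFun _ y σ).trans ?_
    have h : (algebraMap K (descAlg K E R) k).1 = single 1 (algebraMap K E k) := rfl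
    rw [h]
    simp [permOp, Algebra.smul_def]

theorem DescData.apply_act (D : DescData K L E R) (z : descAlg K E R) (y : L)
    (σ : L →ₐ[K] E) : σ (D.act z y) = permOp z.1 (fun τ : L →ₐ[K] E => τ y) σ :=
  D.apply_actFun z y σ

theorem DescData.apply_act_mul (D : DescData K L E R) (x y : L) (σ : L →ₐ[K] E)
    (w : descAlg K E R ⊗[K] descAlg K E R) :
    σ (LinearMap.mul' K L (TensorProduct.map (D.act.toLinearMap.flip x)
      (D.act.toLinearMap.flip y) w)) =
      evalFun (fun t : R × R => (t.1⁻¹ • σ) x * (t.2⁻¹ • σ) y) (descTensor R R w) := by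
  induction w using TensorProduct.induction_on with
  | zero => simp
  | add v v' hv hv' => simp only [map_add]; rw [hv, hv']
  | tmul a b =>
    rw [TensorProduct.map_tmul, LinearMap.mul'_apply, descTensor_tmul,
      evalFun_inl_mul_inr (K := K) (fun r : R => (r⁻¹ • σ) x) (fun r : R => (r⁻¹ • σ) y), map_mul]
    exact congrArg₂ (· * ·) (D.apply_act a x σ) (D.apply_act b y σ)

/-- Both sides have dimension `[L : K]²`. For injectivity, apply an embedding `σ` to the
coefficients: the resulting element of `E[R]` vanishes by independence of embeddings, and a
`K`-basis of the fixed algebra is independent over `E`. -/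
theorem DescData.bijective (D : DescData K L E R) : Function.Bijective
    (LinearMap.mul' K (Module.End K L) ∘ₗ
      TensorProduct.map (LinearMap.mul K L) D.act.toLinearMap) := by
  have hfin : Module.finrank K (L ⊗[K] descAlg K E R) = Module.finrank K (Module.End K L) := by
    rw [Module.finrank_tensorProduct, descAlg.finrank_eq, D.card_group, Module.finrank_linearMap]
  have hinj : Function.Injective (LinearMap.mul' K (Module.End K L) ∘ₗ
      TensorProduct.map (LinearMap.mul K L) D.act.toLinearMap) := by
    rw [injective_iff_map_eq_zero]
    intro w hw
    let b := Module.finBasis K (descAlg K E R)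
    have hsum := (Algebra.TensorProduct.basis L b).sum_repr w
    set c := (Algebra.TensorProduct.basis L b).repr w with hcdef
    simp only [Algebra.TensorProduct.basis_apply, TensorProduct.smul_tmul', smul_eq_mul,
      mul_one] at hsum
    have hb := descAlg.linearIndependent b.linearIndependent
    rw [Fintype.linearIndependent_iff] at hb
    obtain ⟨σ⟩ := D.nonempty
    have h0 : ∑ i, σ (c i) • (b i).1 = 0 := by
      refine permOp_eq_zero (σ := σ) (D.free σ) fun y => ?_
      have h1 := congrArg (fun T : Module.End K L => σ (T y)) hw
      rw [← hsum, map_sum] at h1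
      simp only [LinearMap.comp_apply, TensorProduct.map_tmul, LinearMap.mul'_apply,
        LinearMap.sum_apply, map_sum, LinearMap.zero_apply, map_zero] at h1
      rw [← h1, permOp, map_sum]
      refine Finset.sum_congr rfl fun i _ => ?_
      change _ = σ (c i * D.act (b i) y)
      rw [map_mul, D.apply_act, map_smul, smul_eq_mul]
      rfl
    rw [← hsum]
    refine Finset.sum_eq_zero fun i _ => ?_
    have h2 : σ (c i) = 0 := hb _ h0 i
    rw [(map_eq_zero σ).1 h2, TensorProduct.zero_tmul]
  exact ⟨hinj, (LinearMap.injective_iff_surjective_of_finrank_eq_finrank hfin).1 hinj⟩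

/-- An element of `E[R]` whose operator maps `L` to `L` is automatically Galois-fixed, because it
and its twists have the same operator. The image of the Hopf algebra can thus be described without
mentioning the Galois action. -/
theorem DescData.mem_range_act (D : DescData K L E R) (T : Module.End K L) :
    T ∈ D.act.range ↔ ∃ z : MonoidAlgebra E R, ∀ (σ : L →ₐ[K] E) (y : L),
      σ (T y) = permOp z (fun τ : L →ₐ[K] E => τ y) σ := by
  constructor
  · rintro ⟨z, rfl⟩
    exact ⟨z.1, fun σ y => D.apply_act z y σ⟩
  · rintro ⟨z, hz⟩
    have hmem : z ∈ descAlg K E R := by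
      rw [mem_descAlg_iff]
      intro g
      obtain ⟨σ⟩ := D.nonempty
      rw [← sub_eq_zero]
      refine permOp_eq_zero (σ := g • σ) (D.free _) fun y => ?_
      have h1 := permOp_galTwist D.equivariant (evalMap K L E y).2 z g σ
      have h2 : permOp (galTwist K E R g z) (fun τ : L →ₐ[K] E => τ y) (g • σ) =
          permOp z (fun τ : L →ₐ[K] E => τ y) (g • σ) := by
        refine h1.trans ?_
        rw [← hz]
        exact congrArg g (hz σ y).symm
      rw [permOp, map_sub, sub_eq_zero]
      exact h2
    refine ⟨⟨z, hmem⟩, LinearMap.ext fun y => D.ext fun σ => ?_⟩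
    exact (D.apply_act _ y σ).trans (hz σ y).symm

end DescAction

/-! ### The descended Hopf-Galois structure and its type -/

section DescHGS

variable {K L E : Type u} [Field K] [Field L] [Field E] [Algebra K L] [Algebra K E]
variable {R : Type u} [Group R] [MulDistribMulAction (E ≃ₐ[K] E) R] [MulAction R (L →ₐ[K] E)]
variable [Finite R] [FiniteDimensional K L] [FiniteDimensional K E] [IsGalois K E]

/-- The Hopf-Galois structure of a regular group of permutations of the embeddings. -/
noncomputable def DescData.hgs (D : DescData K L E R) : HopfGaloisStructure K L where
  H := descAlg K E R
  act := D.act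
  act_mul h x y := D.ext fun σ => by
    rw [D.apply_act_mul, descAlg.comul_eq, descTensor_descComul, D.apply_act, permOp,
      evalFun_mapDomain]
    simp only [map_mul]
    rfl
  act_algebraMap h k := D.ext fun σ => by
    rw [D.apply_act, permOp, descAlg.counit_eq, AlgHom.commutes, map_mul, algebraMap_descCounit]
    simp only [AlgHom.commutes]
    induction h.1 using MonoidAlgebra.induction_linear with
    | zero => simp
    | add x y hx hy => rw [map_add, map_add, hx, hy, add_mul]
    | single r a => simp
  bijective := D.bijective

theorem DescData.hasType (D : DescData K L E R) {N : Type} [Group N] (e : R ≃* N) :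
    D.hgs.HasType E N :=
  ⟨(descBaseChangeEquiv K E R).trans (MonoidAlgebra.domCongrBialgEquiv E E e)⟩

end DescHGS

/-! ### Regular subgroups from Hopf-Galois structures -/

namespace HopfGaloisStructure

variable {K L : Type u} [Field K] [Field L] [Algebra K L]

theorem eq_zero_of_sum_mul_act (S : HopfGaloisStructure K L) {ι : Type*} [Fintype ι]
    (b : Module.Basis ι K S.H) {c : ι → L} (h : ∀ x, ∑ i, c i * S.act (b i) x = 0) : c = 0 := by
  have h1 : ∑ i, c i ⊗ₜ[K] b i = 0 := by
    apply S.bijective.1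
    rw [map_zero, map_sum]
    ext x
    rw [LinearMap.sum_apply]
    exact h x
  have h2 : ∑ i, c i • Algebra.TensorProduct.basis L b i = 0 := by
    simpa [TensorProduct.smul_tmul'] using h1
  funext i
  exact Fintype.linearIndependent_iff.1 (Algebra.TensorProduct.basis L b).linearIndependent _ h2 i

theorem act_injective (S : HopfGaloisStructure K L) : Function.Injective S.act := by
  rw [injective_iff_map_eq_zero]
  intro h hh
  have h1 : (1 : L) ⊗ₜ[K] h = 0 := by
    apply S.bijective.1
    rw [map_zero]
    ext x
    change 1 * S.act h x = 0
    rw [hh]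
    simp
  exact (Algebra.TensorProduct.includeRight_injective (R := K) (A := L) (B := S.H)
    (algebraMap K L).injective) (h1.trans (map_zero _).symm)

variable [FiniteDimensional K L]

theorem finiteDimensional (S : HopfGaloisStructure K L) : FiniteDimensional K S.H :=
  FiniteDimensional.of_injective S.act.toLinearMap S.act_injective

theorem finrank_eq (S : HopfGaloisStructure K L) :
    Module.finrank K S.H = Module.finrank K L := by
  have h := (LinearEquiv.ofBijective _ S.bijective).finrank_eq
  rw [Module.finrank_tensorProduct, Module.finrank_linearMap] at h
  exact Nat.eq_of_mul_eq_mul_left Module.finrank_pos h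

/-- An element of `H ⊗ H` is determined by the bilinear map that it induces on `L`. Together with
the module algebra law this means that the action determines the comultiplication. -/
theorem eq_zero_of_bilinear (S : HopfGaloisStructure K L) (w : S.H ⊗[K] S.H)
    (hw : ∀ x y, LinearMap.mul' K L (TensorProduct.map (S.act.toLinearMap.flip x)
      (S.act.toLinearMap.flip y) w) = 0) : w = 0 := by
  have := S.finiteDimensional
  let b := Module.finBasis K S.H
  set k := (b.tensorProduct b).repr w with hk
  have hsum := (b.tensorProduct b).sum_repr w
  have h1 : ∀ x j, ∑ i, algebraMap K L (k (i, j)) * S.act (b i) x = 0 := by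
    intro x
    refine fun j => congrFun (S.eq_zero_of_sum_mul_act b
      (c := fun j => ∑ i, algebraMap K L (k (i, j)) * S.act (b i) x) fun y => ?_) j
    have h2 := hw x y
    rw [← hsum, map_sum, map_sum, Fintype.sum_prod_type, Finset.sum_comm] at h2
    rw [← h2]
    refine Finset.sum_congr rfl fun j _ => ?_
    rw [Finset.sum_mul]
    refine Finset.sum_congr rfl fun i _ => ?_
    rw [map_smul, map_smul, Module.Basis.tensorProduct_apply, TensorProduct.map_tmul,
      LinearMap.mul'_apply, Algebra.smul_def, mul_assoc]
    rfl
  have h3 : k = 0 := by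
    ext ⟨i, j⟩
    have h4 := congrFun (S.eq_zero_of_sum_mul_act b
      (c := fun i => algebraMap K L (k (i, j))) fun x => h1 x j) i
    simpa using h4
  exact (LinearEquiv.map_eq_zero_iff _).1 h3

/-- The algebra `H` is recovered from its faithful image in `End_K(L)`, the counit from the action
on `1`, and the comultiplication from the action on products. So a structure is known once its image
is. -/
theorem iso_of_range_eq (S T : HopfGaloisStructure K L) (h : S.act.range = T.act.range) :
    S.Iso T := by
  let e : S.H ≃ₐ[K] T.H := (AlgEquiv.ofInjective S.act S.act_injective).trans
    ((Subalgebra.equivOfEq _ _ h).trans (AlgEquiv.ofInjective T.act T.act_injective).symm)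
  have he : ∀ z, T.act (e z) = S.act z := by
    intro z
    have := (AlgEquiv.ofInjective T.act T.act_injective).apply_symm_apply
      (Subalgebra.equivOfEq _ _ h (AlgEquiv.ofInjective S.act S.act_injective z))
    exact congrArg Subtype.val this
  refine ⟨BialgEquiv.ofAlgEquiv e ?_ ?_, he⟩
  · ext z
    apply (algebraMap K L).injective
    have h1 := S.act_algebraMap z 1
    have h2 := T.act_algebraMap (e z) 1
    rw [he, h1, mul_one, mul_one] at h2
    exact h2.symm
  · ext z
    change Algebra.TensorProduct.map (e : S.H →ₐ[K] T.H) (e : S.H →ₐ[K] T.H)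
      (Coalgebra.comul (R := K) z) = Coalgebra.comul (R := K) (e z)
    rw [← sub_eq_zero]
    refine T.eq_zero_of_bilinear _ fun x y => ?_
    rw [map_sub, map_sub, ← T.act_mul, he, S.act_mul, sub_eq_zero]
    generalize Coalgebra.comul (R := K) z = w
    induction w using TensorProduct.induction_on with
    | zero => simp
    | add v v' hv hv' => simp only [map_add, hv, hv']
    | tmul a b =>
      rw [Algebra.TensorProduct.map_tmul, TensorProduct.map_tmul, TensorProduct.map_tmul]
      change T.act (e a) x * T.act (e b) y = S.act a x * S.act b y
      rw [he, he]

section OfType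

open MonoidAlgebra

variable {E : Type u} [Field E] [Algebra K E] (S : HopfGaloisStructure K L)

/-- The evaluation of an element of `E ⊗ H`, acting through an embedding. -/
noncomputable def embEval (σ : L →ₐ[K] E) (y : L) : E ⊗[K] S.H →ₗ[E] E :=
  (σ.toLinearMap ∘ₗ S.act.toLinearMap.flip y).liftBaseChange E

omit [FiniteDimensional K L] in
@[simp]
theorem embEval_tmul (σ : L →ₐ[K] E) (y : L) (e : E) (h : S.H) :
    S.embEval σ y (e ⊗ₜ h) = e * σ (S.act h y) := by
  simp [embEval]

/-- For a basis `b` of `H` and a basis `d` of `L`, the matrix of the `b_i • d_j` is square, and it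
is invertible over `L` by the Hopf-Galois condition. An embedding into `E` keeps its determinant
nonzero. -/
theorem eq_zero_of_embEval (σ : L →ₐ[K] E) (w : E ⊗[K] S.H)
    (hw : ∀ y, S.embEval σ y w = 0) : w = 0 := by
  have := S.finiteDimensional
  let b := Module.finBasisOfFinrankEq K S.H S.finrank_eq
  let d := Module.finBasis K L
  have hsum := (Algebra.TensorProduct.basis E b).sum_repr w
  set c := (Algebra.TensorProduct.basis E b).repr w
  simp only [Algebra.TensorProduct.basis_apply, TensorProduct.smul_tmul', smul_eq_mul,
    mul_one] at hsum
  let A : Matrix (Fin (Module.finrank K L)) (Fin (Module.finrank K L)) L :=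
    Matrix.of fun i j => S.act (b i) (d j)
  have hA : A.det ≠ 0 := by
    intro h0
    obtain ⟨v, hv, hvA⟩ := Matrix.exists_vecMul_eq_zero_iff.2 h0
    apply hv
    refine S.eq_zero_of_sum_mul_act b fun x => ?_
    have h1 : (∑ i, LinearMap.mul K L (v i) ∘ₗ S.act (b i)) = 0 := by
      refine d.ext fun j => ?_
      have := congrFun hvA j
      simpa [Matrix.vecMul, dotProduct, A] using this
    have := congrArg (fun T : L →ₗ[K] L => T x) h1
    simpa using this
  have hσA : (A.map σ).det ≠ 0 := by
    have : (A.map σ).det = σ A.det := (AlgHom.map_det σ A).symm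
    rw [this]
    exact (map_ne_zero σ).2 hA
  have hc : (fun i => c i) = 0 := by
    by_contra hne
    apply hσA
    refine Matrix.exists_vecMul_eq_zero_iff.1 ⟨_, hne, ?_⟩
    funext j
    have := hw (d j)
    rw [← hsum, map_sum] at this
    simpa [Matrix.vecMul, dotProduct, A] using this
  rw [← hsum]
  exact Finset.sum_eq_zero fun i _ => by
    rw [congrFun hc i]
    exact TensorProduct.zero_tmul _ _

-- The module algebra law over `E`. For a group-like element it says that the evaluation is
-- multiplicative in `L`, so that an embedding results.
omit [FiniteDimensional K L] in
theorem embEval_comul (σ : L →ₐ[K] E) (x y : L) (w : E ⊗[K] S.H) :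
    S.embEval σ (x * y) w = LinearMap.mul' E E (TensorProduct.map (S.embEval σ x)
      (S.embEval σ y) (Coalgebra.comul (R := E) w)) := by
  induction w using TensorProduct.induction_on with
  | zero => simp
  | add v v' hv hv' => simp only [map_add, hv, hv']
  | tmul e h =>
    rw [TensorProduct.comul_tmul, CommSemiring.comul_apply, embEval_tmul, S.act_mul]
    generalize Coalgebra.comul (R := K) h = w
    induction w using TensorProduct.induction_on with
    | zero => simp
    | add v v' hv hv' => simp only [map_add, TensorProduct.tmul_add, mul_add, hv, hv']
    | tmul a b =>
      rw [TensorProduct.AlgebraTensorModule.tensorTensorTensorComm_tmul, TensorProduct.map_tmul,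
        TensorProduct.map_tmul, LinearMap.mul'_apply, LinearMap.mul'_apply, embEval_tmul,
        embEval_tmul, map_mul]
      change e * (σ (S.act a x) * σ (S.act b y)) = _
      ring

omit [FiniteDimensional K L] in
theorem embEval_algebraMap (σ : L →ₐ[K] E) (k : K) (w : E ⊗[K] S.H) :
    S.embEval σ (algebraMap K L k) w = Coalgebra.counit (R := E) w * algebraMap K E k := by
  induction w using TensorProduct.induction_on with
  | zero => simp
  | add v v' hv hv' => simp only [map_add, hv, hv', add_mul]
  | tmul e h =>
    rw [embEval_tmul, S.act_algebraMap, AlgHom.commutes, TensorProduct.counit_tmul,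
      Algebra.smul_def, map_mul, CommSemiring.counit_apply]
    ring

variable {N : Type} [Group N] (ψ : (E ⊗[K] S.H) ≃ₐc[E] MonoidAlgebra E N)

/-- The group-like elements of the base change. -/
noncomputable def groupLike (n : N) : E ⊗[K] S.H := ψ.symm (single n 1)

omit [FiniteDimensional K L] in
theorem comul_groupLike (n : N) : Coalgebra.comul (R := E) (S.groupLike ψ n) =
    S.groupLike ψ n ⊗ₜ S.groupLike ψ n := by
  have h := CoalgHomClass.map_comp_comul_apply ψ.symm (single n (1 : E))
  rw [MonoidAlgebra.comul_single, CommSemiring.comul_apply, TensorProduct.map_tmul,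
    TensorProduct.map_tmul] at h
  exact h.symm

omit [FiniteDimensional K L] in
theorem counit_groupLike (n : N) : Coalgebra.counit (R := E) (S.groupLike ψ n) = 1 := by
  rw [groupLike, CoalgHomClass.counit_comp_apply ψ.symm]
  simp

/-- The embedding obtained from `σ` by applying a group-like element. -/
noncomputable def embShift (n : N) (σ : L →ₐ[K] E) : L →ₐ[K] E where
  toFun y := S.embEval σ y (S.groupLike ψ n)
  map_one' := by
    have := S.embEval_algebraMap σ 1 (S.groupLike ψ n)
    rwa [map_one, counit_groupLike, map_one, mul_one] at this
  map_mul' x y := by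
    rw [embEval_comul, comul_groupLike, TensorProduct.map_tmul, LinearMap.mul'_apply]
  map_zero' := by
    have := S.embEval_algebraMap σ 0 (S.groupLike ψ n)
    rwa [map_zero, map_zero, mul_zero] at this
  map_add' x y := by
    generalize S.groupLike ψ n = w
    induction w using TensorProduct.induction_on with
    | zero => simp
    | add v v' hv hv' => simp only [map_add, hv, hv']; ring
    | tmul e h => simp [mul_add]
  commutes' k := by rw [embEval_algebraMap, counit_groupLike, one_mul]

omit [FiniteDimensional K L] in
theorem embShift_apply (n : N) (σ : L →ₐ[K] E) (y : L) :
    S.embShift ψ n σ y = S.embEval σ y (S.groupLike ψ n) := rfl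

omit [FiniteDimensional K L] in
theorem embEval_embShift (n : N) (σ : L →ₐ[K] E) (y : L) (w : E ⊗[K] S.H) :
    S.embEval (S.embShift ψ n σ) y w = S.embEval σ y (S.groupLike ψ n * w) := by
  induction w using TensorProduct.induction_on with
  | zero => simp
  | add v v' hv hv' => simp only [map_add, mul_add, hv, hv']
  | tmul e h =>
    rw [embEval_tmul, embShift_apply]
    generalize S.groupLike ψ n = v
    induction v using TensorProduct.induction_on with
    | zero => simp
    | add v v' hv hv' => simp only [map_add, mul_add, add_mul, hv, hv']
    | tmul f k =>
      rw [Algebra.TensorProduct.tmul_mul_tmul, embEval_tmul, embEval_tmul, map_mul]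
      change e * (f * _) = f * e * σ (S.act k (S.act h y))
      ring

omit [FiniteDimensional K L] in
theorem groupLike_mul (m n : N) : S.groupLike ψ m * S.groupLike ψ n = S.groupLike ψ (m * n) := by
  rw [groupLike, groupLike, groupLike, ← map_mul, single_mul_single, one_mul]

omit [FiniteDimensional K L] in
theorem groupLike_one : S.groupLike ψ 1 = 1 := map_one ψ.symm

/-- The group `N` acts on the embeddings. -/
@[reducible]
noncomputable def typeAction : MulAction N (L →ₐ[K] E) where
  -- Shifting by `n` and after that by `m` is shifting by `n m`; the inverse turns this right action
  -- into a left action.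
  smul n σ := S.embShift ψ n⁻¹ σ
  one_smul σ := by
    ext y
    change S.embEval σ y (S.groupLike ψ 1⁻¹) = σ y
    rw [inv_one, groupLike_one, Algebra.TensorProduct.one_def, embEval_tmul]
    simp
  mul_smul m n σ := by
    ext y
    change S.embEval σ y (S.groupLike ψ (m * n)⁻¹) =
      S.embEval (S.embShift ψ n⁻¹ σ) y (S.groupLike ψ m⁻¹)
    rw [embEval_embShift, groupLike_mul, mul_inv_rev]

-- Through `ψ`, the algebra `E ⊗ H` acts exactly as `E[N]` does by permuting the embeddings.
omit [FiniteDimensional K L] in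
theorem embEval_eq_permOp (σ : L →ₐ[K] E) (y : L) (w : E ⊗[K] S.H) :
    letI := S.typeAction ψ
    S.embEval σ y w = permOp (ψ w) (fun τ : L →ₐ[K] E => τ y) σ := by
  let i1 := S.typeAction ψ
  obtain ⟨z, rfl⟩ : ∃ z, ψ.symm z = w := ⟨ψ w, ψ.symm_apply_apply w⟩
  rw [ψ.apply_symm_apply]
  induction z using MonoidAlgebra.induction_linear with
  | zero => simp [permOp]
  | add x x' hx hx' =>
    rw [map_add, map_add, hx, hx', permOp, permOp, permOp, map_add]
  | single n a =>
    have h1 : (single n a : MonoidAlgebra E N) = a • single n 1 := by simp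
    rw [permOp, evalFun_single, h1, map_smul, map_smul, smul_eq_mul]
    congr 1
    change _ = S.embShift ψ n⁻¹⁻¹ σ y
    rw [inv_inv, embShift_apply]
    rfl

theorem typeAction_free (σ : L →ₐ[K] E) (m n : N) :
    letI := S.typeAction ψ
    m • σ = n • σ → m = n := by
  let i1 := S.typeAction ψ
  intro h
  have h1 : S.groupLike ψ m⁻¹ - S.groupLike ψ n⁻¹ = 0 := by
    refine S.eq_zero_of_embEval σ _ fun y => ?_
    rw [map_sub, sub_eq_zero]
    exact congrArg (fun τ : L →ₐ[K] E => τ y) h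
  have h2 := ψ.symm.injective (sub_eq_zero.1 h1)
  have h3 : m⁻¹ = n⁻¹ := by
    have h4 := MonoidAlgebra.of_injective (R := E) (M := N) (a₁ := m⁻¹) (a₂ := n⁻¹) h2
    exact h4
  exact inv_injective h3

include ψ in
theorem card_type [Finite N] : Nat.card N = Module.finrank K L := by
  have := Fintype.ofFinite N
  have := S.finiteDimensional
  have h := (ψ.toCoalgEquiv.toLinearEquiv).finrank_eq
  rw [Module.finrank_baseChange, S.finrank_eq,
    Module.finrank_eq_card_basis (MonoidAlgebra.basis N E)] at h
  rw [h, Nat.card_eq_fintype_card]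

theorem typeAction_regular [Finite N] (hX : Nat.card (L →ₐ[K] E) = Module.finrank K L)
    (σ τ : L →ₐ[K] E) :
    letI := S.typeAction ψ
    ∃! n : N, n • σ = τ := by
  let i1 := S.typeAction ψ
  have hpos : 0 < Nat.card (L →ₐ[K] E) := hX ▸ Module.finrank_pos
  have hfin : Finite (L →ₐ[K] E) := (Nat.card_pos_iff.1 hpos).2
  have hb : Function.Bijective fun n : N => n • σ :=
    (Nat.bijective_iff_injective_and_card _).2
      ⟨fun m n h => S.typeAction_free ψ σ m n h, by rw [hX, S.card_type ψ]⟩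
  obtain ⟨n, hn⟩ := hb.2 τ
  exact ⟨n, hn, fun m hm => hb.1 (hm.trans hn.symm)⟩

omit [FiniteDimensional K L] in
theorem embEval_galois (g : E ≃ₐ[K] E) (σ : L →ₐ[K] E) (y : L) (w : E ⊗[K] S.H) :
    S.embEval (g • σ) y (Algebra.TensorProduct.map (g : E →ₐ[K] E) (AlgHom.id K S.H) w) =
      g (S.embEval σ y w) := by
  induction w using TensorProduct.induction_on with
  | zero => simp
  | add v v' hv hv' => simp only [map_add, hv, hv']
  | tmul e h =>
    rw [Algebra.TensorProduct.map_tmul, embEval_tmul, embEval_tmul, map_mul]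
    rfl

/-- Applying `g` to the coefficients of a group-like element gives some `z` in `E[N]` whose operator
at `g • σ` is the embedding `g • n • σ`. At the one embedding `σ₀` it agrees with the operator of a
group element, so `z` is that group element by independence of embeddings. As `z` does not involve
`σ`, the same `m` serves for all `σ`. -/
theorem typeAction_normalised [Finite N] (hX : Nat.card (L →ₐ[K] E) = Module.finrank K L)
    (g : E ≃ₐ[K] E) (n : N) :
    letI := S.typeAction ψ
    ∃ m : N, ∀ σ : L →ₐ[K] E, g • n • σ = m • g • σ := by
  let i1 := S.typeAction ψ
  have hpos : 0 < Nat.card (L →ₐ[K] E) := hX ▸ Module.finrank_pos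
  obtain ⟨⟨σ₀⟩, -⟩ := Nat.card_pos_iff.1 hpos
  obtain ⟨m, hm, -⟩ := S.typeAction_regular ψ hX (g • σ₀) (g • n • σ₀)
  set z := ψ (Algebra.TensorProduct.map (g : E →ₐ[K] E) (AlgHom.id K S.H) (S.groupLike ψ n⁻¹))
    with hz
  have key : ∀ (σ : L →ₐ[K] E) (y : L),
      permOp z (fun τ : L →ₐ[K] E => τ y) (g • σ) = (g • n • σ : L →ₐ[K] E) y := by
    intro σ y
    rw [hz, ← S.embEval_eq_permOp ψ, embEval_galois]
    rfl
  have hz2 : z = single m⁻¹ 1 := by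
    rw [← sub_eq_zero]
    refine permOp_eq_zero (K := K) (σ := g • σ₀) (S.typeAction_free ψ _) fun y => ?_
    rw [permOp, map_sub, sub_eq_zero]
    refine (key σ₀ y).trans ?_
    rw [evalFun_single, one_mul, inv_inv]
    exact congrArg (fun τ : L →ₐ[K] E => τ y) hm.symm
  refine ⟨m, fun σ => ?_⟩
  ext y
  rw [← key, hz2, permOp, evalFun_single, one_mul, inv_inv]

end OfType

end HopfGaloisStructure

/-! ### The correspondence of Greither and Pareigis -/

section Correspondence

open MonoidAlgebra

variable {K L E : Type u} [Field K] [Field L] [Field E] [Algebra K L] [Algebra K E]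
variable {N : Type} [Group N]

/-- The Galois group acts by conjugation on a regular subgroup that it normalises. -/
@[reducible]
def conjAction (R : regularNormalised (E ≃ₐ[K] E) (L →ₐ[K] E) N) :
    MulDistribMulAction (E ≃ₐ[K] E) R.1 where
  smul g r := ⟨_, R.2.2.1 g r.1 r.2⟩
  one_smul r := Subtype.ext (by
    change MulAction.toPermHom _ _ 1 * r.1 * (MulAction.toPermHom _ _ 1)⁻¹ = r.1
    rw [map_one, one_mul, inv_one, mul_one])
  mul_smul g h r := Subtype.ext (by
    change MulAction.toPermHom _ _ (g * h) * r.1 * (MulAction.toPermHom _ _ (g * h))⁻¹ =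
      MulAction.toPermHom _ _ g * (MulAction.toPermHom _ _ h * r.1 *
        (MulAction.toPermHom _ _ h)⁻¹) * (MulAction.toPermHom _ _ g)⁻¹
    rw [map_mul]
    group)
  smul_mul g r s := Subtype.ext (by
    change MulAction.toPerm g * (r.1 * s.1) * (MulAction.toPerm g)⁻¹ =
      (MulAction.toPerm g * r.1 * (MulAction.toPerm g)⁻¹) *
      (MulAction.toPerm g * s.1 * (MulAction.toPerm g)⁻¹)
    group)
  smul_one g := Subtype.ext (by
    change MulAction.toPerm g * 1 * (MulAction.toPerm g)⁻¹ = 1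
    group)

variable [FiniteDimensional K L] [FiniteDimensional K E] [IsGalois K E]

theorem descData_regular (hX : Nat.card (L →ₐ[K] E) = Module.finrank K L)
    (R : regularNormalised (E ≃ₐ[K] E) (L →ₐ[K] E) N) :
    letI := conjAction R
    DescData K L E R.1 :=
  letI := conjAction R
  { card := hX
    equivariant := fun g r σ => by
      change g • r.1 σ = (MulAction.toPerm g * r.1 * (MulAction.toPerm g)⁻¹ :
        Equiv.Perm (L →ₐ[K] E)) (g • σ)
      simp
    regular := R.2.1 }

theorem finite_embeddings (hX : Nat.card (L →ₐ[K] E) = Module.finrank K L) :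
    Finite (L →ₐ[K] E) :=
  (Nat.card_pos_iff.1 (hX ▸ Module.finrank_pos : 0 < Nat.card (L →ₐ[K] E))).2

/-- The Hopf-Galois structure of a regular subgroup normalised by the Galois group. -/
noncomputable def hgsOfRegular (hX : Nat.card (L →ₐ[K] E) = Module.finrank K L)
    (R : regularNormalised (E ≃ₐ[K] E) (L →ₐ[K] E) N) : HopfGaloisStructure K L :=
  letI := conjAction R
  haveI := finite_embeddings hX
  haveI : Finite (Equiv.Perm (L →ₐ[K] E)) := inferInstance
  (descData_regular hX R).hgs

theorem hgsOfRegular_hasType (hX : Nat.card (L →ₐ[K] E) = Module.finrank K L)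
    (R : regularNormalised (E ≃ₐ[K] E) (L →ₐ[K] E) N) : (hgsOfRegular hX R).HasType E N := by
  letI := conjAction R
  haveI := finite_embeddings hX
  obtain ⟨e⟩ := R.2.2.2
  exact (descData_regular hX R).hasType e.symm

theorem mem_range_hgsOfRegular (hX : Nat.card (L →ₐ[K] E) = Module.finrank K L)
    (R : regularNormalised (E ≃ₐ[K] E) (L →ₐ[K] E) N) (T : Module.End K L) :
    T ∈ (hgsOfRegular hX R).act.range ↔ ∃ z : MonoidAlgebra E R.1, ∀ (σ : L →ₐ[K] E) (y : L),
      σ (T y) = permOp z (fun τ : L →ₐ[K] E => τ y) σ := by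
  letI := conjAction R
  haveI := finite_embeddings hX
  exact (descData_regular hX R).mem_range_act T

/-- The fixed elements span `E[R]` over `E`, so every operator of `E[R]` is one of `E[R']`. The
operator of a permutation `r` is evaluation at another embedding, and by independence of embeddings
an element of `E[R']` with this operator is a single element of `R'`. -/
theorem regular_le_of_range_le (hX : Nat.card (L →ₐ[K] E) = Module.finrank K L)
    (R R' : regularNormalised (E ≃ₐ[K] E) (L →ₐ[K] E) N)
    (h : (hgsOfRegular hX R).act.range ≤ (hgsOfRegular hX R').act.range) : R.1 ≤ R'.1 := by
  letI := conjAction R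
  haveI := finite_embeddings hX
  have D := descData_regular hX R
  have D' := descData_regular hX R'
  have key : ∀ z : MonoidAlgebra E R.1, ∃ z' : MonoidAlgebra E R'.1, ∀ (σ : L →ₐ[K] E) (y : L),
      permOp z (fun τ : L →ₐ[K] E => τ y) σ = permOp z' (fun τ : L →ₐ[K] E => τ y) σ := by
    intro z
    have hz : z ∈ Submodule.span E (descAlg K E R.1 : Set (MonoidAlgebra E R.1)) := by
      rw [descAlg.span_eq_top]
      trivial
    induction hz using Submodule.span_induction with
    | mem x hx =>
      obtain ⟨z', hz'⟩ := (mem_range_hgsOfRegular hX R' _).1 (h ⟨⟨x, hx⟩, rfl⟩)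
      exact ⟨z', fun σ y => (D.apply_act ⟨x, hx⟩ y σ).symm.trans (hz' σ y)⟩
    | zero => exact ⟨0, fun σ y => by simp [permOp]⟩
    | add x x' _ _ hx hx' =>
      obtain ⟨z, hz⟩ := hx
      obtain ⟨z', hz'⟩ := hx'
      refine ⟨z + z', fun σ y => ?_⟩
      have h1 := hz σ y
      have h2 := hz' σ y
      simp only [permOp, map_add] at *
      rw [h1, h2]
    | smul a x _ hx =>
      obtain ⟨z, hz⟩ := hx
      refine ⟨a • z, fun σ y => ?_⟩
      have h1 := hz σ y
      simp only [permOp, map_smul] at *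
      rw [h1]
  intro r hr
  obtain ⟨z', hz'⟩ := key (single ⟨r, hr⟩⁻¹ 1)
  have h1 : ∀ (σ : L →ₐ[K] E) (y : L), (r σ) y = permOp z' (fun τ : L →ₐ[K] E => τ y) σ := by
    intro σ y
    rw [← hz', permOp, evalFun_single, one_mul, inv_inv]
    rfl
  obtain ⟨σ₀⟩ := D.nonempty
  obtain ⟨r', hr', -⟩ := R'.2.1 σ₀ (r σ₀)
  have h2 : z' = single r'⁻¹ 1 := by
    rw [← sub_eq_zero]
    refine permOp_eq_zero (K := K) (σ := σ₀) (fun a b hab => (R'.2.1 σ₀ (b.1 σ₀)).unique hab rfl)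
      fun y => ?_
    rw [permOp, map_sub, sub_eq_zero]
    refine (h1 σ₀ y).symm.trans ?_
    rw [evalFun_single, one_mul, inv_inv, ← hr']
    rfl
  have h3 : r = r'.1 := by
    ext σ y
    rw [h1, h2, permOp, evalFun_single, one_mul, inv_inv]
    rfl
  rw [h3]
  exact r'.2

/-- `R` is the group of permutations of the embeddings by which `N` acts. The image of `H` lies in
that of the descended algebra of `R`, and both images have dimension `[L : K]`. -/
theorem exists_regular_of_hasType [Finite N] (hX : Nat.card (L →ₐ[K] E) = Module.finrank K L)
    (S : HopfGaloisStructure K L) (hS : S.HasType E N) :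
    ∃ R : regularNormalised (E ≃ₐ[K] E) (L →ₐ[K] E) N, (hgsOfRegular hX R).Iso S := by
  obtain ⟨ψ⟩ := hS
  letI i1 := S.typeAction ψ
  have hreg := S.typeAction_regular ψ hX
  have hpos : 0 < Nat.card (L →ₐ[K] E) := hX ▸ Module.finrank_pos
  obtain ⟨⟨σ₀⟩, -⟩ := Nat.card_pos_iff.1 hpos
  have hinj : Function.Injective (MulAction.toPermHom N (L →ₐ[K] E)) := fun m n h =>
    S.typeAction_free ψ σ₀ m n (congrArg (fun π : Equiv.Perm (L →ₐ[K] E) => π σ₀) h)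
  let e : N ≃* (MulAction.toPermHom N (L →ₐ[K] E)).range := MonoidHom.ofInjective hinj
  let R : regularNormalised (E ≃ₐ[K] E) (L →ₐ[K] E) N :=
    ⟨(MulAction.toPermHom N (L →ₐ[K] E)).range, by
      intro σ τ
      obtain ⟨n, hn, huniq⟩ := hreg σ τ
      refine ⟨e n, hn, ?_⟩
      rintro ⟨_, m, rfl⟩ hm
      apply Subtype.ext
      rw [huniq m hm]
      rfl, by
      rintro g _ ⟨n, rfl⟩
      obtain ⟨m, hm⟩ := S.typeAction_normalised ψ hX g n
      refine ⟨m, ?_⟩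
      rw [eq_mul_inv_iff_mul_eq]
      ext σ : 1
      exact (hm σ).symm, ⟨e⟩⟩
  refine ⟨R, HopfGaloisStructure.iso_of_range_eq _ _ ?_⟩
  have hle : S.act.range ≤ (hgsOfRegular hX R).act.range := by
    rintro _ ⟨h, rfl⟩
    refine (mem_range_hgsOfRegular hX R _).2
      ⟨mapDomainAlgHom K E e.toMonoidHom (ψ (1 ⊗ₜ h)), fun σ y => ?_⟩
    have h1 := S.embEval_eq_permOp ψ σ y (1 ⊗ₜ h)
    rw [HopfGaloisStructure.embEval_tmul, one_mul] at h1
    refine h1.trans ?_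
    rw [permOp, permOp, evalFun_mapDomain]
    rfl
  have hfr : ∀ T : HopfGaloisStructure K L,
      Module.finrank K T.act.range = Module.finrank K L := fun T => by
    rw [← T.finrank_eq]
    exact (AlgEquiv.ofInjective T.act T.act_injective).toLinearEquiv.finrank_eq.symm
  symm
  apply Subalgebra.toSubmodule_injective
  refine Submodule.eq_of_le_of_finrank_eq hle ?_
  exact (hfr S).trans (hfr _).symm

theorem card_hgs_eq [Finite N] (hX : Nat.card (L →ₐ[K] E) = Module.finrank K L) :
    Nat.card {c : Quotient (HopfGaloisStructure.isoSetoid K L) //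
      ∃ S : HopfGaloisStructure K L,
        Quotient.mk (HopfGaloisStructure.isoSetoid K L) S = c ∧ S.HasType E N} =
      Nat.card (regularNormalised (E ≃ₐ[K] E) (L →ₐ[K] E) N) := by
  symm
  refine Nat.card_congr (Equiv.ofBijective
    (fun R => ⟨Quotient.mk _ (hgsOfRegular hX R), _, rfl, hgsOfRegular_hasType hX R⟩) ⟨?_, ?_⟩)
  · intro R R' h
    have hrange : ∀ {R R' : regularNormalised (E ≃ₐ[K] E) (L →ₐ[K] E) N},
        (hgsOfRegular hX R).Iso (hgsOfRegular hX R') → R.1 ≤ R'.1 := by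
      rintro R R' ⟨e, he⟩
      refine regular_le_of_range_le hX R R' ?_
      rintro _ ⟨z, rfl⟩
      exact ⟨e z, he z⟩
    have h1 : (hgsOfRegular hX R).Iso (hgsOfRegular hX R') :=
      Quotient.exact (congrArg Subtype.val h)
    have h2 : (hgsOfRegular hX R').Iso (hgsOfRegular hX R) :=
      (HopfGaloisStructure.isoSetoid K L).symm h1
    exact Subtype.ext (le_antisymm (hrange h1) (hrange h2))
  · rintro ⟨c, S, rfl, hS⟩
    obtain ⟨R, hR⟩ := exists_regular_of_hasType hX S hS
    exact ⟨R, Subtype.ext (Quotient.sound hR)⟩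

end Correspondence

/-! ### Regular normal subgroups -/

section RegularNormal

/-- The permutation group `G` of `X` has a regular normal subgroup. -/
def HasRegularNormal (G X : Type*) [Group G] [MulAction G X] : Prop :=
  ∃ C : Subgroup G, C.Normal ∧ ∀ a b : X, ∃! c : C, c • a = b

variable {G X H Y : Type*} [Group G] [MulAction G X] [Group H] [MulAction H Y]

theorem PermIso.hasRegularNormal (h : PermIso G X H Y) (hG : HasRegularNormal G X) :
    HasRegularNormal H Y := by
  obtain ⟨φ, e, h⟩ := h
  obtain ⟨C, hC, hreg⟩ := hG
  refine ⟨C.map φ.toMonoidHom, hC.map _ φ.surjective, fun a b => ?_⟩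
  obtain ⟨c, hc, huniq⟩ := hreg (e.symm a) (e.symm b)
  refine ⟨⟨φ c, _, c.2, rfl⟩, ?_, ?_⟩
  · change φ c • a = b
    have h1 := h c (e.symm a)
    rw [e.apply_symm_apply] at h1
    rw [← h1]
    exact (congrArg e hc).trans (e.apply_symm_apply b)
  · rintro ⟨_, c', hc', rfl⟩ h'
    change φ c' • a = b at h'
    have h1 := h c' (e.symm a)
    rw [e.apply_symm_apply, h', ← e.eq_symm_apply] at h1
    rw [← huniq ⟨c', hc'⟩ h1]
    rfl

/-- Being a complement of the stabiliser of `x` means that exactly one element of `C` carries `x` to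
any given point. Normality moves this from `x` to every other point. -/
theorem hasRegularNormal_iff (ht : MulAction.IsPretransitive G X) (x : X) :
    HasRegularNormal G X ↔
      ∃ C : Subgroup G, C.Normal ∧ C.IsComplement' (MulAction.stabilizer G x) := by
  refine exists_congr fun C => and_congr_right fun hC => ?_
  rw [Subgroup.isComplement'_def, Subgroup.isComplement_iff_existsUnique_inv_mul_mem]
  have key : ∀ (g : G) (c : C), (c : G)⁻¹ * g ∈ (MulAction.stabilizer G x : Set G) ↔
      c • x = g • x := by
    intro g c
    rw [SetLike.mem_coe, MulAction.mem_stabilizer_iff, mul_smul, inv_smul_eq_iff, eq_comm]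
    rfl
  constructor
  · intro h g
    obtain ⟨c, hc, hu⟩ := h x (g • x)
    exact ⟨c, (key g c).2 hc, fun c' hc' => hu c' ((key g c').1 hc')⟩
  · intro h a b
    obtain ⟨g, rfl⟩ := ht.exists_smul_eq x a
    obtain ⟨k, hk⟩ := ht.exists_smul_eq x (g⁻¹ • b)
    obtain ⟨c, hc, hu⟩ := h k
    have hc' := (key k c).1 hc
    -- Here `a = g • x` and `c` carries `x` to `g⁻¹ • b`, so the conjugate carries `a` to `b`.
    refine ⟨⟨g * c * g⁻¹, hC.conj_mem _ c.2 g⟩, ?_, ?_⟩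
    · change (g * c * g⁻¹) • g • x = b
      have h1 : (c : G) • x = g⁻¹ • b := hc'.trans hk
      rw [mul_smul, inv_smul_smul, mul_smul, h1, smul_inv_smul]
    · intro d hd
      have h1 : (⟨g⁻¹ * d * g, by simpa using hC.conj_mem _ d.2 g⁻¹⟩ : C) = c := by
        refine hu _ ((key k _).2 ?_)
        change (g⁻¹ * d * g) • x = k • x
        rw [hk, mul_smul, mul_smul]
        exact congrArg (g⁻¹ • ·) hd
      apply Subtype.ext
      change (d : G) = g * c * g⁻¹
      rw [← h1]
      group

end RegularNormal

/-! ### Finite separable extensions -/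

section Extension

variable (F : SeparableExtension.{u})

namespace SeparableExtension

/-- The embeddings of `L` into the normal closure. -/
abbrev embeddings : Type u := F.L →ₐ[F.K] F.E

/-- The distinguished embedding of `L` into the normal closure. -/
noncomputable abbrev incl : F.embeddings := IsScalarTower.toAlgHom F.K F.L F.E

theorem iSup_fieldRange : ⨆ f : F.embeddings, f.fieldRange = ⊤ :=
  (Algebra.IsAlgebraic.isNormalClosure_iff.1 F.normalClosure).2

instance finiteDimensional_closure : FiniteDimensional F.K F.E := by
  have h : FiniteDimensional F.K (IntermediateField.normalClosure F.K F.L F.E) :=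
    normalClosure.is_finiteDimensional F.K F.L F.E
  rw [show IntermediateField.normalClosure F.K F.L F.E = ⊤ from F.iSup_fieldRange] at h
  exact IntermediateField.topEquiv.toLinearEquiv.finiteDimensional

instance isGalois_closure : IsGalois F.K F.E := by
  have hn : Normal F.K F.E := IsNormalClosure.normal (K := F.L)
  have hs : Algebra.IsSeparable F.K (⊤ : IntermediateField F.K F.E) := by
    rw [← F.iSup_fieldRange]
    refine @IntermediateField.isSeparable_iSup _ _ _ _ _ _ _ fun f => ?_
    exact AlgEquiv.Algebra.isSeparable f.equivFieldRange
  have : Algebra.IsSeparable F.K F.E :=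
    AlgEquiv.Algebra.isSeparable IntermediateField.topEquiv
  exact ⟨⟩

theorem card_embeddings : Nat.card F.embeddings = Module.finrank F.K F.L :=
  AlgHom.natCard_of_splits F.K F.L F.E F.normalClosure.splits

instance finite_embeddings : Finite F.embeddings :=
  Nat.finite_of_card_ne_zero (by rw [F.card_embeddings]; exact Module.finrank_pos.ne')

theorem isPretransitive_embeddings : MulAction.IsPretransitive F.gal F.embeddings := by
  have key : ∀ f : F.embeddings, ∃ g : F.gal, g • F.incl = f := by
    intro f
    have hg : ∀ y : F.L, f.liftNormal F.E (algebraMap F.L F.E y) = f y := fun y =>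
      f.liftNormal_commutes F.E y
    let g := f.liftNormal F.E
    let g' : F.gal := AlgEquiv.ofBijective g (Algebra.IsAlgebraic.algHom_bijective g)
    exact ⟨g', AlgHom.ext hg⟩
  refine ⟨fun a b => ?_⟩
  obtain ⟨g, rfl⟩ := key a
  obtain ⟨k, rfl⟩ := key b
  exact ⟨k * g⁻¹, by rw [mul_smul, inv_smul_smul]⟩

/-- If `g` and `k` agree on all embeddings, `k⁻¹ g` fixes the images of all of them, and these
generate the normal closure. -/
instance faithfulSMul_embeddings : FaithfulSMul F.gal F.embeddings := by
  refine ⟨fun {g k} h => ?_⟩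
  have h1 : ⨆ f : F.embeddings, f.fieldRange ≤
      IntermediateField.fixedField (Subgroup.zpowers (k⁻¹ * g)) := by
    refine iSup_le fun f => ?_
    rintro _ ⟨y, rfl⟩
    rw [IntermediateField.mem_fixedField_iff]
    intro σ hσ
    have h2 : k⁻¹ * g ∈ MulAction.stabilizer F.gal f := by
      rw [MulAction.mem_stabilizer_iff, mul_smul, h, inv_smul_smul]
    have h3 := (Subgroup.zpowers_le.2 h2) hσ
    exact DFunLike.congr_fun (MulAction.mem_stabilizer_iff.1 h3) y
  rw [F.iSup_fieldRange] at h1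
  have h2 : k⁻¹ * g = 1 := by
    ext y
    exact (IntermediateField.mem_fixedField_iff _ _).1 (h1 trivial) _
      (Subgroup.mem_zpowers _)
  exact (inv_mul_eq_one.1 h2).symm

theorem stabilizer_incl : MulAction.stabilizer F.gal F.incl = F.galSub := by
  ext g
  rw [MulAction.mem_stabilizer_iff, galSub, IntermediateField.mem_fixingSubgroup_iff]
  constructor
  · rintro h _ ⟨y, rfl⟩
    exact DFunLike.congr_fun h y
  · intro h
    ext y
    exact h _ ⟨y, rfl⟩

variable {F} {n : ℕ} {G : PermGroup n}

theorem Realises.permIso (h : F.Realises G) : PermIso G.grp (Fin n) F.gal F.embeddings := by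
  obtain ⟨x, θ, h⟩ := h
  rw [← stabilizer_incl, map_stabilizer_eq_iff] at h
  exact permIso_of_stabilizer G.2 F.isPretransitive_embeddings θ x F.incl h

theorem realises_of_permIso (h : PermIso G.grp (Fin n) F.gal F.embeddings) : F.Realises G := by
  obtain ⟨φ, e, he⟩ := h
  refine ⟨e.symm F.incl, φ, ?_⟩
  rw [← stabilizer_incl, map_stabilizer_eq_iff]
  intro g
  rw [← e.apply_eq_iff_eq, he, e.apply_symm_apply]

theorem Realises.isAlmostClassicallyGalois_iff (h : F.Realises G) :
    F.IsAlmostClassicallyGalois ↔ HasRegularNormal G.grp (Fin n) := by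
  have h1 : F.IsAlmostClassicallyGalois ↔ HasRegularNormal F.gal F.embeddings := by
    rw [hasRegularNormal_iff F.isPretransitive_embeddings F.incl, stabilizer_incl]
    rfl
  exact h1.trans ⟨h.permIso.symm.hasRegularNormal, h.permIso.hasRegularNormal⟩

theorem numHGS_eq (N : Type) [Group N] [Finite N] :
    F.numHGS N = Nat.card (regularNormalised F.gal F.embeddings N) :=
  card_hgs_eq F.card_embeddings

theorem Realises.numHGS_mul (h : F.Realises G) (N : Type) [Group N] [Finite N] (x : Fin n) :
    F.numHGS N * Nat.card (MulAut N) = numTransitiveInHol N G * cardAutStab G.grp x := by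
  rw [numHGS_eq, card_regularNormalised_mul F.isPretransitive_embeddings F.incl,
    h.permIso.cardAutStab_eq F.isPretransitive_embeddings x F.incl]
  congr 1
  refine Nat.card_congr (Equiv.subtypeEquivRight fun M => ?_)
  exact and_congr_right fun _ => ⟨fun k => k.trans h.permIso.symm, fun k => k.trans h.permIso⟩

/-- In Byott's formula the factors `|Aut(N)|` and `|Aut(G, G')|` are positive, so the two remaining
counts vanish together. -/
theorem Realises.exists_iff (h : F.Realises G) (N : Type) [Group N] [Finite N] :
    (∃ S : HopfGaloisStructure F.K F.L, S.HasType F.E N) ↔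
      ∃ M : Subgroup (Hol N), MulAction.IsPretransitive M N ∧ PermIso M N G.grp (Fin n) := by
  have hR : (∃ S : HopfGaloisStructure F.K F.L, S.HasType F.E N) ↔
      Nat.card (regularNormalised F.gal F.embeddings N) ≠ 0 := by
    rw [← Nat.pos_iff_ne_zero, Nat.card_pos_iff]
    constructor
    · rintro ⟨S, hS⟩
      exact ⟨⟨(exists_regular_of_hasType F.card_embeddings S hS).choose⟩, inferInstance⟩
    · rintro ⟨⟨R⟩, -⟩
      exact ⟨_, hgsOfRegular_hasType F.card_embeddings R⟩
  have hM : (∃ M : Subgroup (Hol N), MulAction.IsPretransitive M N ∧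
      PermIso M N G.grp (Fin n)) ↔ Nat.card (transitiveInHol F.gal F.embeddings N) ≠ 0 := by
    have : Finite (Hol N) := Finite.of_equiv _ SemidirectProduct.equivProd.symm
    rw [← Nat.pos_iff_ne_zero, Nat.card_pos_iff]
    constructor
    · rintro ⟨M, hM, hM'⟩
      exact ⟨⟨M, hM, hM'.trans h.permIso⟩, inferInstance⟩
    · rintro ⟨⟨M, hM, hM'⟩, -⟩
      exact ⟨M, hM, hM'.trans h.permIso.symm⟩
  have hA : cardAutStab F.gal F.incl ≠ 0 := by
    have : Finite (F.gal ≃* F.gal) := DFunLike.finite _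
    have : Nonempty {θ : F.gal ≃* F.gal // (MulAction.stabilizer F.gal F.incl).map
        θ.toMonoidHom = MulAction.stabilizer F.gal F.incl} :=
      ⟨⟨MulEquiv.refl _, by ext; simp⟩⟩
    exact Nat.card_pos.ne'
  have hN : Nat.card (MulAut N) ≠ 0 := Nat.card_pos.ne'
  have hmul := card_regularNormalised_mul (N := N) F.isPretransitive_embeddings F.incl
  rw [hR, hM]
  constructor
  · intro h0 h1
    rw [h1, zero_mul] at hmul
    exact mul_ne_zero h0 hN hmul
  · intro h0 h1
    rw [h1, zero_mul] at hmul
    exact mul_ne_zero h0 hA hmul.symm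

variable (F)

/-- The Galois group as a permutation group of a standard set. -/
theorem exists_realises (hn : Module.finrank F.K F.L = n) :
    ∃ G : PermGroup n, F.Realises G := by
  obtain ⟨e⟩ : Nonempty (F.embeddings ≃ Fin n) :=
    ⟨Finite.equivFinOfCardEq (F.card_embeddings.trans hn)⟩
  let ψ : F.gal →* Equiv.Perm (Fin n) :=
    e.permCongrHom.toMonoidHom.comp (MulAction.toPermHom F.gal F.embeddings)
  have hψ : Function.Injective ψ :=
    e.permCongrHom.injective.comp MulAction.toPerm_injective
  have hP : PermIso F.gal F.embeddings ψ.range (Fin n) := by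
    refine ⟨MonoidHom.ofInjective hψ, e, fun g x => ?_⟩
    change _ = e (g • e.symm (e x))
    rw [e.symm_apply_apply]
  exact ⟨⟨ψ.range, hP.isPretransitive F.isPretransitive_embeddings⟩, realises_of_permIso hP.symm⟩

/-- If `L/K` is Galois, every embedding is the given one after an automorphism of `L`. All
embeddings then have the same image, which must be all of `E`. -/
theorem exists_galEquiv [IsGalois F.K F.L] : Nonempty (F.gal ≃* (F.L ≃ₐ[F.K] F.L)) := by
  let c : (F.L ≃ₐ[F.K] F.L) → F.embeddings := fun σ => F.incl.comp (σ : F.L →ₐ[F.K] F.L)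
  have hc : Function.Injective c := fun σ τ h => by
    ext y
    exact F.incl.injective (DFunLike.congr_fun h y)
  have hc' : Function.Surjective c := by
    refine ((Nat.bijective_iff_injective_and_card c).2 ⟨hc, ?_⟩).2
    rw [card_embeddings, IsGalois.card_aut_eq_finrank]
  have htop : F.incl.fieldRange = ⊤ := by
    rw [eq_top_iff, ← F.iSup_fieldRange]
    refine iSup_le fun f => ?_
    obtain ⟨σ, rfl⟩ := hc' f
    rintro _ ⟨y, rfl⟩
    exact ⟨σ y, rfl⟩
  have hbij : Function.Bijective F.incl := by
    refine ⟨F.incl.injective, fun y => ?_⟩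
    have : y ∈ F.incl.fieldRange := htop ▸ trivial
    exact this
  exact ⟨(AlgEquiv.autCongr (AlgEquiv.ofBijective F.incl hbij)).symm⟩

end SeparableExtension

end Extension

/-! ### Realising permutation groups -/

section Realise

/-- Artin's theorem makes `Γ` the Galois group of `E` over its fixed field; `L` is the fixed field
of `S`. An automorphism fixing all conjugates of `L` lies in all conjugates of `S`, so a trivial
core makes `E` the normal closure of `L`. -/
theorem exists_extension_of_action {E : Type u} [Field E] {Γ : Type*} [Group Γ] [Finite Γ]
    [MulSemiringAction Γ E] [FaithfulSMul Γ E] (S : Subgroup Γ) (hS : S.normalCore = ⊥) :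
    ∃ (F : SeparableExtension.{u}) (θ : Γ ≃* F.gal), S.map θ.toMonoidHom = F.galSub := by
  let K := FixedPoints.subfield Γ E
  let θ : Γ ≃* (E ≃ₐ[K] E) := FixedPoints.toAlgAutMulEquiv Γ E
  let H : Subgroup (E ≃ₐ[K] E) := S.map θ.toMonoidHom
  let L : IntermediateField K E := IntermediateField.fixedField H
  have hfix : L.fixingSubgroup = H := IntermediateField.fixingSubgroup_fixedField H
  have hn : IsNormalClosure K L E := by
    rw [Algebra.IsAlgebraic.isNormalClosure_iff]
    constructor
    · intro x
      have h := Normal.splits (inferInstance : Normal K E) (x : E)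
      rwa [show minpoly K (x : E) = minpoly K x from
        minpoly.algebraMap_eq (algebraMap L E).injective x] at h
    · have hbot : (IntermediateField.normalClosure K L E).fixingSubgroup = ⊥ := by
        rw [eq_bot_iff]
        intro g hg
        rw [IntermediateField.mem_fixingSubgroup_iff] at hg
        have key : ∀ h : E ≃ₐ[K] E, h⁻¹ * g * h ∈ H := by
          intro h
          rw [← hfix, IntermediateField.mem_fixingSubgroup_iff]
          intro x hx
          have h1 := hg (h x) (AlgHom.fieldRange_le_normalClosure
            ((h : E →ₐ[K] E).comp L.val) ⟨⟨x, hx⟩, rfl⟩)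
          change h.symm (g (h x)) = x
          rw [show g (h x) = h x from h1, AlgEquiv.symm_apply_apply]
        obtain ⟨γ, rfl⟩ := θ.surjective g
        have h1 : γ ∈ S.normalCore := by
          intro δ
          obtain ⟨s, hs, hs'⟩ := key (θ δ⁻¹)
          have : s = δ * γ * δ⁻¹ := by
            apply θ.injective
            refine hs'.trans ?_
            simp
          rwa [← this]
        rw [hS, Subgroup.mem_bot] at h1
        rw [h1, map_one]
        exact Subgroup.one_mem _
      rw [← IsGalois.fixedField_fixingSubgroup (IntermediateField.normalClosure K L E), hbot,
        IntermediateField.fixedField_bot]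
  refine ⟨{ K := K, L := L, E := E }, θ, ?_⟩
  change H = (IsScalarTower.toAlgHom K L E).fieldRange.fixingSubgroup
  rw [← hfix]
  congr 1
  exact (IntermediateField.fieldRange_val (S := L)).symm

/-- `G` permutes the variables of a rational function field over `ℚ`. Lifting the index set places
the field in the required universe. -/
theorem exists_faithful_action (n : ℕ) (G : Subgroup (Equiv.Perm (Fin n))) :
    ∃ (E : Type u) (_ : Field E) (_ : MulSemiringAction G E), FaithfulSMul G E := by
  let σ := ULift.{u} (Fin n)
  let R := MvPolynomial σ ℚ
  let ρ : G →* (R ≃+* R) :=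
    { toFun := fun g => (MvPolynomial.renameEquiv ℚ
        ((Equiv.ulift.trans (g : Equiv.Perm (Fin n))).trans Equiv.ulift.symm)).toRingEquiv
      map_one' := RingEquiv.ext fun x => MvPolynomial.rename_id_apply x
      map_mul' := fun g h => RingEquiv.ext fun x => by
        change MvPolynomial.rename _ x = MvPolynomial.rename _ (MvPolynomial.rename _ x)
        rw [MvPolynomial.rename_rename]
        rfl }
  have hρ : Function.Injective ρ := by
    intro g h hgh
    apply Subtype.ext
    ext i
    have h1 : MvPolynomial.rename _ (MvPolynomial.X (⟨i⟩ : σ) : R) =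
      MvPolynomial.rename _ (MvPolynomial.X (⟨i⟩ : σ)) :=
        RingEquiv.congr_fun hgh (MvPolynomial.X (⟨i⟩ : σ))
    rw [MvPolynomial.rename_X, MvPolynomial.rename_X, MvPolynomial.X_inj] at h1
    exact congrArg (fun z => (ULift.down z).val) h1
  let E := FractionRing R
  let ψ : G →* (E ≃+* E) := (IsFractionRing.ringEquivOfRingEquivHom R E).comp ρ
  have hψ : Function.Injective ψ :=
    (IsFractionRing.ringEquivOfRingEquivHom_injective R E).comp hρ
  letI : MulSemiringAction G E := MulSemiringAction.compHom E ψ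
  exact ⟨E, inferInstance, inferInstance,
    ⟨fun h => hψ (RingEquiv.ext h)⟩⟩

theorem PermGroup.exists_realises {n : ℕ} (hn : 0 < n) (G : PermGroup n) :
    ∃ F : SeparableExtension.{u}, F.Realises G := by
  obtain ⟨E, _, _, _⟩ := exists_faithful_action.{u} n G.grp
  let x : Fin n := ⟨0, hn⟩
  obtain ⟨F, θ, h⟩ := exists_extension_of_action (E := E) (MulAction.stabilizer G.grp x) (by
    rw [eq_bot_iff]
    intro g hg
    rw [Subgroup.mem_bot]
    apply FaithfulSMul.eq_of_smul_eq_smul (α := Fin n)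
    intro y
    obtain ⟨k, rfl⟩ := G.2.exists_smul_eq x y
    have h1 := hg k⁻¹
    rw [MulAction.mem_stabilizer_iff, inv_inv, mul_smul, mul_smul, inv_smul_eq_iff] at h1
    rw [h1, one_smul])
  exact ⟨F, x, θ, h⟩

/-- From here on only transitive subgroups of the holomorph matter; fields return only when the
results are assembled. -/
theorem PermGroup.isRealisedBy_iff {n : ℕ} (hn : 0 < n) (G : PermGroup n) (N : Type) [Group N]
    [Finite N] : G.IsRealisedBy.{u} N ↔
      ∃ M : Subgroup (Hol N), MulAction.IsPretransitive M N ∧ PermIso M N G.grp (Fin n) := by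
  constructor
  · rintro ⟨F, hF, h⟩
    exact (hF.exists_iff N).1 h
  · intro h
    obtain ⟨F, hF⟩ := G.exists_realises hn
    exact ⟨F, hF, (hF.exists_iff N).2 h⟩

end Realise

/-! ### The affine line over `F_p` -/

/-- The affine maps `x ↦ a x + b` of the line over `F_p`. -/
@[ext]
structure AffLine (p : ℕ) : Type where
  b : ZMod p
  a : (ZMod p)ˣ

namespace AffLine

section Basic

variable {p : ℕ}

instance : Mul (AffLine p) := ⟨fun g h => ⟨g.b + g.a * h.b, g.a * h.a⟩⟩
instance : One (AffLine p) := ⟨⟨0, 1⟩⟩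
instance : Inv (AffLine p) := ⟨fun g => ⟨-((g.a⁻¹ : (ZMod p)ˣ) * g.b), g.a⁻¹⟩⟩

@[simp] theorem mul_b (g h : AffLine p) : (g * h).b = g.b + g.a * h.b := rfl
@[simp] theorem mul_a (g h : AffLine p) : (g * h).a = g.a * h.a := rfl
@[simp] theorem one_b : (1 : AffLine p).b = 0 := rfl
@[simp] theorem one_a : (1 : AffLine p).a = 1 := rfl
@[simp] theorem inv_b (g : AffLine p) : (g⁻¹).b = -((g.a⁻¹ : (ZMod p)ˣ) * g.b) := rfl
@[simp] theorem inv_a (g : AffLine p) : (g⁻¹).a = g.a⁻¹ := rfl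

instance : Group (AffLine p) :=
  Group.ofLeftAxioms (fun g h k => AffLine.ext (by simp; ring) (mul_assoc _ _ _))
    (fun g => AffLine.ext (by simp) (one_mul _))
    (fun g => AffLine.ext (by simp) (inv_mul_cancel _))

/-- The linear part. -/
def aHom : AffLine p →* (ZMod p)ˣ where
  toFun := a
  map_one' := rfl
  map_mul' _ _ := rfl

@[simp] theorem pow_a (g : AffLine p) (n : ℕ) : (g ^ n).a = g.a ^ n := map_pow aHom g n

theorem conj_eq (k g : AffLine p) :
    k * g * k⁻¹ = ⟨k.a * g.b + (1 - g.a) * k.b, g.a⟩ := by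
  rw [mul_inv_eq_iff_eq_mul]
  refine AffLine.ext ?_ (mul_comm _ _)
  simp only [mul_b]
  ring

/-- The translation by `x`. -/
def tr (x : ZMod p) : AffLine p := ⟨x, 1⟩

@[simp] theorem tr_b (x : ZMod p) : (tr x).b = x := rfl
@[simp] theorem tr_a (x : ZMod p) : (tr x).a = 1 := rfl

theorem tr_add (x y : ZMod p) : tr (x + y) = tr x * tr y := AffLine.ext (by simp) (by simp)

theorem eq_tr {g : AffLine p} (h : g.a = 1) : g = tr g.b := AffLine.ext rfl h

theorem tr_pow (x : ZMod p) (n : ℕ) : tr x ^ n = tr ((n : ZMod p) * x) := by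
  induction n with
  | zero => rw [pow_zero]; exact AffLine.ext (by simp) rfl
  | succ n ih => rw [pow_succ, ih, ← tr_add]; congr 1; push_cast; ring

/-- The affine maps with linear part in `S`. -/
def withLinear (S : Subgroup (ZMod p)ˣ) : Subgroup (AffLine p) := S.comap aHom

theorem mem_withLinear {S : Subgroup (ZMod p)ˣ} {g : AffLine p} : g ∈ withLinear S ↔ g.a ∈ S :=
  Iff.rfl

/-- Affine maps as pairs. -/
def equivProd : AffLine p ≃ ZMod p × (ZMod p)ˣ where
  toFun g := (g.b, g.a)
  invFun x := ⟨x.1, x.2⟩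
  left_inv _ := rfl
  right_inv _ := rfl

theorem card_withLinear (S : Subgroup (ZMod p)ˣ) :
    Nat.card (withLinear S) = p * Nat.card S := by
  have h : Nat.card (ZMod p × S) = p * Nat.card S := by rw [Nat.card_prod, Nat.card_zmod]
  rw [← h]
  exact Nat.card_congr
    { toFun := fun g => (g.1.b, ⟨g.1.a, g.2⟩)
      invFun := fun x => ⟨⟨x.1, x.2.1⟩, x.2.2⟩
      left_inv := fun _ => rfl
      right_inv := fun _ => rfl }

/-- `C_p ⋊ C_k` as a group of affine maps. -/
def semiEquiv (p k : ℕ) : CpSemi p k ≃* withLinear (rootsOfUnity k (ZMod p)) where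
  toFun n := ⟨⟨n.left.toAdd, n.right⟩, n.right.2⟩
  invFun g := ⟨Multiplicative.ofAdd g.1.b, ⟨g.1.a, g.2⟩⟩
  left_inv _ := rfl
  right_inv _ := rfl
  map_mul' _ _ := rfl

end Basic

section Prime

variable {p : ℕ} [Fact p.Prime]

theorem unit_pow_p (a : (ZMod p)ˣ) : a ^ p = a := by
  ext
  push_cast
  exact ZMod.pow_card _

instance : Finite (AffLine p) := Finite.of_equiv _ equivProd.symm

theorem pow_p_eq_one_iff {g : AffLine p} : g ^ p = 1 ↔ g.a = 1 := by
  constructor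
  · intro h
    have := congrArg a h
    rwa [pow_a, unit_pow_p] at this
  · intro h
    rw [eq_tr h, tr_pow]
    refine AffLine.ext ?_ rfl
    simp

theorem addHom_eq (f : ZMod p →+ ZMod p) (x : ZMod p) : f x = x * f 1 := by
  have := ZMod.map_smul f x 1
  simpa using this

/-- Commuting with the translations forces slope `1`, and commuting with the homothety `x ↦ s x`
forces `0` to be fixed. -/
theorem eq_one_of_commute {S : Subgroup (ZMod p)ˣ} {s : (ZMod p)ˣ} (hs : s ∈ S) (hs1 : s ≠ 1)
    {k : AffLine p} (h : ∀ g ∈ withLinear S, k * g = g * k) : k = 1 := by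
  have h1 := congrArg b (h (tr 1) S.one_mem)
  have h2 := congrArg b (h ⟨0, s⟩ hs)
  simp only [mul_b, tr_b, tr_a, mul_one, Units.val_one, one_mul, mul_zero, add_zero, zero_add]
    at h1 h2
  refine AffLine.ext ?_ (Units.ext ?_)
  · have h3 : ((s : ZMod p) - 1) * k.b = 0 := by rw [sub_mul, ← h2]; ring
    rcases mul_eq_zero.1 h3 with h4 | h4
    · exact absurd (Units.ext (sub_eq_zero.1 h4)) hs1
    · exact h4
  · simpa [add_comm] using h1

/-- Automorphisms of a group of affine maps that contains the translations properly are induced by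
conjugation with affine maps. -/
theorem exists_conj {S : Subgroup (ZMod p)ˣ} {s : (ZMod p)ˣ} (hs : s ∈ S) (hs1 : s ≠ 1)
    (θ : withLinear S ≃* withLinear S) :
    ∃ k : AffLine p, ∀ g, (θ g : AffLine p) = k * g * k⁻¹ := by
  let t : ZMod p → withLinear S := fun x => ⟨tr x, S.one_mem⟩
  -- The translations are exactly the elements killed by `p`, since `a ^ p = a` for slopes. Hence
  -- every automorphism preserves them.
  have hta : ∀ x, (θ (t x) : AffLine p).a = 1 := by
    intro x
    rw [← pow_p_eq_one_iff]
    have h1 : t x ^ p = 1 := Subtype.ext (pow_p_eq_one_iff.2 rfl)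
    have h2 := congrArg (fun g => (θ g : AffLine p)) h1
    simpa using h2
  let f : ZMod p →+ ZMod p :=
    { toFun := fun x => (θ (t x) : AffLine p).b
      map_zero' := by
        rw [show t 0 = 1 from rfl, map_one]
        rfl
      map_add' := fun x y => by
        rw [show t (x + y) = t x * t y from Subtype.ext (tr_add x y), map_mul]
        simp [hta] }
  have hf : ∀ x, (θ (t x) : AffLine p) = tr (x * f 1) := fun x => by
    rw [← addHom_eq]
    exact eq_tr (hta x)
  have hc : f 1 ≠ 0 := by
    intro h0
    have h1 := hf 1
    rw [h0, mul_zero] at h1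
    have h2 : t 1 = 1 := θ.injective (by rw [map_one]; exact Subtype.ext h1)
    exact one_ne_zero (congrArg (fun g : withLinear S => g.1.b) h2)
  -- The slope of `g` is the scalar by which it acts on translations by conjugation, and `θ` acts on
  -- the translations by a scalar itself.
  have ha : ∀ g, (θ g : AffLine p).a = g.1.a := by
    intro g
    have h1 : g * t 1 = t g.1.a * g := Subtype.ext (AffLine.ext (by simp [t, add_comm])
      (by simp [t]))
    have h2 := congrArg (fun g => (θ g : AffLine p).b) h1
    simp only [map_mul, Subgroup.coe_mul, hf, mul_b, tr_b, tr_a, Units.val_one, one_mul] at h2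
    rw [add_comm, add_right_cancel_iff] at h2
    exact Units.ext (mul_right_cancel₀ hc h2)
  let l : S → withLinear S := fun x => ⟨⟨0, x⟩, x.2⟩
  -- The homotheties commute, so their images do; this makes all of them fix the fixed point of the
  -- image of `x ↦ s x`.
  have hl : ∀ x : S, (θ (l x)).1.b * (1 - s) = (θ (l ⟨s, hs⟩)).1.b * (1 - x.1) := by
    intro x
    have h1 : l x * l ⟨s, hs⟩ = l ⟨s, hs⟩ * l x :=
      Subtype.ext (AffLine.ext (by simp [l]) (mul_comm _ _))
    have h2 := congrArg (fun g => (θ g : AffLine p).b) h1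
    simp only [map_mul, Subgroup.coe_mul, mul_b, ha] at h2
    change _ + (x.1 : ZMod p) * _ = _ + (s : ZMod p) * _ at h2
    linear_combination h2
  have hs' : (1 - s : ZMod p) ≠ 0 := fun h => hs1 (Units.ext (sub_eq_zero.1 h).symm)
  -- The constant term is the common fixed point of the images of the homotheties, the slope is the
  -- scalar on translations.
  refine ⟨⟨(θ (l ⟨s, hs⟩)).1.b / (1 - s), Units.mk0 (f 1) hc⟩, fun g => ?_⟩
  rw [conj_eq]
  refine AffLine.ext ?_ (ha g)
  have h1 : g = t g.1.b * l ⟨g.1.a, g.2⟩ := Subtype.ext (AffLine.ext (by simp [t, l])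
    (by simp [t, l]))
  have h2 := hl ⟨g.1.a, g.2⟩
  conv_lhs => rw [h1]
  simp only [map_mul, Subgroup.coe_mul, mul_b, hf, tr_b, tr_a, Units.val_one, one_mul,
    Units.val_mk0]
  rw [← eq_div_iff hs'] at h2
  rw [h2]
  field_simp

end Prime

end AffLine

/-! ### The holomorph as a group of pairs of affine maps -/

section HolEmbedding

variable {p : ℕ} [Fact p.Prime] {q : ℕ}

open AffLine

/-- Pairs of affine maps whose linear parts have a quotient of order dividing `q`. -/
def holPairs (p q : ℕ) : Subgroup (AffLine p × AffLine p) :=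
  (rootsOfUnity q (ZMod p)).comap
    ((aHom.comp (MonoidHom.fst _ _)) / (aHom.comp (MonoidHom.snd _ _)))

theorem mem_holPairs {g : AffLine p × AffLine p} :
    g ∈ holPairs p q ↔ g.1.a / g.2.a ∈ rootsOfUnity q (ZMod p) := Iff.rfl

/-- The elements of `C_p ⋊ C_q` as affine maps. -/
def semiVal (n : CpSemi p q) : AffLine p := semiEquiv p q n

theorem semiVal_mul (m n : CpSemi p q) : semiVal (m * n) = semiVal m * semiVal n :=
  congrArg Subtype.val (map_mul (semiEquiv p q) m n)

theorem semiVal_one : semiVal (1 : CpSemi p q) = 1 := rfl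

theorem semiVal_injective : Function.Injective (semiVal : CpSemi p q → AffLine p) :=
  Subtype.val_injective.comp (semiEquiv p q).injective

theorem exists_semiVal {g : AffLine p} (hg : g.a ∈ rootsOfUnity q (ZMod p)) :
    ∃ n : CpSemi p q, semiVal n = g :=
  ⟨(semiEquiv p q).symm ⟨g, hg⟩, by simp [semiVal]⟩

theorem semiVal_a (n : CpSemi p q) : (semiVal n).a ∈ rootsOfUnity q (ZMod p) :=
  (semiEquiv p q n).2

instance finite_semi : Finite (CpSemi p q) := Finite.of_injective semiVal semiVal_injective

/-- A pair of affine maps acts on `C_p ⋊ C_q` by left and right multiplication. -/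
theorem exists_pairPerm {g : AffLine p × AffLine p} (hg : g ∈ holPairs p q) :
    ∃ f : CpSemi p q ≃ CpSemi p q, ∀ n, semiVal (f n) = g.1 * semiVal n * g.2⁻¹ := by
  have hmem : ∀ n : CpSemi p q,
      (g.1 * semiVal n * g.2⁻¹).a ∈ rootsOfUnity q (ZMod p) := by
    intro n
    have : (g.1 * semiVal n * g.2⁻¹).a = g.1.a / g.2.a * (semiVal n).a := by
      rw [mul_a, mul_a, inv_a, div_eq_mul_inv, mul_right_comm]
    rw [this]
    exact mul_mem hg (semiVal_a n)
  choose f hf using fun n => exists_semiVal (hmem n)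
  have hinj : Function.Injective f := by
    intro m n hmn
    have h := congrArg semiVal hmn
    rw [hf, hf] at h
    exact semiVal_injective (mul_left_cancel (mul_right_cancel h))
  exact ⟨Equiv.ofBijective f (Finite.injective_iff_bijective.1 hinj), hf⟩

theorem exists_conj_of_aut {s : (ZMod p)ˣ} (hs : s ∈ rootsOfUnity q (ZMod p)) (hs1 : s ≠ 1)
    (α : MulAut (CpSemi p q)) :
    ∃ k : AffLine p, ∀ n, semiVal (α n) = k * semiVal n * k⁻¹ := by
  obtain ⟨k, hk⟩ := exists_conj hs hs1
    (((semiEquiv p q).symm.trans α).trans (semiEquiv p q))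
  refine ⟨k, fun n => ?_⟩
  have := hk (semiEquiv p q n)
  simp only [MulEquiv.trans_apply, MulEquiv.symm_apply_apply] at this
  exact this

theorem conj_unique {s : (ZMod p)ˣ} (hs : s ∈ rootsOfUnity q (ZMod p)) (hs1 : s ≠ 1)
    {k l : AffLine p} (h : ∀ n : CpSemi p q, k * semiVal n * k⁻¹ = l * semiVal n * l⁻¹) :
    k = l := by
  rw [← inv_mul_eq_one]
  refine inv_eq_one.1 (eq_one_of_commute hs hs1 fun g hg => ?_)
  obtain ⟨n, rfl⟩ := exists_semiVal hg
  have := h n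
  rw [mul_inv_eq_iff_eq_mul] at this
  rw [mul_inv_rev, inv_inv, mul_assoc, inv_mul_eq_iff_eq_mul]
  rw [this]
  group

/-- Conjugation identifies `Aut(N)` with the whole affine group: conjugation preserves slopes, so
all affine maps normalise `N`, and only the identity centralises it. -/
theorem card_mulAut_semi {s : (ZMod p)ˣ} (hs : s ∈ rootsOfUnity q (ZMod p)) (hs1 : s ≠ 1) :
    Nat.card (MulAut (CpSemi p q)) = p * (p - 1) := by
  choose k hk using exists_conj_of_aut hs hs1
  have hb : Function.Bijective k := by
    constructor
    · intro α β h
      ext1 n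
      apply semiVal_injective
      rw [hk, hk, h]
    · intro l
      let e : MulAut (withLinear (rootsOfUnity q (ZMod p))) :=
        { toFun := fun g => ⟨l * g * l⁻¹, by rw [mem_withLinear, conj_eq]; exact g.2⟩
          invFun := fun g => ⟨l⁻¹ * g * l⁻¹⁻¹, by rw [mem_withLinear, conj_eq]; exact g.2⟩
          left_inv := fun g => Subtype.ext (by simp [mul_assoc])
          right_inv := fun g => Subtype.ext (by simp [mul_assoc])
          map_mul' := fun g h => Subtype.ext (by simp [mul_assoc]) }
      refine ⟨((semiEquiv p q).trans e).trans (semiEquiv p q).symm, conj_unique hs hs1 fun n => ?_⟩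
      rw [← hk]
      simp [semiVal, e]
  rw [Nat.card_congr (Equiv.ofBijective k hb), Nat.card_congr equivProd, Nat.card_prod,
    Nat.card_zmod, Nat.card_eq_fintype_card, ZMod.card_units]

theorem exists_hol_of_pair {g : AffLine p × AffLine p} (hg : g ∈ holPairs p q) :
    ∃ h : Hol (CpSemi p q), ∀ n : CpSemi p q,
      semiVal (h • n) = g.1 * semiVal n * g.2⁻¹ := by
  obtain ⟨f, hf⟩ := exists_pairPerm (p := p) (q := q) (g := g) hg
  have hn : ∀ n, ∃ n', ∀ m, f (n * m) = n' * f m := by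
    intro n
    obtain ⟨n', hn'⟩ := exists_semiVal (q := q) (g := g.1 * semiVal n * g.1⁻¹)
      (by rw [conj_eq]; exact semiVal_a n)
    refine ⟨n', fun m => semiVal_injective ?_⟩
    rw [semiVal_mul, hn', hf, hf, semiVal_mul]
    group
  obtain ⟨h, hh⟩ := Hol.exists_of_normalises f hn
  exact ⟨h, fun n => (congrArg semiVal (hh n)).trans (hf n)⟩

/-- If `α` is conjugation by `k`, then `[η, α]` acts by `n ↦ η k n k⁻¹`, so it corresponds to the
pair `(η k, k)`. The slopes of the pair have the slope of `η` as quotient, which accounts for the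
image. The pair is unique because `N` has trivial centraliser. -/
theorem exists_hol_embedding {s : (ZMod p)ˣ} (hs : s ∈ rootsOfUnity q (ZMod p)) (hs1 : s ≠ 1) :
    ∃ ι : Hol (CpSemi p q) →* AffLine p × AffLine p, Function.Injective ι ∧
      ι.range = holPairs p q ∧ ∀ (h : Hol (CpSemi p q)) (n : CpSemi p q),
        semiVal (h • n) = (ι h).1 * semiVal n * (ι h).2⁻¹ := by
  have hex : ∀ h : Hol (CpSemi p q), ∃ g : AffLine p × AffLine p,
      ∀ n : CpSemi p q, semiVal (h • n) = g.1 * semiVal n * g.2⁻¹ := by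
    intro h
    obtain ⟨k, hk⟩ := exists_conj_of_aut hs hs1 h.right
    refine ⟨(semiVal h.left * k, k), fun n => ?_⟩
    rw [Hol.smul_def, semiVal_mul, hk]
    simp [mul_assoc]
  have huniq : ∀ g g' : AffLine p × AffLine p, (∀ n : CpSemi p q,
      g.1 * semiVal n * g.2⁻¹ = g'.1 * semiVal n * g'.2⁻¹) → g = g' := by
    intro g g' h
    have h1 := h 1
    rw [semiVal_one, mul_one, mul_one] at h1
    have h2 : g.2 = g'.2 := conj_unique hs hs1 fun n => by
      have h3 := h n
      calc g.2 * semiVal n * g.2⁻¹ = (g.1 * g.2⁻¹)⁻¹ * (g.1 * semiVal n * g.2⁻¹) := by group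
        _ = g'.2 * semiVal n * g'.2⁻¹ := by rw [h3, h1]; group
    rw [h2] at h1
    exact Prod.ext (mul_right_cancel h1) h2
  choose ι hι using hex
  have hge : ∀ g ∈ holPairs p q, ∃ h, ι h = g := by
    intro g hg
    have hex := exists_hol_of_pair (p := p) (q := q) (g := g) hg
    refine hex.imp fun h hh => huniq _ _ fun n => ?_
    rw [← hι, hh]
  have hle : ∀ h, ι h ∈ holPairs p q := by
    intro h
    have h1 := hι h 1
    rw [semiVal_one, mul_one] at h1
    rw [mem_holPairs, div_eq_mul_inv]
    have h2 := semiVal_a (h • (1 : CpSemi p q))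
    rw [h1] at h2
    exact h2
  refine ⟨⟨⟨ι, huniq _ _ fun n => ?_⟩, fun h k => huniq _ _ fun n => ?_⟩, ?_, ?_, hι⟩
  · rw [← hι]
    simp
  · rw [← hι, mul_smul, hι, hι]
    simp [mul_assoc]
  · intro h k hk
    refine Hol.eq_of_smul fun n => semiVal_injective ?_
    rw [hι, hι]
    change ι h = ι k at hk
    rw [hk]
  · exact le_antisymm (by rintro _ ⟨h, rfl⟩; exact hle h) hge

end HolEmbedding

/-! ### Roots of unity modulo a safe prime -/

/-- `q` is an odd prime and `p = 2 q + 1`. -/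
class SafePair (p q : ℕ) : Prop where
  prime : q.Prime
  three_le : 3 ≤ q
  eq : p = 2 * q + 1

theorem SafePair.odd (p q : ℕ) [SafePair p q] : Odd q :=
  (SafePair.prime p (q := q)).odd_of_ne_two (by
    have := SafePair.three_le p (q := q)
    omega)

theorem SafePair.pos (p q : ℕ) [SafePair p q] : 0 < q := (SafePair.prime p (q := q)).pos

section Roots

variable (p q : ℕ) [Fact p.Prime] [SafePair p q]

namespace SafePair

theorem pow_two_mul (a : (ZMod p)ˣ) : a ^ (2 * q) = 1 := by
  have h := ZMod.units_pow_card_sub_one_eq_one p a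
  rwa [show p - 1 = 2 * q by have := SafePair.eq (p := p) (q := q); omega] at h

theorem two_mul_cast : (2 : ZMod p) * q = -1 := by
  have h : ((2 * q + 1 : ℕ) : ZMod p) = 0 := by
    rw [← SafePair.eq (p := p) (q := q)]
    exact ZMod.natCast_self p
  push_cast at h
  linear_combination h

include q in
theorem two_ne_zero : (2 : ZMod p) ≠ 0 := by
  intro h
  have h1 := two_mul_cast p q
  rw [h, zero_mul] at h1
  simpa using h1

include q in
theorem neg_one_ne : (-1 : (ZMod p)ˣ) ≠ 1 := by
  intro h
  have h1 : (-1 : ZMod p) = 1 := by simpa using congrArg Units.val h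
  exact two_ne_zero p q (by linear_combination -h1)

theorem neg_pow_q (a : (ZMod p)ˣ) : (-a) ^ q = -a ^ q := (odd p q).neg_pow a

theorem neg_one_notMem : (-1 : (ZMod p)ˣ) ∉ rootsOfUnity q (ZMod p) := by
  rw [mem_rootsOfUnity, neg_pow_q, one_pow]
  exact neg_one_ne p q

theorem pow_q_eq (a : (ZMod p)ˣ) : a ^ q = 1 ∨ a ^ q = -1 := by
  have h : (a ^ q) * (a ^ q) = 1 := by rw [← pow_add, ← two_mul, pow_two_mul]
  have h1 : ((a ^ q : (ZMod p)ˣ) : ZMod p) * (a ^ q : (ZMod p)ˣ) = 1 := by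
    rw [← Units.val_mul, h, Units.val_one]
  rcases mul_self_eq_one_iff.1 h1 with h2 | h2
  · exact Or.inl (Units.ext h2)
  · exact Or.inr (Units.ext (by simpa using h2))

/-- The group of units has order `2 q` with `q` odd, so it is the product of `μ_q` and `{1, -1}`. -/
theorem mem_or_neg_mem (a : (ZMod p)ˣ) :
    a ∈ rootsOfUnity q (ZMod p) ∨ -a ∈ rootsOfUnity q (ZMod p) := by
  rw [mem_rootsOfUnity, mem_rootsOfUnity, neg_pow_q]
  refine (pow_q_eq p q a).imp_right fun h => ?_
  rw [h, neg_neg]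

theorem card_units : Nat.card (ZMod p)ˣ = 2 * q := by
  rw [Nat.card_eq_fintype_card, ZMod.card_units, SafePair.eq (p := p) (q := q)]
  rfl

theorem exists_generator : ∃ z : (ZMod p)ˣ, orderOf z = q ∧
    ∀ a, a ∈ rootsOfUnity q (ZMod p) ↔ ∃ k < q, z ^ k = a := by
  obtain ⟨g, hg⟩ := IsCyclic.exists_generator (α := (ZMod p)ˣ)
  have ho : orderOf g = 2 * q := by
    rw [orderOf_eq_card_of_forall_mem_zpowers hg, card_units p q]
  have hz : orderOf (g ^ 2) = q := by
    rw [orderOf_pow_of_dvd (by norm_num) (by rw [ho]; exact dvd_mul_right _ _), ho]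
    simp
  refine ⟨g ^ 2, hz, fun a => ⟨fun ha => ?_, ?_⟩⟩
  · obtain ⟨k, -, rfl⟩ := Finset.mem_image.1 (mem_zpowers_iff_mem_range_orderOf.1 (hg a))
    change g ^ k ∈ _ at ha
    rw [mem_rootsOfUnity, ← pow_mul, ← orderOf_dvd_iff_pow_eq_one, ho,
      Nat.mul_dvd_mul_iff_right (pos p q)] at ha
    obtain ⟨m, rfl⟩ := ha
    refine ⟨m % q, Nat.mod_lt _ (pos p q), ?_⟩
    rw [pow_mul]
    nth_rw 1 [← hz]
    rw [pow_mod_orderOf]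
  · rintro ⟨k, -, rfl⟩
    rw [mem_rootsOfUnity, ← pow_mul, mul_comm, pow_mul, ← hz, pow_orderOf_eq_one, one_pow]

theorem exists_root : ∃ z ∈ rootsOfUnity q (ZMod p), z ≠ 1 := by
  obtain ⟨z, hz, h⟩ := exists_generator p q
  refine ⟨z, (h z).2 ⟨1, (SafePair.prime p (q := q)).one_lt, pow_one z⟩, ?_⟩
  rintro rfl
  rw [orderOf_one] at hz
  exact (SafePair.prime p (q := q)).one_lt.ne hz

theorem card_roots : Nat.card (rootsOfUnity q (ZMod p)) = q := by
  obtain ⟨z, hz, h⟩ := exists_generator p q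
  suffices hs : rootsOfUnity q (ZMod p) = Subgroup.zpowers z by
    rw [hs, Nat.card_zpowers, hz]
  ext a
  rw [h]
  constructor
  · rintro ⟨k, -, rfl⟩
    exact Subgroup.npow_mem_zpowers z k
  · intro ha
    obtain ⟨k, hk, rfl⟩ := Finset.mem_image.1 (mem_zpowers_iff_mem_range_orderOf.1 ha)
    exact ⟨k, hz ▸ Finset.mem_range.1 hk, rfl⟩

variable {p q}

theorem pow_eq_one_iff {z : (ZMod p)ˣ} (hz : z ∈ rootsOfUnity q (ZMod p)) (hz1 : z ≠ 1) (k : ℕ) :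
    z ^ k = 1 ↔ q ∣ k := by
  have : orderOf z = q := by
    have : Fact q.Prime := ⟨SafePair.prime p⟩
    exact orderOf_eq_prime hz hz1
  rw [← this, orderOf_dvd_iff_pow_eq_one]

theorem mem_iff_pow {z : (ZMod p)ˣ} (hz : z ∈ rootsOfUnity q (ZMod p)) (hz1 : z ≠ 1)
    (a : (ZMod p)ˣ) : a ∈ rootsOfUnity q (ZMod p) ↔ ∃ k < q, z ^ k = a := by
  constructor
  · intro ha
    have : Fact q.Prime := ⟨SafePair.prime p⟩
    have hz' : (⟨z, hz⟩ : rootsOfUnity q (ZMod p)) ≠ 1 := fun h => hz1 (congrArg Subtype.val h)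
    obtain ⟨k, hk⟩ := mem_powers_of_prime_card (h := card_roots p q) hz' (g' := ⟨a, ha⟩)
    have hk' : z ^ k = a := congrArg Subtype.val hk
    refine ⟨k % q, Nat.mod_lt _ (pos p q), ?_⟩
    rw [← hk']
    conv_rhs => rw [← Nat.mod_add_div k q]
    rw [pow_add, pow_mul, show z ^ q = 1 from hz, one_pow, mul_one]
  · rintro ⟨k, -, rfl⟩
    exact pow_mem hz k

end SafePair

end Roots

/-! ### Groups of diagonal matrices -/

section Diagonal

variable {p q : ℕ}

/-- The group generated by a group of diagonal matrices and `-I`. -/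
def withNeg (D : Subgroup ((ZMod p)ˣ × (ZMod p)ˣ)) : Subgroup ((ZMod p)ˣ × (ZMod p)ˣ) :=
  D ⊔ Subgroup.zpowers (-1, -1)

theorem mem_withNeg {D : Subgroup ((ZMod p)ˣ × (ZMod p)ˣ)} {x : (ZMod p)ˣ × (ZMod p)ˣ} :
    x ∈ withNeg D ↔ x ∈ D ∨ -x ∈ D := by
  have hneg : ∀ y : (ZMod p)ˣ × (ZMod p)ˣ, ((-1, -1) : (ZMod p)ˣ × (ZMod p)ˣ) * y = -y := fun y =>
    Prod.ext (by simp) (by simp)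
  constructor
  · intro hx
    obtain ⟨d, hd, _, ⟨k, rfl⟩, rfl⟩ := Subgroup.mem_sup.1 hx
    rcases Int.even_or_odd k with ⟨m, rfl⟩ | ⟨m, rfl⟩
    · left
      have : ((-1, -1) : (ZMod p)ˣ × (ZMod p)ˣ) ^ (m + m) = 1 := by
        rw [← two_mul, zpow_mul]
        have : ((-1, -1) : (ZMod p)ˣ × (ZMod p)ˣ) ^ (2 : ℤ) = 1 := Prod.ext (by simp) (by simp)
        rw [this, one_zpow]
      simpa [this] using hd
    · right
      have : ((-1, -1) : (ZMod p)ˣ × (ZMod p)ˣ) ^ (2 * m + 1) = (-1, -1) := by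
        rw [zpow_add, zpow_mul]
        have : ((-1, -1) : (ZMod p)ˣ × (ZMod p)ˣ) ^ (2 : ℤ) = 1 := Prod.ext (by simp) (by simp)
        rw [this, one_zpow, one_mul, zpow_one]
      change -(d * ((-1, -1) : (ZMod p)ˣ × (ZMod p)ˣ) ^ (2 * m + 1)) ∈ D
      rw [this, mul_comm, hneg, neg_neg]
      exact hd
  · rintro (h | h)
    · exact Subgroup.mem_sup_left h
    · rw [← neg_neg x, ← hneg]
      exact mul_mem (Subgroup.mem_sup_right (Subgroup.mem_zpowers _)) (Subgroup.mem_sup_left h)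

theorem le_withNeg (D : Subgroup ((ZMod p)ˣ × (ZMod p)ˣ)) : D ≤ withNeg D := le_sup_left

theorem mem_diagU {u : ℕ} {x : (ZMod p)ˣ × (ZMod p)ˣ} :
    x ∈ diagU p q u ↔ ∃ z ∈ rootsOfUnity q (ZMod p), x = (z ^ (u + 1), z ^ u) := by
  constructor
  · rintro ⟨z, hz, rfl⟩
    exact ⟨z, hz, rfl⟩
  · rintro ⟨z, hz, rfl⟩
    exact ⟨z, hz, rfl⟩

variable (p q)

/-- The group of all diagonal matrices of order dividing `q`. -/
def diagAll : Subgroup ((ZMod p)ˣ × (ZMod p)ˣ) :=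
  (rootsOfUnity q (ZMod p)).prod (rootsOfUnity q (ZMod p))

/-- The groups of diagonal matrices of order dividing `q` in which all quotients occur. -/
def IsDiagBase (D : Subgroup ((ZMod p)ˣ × (ZMod p)ˣ)) : Prop :=
  D = diagAll p q ∨ ∃ u < q, D = diagU p q u

variable {p q}

theorem diagU_le_diagAll (u : ℕ) : diagU p q u ≤ diagAll p q := by
  intro x hx
  obtain ⟨z, hz, rfl⟩ := mem_diagU.1 hx
  exact ⟨pow_mem hz _, pow_mem hz _⟩

theorem IsDiagBase.le {D : Subgroup ((ZMod p)ˣ × (ZMod p)ˣ)} (h : IsDiagBase p q D) :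
    D ≤ diagAll p q := by
  rcases h with rfl | ⟨u, -, rfl⟩
  · exact le_rfl
  · exact diagU_le_diagAll u

theorem IsDiagBase.exists_quotient {D : Subgroup ((ZMod p)ˣ × (ZMod p)ˣ)}
    (h : IsDiagBase p q D) {s : (ZMod p)ˣ} (hs : s ∈ rootsOfUnity q (ZMod p)) :
    ∃ d ∈ D, d.1 = s * d.2 := by
  rcases h with rfl | ⟨u, -, rfl⟩
  · exact ⟨(s, 1), ⟨hs, one_mem _⟩, (mul_one s).symm⟩
  · exact ⟨_, mem_diagU.2 ⟨s, hs, rfl⟩, pow_succ' s u⟩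

variable [Fact p.Prime] [SafePair p q]

open SafePair

/-- The quotient of the entries maps `D` onto `μ_q` with the scalars in `D` as kernel. As `q` is
prime, either all scalars of `μ_q` occur and `D` is everything, or the kernel is trivial and `D` is
generated by one element with quotient `z`. The second entry of that element is `z^u` for some `u`.
-/
theorem isDiagBase_of_quotients {D : Subgroup ((ZMod p)ˣ × (ZMod p)ˣ)} (hD : D ≤ diagAll p q)
    (h : ∀ s ∈ rootsOfUnity q (ZMod p), ∃ d ∈ D, d.1 = s * d.2) : IsDiagBase p q D := by
  by_cases hs : ∃ s : (ZMod p)ˣ, s ≠ 1 ∧ (s, s) ∈ D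
  · left
    obtain ⟨s, hs1, hs⟩ := hs
    refine le_antisymm hD ?_
    rintro ⟨a, b⟩ ⟨ha, hb⟩
    obtain ⟨⟨d1, d2⟩, hd, hd'⟩ := h (a / b) (div_mem ha hb)
    change d1 = a / b * d2 at hd'
    obtain ⟨k, -, hk⟩ := (mem_iff_pow (hD hs).1 hs1 (b / d2)).1 (div_mem hb (hD hd).2)
    have : ((a, b) : (ZMod p)ˣ × (ZMod p)ˣ) = (s, s) ^ k * (d1, d2) := by
      refine Prod.ext ?_ ?_
      · change a = s ^ k * d1
        rw [hk, hd', mul_left_comm, div_mul_cancel, div_mul_cancel]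
      · change b = s ^ k * d2
        rw [hk, div_mul_cancel]
    rw [this]
    exact mul_mem (pow_mem hs k) hd
  · right
    obtain ⟨z, hz, hz1⟩ := exists_root p q
    obtain ⟨⟨d1, d2⟩, hd, hd'⟩ := h z hz
    obtain ⟨u, hu, hu'⟩ := (mem_iff_pow hz hz1 d2).1 (hD hd).2
    have key : ∀ x ∈ D, ∀ y ∈ D, x.1 / x.2 = y.1 / y.2 → x = y := by
      rintro ⟨x1, x2⟩ hx ⟨y1, y2⟩ hy hxy
      change x1 / x2 = y1 / y2 at hxy
      have h1 : (x1 / y1, x2 / y2) ∈ D := div_mem hx hy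
      have h2 : x1 / y1 = x2 / y2 := by
        rw [div_eq_div_iff_mul_eq_mul] at hxy ⊢
        rw [hxy, mul_comm]
      rw [h2] at h1
      have h3 : x2 / y2 = 1 := by
        by_contra h3
        exact hs ⟨_, h3, h1⟩
      rw [h3] at h2
      exact Prod.ext (div_eq_one.1 h2) (div_eq_one.1 h3)
    refine ⟨u, hu, le_antisymm ?_ ?_⟩
    · intro x hx
      obtain ⟨k, -, hk⟩ := (mem_iff_pow hz hz1 (x.1 / x.2)).1 (div_mem (hD hx).1 (hD hx).2)
      have h1 : x = (d1, d2) ^ k := by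
        refine key _ hx _ (pow_mem hd k) ?_
        rw [← hk]
        change z ^ k = d1 ^ k / d2 ^ k
        rw [← div_pow]
        congr 1
        exact eq_div_iff_mul_eq'.2 hd'.symm
      rw [mem_diagU]
      refine ⟨z ^ k, pow_mem hz k, ?_⟩
      rw [h1]
      change (d1 ^ k, d2 ^ k) = _
      change d1 = z * d2 at hd'
      rw [hd', ← hu', ← pow_succ', ← pow_mul, ← pow_mul, ← pow_mul, ← pow_mul, mul_comm k,
        mul_comm k]
    · intro x hx
      obtain ⟨w, hw, rfl⟩ := mem_diagU.1 hx
      obtain ⟨k, -, rfl⟩ := (mem_iff_pow hz hz1 w).1 hw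
      have : (((z ^ k) ^ (u + 1), (z ^ k) ^ u) : (ZMod p)ˣ × (ZMod p)ˣ) = (d1, d2) ^ k := by
        change _ = (d1 ^ k, d2 ^ k)
        change d1 = z * d2 at hd'
        rw [hd', ← hu', ← pow_succ', ← pow_mul, ← pow_mul, ← pow_mul, ← pow_mul, mul_comm k,
          mul_comm k]
      rw [this]
      exact pow_mem hd k

theorem pow_q_of_neg_mem {d : (ZMod p)ˣ × (ZMod p)ˣ} (h : -d ∈ diagAll p q) (x) :
    d ^ q * x = -x := by
  have h1 : (-d.1) ^ q = 1 := h.1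
  have h2 : (-d.2) ^ q = 1 := h.2
  rw [neg_pow_q, neg_eq_iff_eq_neg] at h1 h2
  refine Prod.ext ?_ ?_
  · change d.1 ^ q * x.1 = -x.1
    rw [h1, neg_one_mul]
  · change d.2 ^ q * x.2 = -x.2
    rw [h2, neg_one_mul]

/-- The two entries have quotient in `μ_q`, so they carry the same sign and every element of `D` is,
up to `-I`, in `μ_q²`. If a sign occurs at all, the `q`-th power of such an element is `-I`, and
every quotient is already attained without sign. -/
theorem exists_diagBase {D : Subgroup ((ZMod p)ˣ × (ZMod p)ˣ)}
    (hD : ∀ d ∈ D, d.1 / d.2 ∈ rootsOfUnity q (ZMod p))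
    (h : ∀ s ∈ rootsOfUnity q (ZMod p), ∃ d ∈ D, d.1 = s * d.2) :
    ∃ B, IsDiagBase p q B ∧ (D = B ∨ D = withNeg B) := by
  have hpow : ∀ d ∈ D, d ∈ diagAll p q ∨ -d ∈ diagAll p q := by
    rintro ⟨a, b⟩ hd
    have h1 := hD _ hd
    change a / b ∈ _ at h1
    rcases mem_or_neg_mem p q b with hb | hb
    · left
      exact ⟨by simpa using mul_mem h1 hb, hb⟩
    · right
      refine ⟨?_, hb⟩
      have := mul_mem h1 hb
      rwa [mul_neg, div_mul_cancel] at this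
  have hB : IsDiagBase p q (D ⊓ diagAll p q) := by
    refine isDiagBase_of_quotients inf_le_right fun s hs => ?_
    obtain ⟨d, hd, hd'⟩ := h s hs
    by_cases hda : d ∈ diagAll p q
    · exact ⟨d, ⟨hd, hda⟩, hd'⟩
    · have h1 := (hpow d hd).resolve_left hda
      refine ⟨-d, ⟨?_, h1⟩, ?_⟩
      · rw [← pow_q_of_neg_mem h1]
        exact mul_mem (pow_mem hd q) hd
      · change -d.1 = s * -d.2
        rw [hd', mul_neg]
  refine ⟨_, hB, ?_⟩
  by_cases hall : D ≤ diagAll p q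
  · left
    exact (inf_eq_left.2 hall).symm
  · right
    obtain ⟨d, hd, hda⟩ := Set.not_subset.1 hall
    have h1 := (hpow d hd).resolve_left hda
    have hneg : ∀ x : (ZMod p)ˣ × (ZMod p)ˣ, x ∈ D ↔ -x ∈ D := by
      have : ∀ x ∈ D, -x ∈ D := fun x hx => by
        rw [← pow_q_of_neg_mem h1]
        exact mul_mem (pow_mem hd q) hx
      exact fun x => ⟨this x, fun hx => by simpa using this _ hx⟩
    ext x
    rw [mem_withNeg]
    constructor
    · intro hx
      exact (hpow x hx).imp (fun hx' => ⟨hx, hx'⟩) fun hx' => ⟨(hneg x).1 hx, hx'⟩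
    · rintro (hx | hx)
      · exact hx.1
      · exact (hneg x).2 hx.1

end Diagonal

/-! ### Subgroups of the group of pairs of affine maps -/

section Pairs

open AffLine SafePair

variable {p q : ℕ}

/-- The pair of linear parts. -/
def linHom : AffLine p × AffLine p →* (ZMod p)ˣ × (ZMod p)ˣ := aHom.prodMap aHom

@[simp] theorem linHom_fst (g : AffLine p × AffLine p) : (linHom g).1 = g.1.a := rfl
@[simp] theorem linHom_snd (g : AffLine p × AffLine p) : (linHom g).2 = g.2.a := rfl

/-- The pairs with linear parts in `D`. -/
def fullPairs (D : Subgroup ((ZMod p)ˣ × (ZMod p)ˣ)) : Subgroup (AffLine p × AffLine p) :=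
  D.comap linHom

/-- The pairs with linear parts in `D` whose second map fixes `v`. -/
def linePairs (D : Subgroup ((ZMod p)ˣ × (ZMod p)ˣ)) (v : ZMod p) :
    Subgroup (AffLine p × AffLine p) where
  carrier := {g | linHom g ∈ D ∧ g.2.b = (1 - g.2.a) * v}
  one_mem' := ⟨D.one_mem, by simp⟩
  mul_mem' := fun {g h} hg hh => ⟨by rw [map_mul]; exact mul_mem hg.1 hh.1, by
    rw [Prod.snd_mul, mul_b, mul_a, hg.2, hh.2]
    push_cast
    ring⟩
  inv_mem' := fun {g} hg => ⟨by rw [map_inv]; exact inv_mem hg.1, by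
    rw [Prod.snd_inv, inv_b, inv_a, hg.2, mul_comm (1 - _ : ZMod p), mul_left_comm, mul_sub,
      Units.inv_mul]
    ring⟩

/-- Exchanging the two maps. -/
def swapPairs (P : Subgroup (AffLine p × AffLine p)) : Subgroup (AffLine p × AffLine p) :=
  P.comap (MulEquiv.prodComm (M := AffLine p) (N := AffLine p)).toMonoidHom

theorem mem_fullPairs {D : Subgroup ((ZMod p)ˣ × (ZMod p)ˣ)} {g : AffLine p × AffLine p} :
    g ∈ fullPairs D ↔ (g.1.a, g.2.a) ∈ D := Iff.rfl

theorem mem_linePairs {D : Subgroup ((ZMod p)ˣ × (ZMod p)ˣ)} {v : ZMod p}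
    {g : AffLine p × AffLine p} :
    g ∈ linePairs D v ↔ (g.1.a, g.2.a) ∈ D ∧ g.2.b = (1 - g.2.a) * v := Iff.rfl

theorem mem_swapPairs {P : Subgroup (AffLine p × AffLine p)} {g : AffLine p × AffLine p} :
    g ∈ swapPairs P ↔ g.swap ∈ P := Iff.rfl

theorem swapPairs_swapPairs (P : Subgroup (AffLine p × AffLine p)) :
    swapPairs (swapPairs P) = P := rfl

/-- A group of pairs of affine maps is transitive on `C_p ⋊ C_q`. -/
def IsTransPairs (q : ℕ) (P : Subgroup (AffLine p × AffLine p)) : Prop :=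
  ∀ n : AffLine p, n.a ∈ rootsOfUnity q (ZMod p) → ∃ g ∈ P, g.1 = n * g.2

theorem IsTransPairs.swap {P : Subgroup (AffLine p × AffLine p)} (h : IsTransPairs q P) :
    IsTransPairs q (swapPairs P) := by
  intro n hn
  obtain ⟨g, hg, hg'⟩ := h n⁻¹ (inv_mem hn)
  exact ⟨g.swap, hg, by simp [hg']⟩

theorem IsTransPairs.exists_quotient {P : Subgroup (AffLine p × AffLine p)}
    (h : IsTransPairs q P) {s : (ZMod p)ˣ} (hs : s ∈ rootsOfUnity q (ZMod p)) :
    ∃ g ∈ P, g.1.a = s * g.2.a := by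
  obtain ⟨g, hg, hg'⟩ := h ⟨0, s⟩ hs
  exact ⟨g, hg, congrArg AffLine.a hg'⟩

/-- A pair of translations. -/
def trPair (x y : ZMod p) : AffLine p × AffLine p := (tr x, tr y)

theorem trPair_add (x y x' y' : ZMod p) :
    trPair (x + x') (y + y') = trPair x y * trPair x' y' :=
  Prod.ext (tr_add x x') (tr_add y y')

theorem eq_trPair_mul (g : AffLine p × AffLine p) :
    g = trPair g.1.b g.2.b * (⟨0, g.1.a⟩, ⟨0, g.2.a⟩) :=
  Prod.ext (AffLine.ext (by simp [trPair]) (by simp [trPair]))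
    (AffLine.ext (by simp [trPair]) (by simp [trPair]))

theorem conj_trPair (g : AffLine p × AffLine p) (x y : ZMod p) :
    g * trPair x y * g⁻¹ = trPair ((g.1.a : ZMod p) * x) ((g.2.a : ZMod p) * y) :=
  Prod.ext ((conj_eq _ _).trans (AffLine.ext (by simp [trPair]) rfl))
    ((conj_eq _ _).trans (AffLine.ext (by simp [trPair]) rfl))

variable [Fact p.Prime]

theorem holPairs_swap {P : Subgroup (AffLine p × AffLine p)} (h : P ≤ holPairs p q) :
    swapPairs P ≤ holPairs p q := by
  intro g hg
  have h1 : (g.2.a / g.1.a)⁻¹ ∈ rootsOfUnity q (ZMod p) := inv_mem (h (mem_swapPairs.1 hg))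
  rwa [inv_div] at h1

theorem trPair_smul {P : Subgroup (AffLine p × AffLine p)} {x y : ZMod p}
    (h : trPair x y ∈ P) (c : ZMod p) : trPair (c * x) (c * y) ∈ P := by
  have h1 : trPair (c * x) (c * y) = trPair x y ^ c.val := by
    refine Prod.ext ?_ ?_
    · change tr _ = tr _ ^ _
      rw [tr_pow, ZMod.natCast_zmod_val]
    · change tr _ = tr _ ^ _
      rw [tr_pow, ZMod.natCast_zmod_val]
  rw [h1]
  exact pow_mem h _

theorem trPair_of_pow {g : AffLine p × AffLine p} (h : g ^ p = 1) :
    g = trPair g.1.b g.2.b :=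
  Prod.ext (eq_tr (pow_p_eq_one_iff.1 (congrArg Prod.fst h)))
    (eq_tr (pow_p_eq_one_iff.1 (congrArg Prod.snd h)))

theorem trPair_pow_p (x y : ZMod p) : (trPair x y) ^ p = 1 :=
  Prod.ext (pow_p_eq_one_iff.2 rfl) (pow_p_eq_one_iff.2 rfl)

theorem units_eq_of_mul_eq {a b : (ZMod p)ˣ} {x : ZMod p} (hx : x ≠ 0)
    (h : (a : ZMod p) * x = b * x) : a = b := Units.ext (mul_right_cancel₀ hx h)

/-- The translations in a transitive group are stable under the projections. -/
theorem trPair_proj {P : Subgroup (AffLine p × AffLine p)} {g : AffLine p × AffLine p}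
    (hg : g ∈ P) (hg' : g.1.a ≠ g.2.a) {x y : ZMod p} (h : trPair x y ∈ P) :
    trPair x 0 ∈ P ∧ trPair 0 y ∈ P := by
  -- Conjugation by `g` acts on the plane of translations with two distinct eigenvalues along the
  -- axes. Subtracting one eigenvalue times the vector leaves a nonzero multiple of a projection.
  have h1 : trPair ((g.1.a : ZMod p) * x) ((g.2.a : ZMod p) * y) ∈ P := by
    rw [← conj_trPair]
    exact mul_mem (mul_mem hg h) (inv_mem hg)
  have hne : (g.1.a - g.2.a : ZMod p) ≠ 0 := fun h0 => hg' (Units.ext (sub_eq_zero.1 h0))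
  constructor
  · have h2 := mul_mem h1 (trPair_smul h (-(g.2.a : ZMod p)))
    rw [← trPair_add] at h2
    have h3 := trPair_smul h2 (g.1.a - g.2.a : ZMod p)⁻¹
    convert h3 using 2
    · field_simp
      ring
    · ring
  · have h2 := mul_mem h1 (trPair_smul h (-(g.1.a : ZMod p)))
    rw [← trPair_add] at h2
    have h3 := trPair_smul h2 (-(g.1.a - g.2.a : ZMod p)⁻¹)
    convert h3 using 2
    · ring
    · field_simp
      ring

theorem trPair_fst_all {P : Subgroup (AffLine p × AffLine p)} {x : ZMod p} (hx : x ≠ 0)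
    (h : trPair x 0 ∈ P) (y : ZMod p) : trPair y 0 ∈ P := by
  have := trPair_smul h (y / x)
  rwa [div_mul_cancel₀ _ hx, mul_zero] at this

theorem trPair_snd_all {P : Subgroup (AffLine p × AffLine p)} {x : ZMod p} (hx : x ≠ 0)
    (h : trPair 0 x ∈ P) (y : ZMod p) : trPair 0 y ∈ P := by
  have := trPair_smul h (y / x)
  rwa [div_mul_cancel₀ _ hx, mul_zero] at this

/-- By Cauchy there is an element of order `p`; slopes have order prime to `p`, so it is a pair of
translations. -/
theorem exists_trPair_mem {P : Subgroup (AffLine p × AffLine p)} (hp : p ∣ Nat.card P) :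
    ∃ x y, trPair x y ∈ P ∧ (x ≠ 0 ∨ y ≠ 0) := by
  obtain ⟨g, hg⟩ := exists_prime_orderOf_dvd_card' p hp
  have h1 : (g : AffLine p × AffLine p) ^ p = 1 := by
    rw [← Subgroup.coe_pow, orderOf_dvd_iff_pow_eq_one.1 hg.dvd, Subgroup.coe_one]
  have h2 := trPair_of_pow h1
  refine ⟨_, _, h2 ▸ g.2, ?_⟩
  by_contra! h3
  rw [h3.1, h3.2] at h2
  have h4 : g = 1 := Subtype.ext h2
  rw [h4, orderOf_one] at hg
  exact (Fact.out : p.Prime).one_lt.ne hg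

theorem eq_fullPairs {P : Subgroup (AffLine p × AffLine p)} (h : ∀ x y, trPair x y ∈ P) :
    P = fullPairs (P.map linHom) := by
  refine le_antisymm (fun g hg => ⟨g, hg, rfl⟩) ?_
  rintro g ⟨k, hk, hkg⟩
  have h1 : g = trPair (g.1.b - k.1.b) (g.2.b - k.2.b) * k :=
    Prod.ext (AffLine.ext (by simp [trPair]) (by simpa [trPair] using (congrArg Prod.fst hkg).symm))
      (AffLine.ext (by simp [trPair]) (by simpa [trPair] using (congrArg Prod.snd hkg).symm))
  rw [h1]
  exact mul_mem (h _ _) hk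

/-- All translations in `P` are along the first axis, so the constant term of the second map depends
only on the slopes. It is a cocycle on an abelian group of order prime to `p`, hence a coboundary:
the second maps have a common fixed point `v`. -/
theorem eq_linePairs [SafePair p q] {P : Subgroup (AffLine p × AffLine p)}
    (h : ∀ x, trPair x 0 ∈ P) (h' : ∀ x y, trPair x y ∈ P → y = 0) :
    ∃ v, P = linePairs (P.map linHom) v := by
  have hb : ∀ g ∈ P, ∀ k ∈ P, g.2.a = k.2.a → g.1.a = k.1.a → g.2.b = k.2.b := by
    intro g hg k hk h2 h1
    have h3 : trPair (g.1.b - k.1.b) (g.2.b - k.2.b) * k = g :=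
      Prod.ext (AffLine.ext (by simp [trPair]) (by simpa [trPair] using h1.symm))
        (AffLine.ext (by simp [trPair]) (by simpa [trPair] using h2.symm))
    have h4 : trPair (g.1.b - k.1.b) (g.2.b - k.2.b) ∈ P := by
      rw [← eq_mul_inv_iff_mul_eq] at h3
      rw [h3]
      exact mul_mem hg (inv_mem hk)
    exact sub_eq_zero.1 (h' _ _ h4)
  suffices hv : ∃ v, ∀ g ∈ P, g.2.b = (1 - g.2.a) * v by
    obtain ⟨v, hv⟩ := hv
    refine ⟨v, le_antisymm (fun g hg => ⟨⟨g, hg, rfl⟩, hv g hg⟩) ?_⟩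
    rintro g ⟨⟨k, hk, hkg⟩, hg⟩
    have ha1 : k.1.a = g.1.a := congrArg Prod.fst hkg
    have ha2 : k.2.a = g.2.a := congrArg Prod.snd hkg
    have h1 : g = trPair (g.1.b - k.1.b) 0 * k :=
      Prod.ext (AffLine.ext (by simp [trPair]) (by simpa [trPair] using ha1.symm))
        (AffLine.ext (by simp [trPair, hg, hv k hk, ha2]) (by simpa [trPair] using ha2.symm))
    rw [h1]
    exact mul_mem (h _) hk
  by_cases hg0 : ∃ g ∈ P, g.2.a ≠ 1
  · obtain ⟨g, hg, hg1⟩ := hg0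
    have hne : (1 - g.2.a : ZMod p) ≠ 0 := fun h0 => hg1 (Units.ext (sub_eq_zero.1 h0).symm)
    refine ⟨g.2.b / (1 - g.2.a), fun k hk => ?_⟩
    -- The two products have equal slopes, so the second maps commute; `v` is the fixed point of a
    -- second map of slope different from `1`.
    have h1 := hb (g * k) (mul_mem hg hk) (k * g) (mul_mem hk hg) (mul_comm _ _) (mul_comm _ _)
    simp only [Prod.snd_mul, mul_b] at h1
    field_simp
    linear_combination -h1
  · push Not at hg0
    refine ⟨0, fun g hg => ?_⟩
    -- The power `2 q` kills all slopes and multiplies the constant term of a translation by `2 q =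
    -- -1`, so this term is zero.
    have h1 : g ^ (2 * q) ∈ P := pow_mem hg _
    have h2 : g ^ (2 * q) = trPair (g ^ (2 * q)).1.b (((2 * q : ℕ) : ZMod p) * g.2.b) := by
      refine Prod.ext (eq_tr ?_) ?_
      · rw [Prod.pow_fst, pow_a, pow_two_mul]
      · change g.2 ^ (2 * q) = tr _
        rw [← tr_pow, ← eq_tr (hg0 g hg)]
    rw [h2] at h1
    have h3 := h' _ _ h1
    push_cast at h3
    rw [two_mul_cast] at h3
    rw [mul_zero]
    linear_combination -h3

/-- The classification of the transitive groups. -/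
theorem exists_of_isTransPairs [SafePair p q] {P : Subgroup (AffLine p × AffLine p)}
    (hP : P ≤ holPairs p q) (ht : IsTransPairs q P) (hp : p ∣ Nat.card P) :
    ∃ B, IsDiagBase p q B ∧ ∃ D, (D = B ∨ D = withNeg B) ∧
      (P = fullPairs D ∨ ∃ v, P = linePairs D v ∨ P = swapPairs (linePairs D v)) := by
  obtain ⟨z, hz, hz1⟩ := exists_root p q
  have hdiag : ∀ {P : Subgroup (AffLine p × AffLine p)}, P ≤ holPairs p q → IsTransPairs q P →
      ∃ B, IsDiagBase p q B ∧ (P.map linHom = B ∨ P.map linHom = withNeg B) := by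
    intro P hP ht
    refine exists_diagBase ?_ fun s hs => ?_
    · rintro _ ⟨g, hg, rfl⟩
      exact hP hg
    · obtain ⟨g, hg, hg'⟩ := ht.exists_quotient hs
      exact ⟨_, ⟨g, hg, rfl⟩, hg'⟩
  have hline : ∀ {P : Subgroup (AffLine p × AffLine p)}, P ≤ holPairs p q → IsTransPairs q P →
      (∃ x, x ≠ 0 ∧ trPair x 0 ∈ P) →
      ∃ B, IsDiagBase p q B ∧ ∃ D, (D = B ∨ D = withNeg B) ∧
        (P = fullPairs D ∨ ∃ v, P = linePairs D v) := by
    intro P hP ht ⟨x, hx, hxP⟩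
    obtain ⟨g, hg, hg'⟩ := ht.exists_quotient hz
    have hne : g.1.a ≠ g.2.a := fun h => hz1 (by simpa [h] using hg')
    obtain ⟨B, hB, hD⟩ := hdiag hP ht
    refine ⟨B, hB, _, hD, ?_⟩
    by_cases hall : ∃ x y, trPair x y ∈ P ∧ y ≠ 0
    · left
      obtain ⟨x', y, hxy, hy⟩ := hall
      refine eq_fullPairs fun a b => ?_
      have := mul_mem (trPair_fst_all hx hxP a)
        (trPair_snd_all hy (trPair_proj hg hne hxy).2 b)
      rwa [← trPair_add, add_zero, zero_add] at this
    · right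
      push Not at hall
      exact eq_linePairs (q := q) (trPair_fst_all hx hxP) hall
  obtain ⟨x, y, hxy, h0⟩ := exists_trPair_mem hp
  obtain ⟨g, hg, hg'⟩ := ht.exists_quotient hz
  have hne : g.1.a ≠ g.2.a := fun h => hz1 (by simpa [h] using hg')
  have h1 := trPair_proj hg hne hxy
  by_cases hx : x = 0
  · have hy : y ≠ 0 := h0.resolve_left (fun h => h hx)
    obtain ⟨B, hB, D, hD, h2⟩ := hline (holPairs_swap hP) ht.swap ⟨y, hy, h1.2⟩
    rcases h2 with h2 | ⟨v, h2⟩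
    · obtain ⟨B', hB', D', hD', h3⟩ : ∃ B, IsDiagBase p q B ∧ ∃ D, (D = B ∨ D = withNeg B) ∧
          P = fullPairs D := by
        obtain ⟨B', hB', hD'⟩ := hdiag hP ht
        refine ⟨B', hB', _, hD', eq_fullPairs fun a b => ?_⟩
        -- The exchanged group contains all translations, hence so does `P`, and the case of the
        -- plane applies to `P` itself.
        change (trPair b a) ∈ swapPairs P
        rw [h2]
        exact D.one_mem
      exact ⟨B', hB', D', hD', Or.inl h3⟩
    · exact ⟨B, hB, D, hD, Or.inr ⟨v, Or.inr (by rw [← h2, swapPairs_swapPairs])⟩⟩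
  · obtain ⟨B, hB, D, hD, h2⟩ := hline hP ht ⟨x, hx, h1.1⟩
    exact ⟨B, hB, D, hD, h2.imp_right fun ⟨v, hv⟩ => ⟨v, Or.inl hv⟩⟩

/-! #### The groups in the classification are transitive -/

theorem fullPairs_le [SafePair p q] {B D : Subgroup ((ZMod p)ˣ × (ZMod p)ˣ)}
    (hB : IsDiagBase p q B) (hD : D = B ∨ D = withNeg B) : fullPairs D ≤ holPairs p q := by
  intro g hg
  have h1 : ∀ x ∈ B, x.1 / x.2 ∈ rootsOfUnity q (ZMod p) := fun x hx =>
    div_mem (hB.le hx).1 (hB.le hx).2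
  rcases hD with rfl | rfl
  · exact h1 _ hg
  · rcases mem_withNeg.1 (mem_fullPairs.1 hg) with h | h
    · exact h1 _ h
    · have := h1 _ h
      rw [mem_holPairs]
      simpa [neg_div_neg_eq] using this

theorem linePairs_le_fullPairs (D : Subgroup ((ZMod p)ˣ × (ZMod p)ˣ)) (v : ZMod p) :
    linePairs D v ≤ fullPairs D := fun _ hg => hg.1

theorem isTransPairs_linePairs {B D : Subgroup ((ZMod p)ˣ × (ZMod p)ˣ)}
    (hB : IsDiagBase p q B) (hD : D = B ∨ D = withNeg B) (v : ZMod p) :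
    IsTransPairs q (linePairs D v) := by
  intro n hn
  obtain ⟨d, hd, hd'⟩ := hB.exists_quotient hn
  have hdD : d ∈ D := by
    rcases hD with rfl | rfl
    · exact hd
    · exact le_withNeg _ hd
  -- The second map is the one of slope `d.2` that fixes `v`; the first is `n` times it, with slope
  -- `n.a * d.2 = d.1`.
  refine ⟨(n * ⟨(1 - d.2) * v, d.2⟩, ⟨(1 - d.2) * v, d.2⟩), ⟨?_, rfl⟩, rfl⟩
  convert hdD using 1
  exact Prod.ext hd'.symm rfl

theorem IsTransPairs.mono {P P' : Subgroup (AffLine p × AffLine p)} (h : IsTransPairs q P)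
    (hle : P ≤ P') : IsTransPairs q P' := fun n hn =>
  (h n hn).imp fun _ hg => ⟨hle hg.1, hg.2⟩

end Pairs

/-! ### Isomorphisms that respect the point stabilisers -/

section StabIso

open AffLine SafePair

variable {p q : ℕ}

/-- Isomorphism of groups of pairs of affine maps that preserves the stabiliser of the identity. -/
def StabIso (P P' : Subgroup (AffLine p × AffLine p)) : Prop :=
  ∃ φ : P ≃* P', ∀ g : P, g.1.1 = g.1.2 ↔ (φ g).1.1 = (φ g).1.2

theorem StabIso.refl (P : Subgroup (AffLine p × AffLine p)) : StabIso P P :=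
  ⟨MulEquiv.refl _, fun _ => Iff.rfl⟩

theorem StabIso.symm {P P' : Subgroup (AffLine p × AffLine p)} (h : StabIso P P') :
    StabIso P' P := by
  obtain ⟨φ, hφ⟩ := h
  exact ⟨φ.symm, fun g => by rw [hφ, MulEquiv.apply_symm_apply]⟩

theorem StabIso.trans {P P' P'' : Subgroup (AffLine p × AffLine p)} (h : StabIso P P')
    (h' : StabIso P' P'') : StabIso P P'' := by
  obtain ⟨φ, hφ⟩ := h
  obtain ⟨ψ, hψ⟩ := h'
  exact ⟨φ.trans ψ, fun g => (hφ g).trans (hψ _)⟩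

theorem stabIso_of_mulEquiv (Ψ : AffLine p × AffLine p ≃* AffLine p × AffLine p)
    {P P' : Subgroup (AffLine p × AffLine p)} (h : ∀ g, g ∈ P ↔ Ψ g ∈ P')
    (h' : ∀ g, g.1 = g.2 ↔ (Ψ g).1 = (Ψ g).2) : StabIso P P' :=
  ⟨{ toFun := fun g => ⟨Ψ g, (h _).1 g.2⟩
     invFun := fun g => ⟨Ψ.symm g, by rw [h, Ψ.apply_symm_apply]; exact g.2⟩
     left_inv := fun g => Subtype.ext (Ψ.symm_apply_apply _)
     right_inv := fun g => Subtype.ext (Ψ.apply_symm_apply _)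
     map_mul' := fun g k => Subtype.ext (map_mul Ψ _ _) }, fun g => h' g⟩

theorem stabIso_swap (P : Subgroup (AffLine p × AffLine p)) : StabIso (swapPairs P) P :=
  stabIso_of_mulEquiv MulEquiv.prodComm (fun _ => Iff.rfl) fun _ => eq_comm

/-- Conjugation by the translation `(v, v)` moves the fixed point from `0` to `v`, and using the
same translation in both coordinates preserves `g₁ = g₂`. -/
theorem stabIso_linePairs (D : Subgroup ((ZMod p)ˣ × (ZMod p)ˣ)) (v : ZMod p) :
    StabIso (linePairs D v) (linePairs D 0) := by
  refine (stabIso_of_mulEquiv (MulAut.conj (trPair v v)) (fun g => ?_) fun g => ?_).symm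
  · have h1 : (MulAut.conj (trPair v v) g).1 = ⟨g.1.b + (1 - g.1.a) * v, g.1.a⟩ :=
      (conj_eq _ _).trans (AffLine.ext (by simp [trPair]) rfl)
    have h2 : (MulAut.conj (trPair v v) g).2 = ⟨g.2.b + (1 - g.2.a) * v, g.2.a⟩ :=
      (conj_eq _ _).trans (AffLine.ext (by simp [trPair]) rfl)
    rw [mem_linePairs, mem_linePairs, h1, h2]
    simp
  · simp [trPair]

/-- Projection of the groups with one-dimensional translation part. -/
theorem exists_lineEquiv {D : Subgroup ((ZMod p)ˣ × (ZMod p)ˣ)} {S : Subgroup (ZMod p)ˣ}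
    (h1 : ∀ d ∈ D, d.1 ∈ S) (h2 : ∀ a ∈ S, ∃! b, (a, b) ∈ D) :
    ∃ φ : linePairs D 0 ≃* withLinear S, ∀ g, (φ g : AffLine p) = g.1.1 := by
  let f : linePairs D 0 →* withLinear S :=
    { toFun := fun g => ⟨g.1.1, h1 _ g.2.1⟩
      map_one' := rfl
      map_mul' := fun _ _ => rfl }
  have hf : Function.Bijective f := by
    constructor
    · intro g k hgk
      have h : g.1.1 = k.1.1 := congrArg Subtype.val hgk
      refine Subtype.ext (Prod.ext h (AffLine.ext ?_ ?_))
      · rw [(mem_linePairs.1 g.2).2, (mem_linePairs.1 k.2).2, mul_zero, mul_zero]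
      · refine (h2 _ (h1 _ g.2.1)).unique g.2.1 ?_
        have := (mem_linePairs.1 k.2).1
        rwa [← h] at this
    · rintro ⟨g, hg⟩
      obtain ⟨b, hb, -⟩ := h2 g.a hg
      exact ⟨⟨(g, ⟨0, b⟩), hb, by simp⟩, rfl⟩
  exact ⟨MulEquiv.ofBijective f hf, fun _ => rfl⟩

/-- The second map is a homothety fixing `0`, so it is known from the first map and the quotient of
the slopes. These two are independent of each other when `D` is defined by separate conditions on
the first entry and on the quotient. -/
theorem exists_lineProdEquiv {D : Subgroup ((ZMod p)ˣ × (ZMod p)ˣ)} {S Q : Subgroup (ZMod p)ˣ}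
    (h : ∀ d, d ∈ D ↔ d.1 ∈ S ∧ d.1 / d.2 ∈ Q) :
    ∃ φ : linePairs D 0 ≃* withLinear S × Q, ∀ g, ((φ g).1 : AffLine p) = g.1.1 ∧
      ((φ g).2 : (ZMod p)ˣ) = g.1.1.a / g.1.2.a := by
  let f : linePairs D 0 →* withLinear S × Q :=
    { toFun := fun g => (⟨g.1.1, ((h _).1 g.2.1).1⟩, ⟨_, ((h _).1 g.2.1).2⟩)
      map_one' := Prod.ext rfl (Subtype.ext (div_self' _))
      map_mul' := fun g k => Prod.ext rfl (Subtype.ext (mul_div_mul_comm g.1.1.a _ _ _)) }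
  have hf : Function.Bijective f := by
    constructor
    · intro g k hgk
      have h1 : g.1.1 = k.1.1 := congrArg (fun x => x.1.1) hgk
      have h2 : g.1.1.a / g.1.2.a = k.1.1.a / k.1.2.a := congrArg (fun x => x.2.1) hgk
      rw [h1] at h2
      refine Subtype.ext (Prod.ext h1 (AffLine.ext ?_ (div_right_injective h2)))
      rw [(mem_linePairs.1 g.2).2, (mem_linePairs.1 k.2).2, mul_zero, mul_zero]
    · rintro ⟨⟨g, hg⟩, ⟨s, hs⟩⟩
      have hd : (g.a, g.a / s) ∈ D := (h _).2 ⟨hg, by simpa using hs⟩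
      refine ⟨⟨(g, ⟨0, g.a / s⟩), hd, by simp⟩, Prod.ext rfl (Subtype.ext ?_)⟩
      exact div_div_cancel g.a s
  exact ⟨MulEquiv.ofBijective f hf, fun _ => ⟨rfl, rfl⟩⟩

theorem nonempty_fullEquiv (D : Subgroup ((ZMod p)ˣ × (ZMod p)ˣ)) :
    Nonempty (fullPairs D ≃* DiagSemi p D) :=
  ⟨{ toFun := fun g => ⟨(Multiplicative.ofAdd g.1.1.b, Multiplicative.ofAdd g.1.2.b), ⟨_, g.2⟩⟩
     invFun := fun x => ⟨(⟨x.left.1.toAdd, x.right.1.1⟩, ⟨x.left.2.toAdd, x.right.1.2⟩), x.right.2⟩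
     left_inv := fun _ => rfl
     right_inv := fun _ => rfl
     map_mul' := fun _ _ => rfl }⟩

/-! ### The groups in the rows of the table -/

/-- The groups with one-dimensional translation part and linear parts in `D`. -/
def lineModels (D : Subgroup ((ZMod p)ˣ × (ZMod p)ˣ)) : Set (Subgroup (AffLine p × AffLine p)) :=
  {P | ∃ v, P = linePairs D v ∨ P = swapPairs (linePairs D v)}

namespace TableRow

/-- A group in each row of the table. -/
def rep (p : ℕ) {q : ℕ} : TableRow q → Subgroup (AffLine p × AffLine p)
  | p2q2 => fullPairs (diagAll p q)
  | two_p2q2 => fullPairs (withNeg (diagAll p q))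
  | p2q u => fullPairs (diagU p q u)
  | two_p2q u => fullPairs (withNeg (diagU p q u))
  | pq2 => linePairs (diagAll p q) 0
  | two_pq2 => linePairs (withNeg (diagAll p q)) 0
  | pq_nonabelian => linePairs (diagU p q 0) 0
  | pq_cyclic => linePairs (diagU p q (q - 1)) 0
  | two_pq_frobenius => linePairs (withNeg (diagU p q 0)) 0
  | two_pq_dihedral => linePairs (withNeg (diagU p q (q - 1))) 0

/-- The transitive groups in each row of the table. -/
def models (p : ℕ) {q : ℕ} : TableRow q → Set (Subgroup (AffLine p × AffLine p))
  | p2q2 => {fullPairs (diagAll p q)}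
  | two_p2q2 => {fullPairs (withNeg (diagAll p q))}
  | p2q u => {fullPairs (diagU p q u), fullPairs (diagU p q (q - 1 - u))}
  | two_p2q u => {fullPairs (withNeg (diagU p q u)), fullPairs (withNeg (diagU p q (q - 1 - u)))}
  | pq2 => lineModels (diagAll p q)
  | two_pq2 => lineModels (withNeg (diagAll p q))
  | pq_nonabelian => {P | ∃ u < q - 1, P ∈ lineModels (diagU p q u)}
  | pq_cyclic => lineModels (diagU p q (q - 1))
  | two_pq_frobenius => {P | ∃ u < q - 1, P ∈ lineModels (withNeg (diagU p q u))}
  | two_pq_dihedral => lineModels (withNeg (diagU p q (q - 1)))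

end TableRow

variable [Fact p.Prime] [SafePair p q]

open TableRow

theorem exists_models {P : Subgroup (AffLine p × AffLine p)}
    (hP : P ≤ holPairs p q) (ht : IsTransPairs q P) (hp : p ∣ Nat.card P) :
    ∃ r : TableRow q, P ∈ r.models p := by
  have h3 := SafePair.three_le p (q := q)
  obtain ⟨B, hB, D, hD, h⟩ := exists_of_isTransPairs hP ht hp
  rcases h with rfl | h
  · rcases hB with rfl | ⟨u, hu, rfl⟩
    · rcases hD with rfl | rfl
      · exact ⟨p2q2, rfl⟩
      · exact ⟨two_p2q2, rfl⟩
    · by_cases hlt : u < (q + 1) / 2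
      · rcases hD with rfl | rfl
        · exact ⟨p2q ⟨u, hlt⟩, Or.inl rfl⟩
        · exact ⟨two_p2q ⟨u, hlt⟩, Or.inl rfl⟩
      · have h1 : q - 1 - u < (q + 1) / 2 := by omega
        have h2 : q - 1 - (q - 1 - u) = u := by omega
        rcases hD with rfl | rfl
        · refine ⟨p2q ⟨q - 1 - u, h1⟩, Or.inr ?_⟩
          change _ = fullPairs (diagU p q (q - 1 - (q - 1 - u)))
          rw [h2]
        · refine ⟨two_p2q ⟨q - 1 - u, h1⟩, Or.inr ?_⟩
          change _ = fullPairs (withNeg (diagU p q (q - 1 - (q - 1 - u))))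
          rw [h2]
  · rcases hB with rfl | ⟨u, hu, rfl⟩
    · rcases hD with rfl | rfl
      · exact ⟨pq2, h⟩
      · exact ⟨two_pq2, h⟩
    · by_cases hlt : u < q - 1
      · rcases hD with rfl | rfl
        · exact ⟨pq_nonabelian, u, hlt, h⟩
        · exact ⟨two_pq_frobenius, u, hlt, h⟩
      · obtain rfl : u = q - 1 := by omega
        rcases hD with rfl | rfl
        · exact ⟨pq_cyclic, h⟩
        · exact ⟨two_pq_dihedral, h⟩

theorem lineModels_trans {B D : Subgroup ((ZMod p)ˣ × (ZMod p)ˣ)} (hB : IsDiagBase p q B)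
    (hD : D = B ∨ D = withNeg B) {P : Subgroup (AffLine p × AffLine p)} (hP : P ∈ lineModels D) :
    P ≤ holPairs p q ∧ IsTransPairs q P := by
  have h : ∀ v, linePairs D v ≤ holPairs p q := fun v =>
    (linePairs_le_fullPairs D v).trans (fullPairs_le hB hD)
  obtain ⟨v, rfl | rfl⟩ := hP
  · exact ⟨h v, isTransPairs_linePairs hB hD v⟩
  · exact ⟨holPairs_swap (h v), (isTransPairs_linePairs hB hD v).swap⟩

theorem fullPairs_trans {B D : Subgroup ((ZMod p)ˣ × (ZMod p)ˣ)} (hB : IsDiagBase p q B)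
    (hD : D = B ∨ D = withNeg B) : fullPairs D ≤ holPairs p q ∧ IsTransPairs q (fullPairs D) :=
  ⟨fullPairs_le hB hD, (isTransPairs_linePairs hB hD 0).mono (linePairs_le_fullPairs D 0)⟩

theorem isTransPairs_of_models {r : TableRow q} {P : Subgroup (AffLine p × AffLine p)}
    (hP : P ∈ r.models p) : P ≤ holPairs p q ∧ IsTransPairs q P := by
  have h3 := SafePair.three_le p (q := q)
  have hall : IsDiagBase p q (diagAll p q) := Or.inl rfl
  have hU : ∀ u < q, IsDiagBase p q (diagU p q u) := fun u hu => Or.inr ⟨u, hu, rfl⟩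
  cases r with
  | p2q2 => rw [show P = _ from hP]; exact fullPairs_trans hall (Or.inl rfl)
  | two_p2q2 => rw [show P = _ from hP]; exact fullPairs_trans hall (Or.inr rfl)
  | p2q u =>
    have hu := u.2
    rcases hP with rfl | hP
    · exact fullPairs_trans (hU u (by omega)) (Or.inl rfl)
    · rw [show P = _ from hP]
      exact fullPairs_trans (hU _ (by omega)) (Or.inl rfl)
  | two_p2q u =>
    have hu := u.2
    rcases hP with rfl | hP
    · exact fullPairs_trans (hU u (by omega)) (Or.inr rfl)
    · rw [show P = _ from hP]
      exact fullPairs_trans (hU _ (by omega)) (Or.inr rfl)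
  | pq2 => exact lineModels_trans hall (Or.inl rfl) hP
  | two_pq2 => exact lineModels_trans hall (Or.inr rfl) hP
  | pq_nonabelian =>
    obtain ⟨u, hu, hP⟩ := hP
    exact lineModels_trans (hU u (by omega)) (Or.inl rfl) hP
  | pq_cyclic => exact lineModels_trans (hU (q - 1) (by omega)) (Or.inl rfl) hP
  | two_pq_frobenius =>
    obtain ⟨u, hu, hP⟩ := hP
    exact lineModels_trans (hU u (by omega)) (Or.inr rfl) hP
  | two_pq_dihedral => exact lineModels_trans (hU (q - 1) (by omega)) (Or.inr rfl) hP

/-- Substitute `z⁻¹` for `z`: as `z ^ q = 1`, exchanging the entries turns the exponents `(u + 1,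
u)` into `(q - u, q - 1 - u)`. -/
theorem mem_diagU_swap {u : ℕ} (hu : u < q) (d : (ZMod p)ˣ × (ZMod p)ˣ) :
    d ∈ diagU p q (q - 1 - u) ↔ d.swap ∈ diagU p q u := by
  have key : ∀ {u : ℕ}, u < q → ∀ {d : (ZMod p)ˣ × (ZMod p)ˣ}, d ∈ diagU p q u →
      d.swap ∈ diagU p q (q - 1 - u) := by
    intro u hu d hd
    obtain ⟨z, hz, rfl⟩ := mem_diagU.1 hd
    rw [mem_diagU]
    have hz' : z ^ q = 1 := hz
    refine ⟨z⁻¹, inv_mem hz, Prod.ext ?_ ?_⟩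
    · change z ^ u = z⁻¹ ^ (q - 1 - u + 1)
      rw [inv_pow, eq_inv_iff_mul_eq_one, ← pow_add, show u + (q - 1 - u + 1) = q by omega, hz']
    · change z ^ (u + 1) = z⁻¹ ^ (q - 1 - u)
      rw [inv_pow, eq_inv_iff_mul_eq_one, ← pow_add, show u + 1 + (q - 1 - u) = q by omega, hz']
  constructor
  · intro hd
    have := key (show q - 1 - u < q by omega) hd
    rwa [show q - 1 - (q - 1 - u) = u by omega] at this
  · intro hd
    exact key hu hd

theorem stabIso_fullPairs_swap {D D' : Subgroup ((ZMod p)ˣ × (ZMod p)ˣ)}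
    (h : ∀ d : (ZMod p)ˣ × (ZMod p)ˣ, d ∈ D ↔ d.swap ∈ D') :
    StabIso (fullPairs D) (fullPairs D') := by
  have h1 : fullPairs D = swapPairs (fullPairs D') := by
    ext g
    rw [mem_fullPairs, h]
    rfl
  rw [h1]
  exact stabIso_swap _

theorem withNeg_swap {D D' : Subgroup ((ZMod p)ˣ × (ZMod p)ˣ)}
    (h : ∀ d : (ZMod p)ˣ × (ZMod p)ˣ, d ∈ D ↔ d.swap ∈ D') (d : (ZMod p)ˣ × (ZMod p)ˣ) :
    d ∈ withNeg D ↔ d.swap ∈ withNeg D' := by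
  rw [mem_withNeg, mem_withNeg, h, h]
  rfl

theorem stabIso_lineModels {D : Subgroup ((ZMod p)ˣ × (ZMod p)ˣ)}
    {P : Subgroup (AffLine p × AffLine p)} (hP : P ∈ lineModels D) :
    StabIso P (linePairs D 0) := by
  obtain ⟨v, rfl | rfl⟩ := hP
  · exact stabIso_linePairs D v
  · exact (stabIso_swap _).trans (stabIso_linePairs D v)

/-! #### The projections to the first coordinate -/

theorem pow_injective_of_lt {u : ℕ} (hu : u < q - 1) {z w : (ZMod p)ˣ}
    (hz : z ∈ rootsOfUnity q (ZMod p)) (hw : w ∈ rootsOfUnity q (ZMod p))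
    (h : z ^ (u + 1) = w ^ (u + 1)) : z = w := by
  rw [← div_eq_one, ← div_pow] at h
  by_contra hne
  rw [pow_eq_one_iff (div_mem hz hw) (fun h1 => hne (div_eq_one.1 h1))] at h
  exact absurd (Nat.le_of_dvd (by omega) h) (by omega)

theorem pow_surjective_of_lt {u : ℕ} (hu : u < q - 1) {a : (ZMod p)ˣ}
    (ha : a ∈ rootsOfUnity q (ZMod p)) : ∃ z ∈ rootsOfUnity q (ZMod p), z ^ (u + 1) = a := by
  let f : rootsOfUnity q (ZMod p) → rootsOfUnity q (ZMod p) := fun z => z ^ (u + 1)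
  have hf : Function.Injective f := fun z w h =>
    Subtype.ext (pow_injective_of_lt hu z.2 w.2 (congrArg Subtype.val h))
  obtain ⟨z, hz⟩ := (Finite.injective_iff_surjective.1 hf) ⟨a, ha⟩
  exact ⟨z, z.2, congrArg Subtype.val hz⟩

/-- For `u < q - 1` the exponent `u + 1` is prime to `q`, so the first slope determines `z` and the
projection to the first coordinate is an isomorphism onto `C_p ⋊ C_q`. Its target does not involve
`u`, so all these groups are alike. The stabiliser is trivial here, since slopes of odd order with
square `1` are `1`; the condition is written so as to cover the case with `-I` too. -/
theorem exists_equiv_diagU {u : ℕ} (hu : u < q - 1) :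
    ∃ φ : linePairs (diagU p q u) 0 ≃* withLinear (rootsOfUnity q (ZMod p)),
      ∀ g, g.1.1 = g.1.2 ↔ (φ g).1.b = 0 ∧ (φ g).1.a ^ 2 = 1 := by
  obtain ⟨φ, hφ⟩ := exists_lineEquiv (D := diagU p q u) (S := rootsOfUnity q (ZMod p))
    (fun d hd => (diagU_le_diagAll u hd).1) (fun a ha => by
      obtain ⟨z, hz, rfl⟩ := pow_surjective_of_lt hu ha
      refine ⟨z ^ u, mem_diagU.2 ⟨z, hz, rfl⟩, fun b hb => ?_⟩
      obtain ⟨w, hw, h⟩ := mem_diagU.1 hb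
      rw [pow_injective_of_lt hu hz hw (congrArg Prod.fst h)]
      exact congrArg Prod.snd h)
  refine ⟨φ, fun g => ?_⟩
  rw [hφ]
  obtain ⟨z, hz, h⟩ := mem_diagU.1 g.2.1
  have h1 : g.1.1.a = z ^ (u + 1) := congrArg Prod.fst h
  have h2 : g.1.2.a = z ^ u := congrArg Prod.snd h
  have h3 : g.1.2.b = 0 := by rw [(mem_linePairs.1 g.2).2, mul_zero]
  constructor
  · intro h4
    rw [h4]
    refine ⟨h3, ?_⟩
    rw [h4, h2, pow_succ] at h1
    have : z = 1 := by simpa using h1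
    rw [h2, this, one_pow, one_pow]
  · rintro ⟨h4, h5⟩
    rw [h1, ← pow_mul] at h5
    have hz1 : z = 1 := by
      by_contra hz1
      rw [pow_eq_one_iff hz hz1, (SafePair.prime p).dvd_mul] at h5
      have h6 := SafePair.three_le p (q := q)
      rcases h5 with h5 | h5
      · exact absurd (Nat.le_of_dvd (by omega) h5) (by omega)
      · exact absurd (Nat.le_of_dvd (by omega) h5) (by omega)
    exact AffLine.ext (h4.trans h3.symm) (by rw [h1, h2, hz1, one_pow, one_pow])

/-- As without `-I`, but the first slopes now fill all of `F_p^×` and the stabiliser is generated by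
the homothety `x ↦ -x`. -/
theorem exists_equiv_withNeg_diagU {u : ℕ} (hu : u < q - 1) :
    ∃ φ : linePairs (withNeg (diagU p q u)) 0 ≃* withLinear (⊤ : Subgroup (ZMod p)ˣ),
      ∀ g, g.1.1 = g.1.2 ↔ (φ g).1.b = 0 ∧ (φ g).1.a ^ 2 = 1 := by
  have hmem : ∀ d : (ZMod p)ˣ × (ZMod p)ˣ, d ∈ withNeg (diagU p q u) ↔
      ∃ z ∈ rootsOfUnity q (ZMod p), d = (z ^ (u + 1), z ^ u) ∨ d = (-z ^ (u + 1), -z ^ u) := by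
    intro d
    rw [mem_withNeg, mem_diagU, mem_diagU]
    constructor
    · rintro (⟨z, hz, h⟩ | ⟨z, hz, h⟩)
      · exact ⟨z, hz, Or.inl h⟩
      · exact ⟨z, hz, Or.inr (neg_eq_iff_eq_neg.1 h)⟩
    · rintro ⟨z, hz, h | h⟩
      · exact Or.inl ⟨z, hz, h⟩
      · exact Or.inr ⟨z, hz, neg_eq_iff_eq_neg.2 h⟩
  have hneg : ∀ {z w : (ZMod p)ˣ}, z ∈ rootsOfUnity q (ZMod p) → w ∈ rootsOfUnity q (ZMod p) →
      z ≠ -w := by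
    rintro z w hz hw rfl
    have h1 := div_mem hz hw
    rw [neg_div, div_self'] at h1
    exact neg_one_notMem p q h1
  obtain ⟨φ, hφ⟩ := exists_lineEquiv (D := withNeg (diagU p q u)) (S := ⊤)
    (fun d hd => Subgroup.mem_top _) (fun a _ => by
      rcases mem_or_neg_mem p q a with ha | ha
      · obtain ⟨z, hz, rfl⟩ := pow_surjective_of_lt hu ha
        refine ⟨z ^ u, (hmem _).2 ⟨z, hz, Or.inl rfl⟩, fun b hb => ?_⟩
        obtain ⟨w, hw, h | h⟩ := (hmem _).1 hb
        · rw [pow_injective_of_lt hu hz hw (congrArg Prod.fst h)]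
          exact congrArg Prod.snd h
        · exact absurd (congrArg Prod.fst h) (hneg ha (pow_mem hw _))
      · obtain ⟨z, hz, h0⟩ := pow_surjective_of_lt hu ha
        rw [← neg_eq_iff_eq_neg] at h0
        subst h0
        refine ⟨-z ^ u, (hmem _).2 ⟨z, hz, Or.inr rfl⟩, fun b hb => ?_⟩
        obtain ⟨w, hw, h | h⟩ := (hmem _).1 hb
        · exact absurd (congrArg Prod.fst h).symm (hneg (pow_mem hw _) (pow_mem hz _))
        · rw [pow_injective_of_lt hu hz hw (neg_injective (congrArg Prod.fst h))]
          exact congrArg Prod.snd h)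
  refine ⟨φ, fun g => ?_⟩
  rw [hφ]
  have h3 : g.1.2.b = 0 := by rw [(mem_linePairs.1 g.2).2, mul_zero]
  have key : ∃ z ∈ rootsOfUnity q (ZMod p), (g.1.1.a = g.1.2.a ↔ z ^ (u + 1) = z ^ u) ∧
      g.1.1.a ^ 2 = z ^ ((u + 1) * 2) := by
    obtain ⟨z, hz, h | h⟩ := (hmem _).1 g.2.1
    · have h1 : g.1.1.a = z ^ (u + 1) := congrArg Prod.fst h
      have h2 : g.1.2.a = z ^ u := congrArg Prod.snd h
      exact ⟨z, hz, by rw [h1, h2], by rw [h1, pow_mul]⟩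
    · have h1 : g.1.1.a = -z ^ (u + 1) := congrArg Prod.fst h
      have h2 : g.1.2.a = -z ^ u := congrArg Prod.snd h
      exact ⟨z, hz, by rw [h1, h2, neg_inj], by rw [h1, pow_mul, neg_sq]⟩
  obtain ⟨z, hz, h1, h2⟩ := key
  rw [h2]
  constructor
  · intro h4
    refine ⟨by rw [h4, h3], ?_⟩
    have h5 := h1.1 (by rw [h4])
    rw [pow_succ] at h5
    have : z = 1 := by simpa using h5
    rw [this, one_pow]
  · rintro ⟨h4, h5⟩
    have hz1 : z = 1 := by
      by_contra hz1
      rw [pow_eq_one_iff hz hz1, (SafePair.prime p).dvd_mul] at h5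
      have h6 := SafePair.three_le p (q := q)
      rcases h5 with h5 | h5
      · exact absurd (Nat.le_of_dvd (by omega) h5) (by omega)
      · exact absurd (Nat.le_of_dvd (by omega) h5) (by omega)
    exact AffLine.ext (h4.trans h3.symm) (h1.2 (by rw [hz1, one_pow, one_pow]))

theorem stabIso_of_equiv {P P' : Subgroup (AffLine p × AffLine p)} {X : Type*} [Group X]
    {A : X → Prop} (h : ∃ φ : P ≃* X, ∀ g, g.1.1 = g.1.2 ↔ A (φ g))
    (h' : ∃ φ : P' ≃* X, ∀ g, g.1.1 = g.1.2 ↔ A (φ g)) : StabIso P P' := by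
  obtain ⟨φ, hφ⟩ := h
  obtain ⟨ψ, hψ⟩ := h'
  exact ⟨φ.trans ψ.symm, fun g => by
    rw [hφ, hψ, MulEquiv.trans_apply, MulEquiv.apply_symm_apply]⟩

theorem stabIso_rep {r : TableRow q} {P : Subgroup (AffLine p × AffLine p)}
    (hP : P ∈ r.models p) : StabIso P (r.rep p) := by
  have h3 := SafePair.three_le p (q := q)
  cases r with
  | p2q2 => rw [show P = _ from hP]; exact StabIso.refl _
  | two_p2q2 => rw [show P = _ from hP]; exact StabIso.refl _
  | p2q u =>
    have hu := u.2
    rcases hP with rfl | hP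
    · exact StabIso.refl _
    · rw [show P = _ from hP]
      exact stabIso_fullPairs_swap (mem_diagU_swap (by omega))
  | two_p2q u =>
    have hu := u.2
    rcases hP with rfl | hP
    · exact StabIso.refl _
    · rw [show P = _ from hP]
      exact stabIso_fullPairs_swap (withNeg_swap (mem_diagU_swap (by omega)))
  | pq2 => exact stabIso_lineModels hP
  | two_pq2 => exact stabIso_lineModels hP
  | pq_nonabelian =>
    obtain ⟨u, hu, hP⟩ := hP
    exact (stabIso_lineModels hP).trans (stabIso_of_equiv
      (A := fun g : withLinear (rootsOfUnity q (ZMod p)) => g.1.b = 0 ∧ g.1.a ^ 2 = 1)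
      (exists_equiv_diagU hu) (exists_equiv_diagU (by omega)))
  | pq_cyclic => exact stabIso_lineModels hP
  | two_pq_frobenius =>
    obtain ⟨u, hu, hP⟩ := hP
    exact (stabIso_lineModels hP).trans (stabIso_of_equiv
      (A := fun g : withLinear (⊤ : Subgroup (ZMod p)ˣ) => g.1.b = 0 ∧ g.1.a ^ 2 = 1)
      (exists_equiv_withNeg_diagU hu) (exists_equiv_withNeg_diagU (by omega)))
  | two_pq_dihedral => exact stabIso_lineModels hP

end StabIso

/-! ### Structure of the groups in the rows -/

section Structure

open AffLine SafePair TableRow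

variable {p q : ℕ} [Fact p.Prime] [SafePair p q]

variable (p q) in
/-- The roots of unity as a standard cyclic group. -/
noncomputable def rootsEquiv : rootsOfUnity q (ZMod p) ≃* Multiplicative (ZMod q) :=
  have : IsCyclic (Multiplicative (ZMod q)) := inferInstance
  mulEquivOfCyclicCardEq (by rw [card_roots]; exact (Nat.card_zmod q).symm)

theorem mem_diagAll_iff (d : (ZMod p)ˣ × (ZMod p)ˣ) : d ∈ diagAll p q ↔
    d.1 ∈ rootsOfUnity q (ZMod p) ∧ d.1 / d.2 ∈ rootsOfUnity q (ZMod p) := by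
  constructor
  · rintro ⟨h1, h2⟩
    exact ⟨h1, div_mem h1 h2⟩
  · rintro ⟨h1, h2⟩
    refine ⟨h1, ?_⟩
    have := div_mem h1 h2
    rwa [div_div_cancel] at this

theorem mem_withNeg_iff {D : Subgroup ((ZMod p)ˣ × (ZMod p)ˣ)} {S S' Q : Subgroup (ZMod p)ˣ}
    (h : ∀ d, d ∈ D ↔ d.1 ∈ S ∧ d.1 / d.2 ∈ Q) (hS : ∀ a, a ∈ S' ↔ a ∈ S ∨ -a ∈ S)
    (d : (ZMod p)ˣ × (ZMod p)ˣ) : d ∈ withNeg D ↔ d.1 ∈ S' ∧ d.1 / d.2 ∈ Q := by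
  rw [mem_withNeg, h, h, hS]
  change _ ∨ -d.1 ∈ S ∧ -d.1 / -d.2 ∈ Q ↔ _
  rw [neg_div_neg_eq]
  tauto

theorem mem_withNeg_diagAll_iff (d : (ZMod p)ˣ × (ZMod p)ˣ) : d ∈ withNeg (diagAll p q) ↔
    d.1 ∈ (⊤ : Subgroup (ZMod p)ˣ) ∧ d.1 / d.2 ∈ rootsOfUnity q (ZMod p) :=
  mem_withNeg_iff mem_diagAll_iff
    (fun a => ⟨fun _ => mem_or_neg_mem p q a, fun _ => Subgroup.mem_top a⟩) d

/-- The matrices are `diag(1, z⁻¹)`: the first entry is trivial and the quotient is free, which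
makes the group a direct product. -/
theorem mem_diagU_sub_one_iff (d : (ZMod p)ˣ × (ZMod p)ˣ) : d ∈ diagU p q (q - 1) ↔
    d.1 ∈ (⊥ : Subgroup (ZMod p)ˣ) ∧ d.1 / d.2 ∈ rootsOfUnity q (ZMod p) := by
  have hq := SafePair.pos p q
  rw [mem_diagU, Subgroup.mem_bot, Nat.sub_add_cancel hq]
  constructor
  · rintro ⟨z, hz, rfl⟩
    exact ⟨hz, div_mem (pow_mem hz _) (pow_mem hz _)⟩
  · rintro ⟨h1, h2⟩
    rw [h1, one_div] at h2
    have h3 := inv_mem h2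
    rw [inv_inv] at h3
    refine ⟨d.2⁻¹, h2, Prod.ext (h1.trans (Eq.symm h2)) ?_⟩
    change d.2 = d.2⁻¹ ^ (q - 1)
    rw [inv_pow, eq_inv_iff_mul_eq_one, ← pow_succ', Nat.sub_add_cancel hq]
    exact h3

theorem mem_withNeg_diagU_sub_one_iff (d : (ZMod p)ˣ × (ZMod p)ˣ) :
    d ∈ withNeg (diagU p q (q - 1)) ↔
      d.1 ∈ rootsOfUnity 2 (ZMod p) ∧ d.1 / d.2 ∈ rootsOfUnity q (ZMod p) := by
  refine mem_withNeg_iff mem_diagU_sub_one_iff (fun a => ?_) d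
  rw [Subgroup.mem_bot, Subgroup.mem_bot, mem_rootsOfUnity, neg_eq_iff_eq_neg]
  constructor
  · intro h
    have h1 : (a : ZMod p) * a = 1 := by rw [← Units.val_mul, ← sq, h, Units.val_one]
    rcases mul_self_eq_one_iff.1 h1 with h2 | h2
    · exact Or.inl (Units.ext h2)
    · exact Or.inr (Units.ext (by simpa using h2))
  · rintro (rfl | rfl) <;> simp

theorem rootsOfUnity_two_mul : rootsOfUnity (2 * q) (ZMod p) = ⊤ :=
  eq_top_iff.2 fun a _ => pow_two_mul p q a

include q in
theorem card_rootsOfUnity_two : Nat.card (rootsOfUnity 2 (ZMod p)) = 2 := by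
  have h := (neg_one_ne p q)
  have hb : Function.Bijective (fun b : Bool =>
      (⟨if b then -1 else 1, by
        cases b
        · exact one_pow 2
        · exact neg_one_sq⟩ : rootsOfUnity 2 (ZMod p))) := by
    constructor
    · intro a b hab
      have h1 := congrArg Subtype.val hab
      cases a <;> cases b
      · rfl
      · exact absurd (Eq.symm h1) h
      · exact absurd h1 h
      · rfl
    · rintro ⟨a, ha⟩
      have h1 : (a : ZMod p) * a = 1 := by rw [← Units.val_mul, ← sq, ha, Units.val_one]
      rcases mul_self_eq_one_iff.1 h1 with h2 | h2
      · exact ⟨false, Subtype.ext (Units.ext h2.symm)⟩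
      · exact ⟨true, Subtype.ext (Units.ext (by simpa using h2.symm))⟩
  rw [← Nat.card_congr (Equiv.ofBijective _ hb)]
  simp

/-- The dihedral group as a group of affine maps. -/
def dihedralHom (p : ℕ) : DihedralGroup p →* AffLine p where
  toFun
    | .r i => ⟨i, 1⟩
    -- The sign of `i` fits the convention `sr i * r j = sr (i + j)`.
    | .sr i => ⟨-i, -1⟩
  map_one' := rfl
  map_mul' x y := by
    cases x <;> cases y <;>
    · simp only [DihedralGroup.r_mul_r, DihedralGroup.r_mul_sr, DihedralGroup.sr_mul_r,
        DihedralGroup.sr_mul_sr]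
      refine AffLine.ext ?_ ?_ <;> simp <;> ring

include q in
theorem nonempty_dihedralEquiv :
    Nonempty (DihedralGroup p ≃* withLinear (rootsOfUnity 2 (ZMod p))) := by
  let f : DihedralGroup p →* withLinear (rootsOfUnity 2 (ZMod p)) :=
    (dihedralHom p).codRestrict _ fun x => by
      cases x
      · change (1 : (ZMod p)ˣ) ^ 2 = 1
        simp
      · change (-1 : (ZMod p)ˣ) ^ 2 = 1
        simp
  have hf : Function.Injective f := by
    intro x y h
    have h1 : dihedralHom p x = dihedralHom p y := congrArg Subtype.val h
    have h2 := congrArg AffLine.b h1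
    have h3 := congrArg AffLine.a h1
    cases x <;> cases y
    · exact congrArg DihedralGroup.r h2
    · exact absurd h3.symm (neg_one_ne p q)
    · exact absurd h3 (neg_one_ne p q)
    · exact congrArg DihedralGroup.sr (neg_injective h2)
  refine ⟨MulEquiv.ofBijective f ((Nat.bijective_iff_injective_and_card f).2 ⟨hf, ?_⟩)⟩
  rw [DihedralGroup.nat_card, card_withLinear, card_rootsOfUnity_two (q := q), mul_comm]

theorem coprime_pq : Nat.Coprime p q := by
  have hp : p.Prime := Fact.out
  rw [Nat.coprime_primes hp (SafePair.prime p)]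
  have := SafePair.eq (p := p) (q := q)
  have := SafePair.pos p q
  omega

theorem nonempty_cyclicEquiv : Nonempty (Multiplicative (ZMod (p * q)) ≃*
    withLinear (⊥ : Subgroup (ZMod p)ˣ) × rootsOfUnity q (ZMod p)) := by
  have h1 : Nat.card (withLinear (⊥ : Subgroup (ZMod p)ˣ)) = p := by
    rw [card_withLinear, Subgroup.card_bot, mul_one]
  have h2 : IsCyclic (withLinear (⊥ : Subgroup (ZMod p)ˣ)) := isCyclic_of_prime_card h1
  have h3 : IsCyclic (withLinear (⊥ : Subgroup (ZMod p)ˣ) × rootsOfUnity q (ZMod p)) := by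
    rw [Group.isCyclic_prod_iff]
    refine ⟨h2, inferInstance, ?_⟩
    rw [h1, card_roots]
    exact coprime_pq
  have h4 : IsCyclic (Multiplicative (ZMod (p * q))) := inferInstance
  exact ⟨mulEquivOfCyclicCardEq (by
    rw [Nat.card_prod, h1, card_roots]
    exact Nat.card_zmod _)⟩

/-- In a direct product of this kind the stabiliser consists of the homotheties in the first factor,
paired with the identity of the second. -/
theorem exists_type_two {D : Subgroup ((ZMod p)ˣ × (ZMod p)ˣ)} {S : Subgroup (ZMod p)ˣ}
    (h : ∀ d, d ∈ D ↔ d.1 ∈ S ∧ d.1 / d.2 ∈ rootsOfUnity q (ZMod p)) :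
    ∃ φ : linePairs D 0 ≃* withLinear S × rootsOfUnity q (ZMod p),
      ∀ g, g.1.1 = g.1.2 ↔ (φ g).1.1.b = 0 ∧ (φ g).2 = 1 := by
  obtain ⟨φ, hφ⟩ := exists_lineProdEquiv h
  refine ⟨φ, fun g => ?_⟩
  have h3 : g.1.2.b = 0 := by rw [(mem_linePairs.1 g.2).2, mul_zero]
  rw [(hφ g).1, ← Subtype.coe_inj, (hφ g).2]
  change _ ↔ _ ∧ g.1.1.a / g.1.2.a = 1
  rw [div_eq_one, AffLine.ext_iff, h3]

theorem nonempty_line_equiv {D : Subgroup ((ZMod p)ˣ × (ZMod p)ˣ)} {S : Subgroup (ZMod p)ˣ}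
    (h : ∀ d, d ∈ D ↔ d.1 ∈ S ∧ d.1 / d.2 ∈ rootsOfUnity q (ZMod p)) {X Y Z : Type*} [Group X]
    [Group Y] [Group Z] (hX : Nonempty (X ≃* withLinear S))
    (hY : Nonempty (Y ≃* Multiplicative (ZMod q))) (hZ : Nonempty (Z ≃* X × Y)) :
    Nonempty (Z ≃* linePairs D 0) := by
  obtain ⟨φ, -⟩ := exists_type_two h
  obtain ⟨e⟩ := hX
  obtain ⟨f⟩ := hY
  obtain ⟨k⟩ := hZ
  exact ⟨(k.trans (e.prodCongr (f.trans (rootsEquiv p q).symm))).trans φ.symm⟩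

theorem nonempty_congr_right {A X Y : Type*} [Group A] [Group X] [Group Y]
    (h : Nonempty (X ≃* Y)) : Nonempty (A ≃* X) ↔ Nonempty (A ≃* Y) :=
  ⟨fun ⟨e⟩ => ⟨e.trans h.some⟩, fun ⟨e⟩ => ⟨e.trans h.some.symm⟩⟩

theorem fullPairs_withNeg_diagAll : fullPairs (withNeg (diagAll p q)) = holPairs p q := by
  ext g
  rw [mem_fullPairs, mem_withNeg_diagAll_iff, mem_holPairs]
  exact and_iff_right (Subgroup.mem_top _)

theorem hasStructure_iff (r : TableRow q) (A : Type) [Group A] :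
    r.HasStructure p A ↔ Nonempty (A ≃* r.rep p) := by
  have h3 := SafePair.three_le p (q := q)
  have hprod : ∀ {X Y : Type} [Group X] [Group Y], Nonempty (Y × X ≃* X × Y) := fun {X Y} _ _ =>
    ⟨MulEquiv.prodComm⟩
  have hY : Nonempty (Multiplicative (ZMod q) ≃* Multiplicative (ZMod q)) := ⟨MulEquiv.refl _⟩
  cases r with
  | p2q2 =>
    exact nonempty_congr_right ((nonempty_fullEquiv (diagAll p q)).map MulEquiv.symm)
  | two_p2q2 =>
    refine nonempty_congr_right ?_
    change Nonempty (Hol (CpSemi p q) ≃* fullPairs (withNeg (diagAll p q)))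
    rw [fullPairs_withNeg_diagAll]
    obtain ⟨z, hz, hz1⟩ := exists_root p q
    obtain ⟨ι, hι, hr, -⟩ := exists_hol_embedding hz hz1
    exact ⟨(MonoidHom.ofInjective hι).trans (MulEquiv.subgroupCongr hr)⟩
  | p2q u =>
    exact nonempty_congr_right ((nonempty_fullEquiv (diagU p q u)).map MulEquiv.symm)
  | two_p2q u =>
    exact nonempty_congr_right ((nonempty_fullEquiv (withNeg (diagU p q u))).map MulEquiv.symm)
  | pq2 =>
    exact nonempty_congr_right (nonempty_line_equiv mem_diagAll_iff ⟨semiEquiv p q⟩ hY hprod)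
  | two_pq2 =>
    refine nonempty_congr_right (nonempty_line_equiv mem_withNeg_diagAll_iff (X := CpSemi p (2 * q))
      ⟨(semiEquiv p (2 * q)).trans (MulEquiv.subgroupCongr ?_)⟩ hY hprod)
    rw [rootsOfUnity_two_mul]
  | pq_nonabelian =>
    obtain ⟨φ, -⟩ := exists_equiv_diagU (p := p) (q := q) (u := 0) (by omega)
    exact nonempty_congr_right ⟨(semiEquiv p q).trans φ.symm⟩
  | pq_cyclic =>
    obtain ⟨φ, -⟩ := exists_type_two (mem_diagU_sub_one_iff (p := p) (q := q))
    obtain ⟨e⟩ := nonempty_cyclicEquiv (p := p) (q := q)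
    exact nonempty_congr_right ⟨e.trans φ.symm⟩
  | two_pq_frobenius =>
    obtain ⟨φ, -⟩ := exists_equiv_withNeg_diagU (p := p) (q := q) (u := 0) (by omega)
    refine nonempty_congr_right ⟨((semiEquiv p (2 * q)).trans
      (MulEquiv.subgroupCongr ?_)).trans φ.symm⟩
    rw [rootsOfUnity_two_mul]
  | two_pq_dihedral =>
    exact nonempty_congr_right (nonempty_line_equiv mem_withNeg_diagU_sub_one_iff
      (nonempty_dihedralEquiv (q := q)) hY ⟨MulEquiv.refl _⟩)

/-! ### Orders -/

theorem card_fullPairs (D : Subgroup ((ZMod p)ˣ × (ZMod p)ˣ)) :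
    Nat.card (fullPairs D) = p ^ 2 * Nat.card D := by
  have h : Nat.card ((ZMod p × ZMod p) × D) = p ^ 2 * Nat.card D := by
    rw [Nat.card_prod, Nat.card_prod, Nat.card_zmod, sq]
  rw [← h]
  exact Nat.card_congr
    { toFun := fun g => ((g.1.1.b, g.1.2.b), ⟨_, g.2⟩)
      invFun := fun x => ⟨(⟨x.1.1, x.2.1.1⟩, ⟨x.1.2, x.2.1.2⟩), x.2.2⟩
      left_inv := fun _ => rfl
      right_inv := fun _ => rfl }

theorem card_linePairs (D : Subgroup ((ZMod p)ˣ × (ZMod p)ˣ)) :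
    Nat.card (linePairs D 0) = p * Nat.card D := by
  have h : Nat.card (ZMod p × D) = p * Nat.card D := by
    rw [Nat.card_prod, Nat.card_zmod]
  rw [← h]
  exact Nat.card_congr
    { toFun := fun g => (g.1.1.b, ⟨_, g.2.1⟩)
      invFun := fun x => ⟨(⟨x.1, x.2.1.1⟩, ⟨0, x.2.1.2⟩), x.2.2, by simp⟩
      left_inv := fun g => Subtype.ext (Prod.ext rfl (AffLine.ext (by
        rw [(mem_linePairs.1 g.2).2, mul_zero]) rfl))
      right_inv := fun _ => rfl }

theorem card_diagAll : Nat.card (diagAll p q) = q ^ 2 := by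
  rw [diagAll, Nat.card_congr (Subgroup.prodEquiv _ _).toEquiv, Nat.card_prod, card_roots, sq]

theorem card_diagU (u : ℕ) : Nat.card (diagU p q u) = q := by
  conv_rhs => rw [← card_roots p q]
  refine (Nat.card_congr (Equiv.ofBijective
    (fun z : rootsOfUnity q (ZMod p) => (⟨(z.1 ^ (u + 1), z.1 ^ u), mem_diagU.2 ⟨z, z.2, rfl⟩⟩ :
      diagU p q u)) ⟨?_, ?_⟩)).symm
  · intro z w h
    have h1 : z.1 ^ (u + 1) = w.1 ^ (u + 1) := congrArg (fun x => x.1.1) h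
    have h2 : z.1 ^ u = w.1 ^ u := congrArg (fun x => x.1.2) h
    rw [pow_succ, pow_succ, h2] at h1
    exact Subtype.ext (mul_left_cancel h1)
  · rintro ⟨d, hd⟩
    obtain ⟨z, hz, rfl⟩ := mem_diagU.1 hd
    exact ⟨⟨z, hz⟩, rfl⟩

theorem neg_notMem_diagAll {d : (ZMod p)ˣ × (ZMod p)ˣ} (hd : d ∈ diagAll p q) :
    -d ∉ diagAll p q := by
  intro h
  have h1 : (-d).1 / d.1 ∈ rootsOfUnity q (ZMod p) := div_mem h.1 hd.1
  change -d.1 / d.1 ∈ _ at h1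
  rw [neg_div, div_self'] at h1
  exact neg_one_notMem p q h1

theorem card_withNeg {D : Subgroup ((ZMod p)ˣ × (ZMod p)ˣ)} (hD : D ≤ diagAll p q) :
    Nat.card (withNeg D) = 2 * Nat.card D := by
  have h : Nat.card (D ⊕ D) = 2 * Nat.card D := by rw [Nat.card_sum, two_mul]
  rw [← h]
  refine (Nat.card_congr (Equiv.ofBijective (fun x : D ⊕ D => (Sum.elim
    (fun d => ⟨d.1, mem_withNeg.2 (Or.inl d.2)⟩)
    (fun d => ⟨-d.1, mem_withNeg.2 (Or.inr (by rw [neg_neg]; exact d.2))⟩) x : withNeg D))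
    ⟨?_, ?_⟩)).symm
  · rintro (x | x) (y | y) hxy
    · exact congrArg Sum.inl (Subtype.ext (congrArg (fun z : withNeg D => z.1) hxy))
    · have h1 : x.1 = -y.1 := congrArg (fun z : withNeg D => z.1) hxy
      exact absurd (h1 ▸ hD x.2) (neg_notMem_diagAll (hD y.2))
    · have h1 : -x.1 = y.1 := congrArg (fun z : withNeg D => z.1) hxy
      exact absurd (h1 ▸ hD y.2) (neg_notMem_diagAll (hD x.2))
    · have h1 : -x.1 = -y.1 := congrArg (fun z : withNeg D => z.1) hxy
      exact congrArg Sum.inr (Subtype.ext (neg_injective h1))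
  · rintro ⟨d, hd⟩
    rcases mem_withNeg.1 hd with h1 | h1
    · exact ⟨Sum.inl ⟨d, h1⟩, rfl⟩
    · exact ⟨Sum.inr ⟨-d, h1⟩, Subtype.ext (neg_neg d)⟩

theorem card_rep (r : TableRow q) : Nat.card (r.rep p) = r.order p := by
  cases r with
  | p2q2 => rw [rep, card_fullPairs, card_diagAll]; rfl
  | two_p2q2 =>
    rw [rep, card_fullPairs, card_withNeg le_rfl, card_diagAll]
    change _ = 2 * p ^ 2 * q ^ 2
    ring
  | p2q u => rw [rep, card_fullPairs, card_diagU]; rfl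
  | two_p2q u =>
    rw [rep, card_fullPairs, card_withNeg (diagU_le_diagAll _), card_diagU]
    change _ = 2 * p ^ 2 * q
    ring
  | pq2 => rw [rep, card_linePairs, card_diagAll]; rfl
  | two_pq2 =>
    rw [rep, card_linePairs, card_withNeg le_rfl, card_diagAll]
    change _ = 2 * p * q ^ 2
    ring
  | pq_nonabelian => rw [rep, card_linePairs, card_diagU]; rfl
  | pq_cyclic => rw [rep, card_linePairs, card_diagU]; rfl
  | two_pq_frobenius =>
    rw [rep, card_linePairs, card_withNeg (diagU_le_diagAll _), card_diagU]
    change _ = 2 * p * q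
    ring
  | two_pq_dihedral =>
    rw [rep, card_linePairs, card_withNeg (diagU_le_diagAll _), card_diagU]
    change _ = 2 * p * q
    ring

end Structure

/-! ### Isomorphisms between the groups with two-dimensional translation part -/

section FullIso

open AffLine SafePair TableRow

variable {p q : ℕ} [Fact p.Prime]

theorem trPair_pow (x y : ZMod p) (n : ℕ) : trPair x y ^ n = trPair ((n : ZMod p) * x) (n * y) :=
  Prod.ext (tr_pow x n) (tr_pow y n)

/-- A pair of translations as an element of a group that contains all of them. -/
def fullTr (D : Subgroup ((ZMod p)ˣ × (ZMod p)ˣ)) (x y : ZMod p) : fullPairs D :=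
  ⟨trPair x y, D.one_mem⟩

theorem fullTr_pow (D : Subgroup ((ZMod p)ˣ × (ZMod p)ˣ)) (x y : ZMod p) (n : ℕ) :
    fullTr D x y ^ n = fullTr D ((n : ZMod p) * x) (n * y) :=
  Subtype.ext (trPair_pow x y n)

theorem fullTr_mul (D : Subgroup ((ZMod p)ˣ × (ZMod p)ˣ)) (x y x' y' : ZMod p) :
    fullTr D x y * fullTr D x' y' = fullTr D (x + x') (y + y') :=
  Subtype.ext (trPair_add x y x' y').symm

theorem conj_fullTr {D : Subgroup ((ZMod p)ˣ × (ZMod p)ˣ)} (g : fullPairs D) (x y : ZMod p) :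
    g * fullTr D x y * g⁻¹ = fullTr D ((g.1.1.a : ZMod p) * x) ((g.1.2.a : ZMod p) * y) :=
  Subtype.ext (conj_trPair g.1 x y)

variable {D D' : Subgroup ((ZMod p)ˣ × (ZMod p)ˣ)}

/-- The translations are exactly the elements killed by `p`, so an isomorphism restricts to an
additive, hence linear, map between the two planes. -/
theorem map_fullTr (φ : fullPairs D ≃* fullPairs D') : ∃ t11 t12 t21 t22 : ZMod p,
    ∀ x y, φ (fullTr D x y) = fullTr D' (t11 * x + t12 * y) (t21 * x + t22 * y) := by
  have h1 : ∀ x y, φ (fullTr D x y) = fullTr D' (φ (fullTr D x y)).1.1.b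
      (φ (fullTr D x y)).1.2.b := by
    intro x y
    refine Subtype.ext (trPair_of_pow ?_)
    have h2 : fullTr D x y ^ p = 1 := Subtype.ext (trPair_pow_p x y)
    rw [← Subgroup.coe_pow, ← map_pow, h2, map_one, Subgroup.coe_one]
  refine ⟨(φ (fullTr D 1 0)).1.1.b, (φ (fullTr D 0 1)).1.1.b, (φ (fullTr D 1 0)).1.2.b,
    (φ (fullTr D 0 1)).1.2.b, fun x y => ?_⟩
  have h2 : fullTr D x y = fullTr D 1 0 ^ x.val * fullTr D 0 1 ^ y.val := by
    rw [fullTr_pow, fullTr_pow, fullTr_mul, ZMod.natCast_zmod_val, ZMod.natCast_zmod_val]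
    congr 1 <;> ring
  rw [h2, map_mul, map_pow, map_pow, h1 1 0, h1 0 1, fullTr_pow, fullTr_pow, fullTr_mul,
    ZMod.natCast_zmod_val, ZMod.natCast_zmod_val]
  congr 1 <;> simp [fullTr, trPair] <;> ring

theorem fullTr_injective {x y x' y' : ZMod p} (h : fullTr D x y = fullTr D x' y') :
    x = x' ∧ y = y' :=
  ⟨congrArg (fun g : fullPairs D => g.1.1.b) h, congrArg (fun g : fullPairs D => g.1.2.b) h⟩

/-- An isomorphism acts on the translations by a diagonal or an antidiagonal matrix. -/
theorem fullPairs_equiv_cases (φ : fullPairs D ≃* fullPairs D') (hD : ∃ d ∈ D, d.1 ≠ d.2) :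
    (∃ t1 t2 : (ZMod p)ˣ, (∀ x y, φ (fullTr D x y) = fullTr D' (t1 * x) (t2 * y)) ∧
      ∀ g, linHom (φ g).1 = linHom g.1) ∨
    (∀ g, linHom (φ g).1 = (linHom g.1).swap) := by
  obtain ⟨t11, t12, t21, t22, ht⟩ := map_fullTr φ
  have hrel : ∀ g : fullPairs D, ∀ x y : ZMod p,
      t11 * (g.1.1.a * x) + t12 * (g.1.2.a * y) = (φ g).1.1.a * (t11 * x + t12 * y) ∧
      t21 * (g.1.1.a * x) + t22 * (g.1.2.a * y) = (φ g).1.2.a * (t21 * x + t22 * y) := by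
    intro g x y
    have h1 := congrArg φ (conj_fullTr g x y)
    rw [map_mul, map_mul, map_inv, ht, ht, conj_fullTr] at h1
    have h2 := fullTr_injective h1
    exact ⟨h2.1.symm, h2.2.symm⟩
  -- The matrix `T` of `φ` on translations intertwines the slopes of `g` with those of `φ g`. A
  -- nonzero entry of `T` equates two slopes, so an element with distinct slopes leaves only one
  -- nonzero entry in each column.
  have hr : ∀ g : fullPairs D, t11 * (g.1.1.a : ZMod p) = (φ g).1.1.a * t11 ∧
      t12 * (g.1.2.a : ZMod p) = (φ g).1.1.a * t12 ∧
      t21 * (g.1.1.a : ZMod p) = (φ g).1.2.a * t21 ∧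
      t22 * (g.1.2.a : ZMod p) = (φ g).1.2.a * t22 := by
    intro g
    have h1 := hrel g 1 0
    have h2 := hrel g 0 1
    simp only [mul_one, mul_zero, add_zero, zero_add] at h1 h2
    exact ⟨h1.1, h2.1, h1.2, h2.2⟩
  have hu : ∀ {a b : (ZMod p)ˣ} {t : ZMod p}, t ≠ 0 → t * (a : ZMod p) = b * t → b = a :=
    fun h h' => units_eq_of_mul_eq h (by rw [← h', mul_comm])
  have hn1 : ¬ (t11 = 0 ∧ t21 = 0) := by
    rintro ⟨h1, h2⟩
    have h3 : fullTr D 1 0 = fullTr D 0 0 := φ.injective (by rw [ht, ht, h1, h2]; simp)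
    exact one_ne_zero (fullTr_injective h3).1
  have hn2 : ¬ (t12 = 0 ∧ t22 = 0) := by
    rintro ⟨h1, h2⟩
    have h3 : fullTr D 0 1 = fullTr D 0 0 := φ.injective (by rw [ht, ht, h1, h2]; simp)
    exact one_ne_zero (fullTr_injective h3).2
  obtain ⟨d, hd, hne⟩ := hD
  let g0 : fullPairs D := ⟨(⟨0, d.1⟩, ⟨0, d.2⟩), hd⟩
  obtain ⟨r1, r2, r3, r4⟩ := hr g0
  by_cases h11 : t11 = 0
  · right
    have h21 : t21 ≠ 0 := fun h => hn1 ⟨h11, h⟩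
    have h22 : t22 = 0 := by
      by_contra h22
      exact hne ((hu h21 r3).symm.trans (hu h22 r4))
    have h12 : t12 ≠ 0 := fun h => hn2 ⟨h, h22⟩
    intro g
    obtain ⟨s1, s2, s3, s4⟩ := hr g
    exact Prod.ext (hu h12 s2) (hu h21 s3)
  · left
    have h12 : t12 = 0 := by
      by_contra h12
      exact hne ((hu h11 r1).symm.trans (hu h12 r2))
    have h22 : t22 ≠ 0 := fun h => hn2 ⟨h12, h⟩
    have h21 : t21 = 0 := by
      by_contra h21
      exact hne ((hu h21 r3).symm.trans (hu h22 r4))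
    refine ⟨Units.mk0 t11 h11, Units.mk0 t22 h22, fun x y => ?_, fun g => ?_⟩
    · rw [ht, h12, h21]
      simp
    · obtain ⟨s1, s2, s3, s4⟩ := hr g
      exact Prod.ext (hu h11 s1) (hu h22 s4)

theorem eq_or_swap_of_equiv (φ : fullPairs D ≃* fullPairs D') (hD : ∃ d ∈ D, d.1 ≠ d.2) :
    D = D' ∨ ∀ d, d ∈ D ↔ d.swap ∈ D' := by
  have hlift : ∀ {D : Subgroup ((ZMod p)ˣ × (ZMod p)ˣ)}, ∀ d ∈ D,
      ∃ g : fullPairs D, linHom g.1 = d := fun d hd => ⟨⟨(⟨0, d.1⟩, ⟨0, d.2⟩), hd⟩, rfl⟩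
  rcases fullPairs_equiv_cases φ hD with ⟨-, -, -, h⟩ | h
  · left
    ext d
    constructor
    · intro hd
      obtain ⟨g, rfl⟩ := hlift d hd
      rw [← h]
      exact (φ g).2
    · intro hd
      obtain ⟨g, rfl⟩ := hlift d hd
      obtain ⟨k, rfl⟩ := φ.surjective g
      rw [h]
      exact k.2
  · right
    intro d
    constructor
    · intro hd
      obtain ⟨g, rfl⟩ := hlift d hd
      rw [← h]
      exact (φ g).2
    · intro hd
      obtain ⟨g, hg⟩ := hlift _ hd
      obtain ⟨k, rfl⟩ := φ.surjective g
      rw [h] at hg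
      rw [← Prod.swap_injective hg]
      exact k.2

variable [SafePair p q]

theorem exists_diagU_ne (u : ℕ) : ∃ d ∈ diagU p q u, d.1 ≠ d.2 := by
  obtain ⟨z, hz, hz1⟩ := exists_root p q
  refine ⟨_, mem_diagU.2 ⟨z, hz, rfl⟩, fun h => hz1 ?_⟩
  change z ^ (u + 1) = z ^ u at h
  rw [pow_succ] at h
  simpa using h

/-- The quotient of the two entries of `diag(z^(u+1), z^u)` is `z`, so the second entry reveals the
exponent `u` modulo `q`. The sign cannot interfere, since `-1` is not in `μ_q`. -/
theorem diagU_le_withNeg {u u' : ℕ} (hu : u < q) (hu' : u' < q)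
    (h : diagU p q u ≤ withNeg (diagU p q u')) : u = u' := by
  obtain ⟨z, hz, hz1⟩ := exists_root p q
  have h1 := h (mem_diagU.2 ⟨z, hz, rfl⟩)
  have hall := diagU_le_diagAll u (mem_diagU.2 ⟨z, hz, rfl⟩)
  rcases mem_withNeg.1 h1 with h2 | h2
  · obtain ⟨w, hw, h3⟩ := mem_diagU.1 h2
    have h4 : z ^ (u + 1) = w ^ (u' + 1) := congrArg Prod.fst h3
    have h5 : z ^ u = w ^ u' := congrArg Prod.snd h3
    rw [pow_succ, pow_succ, h5] at h4
    rw [← mul_left_cancel h4] at h5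
    have key : ∀ {a b : ℕ}, a < q → z ^ a = z ^ b → b ≤ a → a = b := by
      intro a b ha hab hle
      have h6 : z ^ (a - b) = 1 := by
        have h7 : z ^ (a - b) * z ^ b = z ^ b := by rw [← pow_add, Nat.sub_add_cancel hle, hab]
        simpa using h7
      rw [pow_eq_one_iff hz hz1] at h6
      have := Nat.eq_zero_of_dvd_of_lt h6 (by omega)
      omega
    rcases le_total u u' with hle | hle
    · exact (key hu' h5.symm hle).symm
    · exact key hu h5 hle
  · exact absurd (diagU_le_diagAll u' h2) (neg_notMem_diagAll hall)

/-- An isomorphism matches the groups of slopes up to exchange, giving `u = u'` or `u = q - 1 - u'`.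
Both parameters are at most `(q - 1) / 2`, so the second case forces equality too. The inclusions in
the hypotheses cover the groups with and without `-I` at once. -/
theorem fullPairs_diagU_unique {u u' : ℕ} (hu : u < (q + 1) / 2) (hu' : u' < (q + 1) / 2)
    {D D' : Subgroup ((ZMod p)ˣ × (ZMod p)ˣ)} (hD : diagU p q u ≤ D)
    (hD' : D' ≤ withNeg (diagU p q u')) (h : Nonempty (fullPairs D ≃* fullPairs D')) :
    u = u' := by
  obtain ⟨φ⟩ := h
  have h3 := SafePair.three_le p (q := q)
  obtain ⟨d, hd, hne⟩ := exists_diagU_ne (p := p) (q := q) u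
  rcases eq_or_swap_of_equiv φ ⟨d, hD hd, hne⟩ with rfl | h
  · exact diagU_le_withNeg (by omega) (by omega) (hD.trans hD')
  · have hle : diagU p q u ≤ withNeg (diagU p q (q - 1 - u')) := fun e he =>
      (withNeg_swap (mem_diagU_swap (show u' < q by omega)) e).2 (hD' ((h e).1 (hD he)))
    have h1 := diagU_le_withNeg (by omega) (by omega) hle
    omega

theorem tr_one_ne : (tr 1 : AffLine p) ≠ 1 := fun h =>
  one_ne_zero (α := ZMod p) (congrArg AffLine.b h)

theorem not_comm_withLinear {S : Subgroup (ZMod p)ˣ} {s : (ZMod p)ˣ} (hs : s ∈ S) (hs1 : s ≠ 1) :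
    ¬ ∀ g k : withLinear S, g * k = k * g := fun h =>
  tr_one_ne (p := p) (eq_one_of_commute hs hs1 fun g hg =>
    congrArg Subtype.val (h ⟨tr 1, S.one_mem⟩ ⟨g, hg⟩))

theorem center_withLinear {S : Subgroup (ZMod p)ˣ} {s : (ZMod p)ˣ} (hs : s ∈ S) (hs1 : s ≠ 1)
    {k : withLinear S} (h : ∀ g, k * g = g * k) : k = 1 :=
  Subtype.ext (eq_one_of_commute hs hs1 fun g hg => congrArg Subtype.val (h ⟨g, hg⟩))

/-- The order divided by `p q`. -/
def TableRow.cofactor {q : ℕ} : TableRow q → ℕ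
  | p2q2 => 2 * (q * q) + q
  | two_p2q2 => 4 * (q * q) + 2 * q
  | p2q _ => 2 * q + 1
  | two_p2q _ => 4 * q + 2
  | pq2 => q
  | two_pq2 => 2 * q
  | pq_nonabelian => 1
  | pq_cyclic => 1
  | two_pq_frobenius => 2
  | two_pq_dihedral => 2

theorem order_eq (r : TableRow q) : r.order p = p * q * r.cofactor := by
  have := SafePair.eq (p := p) (q := q)
  cases r <;> simp only [order, cofactor] <;> rw [this] <;> ring

theorem not_nonabelian_equiv_cyclic :
    ¬ Nonempty (rep p (pq_nonabelian : TableRow q) ≃* rep p (pq_cyclic : TableRow q)) := by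
  rintro ⟨e⟩
  have h3 := SafePair.three_le p (q := q)
  obtain ⟨φ, -⟩ := exists_equiv_diagU (p := p) (q := q) (u := 0) (by omega)
  obtain ⟨f⟩ := (hasStructure_iff (p := p) (pq_cyclic : TableRow q)
    (Multiplicative (ZMod (p * q)))).1 ⟨MulEquiv.refl _⟩
  obtain ⟨z, hz, hz1⟩ := exists_root p q
  let ψ := (φ.symm.trans e).trans f.symm
  exact not_comm_withLinear hz hz1 fun g k => ψ.injective (by
    rw [map_mul, map_mul]
    exact mul_comm (ψ g) (ψ k))

/-- The dihedral row has a central factor `C_q`, while the Frobenius group has trivial centre. -/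
theorem not_frobenius_equiv_dihedral :
    ¬ Nonempty (rep p (two_pq_frobenius : TableRow q) ≃*
      rep p (two_pq_dihedral : TableRow q)) := by
  rintro ⟨e⟩
  have h3 := SafePair.three_le p (q := q)
  obtain ⟨φ, -⟩ := exists_equiv_withNeg_diagU (p := p) (q := q) (u := 0) (by omega)
  obtain ⟨f, -⟩ := exists_type_two (mem_withNeg_diagU_sub_one_iff (p := p) (q := q))
  obtain ⟨z, hz, hz1⟩ := exists_root p q
  let ψ : _ ≃* withLinear (⊤ : Subgroup (ZMod p)ˣ) := (f.symm.trans e.symm).trans φ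
  have h1 := center_withLinear (Subgroup.mem_top z) hz1 (k := ψ (1, ⟨z, hz⟩)) (fun g => by
    obtain ⟨k, rfl⟩ := ψ.surjective g
    rw [← map_mul, ← map_mul]
    congr 1
    exact Prod.ext (by simp) (mul_comm _ _))
  rw [map_eq_one_iff ψ ψ.injective] at h1
  exact hz1 (congrArg (fun x => x.2.1) h1)

/-- The orders, divided by `p q` and written in terms of `q`, separate all rows except the
parameters within `p2q` and within `two_p2q`, the two groups of order `p q`, and the two of order `2
p q`. -/
theorem rep_injective {r r' : TableRow q} (h : Nonempty (r.rep p ≃* r'.rep p)) : r = r' := by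
  have hq3 := SafePair.three_le p (q := q)
  have hp : p.Prime := Fact.out
  have hord : r.cofactor = r'.cofactor := by
    have h1 : Nat.card (r.rep p) = Nat.card (r'.rep p) := Nat.card_congr h.some.toEquiv
    rw [card_rep, card_rep, order_eq, order_eq] at h1
    exact Nat.eq_of_mul_eq_mul_left (Nat.mul_pos hp.pos (by omega)) h1
  have hqq : 3 * q ≤ q * q := Nat.mul_le_mul_right q hq3
  cases r <;> cases r' <;> simp only [cofactor] at hord <;> first
    | rfl
    | omega
    | skip
  case p2q.p2q u u' =>
    congr 1
    exact Fin.ext (fullPairs_diagU_unique u.2 u'.2 le_rfl (le_withNeg _) h)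
  case two_p2q.two_p2q u u' =>
    congr 1
    exact Fin.ext (fullPairs_diagU_unique u.2 u'.2 (le_withNeg _) le_rfl h)
  case pq_nonabelian.pq_cyclic => exact absurd h not_nonabelian_equiv_cyclic
  case pq_cyclic.pq_nonabelian =>
    exact absurd (h.map MulEquiv.symm) not_nonabelian_equiv_cyclic
  case two_pq_frobenius.two_pq_dihedral => exact absurd h not_frobenius_equiv_dihedral
  case two_pq_dihedral.two_pq_frobenius =>
    exact absurd (h.map MulEquiv.symm) not_frobenius_equiv_dihedral

end FullIso

/-! ### Numbers of transitive subgroups -/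

section Counting

open AffLine SafePair TableRow

variable {p q : ℕ}

/-- The groups with one-dimensional translation part, with the coordinates exchanged or not. -/
def lineModel (s : Bool) (D : Subgroup ((ZMod p)ˣ × (ZMod p)ˣ)) (v : ZMod p) :
    Subgroup (AffLine p × AffLine p) :=
  if s then swapPairs (linePairs D v) else linePairs D v

theorem mem_lineModels_iff {D : Subgroup ((ZMod p)ˣ × (ZMod p)ˣ)}
    {P : Subgroup (AffLine p × AffLine p)} : P ∈ lineModels D ↔ ∃ s v, P = lineModel s D v := by
  constructor
  · rintro ⟨v, h | h⟩
    · exact ⟨false, v, h⟩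
    · exact ⟨true, v, h⟩
  · rintro ⟨s, v, h⟩
    cases s
    · exact ⟨v, Or.inl h⟩
    · exact ⟨v, Or.inr h⟩

theorem linePairs_lift {D : Subgroup ((ZMod p)ˣ × (ZMod p)ˣ)} {d : (ZMod p)ˣ × (ZMod p)ˣ}
    (hd : d ∈ D) (v : ZMod p) :
    ((⟨0, d.1⟩, ⟨(1 - d.2) * v, d.2⟩) : AffLine p × AffLine p) ∈ linePairs D v := ⟨hd, rfl⟩

theorem linePairs_injective {D D' : Subgroup ((ZMod p)ˣ × (ZMod p)ˣ)} {v v' : ZMod p}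
    (h : linePairs D v = linePairs D' v') : D = D' := by
  ext d
  exact ⟨fun hd => (h.le (linePairs_lift hd v)).1, fun hd => (h.ge (linePairs_lift hd v')).1⟩

theorem fullPairs_injective {D D' : Subgroup ((ZMod p)ˣ × (ZMod p)ˣ)}
    (h : fullPairs D = fullPairs D') : D = D' := by
  ext d
  exact ⟨fun hd => h.le (x := (⟨0, d.1⟩, ⟨0, d.2⟩)) hd,
    fun hd => h.ge (x := (⟨0, d.1⟩, ⟨0, d.2⟩)) hd⟩

variable [Fact p.Prime]

theorem linePairs_injective_right {D : Subgroup ((ZMod p)ˣ × (ZMod p)ˣ)} {v v' : ZMod p}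
    (hD : ∃ d ∈ D, d.2 ≠ 1) (h : linePairs D v = linePairs D v') : v = v' := by
  obtain ⟨d, hd, h1⟩ := hD
  have h2 := (h.le (linePairs_lift hd v)).2
  have hne : (1 - d.2 : ZMod p) ≠ 0 := fun h0 => h1 (Units.ext (sub_eq_zero.1 h0).symm)
  exact mul_left_cancel₀ hne h2

theorem linePairs_ne_swap (D D' : Subgroup ((ZMod p)ˣ × (ZMod p)ˣ)) (v v' : ZMod p) :
    linePairs D v ≠ swapPairs (linePairs D' v') := by
  intro h
  have h1 : trPair 1 0 ∈ linePairs D v := ⟨D.one_mem, by simp [trPair]⟩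
  rw [h] at h1
  have h2 := h1.2
  simp [trPair] at h2

theorem lineModel_injective {s s' : Bool} {D D' : Subgroup ((ZMod p)ˣ × (ZMod p)ˣ)} {v v' : ZMod p}
    (h : lineModel s D v = lineModel s' D' v') :
    s = s' ∧ D = D' ∧ linePairs D v = linePairs D' v' := by
  cases s <;> cases s'
  · exact ⟨rfl, linePairs_injective h, h⟩
  · exact absurd h (linePairs_ne_swap _ _ _ _)
  · exact absurd h.symm (linePairs_ne_swap _ _ _ _)
  · have h1 : linePairs D v = linePairs D' v' := congrArg swapPairs h
    exact ⟨rfl, linePairs_injective h1, h1⟩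

/-- The factor `2` is the choice of the axis, the factor `p` the choice of the fixed point `v`. A
second slope different from `1` makes `v` visible. -/
theorem card_lineModels {D : Subgroup ((ZMod p)ˣ × (ZMod p)ˣ)} (hD : ∃ d ∈ D, d.2 ≠ 1) :
    Nat.card (lineModels D) = 2 * p := by
  have h : Nat.card (Bool × ZMod p) = 2 * p := by
    rw [Nat.card_prod, Nat.card_zmod, Nat.card_eq_fintype_card, Fintype.card_bool]
  rw [← h]
  refine (Nat.card_congr (Equiv.ofBijective (fun x : Bool × ZMod p =>
    (⟨lineModel x.1 D x.2, mem_lineModels_iff.2 ⟨_, _, rfl⟩⟩ : lineModels D)) ⟨?_, ?_⟩)).symm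
  · rintro ⟨s, v⟩ ⟨s', v'⟩ hx
    obtain ⟨h1, -, h2⟩ := lineModel_injective (congrArg Subtype.val hx)
    exact Prod.ext h1 (linePairs_injective_right hD h2)
  · rintro ⟨P, hP⟩
    obtain ⟨s, v, rfl⟩ := mem_lineModels_iff.1 hP
    exact ⟨(s, v), rfl⟩

variable [SafePair p q]

theorem withNeg_exists_snd_ne (D : Subgroup ((ZMod p)ˣ × (ZMod p)ˣ)) (q : ℕ) [SafePair p q] :
    ∃ d ∈ withNeg D, d.2 ≠ 1 :=
  ⟨(-1, -1), mem_withNeg.2 (Or.inr (by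
    rw [show -((-1, -1) : (ZMod p)ˣ × (ZMod p)ˣ) = 1 from Prod.ext (neg_neg 1) (neg_neg 1)]
    exact one_mem _)), neg_one_ne p q⟩

theorem diagU_exists_snd_ne {u : ℕ} (hu : 0 < u) (hu' : u < q) :
    ∃ d ∈ diagU p q u, d.2 ≠ 1 := by
  obtain ⟨z, hz, hz1⟩ := exists_root p q
  refine ⟨_, mem_diagU.2 ⟨z, hz, rfl⟩, fun h => ?_⟩
  change z ^ u = 1 at h
  rw [pow_eq_one_iff hz hz1] at h
  exact absurd (Nat.le_of_dvd hu h) (by omega)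

theorem diagU_injective {u u' : ℕ} (hu : u < q) (hu' : u' < q)
    (h : diagU p q u = diagU p q u') : u = u' :=
  diagU_le_withNeg hu hu' (h.le.trans (le_withNeg _))

theorem withNeg_diagU_injective {u u' : ℕ} (hu : u < q) (hu' : u' < q)
    (h : withNeg (diagU p q u) = withNeg (diagU p q u')) : u = u' :=
  diagU_le_withNeg hu hu' ((le_withNeg _).trans h.le)

/-- For `u = 0` the second map is always the identity and has no distinguished fixed point. The `p`
choices of `v` collapse to one, which is the source of the summand `2` in `2 p (q - 2) + 2`. -/
theorem linePairs_diagU_zero (v : ZMod p) :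
    linePairs (diagU p q 0) v = linePairs (diagU p q 0) 0 := by
  ext g
  rw [mem_linePairs, mem_linePairs]
  refine and_congr_right fun h => ?_
  obtain ⟨z, hz, h1⟩ := mem_diagU.1 h
  have h2 : g.2.a = 1 := (congrArg Prod.snd h1).trans (pow_zero z)
  rw [h2, Units.val_one, sub_self, zero_mul, zero_mul]

theorem card_pair_eq {A : Type*} {a b : A} {P : Prop} [Decidable P] (h : a = b ↔ P) :
    Nat.card ({a, b} : Set A) = if P then 1 else 2 := by
  rw [Nat.card_coe_set_eq]
  split_ifs with hP
  · rw [h.2 hP, Set.pair_eq_singleton, Set.ncard_singleton]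
  · exact Set.ncard_pair (mt h.1 hP)

theorem lineModel_congr {s s' : Bool} {D : Subgroup ((ZMod p)ˣ × (ZMod p)ˣ)} {v v' : ZMod p}
    (h : lineModel s D v = lineModel s' D v') (hD : ∃ d ∈ D, d.2 ≠ 1) : (s, v) = (s', v') := by
  obtain ⟨h1, -, h2⟩ := lineModel_injective h
  exact Prod.ext h1 (linePairs_injective_right hD h2)

/-- A parametrisation of the regular non-abelian groups. -/
def nonabelianModel (p q : ℕ) : (Fin (q - 2) × Bool × ZMod p) ⊕ Bool →
    Subgroup (AffLine p × AffLine p)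
  | Sum.inl x => lineModel x.2.1 (diagU p q (x.1 + 1)) x.2.2
  | Sum.inr s => lineModel s (diagU p q 0) 0

theorem nonabelianModel_injective : Function.Injective (nonabelianModel p q) := by
  have h3 := SafePair.three_le p (q := q)
  rintro (⟨i, x⟩ | s) (⟨i', x'⟩ | s') hx
  · have h1 : lineModel x.1 (diagU p q (i + 1)) x.2 = lineModel x'.1 (diagU p q (i' + 1)) x'.2 := hx
    have hi := i.2
    have hi' := i'.2
    have h5 := diagU_injective (p := p) (q := q) (by omega) (by omega) (lineModel_injective h1).2.1
    obtain rfl : i = i' := Fin.ext (by omega)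
    have h6 := lineModel_congr h1 (diagU_exists_snd_ne (by omega) (by omega))
    exact congrArg (fun y => Sum.inl (i, y)) h6
  · have h1 : lineModel x.1 (diagU p q (i + 1)) x.2 = lineModel s' (diagU p q 0) 0 := hx
    have hi := i.2
    have h5 := diagU_injective (p := p) (q := q) (by omega) (by omega) (lineModel_injective h1).2.1
    omega
  · have h1 : lineModel s (diagU p q 0) 0 = lineModel x'.1 (diagU p q (i' + 1)) x'.2 := hx
    have hi := i'.2
    have h5 := diagU_injective (p := p) (q := q) (by omega) (by omega) (lineModel_injective h1).2.1
    omega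
  · have h1 : lineModel s (diagU p q 0) 0 = lineModel s' (diagU p q 0) 0 := hx
    rw [(lineModel_injective h1).1]

theorem range_nonabelianModel :
    Set.range (nonabelianModel p q) = (pq_nonabelian : TableRow q).models p := by
  have h3 := SafePair.three_le p (q := q)
  ext P
  constructor
  · rintro ⟨⟨i, x⟩ | s, rfl⟩
    · have hi := i.2
      exact ⟨i + 1, by omega, mem_lineModels_iff.2 ⟨_, _, rfl⟩⟩
    · exact ⟨0, by omega, mem_lineModels_iff.2 ⟨_, _, rfl⟩⟩
  · rintro ⟨u, hu, hP⟩
    obtain ⟨s, v, rfl⟩ := mem_lineModels_iff.1 hP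
    rcases Nat.eq_zero_or_pos u with rfl | hu0
    · refine ⟨Sum.inr s, ?_⟩
      cases s
      · exact (linePairs_diagU_zero v).symm
      · exact congrArg swapPairs (linePairs_diagU_zero v).symm
    · refine ⟨Sum.inl (⟨u - 1, by omega⟩, s, v), ?_⟩
      change lineModel s (diagU p q (u - 1 + 1)) v = _
      rw [Nat.sub_add_cancel hu0]

theorem card_nonabelian_models :
    Nat.card ((pq_nonabelian : TableRow q).models p) = 2 * p * (q - 2) + 2 := by
  rw [← range_nonabelianModel, Nat.card_range_of_injective nonabelianModel_injective,
    Nat.card_sum, Nat.card_prod, Nat.card_prod, Nat.card_zmod, Nat.card_eq_fintype_card,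
    Nat.card_eq_fintype_card, Fintype.card_bool, Fintype.card_fin]
  ring

/-- A parametrisation of the Frobenius groups of order `2 p q`. -/
def frobeniusModel (p q : ℕ) (x : Fin (q - 1) × Bool × ZMod p) :
    Subgroup (AffLine p × AffLine p) :=
  lineModel x.2.1 (withNeg (diagU p q x.1)) x.2.2

theorem frobeniusModel_injective : Function.Injective (frobeniusModel p q) := by
  rintro ⟨i, x⟩ ⟨i', x'⟩ hx
  have h1 : lineModel x.1 (withNeg (diagU p q i)) x.2 =
    lineModel x'.1 (withNeg (diagU p q i')) x'.2 := hx
  have hi := i.2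
  have hi' := i'.2
  have h5 := withNeg_diagU_injective (p := p) (q := q) (by omega) (by omega)
    (lineModel_injective h1).2.1
  obtain rfl : i = i' := Fin.ext h5
  exact congrArg (Prod.mk i) (lineModel_congr h1 (withNeg_exists_snd_ne _ q))

theorem range_frobeniusModel :
    Set.range (frobeniusModel p q) = (two_pq_frobenius : TableRow q).models p := by
  ext P
  constructor
  · rintro ⟨x, rfl⟩
    exact ⟨x.1, x.1.2, mem_lineModels_iff.2 ⟨_, _, rfl⟩⟩
  · rintro ⟨u, hu, hP⟩
    obtain ⟨s, v, rfl⟩ := mem_lineModels_iff.1 hP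
    exact ⟨(⟨u, hu⟩, s, v), rfl⟩

theorem card_frobenius_models :
    Nat.card ((two_pq_frobenius : TableRow q).models p) = 2 * p * (q - 1) := by
  rw [← range_frobeniusModel, Nat.card_range_of_injective frobeniusModel_injective,
    Nat.card_prod, Nat.card_prod, Nat.card_zmod, Nat.card_eq_fintype_card,
    Nat.card_eq_fintype_card, Fintype.card_bool, Fintype.card_fin]
  ring

theorem card_models (r : TableRow q) : Nat.card (r.models p) = r.numGroups p := by
  have h3 := SafePair.three_le p (q := q)
  have hodd := SafePair.odd p q
  obtain ⟨m, hm⟩ := hodd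
  cases r with
  | p2q2 => exact (Nat.card_coe_set_eq _).trans (Set.ncard_singleton _)
  | two_p2q2 => exact (Nat.card_coe_set_eq _).trans (Set.ncard_singleton _)
  | p2q u =>
    have hu := u.2
    refine card_pair_eq ⟨fun h => ?_, fun h => ?_⟩
    · have := diagU_injective (p := p) (q := q) (by omega) (by omega) (fullPairs_injective h)
      omega
    · rw [show q - 1 - u.val = u.val by omega]
  | two_p2q u =>
    have hu := u.2
    refine card_pair_eq ⟨fun h => ?_, fun h => ?_⟩
    · have := withNeg_diagU_injective (p := p) (q := q) (by omega) (by omega)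
        (fullPairs_injective h)
      omega
    · rw [show q - 1 - u.val = u.val by omega]
  | pq2 =>
    obtain ⟨z, hz, hz1⟩ := exists_root p q
    exact card_lineModels ⟨(1, z), ⟨one_mem _, hz⟩, hz1⟩
  | two_pq2 => exact card_lineModels (withNeg_exists_snd_ne _ q)
  | pq_nonabelian => exact card_nonabelian_models
  | pq_cyclic => exact card_lineModels (diagU_exists_snd_ne (by omega) (by omega))
  | two_pq_frobenius => exact card_frobenius_models
  | two_pq_dihedral => exact card_lineModels (withNeg_exists_snd_ne _ q)

end Counting

/-! ### Automorphisms that preserve a point stabiliser -/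

section PredAut

open AffLine SafePair

/-- The number of automorphisms that preserve a predicate. -/
noncomputable def predAut {X : Type*} [Group X] (A : X → Prop) : ℕ :=
  Nat.card {θ : X ≃* X // ∀ g, A g ↔ A (θ g)}

theorem predAut_congr {X Y : Type*} [Group X] [Group Y] {A : X → Prop} {B : Y → Prop}
    (φ : X ≃* Y) (h : ∀ g, A g ↔ B (φ g)) : predAut A = predAut B := by
  have h' : ∀ k, A (φ.symm k) ↔ B k := fun k => by rw [h, φ.apply_symm_apply]
  exact Nat.card_congr
    { toFun := fun θ => ⟨(φ.symm.trans θ.1).trans φ, fun g => by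
        rw [← h', θ.2, h]
        rfl⟩
      invFun := fun θ => ⟨(φ.trans θ.1).trans φ.symm, fun g => by
        rw [h, θ.2, ← h']
        rfl⟩
      left_inv := fun θ => by ext; simp
      right_inv := fun θ => by ext; simp }

variable {p q : ℕ} [Fact p.Prime]

/-- Conjugation by an affine map. -/
def conjWithLinear (S : Subgroup (ZMod p)ˣ) (k : AffLine p) : withLinear S ≃* withLinear S where
  toFun g := ⟨k * g * k⁻¹, by rw [mem_withLinear, conj_eq]; exact g.2⟩
  invFun g := ⟨k⁻¹ * g * k⁻¹⁻¹, by rw [mem_withLinear, conj_eq]; exact g.2⟩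
  left_inv g := Subtype.ext (by simp [mul_assoc])
  right_inv g := Subtype.ext (by simp [mul_assoc])
  map_mul' g h := Subtype.ext (by simp [mul_assoc])

/-- Automorphisms are conjugations by unique affine maps, so counting them becomes counting affine
maps that respect the predicate. -/
theorem predAut_withLinear {S : Subgroup (ZMod p)ˣ} {s : (ZMod p)ˣ} (hs : s ∈ S) (hs1 : s ≠ 1)
    (A : withLinear S → Prop) :
    predAut A = Nat.card {k : AffLine p // ∀ g, A g ↔ A (conjWithLinear S k g)} := by
  refine (Nat.card_congr (Equiv.ofBijective (fun k : {k : AffLine p //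
    ∀ g, A g ↔ A (conjWithLinear S k g)} => (⟨conjWithLinear S k.1, k.2⟩ :
      {θ : withLinear S ≃* withLinear S // ∀ g, A g ↔ A (θ g)})) ⟨?_, ?_⟩)).symm
  · rintro ⟨k, hk⟩ ⟨l, hl⟩ h
    refine Subtype.ext (inv_mul_eq_one.1 (eq_one_of_commute hs hs1 fun g hg => ?_)).symm
    have h1 : conjWithLinear S k ⟨g, hg⟩ = conjWithLinear S l ⟨g, hg⟩ :=
      DFunLike.congr_fun (congrArg Subtype.val h) _
    have h2 : k * g * k⁻¹ = l * g * l⁻¹ := congrArg Subtype.val h1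
    rw [mul_inv_eq_iff_eq_mul] at h2
    rw [mul_assoc, inv_mul_eq_iff_eq_mul, h2]
    group
  · rintro ⟨θ, hθ⟩
    obtain ⟨k, hk⟩ := exists_conj hs hs1 θ
    have h1 : θ = conjWithLinear S k := MulEquiv.ext fun g => Subtype.ext (hk g)
    subst h1
    exact ⟨⟨k, hθ⟩, rfl⟩

theorem card_affLine : Nat.card (AffLine p) = p * (p - 1) := by
  rw [Nat.card_congr equivProd, Nat.card_prod, Nat.card_zmod, Nat.card_eq_fintype_card,
    ZMod.card_units]

variable [SafePair p q]

/-- The predicate singles out the identity, as for a regular group, so every automorphism is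
admitted. -/
theorem predAut_nonabelian :
    predAut (fun g : withLinear (rootsOfUnity q (ZMod p)) => g.1.b = 0 ∧ g.1.a ^ 2 = 1) =
      p * (p - 1) := by
  obtain ⟨z, hz, hz1⟩ := exists_root p q
  have h3 := SafePair.three_le p (q := q)
  have hA : ∀ g : withLinear (rootsOfUnity q (ZMod p)), (g.1.b = 0 ∧ g.1.a ^ 2 = 1) ↔ g = 1 := by
    intro g
    constructor
    · rintro ⟨h1, h2⟩
      refine Subtype.ext (AffLine.ext h1 ?_)
      by_contra h4
      rw [SafePair.pow_eq_one_iff (show g.1.a ∈ rootsOfUnity q (ZMod p) from g.2) h4] at h2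
      exact absurd (Nat.le_of_dvd two_pos h2) (by omega)
    · rintro rfl
      exact ⟨rfl, one_pow 2⟩
  simp only [hA]
  rw [predAut_withLinear hz hz1, ← card_affLine]
  exact Nat.card_congr (Equiv.subtypeUnivEquiv fun k g =>
    (map_eq_one_iff _ (conjWithLinear _ k).injective).symm)

/-- A conjugation preserves the stabiliser exactly if it fixes the involution `x ↦ -x`, that is, if
the conjugating map fixes `0`. Only its slope remains free. -/
theorem predAut_frobenius (q : ℕ) [SafePair p q] :
    predAut (fun g : withLinear (⊤ : Subgroup (ZMod p)ˣ) => g.1.b = 0 ∧ g.1.a ^ 2 = 1) =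
      p - 1 := by
  rw [predAut_withLinear (Subgroup.mem_top (-1)) (neg_one_ne p q)]
  have h : Nat.card (ZMod p)ˣ = p - 1 := by rw [Nat.card_eq_fintype_card, ZMod.card_units]
  rw [← h]
  have hb : ∀ k : AffLine p, (∀ g : withLinear (⊤ : Subgroup (ZMod p)ˣ),
      (g.1.b = 0 ∧ g.1.a ^ 2 = 1) ↔ ((conjWithLinear ⊤ k g).1.b = 0 ∧
        (conjWithLinear ⊤ k g).1.a ^ 2 = 1)) ↔ k.b = 0 := by
    intro k
    have hc : ∀ g : withLinear (⊤ : Subgroup (ZMod p)ˣ), (conjWithLinear ⊤ k g).1 = _ := fun g =>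
      conj_eq k g.1
    simp only [hc]
    constructor
    · intro h1
      have h2 := ((h1 ⟨⟨0, -1⟩, Subgroup.mem_top _⟩).1 ⟨rfl, neg_one_sq⟩).1
      simp only [mul_zero, zero_add, Units.val_neg, Units.val_one] at h2
      have h4 : (2 : ZMod p) * k.b = 0 := by linear_combination h2
      exact (mul_eq_zero.1 h4).resolve_left (two_ne_zero p q)
    · intro h1 g
      rw [h1]
      simp
  exact Nat.card_congr
    { toFun := fun k => k.1.a
      invFun := fun a => ⟨⟨0, a⟩, (hb _).2 rfl⟩
      left_inv := fun k => Subtype.ext (AffLine.ext ((hb _).1 k.2).symm rfl)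
      right_inv := fun a => rfl }

/-- The diagonal automorphism `((b, a), z) ↦ ((t b, a), f z)`. -/
def prodAut (S : Subgroup (ZMod p)ˣ) {Q : Type*} [Group Q] (t : (ZMod p)ˣ) (f : MulAut Q) :
    withLinear S × Q ≃* withLinear S × Q :=
  (conjWithLinear S ⟨0, t⟩).prodCongr f

theorem prodAut_fst (S : Subgroup (ZMod p)ˣ) {Q : Type*} [Group Q] (t : (ZMod p)ˣ) (f : MulAut Q)
    (g : withLinear S × Q) : ((prodAut S t f g).1 : AffLine p) = ⟨t * g.1.1.b, g.1.1.a⟩ := by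
  change _ * _ * _ = _
  rw [conj_eq]
  simp

theorem q_cast_ne_zero (p q : ℕ) [Fact p.Prime] [SafePair p q] : (q : ZMod p) ≠ 0 := by
  intro h
  have h1 := two_mul_cast p q
  rw [h, mul_zero] at h1
  simpa using h1

/-- An admissible automorphism scales the translations by some `t`, acts on the factor `μ_q` by some
`f`, and fixes every homothety in the first factor. Conversely `t` and `f` can be prescribed freely.
The argument is uniform in `S` and includes the trivial group. -/
theorem predAut_prod (S : Subgroup (ZMod p)ˣ) :
    predAut (fun g : withLinear S × rootsOfUnity q (ZMod p) => g.1.1.b = 0 ∧ g.2 = 1) =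
      (p - 1) * (q - 1) := by
  have hcard : Nat.card ((ZMod p)ˣ × MulAut (rootsOfUnity q (ZMod p))) = (p - 1) * (q - 1) := by
    rw [Nat.card_prod, IsCyclic.card_mulAut, card_roots, Nat.totient_prime (SafePair.prime p),
      Nat.card_eq_fintype_card, ZMod.card_units]
  rw [← hcard]
  let A : (withLinear S × rootsOfUnity q (ZMod p)) → Prop := fun g => g.1.1.b = 0 ∧ g.2 = 1
  let T : ZMod p → (withLinear S × rootsOfUnity q (ZMod p)) := fun x => (⟨tr x, S.one_mem⟩, 1)
  let Z : rootsOfUnity q (ZMod p) → (withLinear S × rootsOfUnity q (ZMod p)) := fun z => (1, z)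
  let L : S → (withLinear S × rootsOfUnity q (ZMod p)) := fun a => (⟨⟨0, a.1⟩, a.2⟩, 1)
  have hdec : ∀ g : (withLinear S × rootsOfUnity q (ZMod p)), g = T g.1.1.b * L ⟨g.1.1.a, g.1.2⟩ * Z g.2 := fun g =>
    Prod.ext (Subtype.ext (AffLine.ext (by simp [T, L, Z]) (by simp [T, L, Z])))
      (by simp [T, L, Z])
  have hTp : ∀ g : (withLinear S × rootsOfUnity q (ZMod p)), g ^ p = 1 ↔ g.1.1.a = 1 ∧ g.2 = 1 := by
    intro g
    have h1 : g.2 ^ p = g.2 := Subtype.ext (unit_pow_p g.2.1)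
    rw [Prod.ext_iff, Prod.pow_fst, Prod.pow_snd, h1, ← pow_p_eq_one_iff, Subtype.ext_iff]
    rfl
  have hT : ∀ (θ : (withLinear S × rootsOfUnity q (ZMod p)) ≃* (withLinear S × rootsOfUnity q (ZMod p))) (x : ZMod p), θ (T x) = T (θ (T x)).1.1.b := by
    intro θ x
    have h1 : (θ (T x)) ^ p = 1 := by
      rw [← map_pow, (hTp _).2 ⟨rfl, rfl⟩, map_one]
    obtain ⟨h2, h3⟩ := (hTp _).1 h1
    exact Prod.ext (Subtype.ext (eq_tr h2)) h3
  have hT' : ∀ θ : (withLinear S × rootsOfUnity q (ZMod p)) ≃* (withLinear S × rootsOfUnity q (ZMod p)), ∃ t : (ZMod p)ˣ, ∀ x, θ (T x) = T (t * x) := by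
    intro θ
    let f : ZMod p →+ ZMod p :=
      { toFun := fun x => (θ (T x)).1.1.b
        map_zero' := by
          rw [show T 0 = 1 from rfl, map_one]
          rfl
        map_add' := fun x y => by
          rw [show T (x + y) = T x * T y from
            Prod.ext (Subtype.ext (tr_add x y)) (mul_one _).symm, map_mul, hT θ x, hT θ y]
          simp [T] }
    have hf : ∀ x, θ (T x) = T (f 1 * x) := fun x => by
      rw [mul_comm, ← addHom_eq]
      exact hT θ x
    have hne : f 1 ≠ 0 := by
      intro h0
      have h1 : T 1 = T 0 := θ.injective (by rw [hf, hf, h0, zero_mul, zero_mul])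
      exact one_ne_zero (congrArg (fun g : (withLinear S × rootsOfUnity q (ZMod p)) => g.1.1.b) h1)
    exact ⟨Units.mk0 _ hne, hf⟩
  -- The image of the factor `μ_q` is central and killed by `q`. Commuting with translations gives
  -- slope `1`, and a translation killed by `q` is trivial because `q` is invertible modulo `p`.
  have hZ : ∀ (θ : (withLinear S × rootsOfUnity q (ZMod p)) ≃* (withLinear S × rootsOfUnity q (ZMod p))) (z), θ (Z z) = Z (θ (Z z)).2 := by
    intro θ z
    have hcomm : ∀ g, θ (Z z) * g = g * θ (Z z) := by
      intro g
      obtain ⟨k, rfl⟩ := θ.surjective g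
      rw [← map_mul, ← map_mul]
      congr 1
      exact Prod.ext (by simp [Z]) (mul_comm _ _)
    have hpow : θ (Z z) ^ q = 1 := by
      rw [← map_pow, show Z z ^ q = 1 from Prod.ext (one_pow q) (Subtype.ext z.2), map_one]
    have h1 : (θ (Z z)).1.1.a = 1 := by
      have h2 := congrArg (fun g : (withLinear S × rootsOfUnity q (ZMod p)) => g.1.1.b) (hcomm (T 1))
      simp only [T, Prod.fst_mul, Subgroup.coe_mul, mul_b, tr_b, tr_a, Units.val_one, mul_one,
        one_mul] at h2
      exact Units.ext (by rw [Units.val_one]; linear_combination h2)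
    have h2 : (θ (Z z)).1.1 ^ q = 1 := congrArg (fun g : (withLinear S × rootsOfUnity q (ZMod p)) => g.1.1) hpow
    rw [eq_tr h1, tr_pow] at h2
    have h4 : (q : ZMod p) * (θ (Z z)).1.1.b = 0 := congrArg AffLine.b h2
    have h5 := (mul_eq_zero.1 h4).resolve_left (q_cast_ne_zero p q)
    exact Prod.ext (Subtype.ext (AffLine.ext h5 h1)) rfl
  have hZ' : ∀ θ : (withLinear S × rootsOfUnity q (ZMod p)) ≃* (withLinear S × rootsOfUnity q (ZMod p)), ∃ f : MulAut (rootsOfUnity q (ZMod p)), ∀ z, θ (Z z) = Z (f z) := by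
    intro θ
    refine ⟨{ toFun := fun z => (θ (Z z)).2
              invFun := fun z => (θ.symm (Z z)).2
              left_inv := fun z => ?_
              right_inv := fun z => ?_
              map_mul' := fun z w => ?_ }, hZ θ⟩
    · change (θ.symm (Z (θ (Z z)).2)).2 = z
      rw [← hZ, θ.symm_apply_apply]
    · change (θ (Z (θ.symm (Z z)).2)).2 = z
      rw [← hZ, θ.apply_symm_apply]
    · rw [show Z (z * w) = Z z * Z w from Prod.ext (mul_one _).symm rfl, map_mul]
      rfl
  refine (Nat.card_congr (Equiv.ofBijective (fun x : (ZMod p)ˣ × MulAut (rootsOfUnity q (ZMod p)) =>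
    (⟨prodAut S x.1 x.2, fun g => ?_⟩ : {θ : (withLinear S × rootsOfUnity q (ZMod p)) ≃* (withLinear S × rootsOfUnity q (ZMod p)) // ∀ g, A g ↔ A (θ g)})) ⟨?_, ?_⟩)).symm
  · change _ ↔ ((prodAut S x.1 x.2 g).1.1.b = 0 ∧ x.2 g.2 = 1)
    rw [prodAut_fst, map_eq_one_iff _ x.2.injective]
    simp [A]
  · rintro ⟨t, f⟩ ⟨t', f'⟩ h
    have h1 : ∀ g, prodAut S t f g = prodAut S t' f' g := fun g =>
      DFunLike.congr_fun (congrArg Subtype.val h) g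
    have h2 := congrArg (fun g : (withLinear S × rootsOfUnity q (ZMod p)) => g.1.1.b) (h1 (T 1))
    simp only [prodAut_fst] at h2
    refine Prod.ext (Units.ext (by simpa [T] using h2)) (MulEquiv.ext fun z => ?_)
    exact congrArg Prod.snd (h1 (Z z))
  · rintro ⟨θ, hθ⟩
    obtain ⟨t, ht⟩ := hT' θ
    obtain ⟨f, hf⟩ := hZ' θ
    refine ⟨(t, f), Subtype.ext (MulEquiv.ext fun g => ?_)⟩
    -- Preserving the stabiliser leaves only the slope of the image undetermined. That slope is read
    -- off from the action on translations, where scaling by `t` has no effect.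
    have hL : ∀ a, θ (L a) = L a := by
      intro a
      obtain ⟨h1, h2⟩ := (hθ (L a)).1 ⟨rfl, rfl⟩
      have h3 : L a * T 1 * (L a)⁻¹ = T (a : (ZMod p)ˣ) := by
        refine Prod.ext (Subtype.ext ?_) (by simp [L, T])
        exact (conj_eq _ _).trans (AffLine.ext (by simp [T, L]) rfl)
      have h4 := congrArg θ h3
      rw [map_mul, map_mul, map_inv, ht, ht] at h4
      have h5 := (conj_eq (θ (L a)).1.1 (T (t * 1)).1.1).symm.trans (congrArg (fun g : (withLinear S × rootsOfUnity q (ZMod p)) => g.1.1) h4)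
      have h6 := congrArg AffLine.b h5
      simp only [T, tr_a, tr_b, Units.val_one, sub_self, zero_mul, add_zero, mul_one] at h6
      refine Prod.ext (Subtype.ext (AffLine.ext h1 (units_eq_of_mul_eq t.ne_zero ?_))) h2
      rw [h6, mul_comm]
    change prodAut S t f g = θ g
    rw [hdec g, map_mul, map_mul, map_mul, map_mul, ht, hf, hL]
    congr 1
    · congr 1
      · exact Prod.ext (Subtype.ext ((prodAut_fst _ _ _ _).trans rfl)) (map_one f)
      · refine Prod.ext (Subtype.ext ((prodAut_fst _ _ _ _).trans ?_)) (map_one f)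
        exact AffLine.ext (mul_zero _) rfl
    · refine Prod.ext (Subtype.ext ((prodAut_fst _ _ _ _).trans ?_)) rfl
      exact AffLine.ext (mul_zero _) rfl

end PredAut

/-! ### Automorphisms of the groups with two-dimensional translation part -/

section FullAut

open AffLine SafePair TableRow

variable {p q : ℕ}

theorem conj_mem_fullPairs {D : Subgroup ((ZMod p)ˣ × (ZMod p)ˣ)} (h : AffLine p × AffLine p)
    {g : AffLine p × AffLine p} (hg : g ∈ fullPairs D) : h * g * h⁻¹ ∈ fullPairs D := by
  have : linHom (h * g * h⁻¹) = linHom g := by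
    rw [map_mul, map_mul, map_inv, mul_right_comm, mul_inv_cancel, one_mul]
  change linHom _ ∈ D
  rw [this]
  exact hg

/-- Conjugation by a pair of affine maps. -/
def conjPairs (D : Subgroup ((ZMod p)ˣ × (ZMod p)ˣ)) (h : AffLine p × AffLine p) :
    fullPairs D ≃* fullPairs D where
  toFun g := ⟨h * g.1 * h⁻¹, conj_mem_fullPairs h g.2⟩
  invFun g := ⟨h⁻¹ * g.1 * h⁻¹⁻¹, conj_mem_fullPairs h⁻¹ g.2⟩
  left_inv g := Subtype.ext (by simp [mul_assoc])
  right_inv g := Subtype.ext (by simp [mul_assoc])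
  map_mul' g k := Subtype.ext (by simp [mul_assoc])

theorem conjPairs_fst (D : Subgroup ((ZMod p)ˣ × (ZMod p)ˣ)) (h : AffLine p × AffLine p)
    (g : fullPairs D) : (conjPairs D h g).1.1 = h.1 * g.1.1 * h.1⁻¹ := rfl

theorem conjPairs_snd (D : Subgroup ((ZMod p)ˣ × (ZMod p)ˣ)) (h : AffLine p × AffLine p)
    (g : fullPairs D) : (conjPairs D h g).1.2 = h.2 * g.1.2 * h.2⁻¹ := rfl

theorem linHom_conjPairs (D : Subgroup ((ZMod p)ˣ × (ZMod p)ˣ)) (h : AffLine p × AffLine p)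
    (g : fullPairs D) : linHom (conjPairs D h g).1 = linHom g.1 := by
  refine Prod.ext ?_ ?_
  · rw [linHom_fst, conjPairs_fst, conj_eq]
    rfl
  · rw [linHom_snd, conjPairs_snd, conj_eq]
    rfl

variable [Fact p.Prime]

/-- An abelian group of affine maps of exponent prime to `p` has a common fixed point: the fixed
point of any member with slope different from `1`. If all slopes are `1`, the maps are translations
killed by `2 q`, hence trivial. -/
theorem exists_fixedPoint [SafePair p q] {D : Type*} [CommGroup D] (f : D →* AffLine p)
    (hD : ∀ d : D, d ^ (2 * q) = 1) : ∃ v, ∀ d, (f d).b = (1 - (f d).a) * v := by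
  by_cases hg0 : ∃ e, (f e).a ≠ 1
  · obtain ⟨e, he⟩ := hg0
    have hne : (1 - (f e).a : ZMod p) ≠ 0 := fun h0 => he (Units.ext (sub_eq_zero.1 h0).symm)
    refine ⟨(f e).b / (1 - (f e).a), fun d => ?_⟩
    have h1 : f e * f d = f d * f e := by rw [← map_mul, mul_comm, map_mul]
    have h2 := congrArg AffLine.b h1
    simp only [mul_b] at h2
    field_simp
    linear_combination -h2
  · push Not at hg0
    refine ⟨0, fun d => ?_⟩
    have h1 : f d ^ (2 * q) = 1 := by rw [← map_pow, hD, map_one]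
    rw [eq_tr (hg0 d), tr_pow] at h1
    have h2 : ((2 * q : ℕ) : ZMod p) * (f d).b = 0 := congrArg AffLine.b h1
    push_cast at h2
    rw [two_mul_cast] at h2
    rw [mul_zero]
    linear_combination -h2

variable {D : Subgroup ((ZMod p)ˣ × (ZMod p)ˣ)}

/-- The linear maps in a group that contains all translations. -/
def linearSection (D : Subgroup ((ZMod p)ˣ × (ZMod p)ˣ)) : D →* fullPairs D where
  toFun d := ⟨(⟨0, d.1.1⟩, ⟨0, d.1.2⟩), d.2⟩
  map_one' := rfl
  map_mul' d e := Subtype.ext (Prod.ext (AffLine.ext (by simp) rfl) (AffLine.ext (by simp) rfl))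

theorem eq_fullTr_mul (g : fullPairs D) :
    g = fullTr D g.1.1.b g.1.2.b * linearSection D ⟨linHom g.1, g.2⟩ :=
  Subtype.ext (eq_trPair_mul g.1)

/-- On translations such an automorphism is a diagonal matrix `diag(t1, t2)`. The images of the
linear maps have a common fixed point `(v1, v2)`. The pair with slopes `t1`, `t2` and constant terms
`v1`, `v2` conjugates accordingly. -/
theorem exists_conjPairs (q : ℕ) [SafePair p q] {θ : fullPairs D ≃* fullPairs D}
    (hD : ∃ d ∈ D, d.1 ≠ d.2) (hθ : ∀ g, linHom (θ g).1 = linHom g.1) :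
    ∃ h, θ = conjPairs D h := by
  rcases fullPairs_equiv_cases θ hD with ⟨t1, t2, ht, -⟩ | h
  · have hDq : ∀ d : D, d ^ (2 * q) = 1 := fun d =>
      Subtype.ext (Prod.ext (pow_two_mul p q _) (pow_two_mul p q _))
    let σ : D →* AffLine p × AffLine p :=
      (fullPairs D).subtype.comp (θ.toMonoidHom.comp (linearSection D))
    have hσ : ∀ d : D, linHom (σ d) = d := fun d => hθ (linearSection D d)
    obtain ⟨v1, hv1⟩ := exists_fixedPoint (q := q) ((MonoidHom.fst _ _).comp σ) hDq
    obtain ⟨v2, hv2⟩ := exists_fixedPoint (q := q) ((MonoidHom.snd _ _).comp σ) hDq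
    refine ⟨(⟨v1, t1⟩, ⟨v2, t2⟩), MulEquiv.ext fun g => ?_⟩
    rw [eq_fullTr_mul g, map_mul, map_mul, ht]
    congr 1
    · refine Subtype.ext (Prod.ext ?_ ?_)
      · rw [conjPairs_fst, conj_eq]
        exact AffLine.ext (by simp [fullTr, trPair]) rfl
      · rw [conjPairs_snd, conj_eq]
        exact AffLine.ext (by simp [fullTr, trPair]) rfl
    · generalize (⟨linHom g.1, g.2⟩ : D) = d
      have h1 : (σ d).1.a = d.1.1 := congrArg Prod.fst (hσ d)
      have h2 : (σ d).2.a = d.1.2 := congrArg Prod.snd (hσ d)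
      have h3 : (σ d).1.b = (1 - (σ d).1.a) * v1 := hv1 d
      have h4 : (σ d).2.b = (1 - (σ d).2.a) * v2 := hv2 d
      refine Subtype.ext (Prod.ext ?_ ?_)
      · refine Eq.trans ?_ (conj_eq _ _).symm
        refine AffLine.ext (h3.trans ?_) h1
        rw [h1]
        simp [linearSection]
      · refine Eq.trans ?_ (conj_eq _ _).symm
        refine AffLine.ext (h4.trans ?_) h2
        rw [h2]
        simp [linearSection]
  · obtain ⟨d, hd, hne⟩ := hD
    have h1 := h (linearSection D ⟨d, hd⟩)
    rw [hθ] at h1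
    exact absurd (congrArg Prod.fst h1) hne

/-- The number of automorphisms that preserve the linear parts and the stabiliser of the
identity. -/
noncomputable def linAut (D : Subgroup ((ZMod p)ˣ × (ZMod p)ˣ)) : ℕ :=
  Nat.card {θ : fullPairs D ≃* fullPairs D //
    (∀ g, g.1.1 = g.1.2 ↔ (θ g).1.1 = (θ g).1.2) ∧ ∀ g, linHom (θ g).1 = linHom g.1}

/-- An automorphism acting antidiagonally on translations exchanges the entries of all slopes, which
is impossible if `D` is not closed under the exchange. -/
theorem predAut_fullPairs_of_not_swap (hD : ∃ d ∈ D, d.1 ≠ d.2) (hs : ∃ d ∈ D, d.swap ∉ D) :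
    predAut (fun g : fullPairs D => g.1.1 = g.1.2) = linAut D := by
  refine Nat.card_congr (Equiv.subtypeEquivRight fun θ => ⟨fun h => ⟨h, ?_⟩, And.left⟩)
  rcases fullPairs_equiv_cases θ hD with ⟨-, -, -, h'⟩ | h'
  · exact h'
  · obtain ⟨d, hd, hne⟩ := hs
    refine absurd ?_ hne
    have := h' (linearSection D ⟨d, hd⟩)
    rw [show linHom (linearSection D ⟨d, hd⟩).1 = d from rfl] at this
    rw [← this]
    exact (θ _).2

/-- The exchange of coordinates is itself an automorphism preserving the stabiliser. Composition
with it pairs the automorphisms that preserve slopes with those that exchange them, hence the factor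
`2`. -/
theorem predAut_fullPairs_of_swap (hD : ∃ d ∈ D, d.1 ≠ d.2) (hs : ∀ d ∈ D, d.swap ∈ D) :
    predAut (fun g : fullPairs D => g.1.1 = g.1.2) = 2 * linAut D := by
  let σ : fullPairs D ≃* fullPairs D :=
    { toFun := fun g => ⟨g.1.swap, hs _ g.2⟩
      invFun := fun g => ⟨g.1.swap, hs _ g.2⟩
      left_inv := fun _ => rfl
      right_inv := fun _ => rfl
      map_mul' := fun _ _ => rfl }
  have hσ : ∀ g, linHom (σ g).1 = (linHom g.1).swap := fun _ => rfl
  let T := {θ : fullPairs D ≃* fullPairs D //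
    (∀ g, g.1.1 = g.1.2 ↔ (θ g).1.1 = (θ g).1.2) ∧ ∀ g, linHom (θ g).1 = linHom g.1}
  let U := {θ : fullPairs D ≃* fullPairs D // ∀ g, g.1.1 = g.1.2 ↔ (θ g).1.1 = (θ g).1.2}
  have hfin : Finite (fullPairs D ≃* fullPairs D) :=
    Finite.of_injective (fun θ : fullPairs D ≃* fullPairs D => (θ : fullPairs D → fullPairs D))
      DFunLike.coe_injective
  have hsum : Nat.card (T ⊕ T) = 2 * linAut D := by
    rw [Nat.card_sum, ← two_mul]
    rfl
  rw [← hsum]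
  refine (Nat.card_congr (Equiv.ofBijective (Sum.elim (fun θ : T => (⟨θ.1, θ.2.1⟩ : U))
    (fun θ : T => (⟨θ.1.trans σ, fun g => (θ.2.1 g).trans eq_comm⟩ : U))) ⟨?_, ?_⟩)).symm
  · obtain ⟨d, hd, hne⟩ := hD
    have hno : ∀ θ θ' : T, θ.1 ≠ θ'.1.trans σ := by
      intro θ θ' h
      have h1 := θ.2.2 (linearSection D ⟨d, hd⟩)
      rw [h, MulEquiv.trans_apply, hσ, θ'.2.2] at h1
      exact hne (congrArg Prod.snd h1)
    rintro (θ | θ) (θ' | θ') h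
    · exact congrArg Sum.inl (Subtype.ext (congrArg (fun x : U => x.1) h))
    · exact absurd (congrArg (fun x : U => x.1) h) (hno θ θ')
    · exact absurd (congrArg (fun x : U => x.1) h).symm (hno θ' θ)
    · refine congrArg Sum.inr (Subtype.ext (MulEquiv.ext fun g => σ.injective ?_))
      exact DFunLike.congr_fun (congrArg (fun x : U => x.1) h) g
  · rintro ⟨θ, hθ⟩
    rcases fullPairs_equiv_cases θ hD with ⟨-, -, -, h'⟩ | h'
    · exact ⟨Sum.inl ⟨θ, hθ, h'⟩, rfl⟩
    · exact ⟨Sum.inr ⟨θ.trans σ, fun g => (hθ g).trans eq_comm, fun g => by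
        rw [MulEquiv.trans_apply, hσ, h', Prod.swap_swap]⟩, rfl⟩

/-- With a nontrivial scalar in `D`, the stabiliser contains the pairs `(g, g)` for `g` in a group
of affine maps with trivial centraliser. Conjugation by `(k, l)` preserves it only if `k = l`, and
`k` is then arbitrary. -/
theorem linAut_of_scalar (q : ℕ) [SafePair p q] (hD : ∃ d ∈ D, d.1 ≠ d.2) {s : (ZMod p)ˣ}
    (hs : (s, s) ∈ D) (hs1 : s ≠ 1) : linAut D = p * (p - 1) := by
  let S : Subgroup (ZMod p)ˣ := D.comap ((MonoidHom.id _).prod (MonoidHom.id _))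
  have hsS : s ∈ S := hs
  rw [← card_affLine]
  refine (Nat.card_congr (Equiv.ofBijective (fun k : AffLine p =>
    (⟨conjPairs D (k, k), fun g => ?_, linHom_conjPairs D _⟩ :
      {θ : fullPairs D ≃* fullPairs D //
        (∀ g, g.1.1 = g.1.2 ↔ (θ g).1.1 = (θ g).1.2) ∧ ∀ g, linHom (θ g).1 = linHom g.1}))
    ⟨?_, ?_⟩)).symm
  · rw [conjPairs_fst, conjPairs_snd, mul_left_inj, mul_right_inj]
  · intro k l h
    refine (inv_mul_eq_one.1 (eq_one_of_commute hsS hs1 fun g hg => ?_)).symm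
    have h1 : conjPairs D (k, k) ⟨(g, g), hg⟩ = conjPairs D (l, l) ⟨(g, g), hg⟩ :=
      DFunLike.congr_fun (congrArg Subtype.val h) _
    have h2 : k * g * k⁻¹ = l * g * l⁻¹ := congrArg (fun x => x.1.1) h1
    rw [mul_inv_eq_iff_eq_mul] at h2
    rw [mul_assoc, inv_mul_eq_iff_eq_mul, h2]
    group
  · rintro ⟨θ, hθ, hl⟩
    obtain ⟨⟨k, l⟩, rfl⟩ := exists_conjPairs q hD hl
    have : k = l := by
      refine (inv_mul_eq_one.1 (eq_one_of_commute hsS hs1 fun g hg => ?_)).symm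
      have h2 : k * g * k⁻¹ = l * g * l⁻¹ := (hθ ⟨(g, g), hg⟩).1 rfl
      rw [mul_inv_eq_iff_eq_mul] at h2
      rw [mul_assoc, inv_mul_eq_iff_eq_mul, h2]
      group
    subst this
    exact ⟨k, rfl⟩

/-- Conjugations of a group without scalar linear parts. -/
theorem conjPairs_pres_iff (h1 : ∀ s, (s, s) ∈ D → s = 1) (h : AffLine p × AffLine p) :
    (∀ g : fullPairs D, g.1.1 = g.1.2 ↔ (conjPairs D h g).1.1 = (conjPairs D h g).1.2) ↔
      h.1.a = h.2.a := by
  constructor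
  · intro hA
    -- Without scalars the stabiliser consists of the translations `(x, x)` alone, and conjugation
    -- preserves these exactly if the two slopes of `h` agree.
    have h2 := (hA (fullTr D 1 1)).1 rfl
    rw [conjPairs_fst, conjPairs_snd, conj_eq, conj_eq] at h2
    have h3 := congrArg AffLine.b h2
    exact Units.ext (by simpa [fullTr, trPair] using h3)
  · intro ha g
    rw [conjPairs_fst, conjPairs_snd, conj_eq, conj_eq, AffLine.ext_iff, AffLine.ext_iff, ha]
    refine and_congr_left fun hg => ?_
    change g.1.1.a = g.1.2.a at hg
    have h2 : (g.1.1.a, g.1.2.a) ∈ D := g.2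
    rw [hg] at h2
    rw [hg, h1 _ h2]
    simp

theorem conjPairs_congr {h k : AffLine p × AffLine p} (h1 : h.1.a = k.1.a) (h2 : h.2.a = k.2.a)
    (h3 : ∀ d ∈ D, (1 - d.1 : ZMod p) * h.1.b = (1 - d.1) * k.1.b)
    (h4 : ∀ d ∈ D, (1 - d.2 : ZMod p) * h.2.b = (1 - d.2) * k.2.b) :
    conjPairs D h = conjPairs D k := by
  refine MulEquiv.ext fun g => Subtype.ext (Prod.ext ?_ ?_)
  · have h5 : (1 - g.1.1.a : ZMod p) * h.1.b = (1 - g.1.1.a) * k.1.b := h3 _ g.2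
    rw [conjPairs_fst, conjPairs_fst, conj_eq, conj_eq, h1, h5]
  · have h5 : (1 - g.1.2.a : ZMod p) * h.2.b = (1 - g.1.2.a) * k.2.b := h4 _ g.2
    rw [conjPairs_snd, conjPairs_snd, conj_eq, conj_eq, h2, h5]

theorem conjPairs_fst_injective {h k : AffLine p × AffLine p} (hD : ∃ d ∈ D, d.1 ≠ 1)
    (heq : conjPairs D h = conjPairs D k) : h.1 = k.1 := by
  have h1 : ∀ g : fullPairs D, _ := fun g =>
    congrArg (fun x : fullPairs D => x.1.1) (DFunLike.congr_fun heq g)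
  simp only [conjPairs_fst, conj_eq] at h1
  obtain ⟨d, hd, hne⟩ := hD
  have hne' : (1 - d.1 : ZMod p) ≠ 0 := fun h0 => hne (Units.ext (sub_eq_zero.1 h0).symm)
  have h2 := congrArg AffLine.b (h1 (fullTr D 1 1))
  have h3 := congrArg AffLine.b (h1 (linearSection D ⟨d, hd⟩))
  refine AffLine.ext (mul_left_cancel₀ hne' ?_) (Units.ext ?_)
  · simpa [linearSection] using h3
  · simpa [fullTr, trPair] using h2

theorem conjPairs_snd_injective {h k : AffLine p × AffLine p} (hD : ∃ d ∈ D, d.2 ≠ 1)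
    (heq : conjPairs D h = conjPairs D k) : h.2 = k.2 := by
  have h1 : ∀ g : fullPairs D, _ := fun g =>
    congrArg (fun x : fullPairs D => x.1.2) (DFunLike.congr_fun heq g)
  simp only [conjPairs_snd, conj_eq] at h1
  obtain ⟨d, hd, hne⟩ := hD
  have hne' : (1 - d.2 : ZMod p) ≠ 0 := fun h0 => hne (Units.ext (sub_eq_zero.1 h0).symm)
  have h2 := congrArg AffLine.b (h1 (fullTr D 1 1))
  have h3 := congrArg AffLine.b (h1 (linearSection D ⟨d, hd⟩))
  refine AffLine.ext (mul_left_cancel₀ hne' ?_) (Units.ext ?_)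
  · simpa [linearSection] using h3
  · simpa [fullTr, trPair] using h2

/-- The conjugating pair has two free constant terms and one common slope, and all of these are
visible since both coordinates have nontrivial slopes. -/
theorem linAut_of_snd_ne (q : ℕ) [SafePair p q] (hD : ∃ d ∈ D, d.1 ≠ d.2)
    (h1 : ∀ s, (s, s) ∈ D → s = 1) (h2 : ∃ d ∈ D, d.1 ≠ 1) (h3 : ∃ d ∈ D, d.2 ≠ 1) :
    linAut D = p ^ 2 * (p - 1) := by
  have hcard : Nat.card (ZMod p × ZMod p × (ZMod p)ˣ) = p ^ 2 * (p - 1) := by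
    rw [Nat.card_prod, Nat.card_prod, Nat.card_zmod, Nat.card_eq_fintype_card, ZMod.card_units]
    ring
  rw [← hcard]
  refine (Nat.card_congr (Equiv.ofBijective (fun k : ZMod p × ZMod p × (ZMod p)ˣ =>
    (⟨conjPairs D (⟨k.1, k.2.2⟩, ⟨k.2.1, k.2.2⟩), (conjPairs_pres_iff h1 _).2 rfl,
      linHom_conjPairs D _⟩ : {θ : fullPairs D ≃* fullPairs D //
        (∀ g, g.1.1 = g.1.2 ↔ (θ g).1.1 = (θ g).1.2) ∧ ∀ g, linHom (θ g).1 = linHom g.1}))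
    ⟨?_, ?_⟩)).symm
  · rintro ⟨v1, v2, t⟩ ⟨w1, w2, s⟩ h
    have h4 := conjPairs_fst_injective h2 (congrArg Subtype.val h)
    have h5 := conjPairs_snd_injective h3 (congrArg Subtype.val h)
    exact Prod.ext (congrArg AffLine.b h4) (Prod.ext (congrArg AffLine.b h5)
      (congrArg AffLine.a h4))
  · rintro ⟨θ, hθ, hl⟩
    obtain ⟨⟨⟨v1, t1⟩, ⟨v2, t2⟩⟩, rfl⟩ := exists_conjPairs q hD hl
    obtain rfl : t1 = t2 := (conjPairs_pres_iff h1 _).1 hθ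
    exact ⟨(v1, v2, t1), rfl⟩

/-- When all second slopes are `1`, conjugating by a translation in the second coordinate does
nothing. One factor `p` is lost, which is why the row `u = 0` stands apart. -/
theorem linAut_of_snd_eq (q : ℕ) [SafePair p q] (hD : ∃ d ∈ D, d.1 ≠ d.2)
    (h1 : ∀ s, (s, s) ∈ D → s = 1) (h2 : ∃ d ∈ D, d.1 ≠ 1) (h3 : ∀ d ∈ D, d.2 = 1) :
    linAut D = p * (p - 1) := by
  rw [← card_affLine]
  refine (Nat.card_congr (Equiv.ofBijective (fun k : AffLine p =>
    (⟨conjPairs D (k, ⟨0, k.a⟩), (conjPairs_pres_iff h1 _).2 rfl,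
      linHom_conjPairs D _⟩ : {θ : fullPairs D ≃* fullPairs D //
        (∀ g, g.1.1 = g.1.2 ↔ (θ g).1.1 = (θ g).1.2) ∧ ∀ g, linHom (θ g).1 = linHom g.1}))
    ⟨?_, ?_⟩)).symm
  · intro k l h
    exact conjPairs_fst_injective h2 (congrArg Subtype.val h)
  · rintro ⟨θ, hθ, hl⟩
    obtain ⟨⟨k, l⟩, rfl⟩ := exists_conjPairs q hD hl
    have ha : k.a = l.a := (conjPairs_pres_iff h1 _).1 hθ
    refine ⟨k, Subtype.ext (conjPairs_congr rfl ha (fun _ _ => rfl) fun d hd => ?_)⟩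
    rw [h3 d hd]
    simp

variable [SafePair p q]

theorem eq_one_of_scalar_mem_diagU {u : ℕ} {s : (ZMod p)ˣ} (h : (s, s) ∈ diagU p q u) :
    s = 1 := by
  obtain ⟨z, -, h⟩ := mem_diagU.1 h
  have h1 : s = z ^ (u + 1) := congrArg Prod.fst h
  have h2 : s = z ^ u := congrArg Prod.snd h
  rw [h2, pow_succ] at h1
  have hz : z = 1 := by simpa using h1
  rw [h2, hz, one_pow]

theorem diagU_exists_fst_ne {u : ℕ} (hu : u < q - 1) : ∃ d ∈ diagU p q u, d.1 ≠ 1 := by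
  obtain ⟨z, hz, hz1⟩ := exists_root p q
  refine ⟨_, mem_diagU.2 ⟨z, hz, rfl⟩, fun h => ?_⟩
  change z ^ (u + 1) = 1 at h
  rw [pow_eq_one_iff hz hz1] at h
  exact absurd (Nat.le_of_dvd (by omega) h) (by omega)

theorem linAut_diagU {u : ℕ} (hu : u < q - 1) :
    linAut (diagU p q u) = if u = 0 then p * (p - 1) else p ^ 2 * (p - 1) := by
  have h1 : ∀ s : (ZMod p)ˣ, (s, s) ∈ diagU p q u → s = 1 := fun s =>
    eq_one_of_scalar_mem_diagU
  split_ifs with h0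
  · subst h0
    refine linAut_of_snd_eq q (exists_diagU_ne 0) h1 (diagU_exists_fst_ne hu) fun d hd => ?_
    obtain ⟨z, -, rfl⟩ := mem_diagU.1 hd
    exact pow_zero z
  · exact linAut_of_snd_ne q (exists_diagU_ne u) h1 (diagU_exists_fst_ne hu)
      (diagU_exists_snd_ne (by omega) (by omega))

/-- The middle value is the fixed point of `u ↦ q - 1 - u`, so the exchange of coordinates is a
symmetry of this group. -/
theorem diagU_swap_mid {d : (ZMod p)ˣ × (ZMod p)ˣ} (hd : d ∈ diagU p q ((q - 1) / 2)) :
    d.swap ∈ diagU p q ((q - 1) / 2) := by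
  obtain ⟨k, hk⟩ := SafePair.odd p q
  have := (mem_diagU_swap (p := p) (q := q) (u := (q - 1) / 2) (by omega) d.swap).2
    (by simpa using hd)
  rwa [show q - 1 - (q - 1) / 2 = (q - 1) / 2 by omega] at this

theorem exists_swap_notMem {u : ℕ} (hu : u < (q + 1) / 2) (hne : u ≠ (q - 1) / 2) :
    ∃ d ∈ diagU p q u, d.swap ∉ withNeg (diagU p q u) := by
  by_contra! h
  have h1 : diagU p q (q - 1 - u) ≤ withNeg (diagU p q u) := fun d hd => by
    simpa using h _ ((mem_diagU_swap (show u < q by omega) d).1 hd)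
  have h2 := diagU_le_withNeg (p := p) (q := q) (by omega) (by omega) h1
  omega

theorem neg_one_mem_withNeg (D : Subgroup ((ZMod p)ˣ × (ZMod p)ˣ)) :
    ((-1, -1) : (ZMod p)ˣ × (ZMod p)ˣ) ∈ withNeg D :=
  mem_withNeg.2 (Or.inr (by
    rw [show -((-1, -1) : (ZMod p)ˣ × (ZMod p)ˣ) = 1 from Prod.ext (neg_neg 1) (neg_neg 1)]
    exact one_mem _))

theorem predAut_rep (r : TableRow q) :
    predAut (fun g : r.rep p => g.1.1 = g.1.2) = r.numAut p := by
  have h3 := SafePair.three_le p (q := q)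
  obtain ⟨z, hz, hz1⟩ := exists_root p q
  have hall : ∃ d ∈ diagAll p q, d.1 ≠ d.2 := ⟨(z, 1), ⟨hz, one_mem _⟩, hz1⟩
  have hall' : ∃ d ∈ withNeg (diagAll p q), d.1 ≠ d.2 := ⟨(z, 1),
    le_withNeg _ ⟨hz, one_mem _⟩, hz1⟩
  have hsw : ∀ d ∈ diagAll p q, d.swap ∈ diagAll p q := fun d hd => ⟨hd.2, hd.1⟩
  have hneg : ∀ {D : Subgroup ((ZMod p)ˣ × (ZMod p)ˣ)}, (∀ d ∈ D, d.swap ∈ D) →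
      ∀ d ∈ withNeg D, d.swap ∈ withNeg D := fun h d hd =>
    mem_withNeg.2 ((mem_withNeg.1 hd).imp (h _) (h _))
  have hU : ∀ u, ∃ d ∈ withNeg (diagU p q u), d.1 ≠ d.2 := fun u => by
    obtain ⟨d, hd, hne⟩ := exists_diagU_ne (p := p) (q := q) u
    exact ⟨d, le_withNeg _ hd, hne⟩
  cases r with
  | p2q2 =>
    refine (predAut_fullPairs_of_swap hall hsw).trans ?_
    rw [linAut_of_scalar q hall (s := z) ⟨hz, hz⟩ hz1]
    exact (mul_assoc _ _ _).symm
  | two_p2q2 =>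
    refine (predAut_fullPairs_of_swap hall' (hneg hsw)).trans ?_
    rw [linAut_of_scalar q hall' (s := z) (le_withNeg _ ⟨hz, hz⟩) hz1]
    exact (mul_assoc _ _ _).symm
  | p2q u =>
    obtain ⟨u, hu⟩ := u
    change _ = if u = 0 then _ else if u = _ then _ else _
    by_cases hmid : u = (q - 1) / 2
    · refine (predAut_fullPairs_of_swap (exists_diagU_ne u) ?_).trans ?_
      · subst hmid
        exact fun d hd => diagU_swap_mid hd
      · change 2 * linAut (diagU p q u) = _
        rw [linAut_diagU (by omega), if_neg (by omega), if_neg (by omega), if_pos hmid]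
        ring
    · obtain ⟨d, hd, hd'⟩ := exists_swap_notMem (p := p) hu hmid
      refine (predAut_fullPairs_of_not_swap (exists_diagU_ne u)
        ⟨d, hd, fun h => hd' (le_withNeg _ h)⟩).trans ?_
      change linAut (diagU p q u) = _
      rw [linAut_diagU (by omega), if_neg hmid]
  | two_p2q u =>
    obtain ⟨u, hu⟩ := u
    change _ = if u = _ then _ else _
    have hlin : linAut (withNeg (diagU p q u)) = p * (p - 1) :=
      linAut_of_scalar q (hU u) (neg_one_mem_withNeg _) (neg_one_ne p q)
    split_ifs with hmid
    · refine (predAut_fullPairs_of_swap (hU u) (hneg ?_)).trans ?_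
      · subst hmid
        exact fun d hd => diagU_swap_mid hd
      · change 2 * linAut (withNeg (diagU p q u)) = _
        rw [hlin]
        ring
    · obtain ⟨d, hd, hd'⟩ := exists_swap_notMem (p := p) hu hmid
      exact (predAut_fullPairs_of_not_swap (hU u) ⟨d, le_withNeg _ hd, hd'⟩).trans hlin
  | pq2 =>
    obtain ⟨φ, hφ⟩ := exists_type_two (mem_diagAll_iff (p := p) (q := q))
    exact (predAut_congr φ hφ).trans (predAut_prod _)
  | two_pq2 =>
    obtain ⟨φ, hφ⟩ := exists_type_two (mem_withNeg_diagAll_iff (p := p) (q := q))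
    exact (predAut_congr φ hφ).trans (predAut_prod _)
  | pq_nonabelian =>
    obtain ⟨φ, hφ⟩ := exists_equiv_diagU (p := p) (q := q) (u := 0) (by omega)
    exact (predAut_congr φ hφ).trans predAut_nonabelian
  | pq_cyclic =>
    obtain ⟨φ, hφ⟩ := exists_type_two (mem_diagU_sub_one_iff (p := p) (q := q))
    exact (predAut_congr φ hφ).trans (predAut_prod _)
  | two_pq_frobenius =>
    obtain ⟨φ, hφ⟩ := exists_equiv_withNeg_diagU (p := p) (q := q) (u := 0) (by omega)
    exact (predAut_congr φ hφ).trans (predAut_frobenius q)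
  | two_pq_dihedral =>
    obtain ⟨φ, hφ⟩ := exists_type_two (mem_withNeg_diagU_sub_one_iff (p := p) (q := q))
    exact (predAut_congr φ hφ).trans (predAut_prod _)

end FullAut

/-! ### Regular normal subgroups of the groups in the table -/

section RegularPairs

open AffLine SafePair TableRow

variable {p q : ℕ}

/-- The group `P` of pairs of affine maps has a normal subgroup that is regular on `C_p ⋊ C_q`. -/
def HasRegularNormalPairs (q : ℕ) (P : Subgroup (AffLine p × AffLine p)) : Prop :=
  ∃ C ≤ P, (∀ g ∈ P, ∀ c ∈ C, g * c * g⁻¹ ∈ C) ∧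
    ∀ n m : AffLine p, n.a ∈ rootsOfUnity q (ZMod p) → m.a ∈ rootsOfUnity q (ZMod p) →
      ∃! c, c ∈ C ∧ c.1 * n = m * c.2

/-- The copy `N × 1`, acting by left translations, is regular; it is normal because conjugation by
affine maps preserves slopes. -/
theorem hasRegularNormalPairs_of_fst {P : Subgroup (AffLine p × AffLine p)}
    (h : ∀ g : AffLine p, g.a ∈ rootsOfUnity q (ZMod p) → (g, 1) ∈ P) :
    HasRegularNormalPairs q P := by
  refine ⟨(withLinear (rootsOfUnity q (ZMod p))).prod ⊥, ?_, ?_, fun n m hn hm => ?_⟩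
  · rintro ⟨g, k⟩ ⟨hg, hk⟩
    obtain rfl : k = 1 := hk
    exact h g hg
  · rintro g - ⟨c, d⟩ ⟨hc, hd⟩
    obtain rfl : d = 1 := hd
    refine ⟨?_, ?_⟩
    · change (g.1 * c * g.1⁻¹).a ∈ rootsOfUnity q (ZMod p)
      rw [conj_eq]
      exact hc
    · change g.2 * 1 * g.2⁻¹ = 1
      simp
  · refine ⟨(m * n⁻¹, 1), ⟨⟨?_, rfl⟩, by simp⟩, ?_⟩
    · change m.a * n.a⁻¹ ∈ rootsOfUnity q (ZMod p)
      exact mul_mem hm (inv_mem hn)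
    · rintro ⟨c, d⟩ ⟨⟨-, hd⟩, hcd⟩
      obtain rfl : d = 1 := hd
      exact Prod.ext (eq_mul_inv_of_mul_eq (by simpa using hcd)) rfl

/-- The subgroup combines all translations in the first coordinate with the homotheties of slope in
`μ_q` in the second. It is normal since all second maps are homotheties about `0` and commute. -/
theorem hasRegularNormalPairs_linePairs {D : Subgroup ((ZMod p)ˣ × (ZMod p)ˣ)}
    (hD : ∀ s ∈ rootsOfUnity q (ZMod p), (1, s) ∈ D) :
    HasRegularNormalPairs q (linePairs D 0) := by
  let B : Subgroup ((ZMod p)ˣ × (ZMod p)ˣ) := (⊥ : Subgroup (ZMod p)ˣ).prod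
    (rootsOfUnity q (ZMod p))
  have hB : ∀ {c}, c ∈ linePairs B 0 ↔ c.1.a = 1 ∧ c.2.a ∈ rootsOfUnity q (ZMod p) ∧
      c.2.b = 0 := by
    intro c
    rw [mem_linePairs, mul_zero, ← and_assoc]
    rfl
  refine ⟨linePairs B 0, ?_, ?_, fun n m hn hm => ?_⟩
  · intro c hc
    obtain ⟨h1, h2, h3⟩ := hB.1 hc
    refine mem_linePairs.2 ⟨?_, by rw [h3, mul_zero]⟩
    rw [h1]
    exact hD _ h2
  · intro g hg c hc
    obtain ⟨h1, h2, h3⟩ := hB.1 hc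
    have h4 := (mem_linePairs.1 hg).2
    rw [mul_zero] at h4
    rw [hB]
    rw [Prod.fst_mul, Prod.fst_mul, Prod.snd_mul, Prod.snd_mul, Prod.fst_inv, Prod.snd_inv,
      conj_eq, conj_eq]
    refine ⟨h1, h2, ?_⟩
    simp [h3, h4]
  · refine ⟨(m * ⟨0, n.a / m.a⟩ * n⁻¹, ⟨0, n.a / m.a⟩), ⟨hB.2 ⟨?_, ?_, rfl⟩, ?_⟩, ?_⟩
    · change m.a * (n.a / m.a) * n.a⁻¹ = 1
      rw [mul_div_cancel, mul_inv_cancel]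
    · exact div_mem hn hm
    · exact inv_mul_cancel_right _ _
    · rintro ⟨c, d⟩ ⟨hc, hcd⟩
      obtain ⟨h1, h2, h3⟩ := hB.1 hc
      change c * n = m * d at hcd
      have h4 := congrArg AffLine.a hcd
      change c.a * n.a = m.a * d.a at h4
      rw [show c.a = 1 from h1, one_mul] at h4
      obtain rfl : d = ⟨0, n.a / m.a⟩ := AffLine.ext h3 (eq_div_of_mul_eq' (by rw [h4, mul_comm]))
      exact Prod.ext (eq_mul_inv_of_mul_eq hcd) rfl

/-- A regular normal subgroup `C` contains an element carrying `1` to the homothety of slope `s`.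
Its square has both slopes different from `1`, so commutators of the square with translations fill
the whole plane. Then `C` contains the translation `(1, 1)`, which fixes the identity. -/
theorem not_hasRegularNormalPairs [Fact p.Prime] {D : Subgroup ((ZMod p)ˣ × (ZMod p)ˣ)}
    {s : (ZMod p)ˣ} (hs : s ∈ rootsOfUnity q (ZMod p))
    (hD : ∀ d ∈ D, d.1 = s * d.2 → d.1 ^ 2 ≠ 1 ∧ d.2 ^ 2 ≠ 1) :
    ¬ HasRegularNormalPairs q (fullPairs D) := by
  rintro ⟨C, hC, hn, hreg⟩
  obtain ⟨c, ⟨hc, hc'⟩, -⟩ := hreg 1 ⟨0, s⟩ (one_mem _) hs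
  obtain ⟨h1, h2⟩ := hD _ (hC hc) (by simpa using congrArg AffLine.a hc')
  have hne : ∀ {a : (ZMod p)ˣ}, a ≠ 1 → (1 - a : ZMod p) ≠ 0 := fun h h0 =>
    h (Units.ext (sub_eq_zero.1 h0).symm)
  set e := c ^ 2 with he
  have hee : e ∈ C := pow_mem hc 2
  have h1' : (1 - e.1.a : ZMod p) ≠ 0 := hne (by rw [he, Prod.pow_fst, pow_a]; exact h1)
  have h2' : (1 - e.2.a : ZMod p) ≠ 0 := hne (by rw [he, Prod.pow_snd, pow_a]; exact h2)
  have key : ∀ x y : ZMod p, trPair ((1 - (e.1.a : ZMod p)) * x) ((1 - (e.2.a : ZMod p)) * y) ∈ C := by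
    intro x y
    have h3 : trPair x y * e * (trPair x y)⁻¹ * e⁻¹ ∈ C :=
      mul_mem (hn _ (show trPair x y ∈ fullPairs D from D.one_mem) _ hee) (inv_mem hee)
    convert h3 using 1
    rw [eq_mul_inv_iff_mul_eq]
    refine Prod.ext ?_ ?_
    · change _ = (tr x) * e.1 * (tr x)⁻¹
      rw [conj_eq]
      refine AffLine.ext ?_ ?_
      · simp [trPair]
        ring
      · simp [trPair]
    · change _ = (tr y) * e.2 * (tr y)⁻¹
      rw [conj_eq]
      refine AffLine.ext ?_ ?_
      · simp [trPair]
        ring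
      · simp [trPair]
  have h3 := key (1 - e.1.a : ZMod p)⁻¹ (1 - e.2.a : ZMod p)⁻¹
  rw [mul_inv_cancel₀ h1', mul_inv_cancel₀ h2'] at h3
  have h4 := (hreg 1 1 (one_mem _) (one_mem _)).unique ⟨h3, by simp [trPair]⟩ ⟨one_mem C, by simp⟩
  exact one_ne_zero (congrArg (fun g => g.1.b) h4)

variable [Fact p.Prime] [SafePair p q]

theorem not_hasRegularNormalPairs_withNeg {u : ℕ} (hu : 0 < u) (hu' : u < (q + 1) / 2)
    {D : Subgroup ((ZMod p)ˣ × (ZMod p)ˣ)} (hD : D ≤ withNeg (diagU p q u)) :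
    ¬ HasRegularNormalPairs q (fullPairs D) := by
  have h3 := SafePair.three_le p (q := q)
  obtain ⟨z, hz, hz1⟩ := exists_root p q
  refine not_hasRegularNormalPairs hz fun d hd hd' => ?_
  obtain ⟨w, hw, h⟩ : ∃ w ∈ rootsOfUnity q (ZMod p), d = (w ^ (u + 1), w ^ u) ∨
      d = (-w ^ (u + 1), -w ^ u) := by
    rcases mem_withNeg.1 (hD hd) with h | h
    · obtain ⟨w, hw, h⟩ := mem_diagU.1 h
      exact ⟨w, hw, Or.inl h⟩
    · obtain ⟨w, hw, h⟩ := mem_diagU.1 h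
      exact ⟨w, hw, Or.inr (neg_eq_iff_eq_neg.1 h)⟩
  -- Squaring removes the sign, and the prescribed quotient of the slopes forces `w = z`.
  have hsq : d.1 ^ 2 = w ^ ((u + 1) * 2) ∧ d.2 ^ 2 = w ^ (u * 2) ∧ w = z := by
    rcases h with rfl | rfl
    · refine ⟨(pow_mul _ _ _).symm, (pow_mul _ _ _).symm, ?_⟩
      change w ^ (u + 1) = z * w ^ u at hd'
      rw [pow_succ'] at hd'
      exact mul_right_cancel hd'
    · refine ⟨(neg_sq _).trans (pow_mul _ _ _).symm, (neg_sq _).trans (pow_mul _ _ _).symm, ?_⟩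
      change -w ^ (u + 1) = z * -w ^ u at hd'
      rw [pow_succ', mul_neg, neg_inj] at hd'
      exact mul_right_cancel hd'
  obtain ⟨h1, h2, rfl⟩ := hsq
  have key : ∀ k, 0 < k → k < q → w ^ (k * 2) ≠ 1 := by
    intro k hk hk' h
    rw [pow_eq_one_iff hz hz1, (SafePair.prime p).dvd_mul] at h
    rcases h with h | h
    · exact absurd (Nat.le_of_dvd hk h) (by omega)
    · exact absurd (Nat.le_of_dvd two_pos h) (by omega)
  rw [h1, h2]
  exact ⟨key _ (by omega) (by omega), key _ hu (by omega)⟩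

theorem hasRegularNormalPairs_rep (r : TableRow q) :
    HasRegularNormalPairs q (r.rep p) ↔ r.IsACG := by
  have hq := SafePair.pos p q
  have hU : ∀ s ∈ rootsOfUnity q (ZMod p), (s, (1 : (ZMod p)ˣ)) ∈ diagU p q 0 := fun s hs =>
    mem_diagU.2 ⟨s, hs, Prod.ext (pow_one s).symm (pow_zero s).symm⟩
  have hU' : ∀ s ∈ rootsOfUnity q (ZMod p), ((1 : (ZMod p)ˣ), s) ∈ diagU p q (q - 1) := by
    intro s hs
    rw [mem_diagU_sub_one_iff]
    refine ⟨rfl, ?_⟩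
    rw [one_div]
    exact inv_mem hs
  have hA : ∀ s ∈ rootsOfUnity q (ZMod p), (s, (1 : (ZMod p)ˣ)) ∈ diagAll p q := fun s hs =>
    ⟨hs, one_mem _⟩
  have hfull : ∀ {D : Subgroup ((ZMod p)ˣ × (ZMod p)ˣ)},
      (∀ s ∈ rootsOfUnity q (ZMod p), (s, (1 : (ZMod p)ˣ)) ∈ D) →
      HasRegularNormalPairs q (fullPairs D) := fun h =>
    hasRegularNormalPairs_of_fst fun g hg => h _ hg
  have hline : ∀ {D : Subgroup ((ZMod p)ˣ × (ZMod p)ˣ)},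
      (∀ s ∈ rootsOfUnity q (ZMod p), (s, (1 : (ZMod p)ˣ)) ∈ D) →
      HasRegularNormalPairs q (linePairs D 0) := fun h =>
    hasRegularNormalPairs_of_fst fun g hg => ⟨h _ hg, by simp⟩
  cases r with
  | p2q2 => exact iff_of_true (hfull hA) trivial
  | two_p2q2 => exact iff_of_true (hfull fun s hs => le_withNeg _ (hA s hs)) trivial
  | p2q u =>
    obtain ⟨u, hu⟩ := u
    change _ ↔ u = 0
    rcases Nat.eq_zero_or_pos u with rfl | h
    · exact iff_of_true (hfull hU) rfl
    · exact iff_of_false (not_hasRegularNormalPairs_withNeg h hu (le_withNeg _)) h.ne'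
  | two_p2q u =>
    obtain ⟨u, hu⟩ := u
    change _ ↔ u = 0
    rcases Nat.eq_zero_or_pos u with rfl | h
    · exact iff_of_true (hfull fun s hs => le_withNeg _ (hU s hs)) rfl
    · exact iff_of_false (not_hasRegularNormalPairs_withNeg h hu le_rfl) h.ne'
  | pq2 => exact iff_of_true (hline hA) trivial
  | two_pq2 => exact iff_of_true (hline fun s hs => le_withNeg _ (hA s hs)) trivial
  | pq_nonabelian => exact iff_of_true (hline hU) trivial
  | pq_cyclic => exact iff_of_true (hasRegularNormalPairs_linePairs hU') trivial
  | two_pq_frobenius => exact iff_of_true (hline fun s hs => le_withNeg _ (hU s hs)) trivial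
  | two_pq_dihedral =>
    exact iff_of_true (hasRegularNormalPairs_linePairs fun s hs => le_withNeg _ (hU' s hs)) trivial

end RegularPairs

/-! ### The holomorph of `C_p ⋊ C_q` as a group of pairs of affine maps -/

section Bridge

open AffLine SafePair TableRow

variable {p q : ℕ}

/-- An embedding of the holomorph into the group of pairs of affine maps that carries its action
to `n ↦ g₁ n g₂⁻¹`. -/
structure HolEmbedding (p q : ℕ) where
  hom : Hol (CpSemi p q) →* AffLine p × AffLine p
  injective : Function.Injective hom
  range_eq : hom.range = holPairs p q
  semiVal_smul : ∀ (h : Hol (CpSemi p q)) (n : CpSemi p q),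
    semiVal (h • n) = (hom h).1 * semiVal n * (hom h).2⁻¹

theorem nonempty_holEmbedding (p q : ℕ) [Fact p.Prime] [SafePair p q] :
    Nonempty (HolEmbedding p q) := by
  obtain ⟨z, hz, hz1⟩ := exists_root p q
  obtain ⟨ι, h1, h2, h3⟩ := exists_hol_embedding hz hz1
  exact ⟨ι, h1, h2, h3⟩

theorem card_semi (p q : ℕ) [Fact p.Prime] [SafePair p q] : Nat.card (CpSemi p q) = p * q := by
  rw [Nat.card_congr (semiEquiv p q).toEquiv, card_withLinear, card_roots]

namespace HolEmbedding

variable [Fact p.Prime] (E : HolEmbedding p q) {M M' : Subgroup (Hol (CpSemi p q))}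

theorem smul_eq_iff (h : Hol (CpSemi p q)) (n m : CpSemi p q) :
    h • n = m ↔ (E.hom h).1 * semiVal n = semiVal m * (E.hom h).2 := by
  rw [← semiVal_injective.eq_iff, E.semiVal_smul, mul_inv_eq_iff_eq_mul]

theorem smul_one_iff (h : Hol (CpSemi p q)) :
    h • (1 : CpSemi p q) = 1 ↔ (E.hom h).1 = (E.hom h).2 := by
  rw [E.smul_eq_iff, semiVal_one, mul_one, one_mul]

theorem map_comap {P : Subgroup (AffLine p × AffLine p)} (hP : P ≤ holPairs p q) :
    (P.comap E.hom).map E.hom = P :=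
  Subgroup.map_comap_eq_self (by rwa [E.range_eq])

theorem comap_map (M : Subgroup (Hol (CpSemi p q))) : (M.map E.hom).comap E.hom = M :=
  Subgroup.comap_map_eq_self_of_injective E.injective M

theorem map_le (M : Subgroup (Hol (CpSemi p q))) : M.map E.hom ≤ holPairs p q := by
  rw [← E.range_eq]
  exact Subgroup.map_le_range E.hom M

theorem isPretransitive_iff :
    MulAction.IsPretransitive M (CpSemi p q) ↔ IsTransPairs q (M.map E.hom) := by
  constructor
  · intro h n hn
    obtain ⟨m, rfl⟩ := exists_semiVal hn
    obtain ⟨g, hg⟩ := h.exists_smul_eq 1 m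
    refine ⟨_, ⟨g, g.2, rfl⟩, ?_⟩
    have := (E.smul_eq_iff g 1 m).1 hg
    rwa [semiVal_one, mul_one] at this
  · intro h
    have key : ∀ m : CpSemi p q, ∃ g : M, g • (1 : CpSemi p q) = m := by
      intro m
      obtain ⟨_, ⟨g, hg, rfl⟩, hgm⟩ := h (semiVal m) (semiVal_a m)
      exact ⟨⟨g, hg⟩, (E.smul_eq_iff g 1 m).2 (by rw [semiVal_one, mul_one, hgm])⟩
    refine ⟨fun a b => ?_⟩
    obtain ⟨g, rfl⟩ := key a
    obtain ⟨k, rfl⟩ := key b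
    exact ⟨k * g⁻¹, by rw [mul_smul, inv_smul_smul]⟩

/-- A group of permutations of `C_p ⋊ C_q` as a group of pairs. -/
noncomputable def mapEquiv (M : Subgroup (Hol (CpSemi p q))) : M ≃* M.map E.hom :=
  M.equivMapOfInjective E.hom E.injective

theorem mapEquiv_smul_one (g : M) :
    g • (1 : CpSemi p q) = 1 ↔ (E.mapEquiv M g).1.1 = (E.mapEquiv M g).1.2 :=
  E.smul_one_iff g

theorem permIso_of_stabIso (hM : MulAction.IsPretransitive M (CpSemi p q))
    (hM' : MulAction.IsPretransitive M' (CpSemi p q))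
    (h : StabIso (M.map E.hom) (M'.map E.hom)) :
    PermIso M (CpSemi p q) M' (CpSemi p q) := by
  obtain ⟨φ, hφ⟩ := h
  refine permIso_of_stabilizer hM hM' (((E.mapEquiv M).trans φ).trans (E.mapEquiv M').symm) 1 1
    fun g => ?_
  rw [E.mapEquiv_smul_one, E.mapEquiv_smul_one, hφ]
  simp

theorem cardAutStab_one (M : Subgroup (Hol (CpSemi p q))) :
    cardAutStab M (1 : CpSemi p q) = predAut (fun g : M.map E.hom => g.1.1 = g.1.2) := by
  rw [cardAutStab_eq_card]
  exact predAut_congr (A := fun g : M => g • (1 : CpSemi p q) = 1) (E.mapEquiv M)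
    E.mapEquiv_smul_one

theorem hasRegularNormal_iff :
    HasRegularNormal M (CpSemi p q) ↔ HasRegularNormalPairs q (M.map E.hom) := by
  constructor
  · rintro ⟨C, hC, hreg⟩
    refine ⟨(C.map M.subtype).map E.hom, Subgroup.map_mono (Subgroup.map_subtype_le C), ?_, ?_⟩
    · rintro _ ⟨g, hg, rfl⟩ _ ⟨_, ⟨c, hc, rfl⟩, rfl⟩
      refine ⟨_, ⟨_, hC.conj_mem c hc ⟨g, hg⟩, rfl⟩, ?_⟩
      simp
    · intro n m hn hm
      obtain ⟨n, rfl⟩ := exists_semiVal hn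
      obtain ⟨m, rfl⟩ := exists_semiVal hm
      obtain ⟨c, hc, hu⟩ := hreg n m
      refine ⟨_, ⟨⟨_, ⟨c, c.2, rfl⟩, rfl⟩, (E.smul_eq_iff _ n m).1 hc⟩, ?_⟩
      rintro _ ⟨⟨_, ⟨d, hd, rfl⟩, rfl⟩, h⟩
      rw [← hu ⟨d, hd⟩ ((E.smul_eq_iff _ n m).2 h)]
  · rintro ⟨C, hCM, hC, hreg⟩
    have hmem : ∀ c ∈ C, ∃ g ∈ M, E.hom g = c := fun c hc => hCM hc
    refine ⟨C.comap (E.hom.comp M.subtype), ⟨fun c hc g => ?_⟩, fun n m => ?_⟩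
    · rw [Subgroup.mem_comap, map_mul, map_mul, map_inv]
      exact hC _ ⟨g, g.2, rfl⟩ _ hc
    · obtain ⟨c, ⟨hc, hc'⟩, hu⟩ := hreg _ _ (semiVal_a n) (semiVal_a m)
      obtain ⟨g, hg, rfl⟩ := hmem c hc
      refine ⟨⟨⟨g, hg⟩, hc⟩, (E.smul_eq_iff g n m).2 hc', ?_⟩
      rintro ⟨⟨k, hk⟩, hkC⟩ h
      have h1 := hu (E.hom k) ⟨hkC, (E.smul_eq_iff k n m).1 h⟩
      exact Subtype.ext (Subtype.ext (E.injective h1))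

variable [SafePair p q]

/-- The degree `p q` is the index of a stabiliser and divides the order, which supplies the
divisibility by `p` needed for the classification. -/
theorem exists_models (hM : MulAction.IsPretransitive M (CpSemi p q)) :
    ∃ r : TableRow q, M.map E.hom ∈ r.models p := by
  refine _root_.exists_models (E.map_le M) (E.isPretransitive_iff.1 hM) ?_
  have h1 := MulAction.index_stabilizer_of_transitive M (1 : CpSemi p q)
  rw [card_semi] at h1
  rw [← Nat.card_congr (E.mapEquiv M).toEquiv]
  exact (Dvd.intro q h1.symm).trans
    ((Subgroup.index_dvd_card (MulAction.stabilizer M (1 : CpSemi p q))))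

/-- The representative of a row of the table in the holomorph. -/
def model (r : TableRow q) : Subgroup (Hol (CpSemi p q)) := (r.rep p).comap E.hom

theorem rep_mem_models (r : TableRow q) : r.rep p ∈ r.models p := by
  have h3 := SafePair.three_le p (q := q)
  cases r with
  | p2q2 => rfl
  | two_p2q2 => rfl
  | p2q u => exact Or.inl rfl
  | two_p2q u => exact Or.inl rfl
  | pq2 => exact ⟨0, Or.inl rfl⟩
  | two_pq2 => exact ⟨0, Or.inl rfl⟩
  | pq_nonabelian => exact ⟨0, by omega, 0, Or.inl rfl⟩
  | pq_cyclic => exact ⟨0, Or.inl rfl⟩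
  | two_pq_frobenius => exact ⟨0, by omega, 0, Or.inl rfl⟩
  | two_pq_dihedral => exact ⟨0, Or.inl rfl⟩

theorem map_model (r : TableRow q) : (E.model r).map E.hom = r.rep p :=
  E.map_comap (isTransPairs_of_models (rep_mem_models r)).1

theorem isPretransitive_model (r : TableRow q) :
    MulAction.IsPretransitive (E.model r) (CpSemi p q) := by
  rw [E.isPretransitive_iff, E.map_model]
  exact (isTransPairs_of_models (rep_mem_models r)).2

/-- The representative as a group of pairs. -/
noncomputable def modelEquiv (r : TableRow q) : E.model r ≃* r.rep p :=
  (E.mapEquiv _).trans (MulEquiv.subgroupCongr (E.map_model r))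

theorem permIso_model {r : TableRow q} (h : M.map E.hom ∈ r.models p) :
    PermIso M (CpSemi p q) (E.model r) (CpSemi p q) :=
  E.permIso_of_stabIso (E.isPretransitive_iff.2 (isTransPairs_of_models h).2)
    (E.isPretransitive_model r) (by rw [E.map_model]; exact stabIso_rep h)

variable {G : PermGroup (p * q)} {r : TableRow q}

/-- The permutation group `G` is in the row `r`. -/
def InRow (G : PermGroup (p * q)) (r : TableRow q) : Prop :=
  PermIso (E.model r) (CpSemi p q) G.grp (Fin (p * q))

theorem isRealisedBy_iff : G.IsRealisedBy.{u} (CpSemi p q) ↔ ∃ r, E.InRow G r := by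
  rw [G.isRealisedBy_iff (Nat.mul_pos (Fact.out : p.Prime).pos (SafePair.pos p q))]
  constructor
  · rintro ⟨M, hM, h⟩
    obtain ⟨r, hr⟩ := E.exists_models hM
    exact ⟨r, (E.permIso_model hr).symm.trans h⟩
  · rintro ⟨r, hr⟩
    exact ⟨_, E.isPretransitive_model r, hr⟩

variable {E}

theorem InRow.hasStructure (h : E.InRow G r) : r.HasStructure p G.grp := by
  obtain ⟨φ, -, -⟩ := h
  rw [hasStructure_iff]
  exact ⟨φ.symm.trans (E.modelEquiv r)⟩

/-- Since different rows have non-isomorphic representatives, the abstract group of a realised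
permutation group already determines its row. -/
theorem InRow.hasStructure_iff (h : E.InRow G r) {r' : TableRow q} :
    r'.HasStructure p G.grp ↔ r' = r := by
  constructor
  · intro h'
    have h1 := h.hasStructure
    rw [_root_.hasStructure_iff] at h1 h'
    obtain ⟨φ⟩ := h1
    obtain ⟨ψ⟩ := h'
    exact rep_injective ⟨ψ.symm.trans φ⟩
  · rintro rfl
    exact h.hasStructure

theorem InRow.unique (h : E.InRow G r) {r' : TableRow q} (h' : E.InRow G r') : r' = r :=
  h.hasStructure_iff.1 h'.hasStructure

theorem InRow.iso (h : E.InRow G r) {G' : PermGroup (p * q)} (h' : E.InRow G' r) : G.Iso G' :=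
  PermIso.trans (PermIso.symm h) h'

theorem InRow.of_iso (h : E.InRow G r) {G' : PermGroup (p * q)} (h' : G.Iso G') :
    E.InRow G' r := PermIso.trans h h'

theorem InRow.card (h : E.InRow G r) : Nat.card G.grp = r.order p := by
  obtain ⟨φ, -, -⟩ := h
  rw [← card_rep, ← Nat.card_congr φ.toEquiv, Nat.card_congr (E.modelEquiv r).toEquiv]

/-- A transitive subgroup is one of the models of some row; being isomorphic to `G` forces this row
to be `r`. So the count is that of the models. -/
theorem InRow.numTransitiveInHol (h : E.InRow G r) :
    numTransitiveInHol (CpSemi p q) G = r.numGroups p := by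
  rw [← card_models]
  refine Nat.card_congr
    { toFun := fun M => ⟨M.1.map E.hom, ?_⟩
      invFun := fun P => ⟨P.1.comap E.hom, ?_⟩
      left_inv := fun M => Subtype.ext (E.comap_map M.1)
      right_inv := fun P => Subtype.ext (E.map_comap (isTransPairs_of_models P.2).1) }
  · obtain ⟨M, hM, h'⟩ := M
    obtain ⟨r', hr'⟩ := E.exists_models hM
    have h1 : E.InRow G r' := PermIso.trans (PermIso.symm (E.permIso_model hr')) h'
    rwa [h.unique h1] at hr'
  · have h1 : (P.1.comap E.hom).map E.hom ∈ r.models p := by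
      rw [E.map_comap (isTransPairs_of_models P.2).1]
      exact P.2
    exact ⟨E.isPretransitive_iff.2 (isTransPairs_of_models h1).2,
      PermIso.trans (E.permIso_model h1) h⟩

theorem InRow.cardAutStab (h : E.InRow G r) (x : Fin (p * q)) :
    cardAutStab G.grp x = r.numAut p := by
  rw [← h.cardAutStab_eq G.2 1 x, E.cardAutStab_one, E.map_model, predAut_rep]

theorem InRow.hasRegularNormal_iff (h : E.InRow G r) :
    HasRegularNormal G.grp (Fin (p * q)) ↔ r.IsACG := by
  rw [← hasRegularNormalPairs_rep (p := p), ← E.map_model, ← E.hasRegularNormal_iff]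
  exact ⟨(PermIso.symm h).hasRegularNormal, PermIso.hasRegularNormal h⟩

variable (E)

theorem exists_inRow (r : TableRow q) : ∃ G : PermGroup (p * q), E.InRow G r := by
  obtain ⟨e⟩ : Nonempty (CpSemi p q ≃ Fin (p * q)) :=
    ⟨Finite.equivFinOfCardEq (card_semi p q)⟩
  let ψ : E.model r →* Equiv.Perm (Fin (p * q)) :=
    e.permCongrHom.toMonoidHom.comp (MulAction.toPermHom (E.model r) (CpSemi p q))
  have hψ : Function.Injective ψ := e.permCongrHom.injective.comp fun g h hgh =>
    Subtype.ext (Hol.eq_of_smul fun n => DFunLike.congr_fun hgh n)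
  have hP : PermIso (E.model r) (CpSemi p q) ψ.range (Fin (p * q)) := by
    refine ⟨MonoidHom.ofInjective hψ, e, fun g x => ?_⟩
    change _ = e (g • e.symm (e x))
    rw [e.symm_apply_apply]
  exact ⟨⟨ψ.range, hP.isPretransitive (E.isPretransitive_model r)⟩, hP⟩

end HolEmbedding

end Bridge

/-! ### Groups of order `p q` -/

section OrderPQ

open AffLine SafePair TableRow

variable {p q : ℕ} [Fact p.Prime]

section Lift

variable {G : Type*} [Group G]

theorem pow_val_natCast {x : G} (hx : orderOf x = p) (n : ℕ) : x ^ (n : ZMod p).val = x ^ n := by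
  rw [ZMod.val_natCast]
  conv_lhs => rw [← hx]
  exact pow_mod_orderOf x n

/-- The homomorphism from the cyclic group of order `p` given by an element of order `p`. -/
def zmodPow {x : G} (hx : orderOf x = p) : Multiplicative (ZMod p) →* G where
  toFun b := x ^ b.toAdd.val
  map_one' := by simp
  map_mul' b c := by
    rw [← pow_add, ← pow_val_natCast hx (b.toAdd.val + c.toAdd.val)]
    push_cast
    rw [ZMod.natCast_zmod_val, ZMod.natCast_zmod_val]
    rfl

theorem conj_pow_pow {x y : G} {k : ℕ} (h : y * x * y⁻¹ = x ^ k) (j m : ℕ) :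
    y ^ j * x ^ m * (y ^ j)⁻¹ = x ^ (k ^ j * m) := by
  induction j with
  | zero => simp
  | succ j ih =>
    calc y ^ (j + 1) * x ^ m * (y ^ (j + 1))⁻¹ = y * (y ^ j * x ^ m * (y ^ j)⁻¹) * y⁻¹ := by
          rw [pow_succ']
          group
      _ = x ^ (k ^ (j + 1) * m) := by
          rw [ih, ← conj_pow, h, ← pow_mul, pow_succ']
          congr 1
          ring

/-- `κ` generates `μ_q`, so `κ ↦ y` defines a homomorphism from `μ_q`; the relation between `x` and
`y` makes it compatible with the action on the powers of `x`. -/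
theorem exists_hom_of_semi [SafePair p q] {x y : G} (hx : orderOf x = p) (hy : orderOf y = q)
    {κ : (ZMod p)ˣ} (hκ : κ ∈ rootsOfUnity q (ZMod p)) (hκ1 : κ ≠ 1)
    (h : y * x * y⁻¹ = x ^ (κ : ZMod p).val) :
    ∃ f : CpSemi p q →* G, x ∈ f.range ∧ y ∈ f.range := by
  have hgen : ∀ z : rootsOfUnity q (ZMod p), z ∈ Subgroup.zpowers
      (⟨κ, hκ⟩ : rootsOfUnity q (ZMod p)) := by
    intro z
    obtain ⟨j, -, hj⟩ := (mem_iff_pow hκ hκ1 z.1).1 z.2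
    exact ⟨j, Subtype.ext (by simpa using hj)⟩
  have hord : orderOf y ∣ orderOf (⟨κ, hκ⟩ : rootsOfUnity q (ZMod p)) := by
    rw [hy, ← Subgroup.orderOf_coe]
    exact (pow_eq_one_iff hκ hκ1 _).1 (pow_orderOf_eq_one κ)
  let fg := monoidHomOfForallMemZpowers hgen hord
  have hfg : fg ⟨κ, hκ⟩ = y := monoidHomOfForallMemZpowers_apply_gen hgen hord
  have hcomp : ∀ z : rootsOfUnity q (ZMod p),
      (zmodPow hx).comp (((unitsAct p).comp (rootsOfUnity q (ZMod p)).subtype) z).toMonoidHom =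
        (MulAut.conj (fg z)).toMonoidHom.comp (zmodPow hx) := by
    intro z
    obtain ⟨j, -, hj⟩ := (mem_iff_pow hκ hκ1 z.1).1 z.2
    obtain rfl : z = ⟨κ, hκ⟩ ^ j := Subtype.ext hj.symm
    refine MonoidHom.ext fun b => ?_
    change x ^ ((κ ^ j : (ZMod p)ˣ) * b.toAdd : ZMod p).val =
      fg (⟨κ, hκ⟩ ^ j) * x ^ b.toAdd.val * (fg (⟨κ, hκ⟩ ^ j))⁻¹
    rw [map_pow, hfg, conj_pow_pow h, ← pow_val_natCast hx (_ * _)]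
    push_cast
    rw [ZMod.natCast_zmod_val, ZMod.natCast_zmod_val]
  refine ⟨SemidirectProduct.lift (zmodPow hx) fg hcomp,
    ⟨SemidirectProduct.inl (Multiplicative.ofAdd 1), ?_⟩,
    ⟨SemidirectProduct.inr ⟨κ, hκ⟩, ?_⟩⟩
  · rw [SemidirectProduct.lift_inl]
    change x ^ (1 : ZMod p).val = x
    rw [ZMod.val_one, pow_one]
  · rw [SemidirectProduct.lift_inr, hfg]

/-- A group of order `p q` is cyclic or isomorphic to `C_p ⋊ C_q`. -/
theorem isCyclic_or_nonempty_equiv [SafePair p q] [Finite G] (hG : Nat.card G = p * q) :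
    IsCyclic G ∨ Nonempty (CpSemi p q ≃* G) := by
  classical
  have hp : p.Prime := Fact.out
  have hq : q.Prime := SafePair.prime p
  have hqf : Fact q.Prime := ⟨hq⟩
  have hpq := SafePair.eq (p := p) (q := q)
  have hcop : Nat.Coprime p q := (Nat.coprime_primes hp hq).2 (by omega)
  obtain ⟨x, hx⟩ := exists_prime_orderOf_dvd_card' (G := G) p (hG ▸ dvd_mul_right p q)
  obtain ⟨y, hy⟩ := exists_prime_orderOf_dvd_card' (G := G) q (hG ▸ dvd_mul_left q p)
  -- Its index is `q`, the smallest prime factor of the group order `p q`.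
  have hnorm : (Subgroup.zpowers x).Normal := by
    refine Subgroup.normal_of_index_eq_minFac_card ?_
    have h1 := Subgroup.card_mul_index (Subgroup.zpowers x)
    rw [Nat.card_zpowers, hx, hG] at h1
    rw [Nat.eq_of_mul_eq_mul_left hp.pos h1, hG]
    refine le_antisymm ?_ (Nat.minFac_le_of_dvd hq.two_le (dvd_mul_left q p))
    have h2 := Nat.minFac_prime (n := p * q) (by nlinarith [hp.two_le, hq.two_le])
    rcases (h2.dvd_mul).1 (Nat.minFac_dvd _) with h3 | h3
    · rw [(Nat.prime_dvd_prime_iff_eq h2 hp).1 h3]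
      omega
    · rw [(Nat.prime_dvd_prime_iff_eq h2 hq).1 h3]
  have hmem : y * x * y⁻¹ ∈ Subgroup.zpowers x :=
    hnorm.conj_mem _ (Subgroup.mem_zpowers x) y
  obtain ⟨k, -, hk⟩ := Finset.mem_image.1 (mem_zpowers_iff_mem_range_orderOf.1 hmem)
  change x ^ k = _ at hk
  -- Conjugating `x` by `y ^ q = 1` raises it to the power `k ^ q`.
  have hkq : (k : ZMod p) ^ q = 1 := by
    have h1 := conj_pow_pow hk.symm q 1
    rw [← hy, pow_orderOf_eq_one] at h1
    have h2 : x ^ k ^ q = x ^ 1 := by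
      rw [hy] at h1
      simpa using h1.symm
    rw [pow_eq_pow_iff_modEq, hx] at h2
    have h3 := (ZMod.natCast_eq_natCast_iff _ _ _).2 h2
    simpa using h3
  let κ : (ZMod p)ˣ := Units.ofPowEqOne (k : ZMod p) q hkq hq.ne_zero
  have hκv : (κ : ZMod p) = k := rfl
  have hκ : κ ∈ rootsOfUnity q (ZMod p) := Units.ext (by simpa [hκv] using hkq)
  by_cases hκ1 : κ = 1
  · left
    have h1 : (k : ZMod p) = (1 : ℕ) := by
      rw [← hκv, hκ1]
      simp
    have h2 : x ^ k = x := by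
      have h3 := (ZMod.natCast_eq_natCast_iff _ _ _).1 h1
      rw [← hx, ← pow_eq_pow_iff_modEq, pow_one] at h3
      exact h3
    have hc : Commute y x := by
      rw [h2] at hk
      exact (mul_inv_eq_iff_eq_mul.1 hk.symm)
    refine isCyclic_of_orderOf_eq_card (y * x) ?_
    rw [hc.orderOf_mul_eq_mul_orderOf_of_coprime (by rw [hx, hy]; exact hcop.symm), hx, hy, hG,
      mul_comm]
  · right
    obtain ⟨f, hfx, hfy⟩ := exists_hom_of_semi hx hy hκ hκ1
      (by rw [hκv, pow_val_natCast hx, hk])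
    have hdvd : ∀ {g : G}, g ∈ f.range → orderOf g ∣ Nat.card f.range := fun {g} hg => by
      have := orderOf_dvd_natCard (⟨g, hg⟩ : f.range)
      rwa [Subgroup.orderOf_mk] at this
    have htop : f.range = ⊤ := by
      refine Subgroup.eq_top_of_card_eq _ (Nat.dvd_antisymm (Subgroup.card_subgroup_dvd_card _) ?_)
      rw [hG]
      exact hcop.mul_dvd_of_dvd_of_dvd (hx ▸ hdvd hfx) (hy ▸ hdvd hfy)
    have hsurj : Function.Surjective f := MonoidHom.range_eq_top.1 htop
    exact ⟨MulEquiv.ofBijective f ((Nat.bijective_iff_surjective_and_card f).2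
      ⟨hsurj, by rw [hG, card_semi]⟩)⟩

end Lift

variable [SafePair p q]

theorem smul_eq_self_iff_of_card {G X : Type*} [Group G] [MulAction G X] [Finite G]
    (h : MulAction.IsPretransitive G X) (hc : Nat.card G = Nat.card X) (x : X) (g : G) :
    g • x = x ↔ g = 1 := by
  have h1 := Subgroup.card_mul_index (MulAction.stabilizer G x)
  rw [MulAction.index_stabilizer_of_transitive, ← hc] at h1
  have h2 : Nat.card (MulAction.stabilizer G x) = 1 :=
    Nat.eq_of_mul_eq_mul_right Nat.card_pos (h1.trans (one_mul _).symm)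
  rw [← MulAction.mem_stabilizer_iff, Subgroup.card_eq_one.1 h2, Subgroup.mem_bot]

theorem PermIso.of_regular {G X H Y : Type*} [Group G] [MulAction G X] [Group H] [MulAction H Y]
    [Finite G] [Finite H] [Nonempty X] [Nonempty Y]
    (hG : MulAction.IsPretransitive G X) (hH : MulAction.IsPretransitive H Y) (φ : G ≃* H)
    (hGX : Nat.card G = Nat.card X) (hHY : Nat.card H = Nat.card Y) :
    PermIso G X H Y := by
  obtain ⟨x⟩ := ‹Nonempty X›
  obtain ⟨y⟩ := ‹Nonempty Y›
  exact permIso_of_stabilizer hG hH φ x y fun g => by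
    rw [smul_eq_self_iff_of_card hG hGX, smul_eq_self_iff_of_card hH hHY, map_eq_one_iff _ φ.injective]

variable (E : HolEmbedding p q)

/-- For groups of order `p q` the stabilisers are trivial, so an isomorphism of abstract groups is
already one of permutation groups. -/
theorem HolEmbedding.inRow_of_equiv {G : PermGroup (p * q)} {r : TableRow q}
    (hr : r.order p = p * q) (φ : r.rep p ≃* G.grp) : E.InRow G r := by
  have hpos : 0 < p * q := Nat.mul_pos (Fact.out : p.Prime).pos (SafePair.pos p q)
  have hcard : Nat.card (r.rep p) = p * q := by rw [card_rep, hr]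
  have h1 : Nat.card (E.model r) = p * q := by
    rw [Nat.card_congr (E.modelEquiv r).toEquiv, hcard]
  have h2 : Nat.card G.grp = p * q := by rw [← Nat.card_congr φ.toEquiv, hcard]
  have : Nonempty (Fin (p * q)) := ⟨⟨0, hpos⟩⟩
  have : Finite (E.model r) := Nat.finite_of_card_ne_zero (by rw [h1]; exact hpos.ne')
  exact PermIso.of_regular (E.isPretransitive_model r) G.2 ((E.modelEquiv r).trans φ)
    (by rw [h1, card_semi]) (by rw [h2, Nat.card_fin])

theorem HolEmbedding.inRow_nonabelian {G : PermGroup (p * q)}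
    (h : Nonempty (G.grp ≃* CpSemi p q)) : E.InRow G pq_nonabelian := by
  obtain ⟨φ⟩ := (hasStructure_iff (p := p) (pq_nonabelian : TableRow q) G.grp).1 h
  exact E.inRow_of_equiv rfl φ.symm

theorem HolEmbedding.inRow_cyclic {G : PermGroup (p * q)}
    (h : Nonempty (G.grp ≃* Multiplicative (ZMod (p * q)))) : E.InRow G pq_cyclic := by
  obtain ⟨φ⟩ := (hasStructure_iff (p := p) (pq_cyclic : TableRow q) G.grp).1 h
  exact E.inRow_of_equiv rfl φ.symm

theorem HolEmbedding.exists_inRow_of_card {G : PermGroup (p * q)}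
    (h : Nat.card G.grp = p * q) : ∃ r, E.InRow G r := by
  rcases isCyclic_or_nonempty_equiv h with h1 | h1
  · have e := zmodCyclicMulEquiv h1
    rw [h] at e
    exact ⟨_, E.inRow_cyclic ⟨e.symm⟩⟩
  · obtain ⟨φ⟩ := h1
    exact ⟨_, E.inRow_nonabelian ⟨φ.symm⟩⟩

end OrderPQ

/-! ### Counting isomorphism types -/

section Types

open SafePair TableRow

variable {p q : ℕ}

/-- The rows without a parameter. -/
def TableRow.single (q : ℕ) : Fin 8 → TableRow q :=
  ![p2q2, two_p2q2, pq2, two_pq2, pq_nonabelian, pq_cyclic, two_pq_frobenius, two_pq_dihedral]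

/-- The rows of the table as a disjoint union. -/
def TableRow.equivSum (q : ℕ) :
    TableRow q ≃ Fin 8 ⊕ (Fin ((q + 1) / 2) ⊕ Fin ((q + 1) / 2)) where
  toFun
    | p2q2 => Sum.inl 0
    | two_p2q2 => Sum.inl 1
    | pq2 => Sum.inl 2
    | two_pq2 => Sum.inl 3
    | pq_nonabelian => Sum.inl 4
    | pq_cyclic => Sum.inl 5
    | two_pq_frobenius => Sum.inl 6
    | two_pq_dihedral => Sum.inl 7
    | p2q u => Sum.inr (Sum.inl u)
    | two_p2q u => Sum.inr (Sum.inr u)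
  invFun := Sum.elim (single q) (Sum.elim p2q two_p2q)
  left_inv r := by cases r <;> rfl
  right_inv x := by
    rcases x with i | u | u
    · fin_cases i <;> rfl
    · rfl
    · rfl

theorem TableRow.card_subtype (K : TableRow q → Prop) :
    Nat.card {r // K r} = Nat.card {i // K (single q i)} +
      (Nat.card {u // K (p2q u)} + Nat.card {u // K (two_p2q u)}) := by
  have h : {r // K r} ≃ {i // K (single q i)} ⊕ ({u // K (p2q u)} ⊕ {u // K (two_p2q u)}) :=
    ((equivSum q).symm.subtypeEquivOfSubtype.symm.trans
      (Equiv.subtypeSum.trans (Equiv.sumCongr (Equiv.refl _) Equiv.subtypeSum)))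
  rw [Nat.card_congr h, Nat.card_sum, Nat.card_sum]

theorem card_fin_val_eq_zero {n : ℕ} (hn : 0 < n) : Nat.card {u : Fin n // u.val = 0} = 1 := by
  have : Unique {u : Fin n // u.val = 0} :=
    { default := ⟨⟨0, hn⟩, rfl⟩
      uniq := fun u => Subtype.ext (Fin.ext u.2) }
  exact Nat.card_unique

theorem card_fin_val_ne_zero {n : ℕ} (hn : 0 < n) :
    Nat.card {u : Fin n // ¬ u.val = 0} = n - 1 := by
  rw [Nat.card_eq_fintype_card, Fintype.card_subtype_compl, Fintype.card_fin,
    ← Nat.card_eq_fintype_card, card_fin_val_eq_zero hn]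

theorem Nat.card_subtype_image {A B : Type*} {f : A → B} (hf : Function.Injective f)
    (K : B → Prop) : Nat.card {b // (∃ a, b = f a) ∧ K b} = Nat.card {a // K (f a)} := by
  refine (Nat.card_congr (Equiv.ofBijective (fun a : {a // K (f a)} =>
    (⟨f a.1, ⟨a.1, rfl⟩, a.2⟩ : {b // (∃ a, b = f a) ∧ K b})) ⟨fun a b h => ?_, ?_⟩)).symm
  · exact Subtype.ext (hf (congrArg (fun x : {b // (∃ a, b = f a) ∧ K b} => x.1) h))
  · rintro ⟨_, ⟨a, rfl⟩, ha⟩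
    exact ⟨⟨a, ha⟩, rfl⟩

theorem Nat.card_subtype_false {A : Type*} {K : A → Prop} (h : ∀ a, ¬ K a) :
    Nat.card {a // K a} = 0 := by
  have : IsEmpty {a // K a} := ⟨fun a => h a.1 a.2⟩
  exact Nat.card_of_isEmpty

variable [Fact p.Prime] [SafePair p q]

theorem card_tableRow (p : ℕ) [SafePair p q] : Nat.card (TableRow q) = q + 9 := by
  obtain ⟨k, hk⟩ := SafePair.odd p q
  rw [Nat.card_congr (TableRow.equivSum q), Nat.card_sum, Nat.card_sum, Nat.card_fin,
    Nat.card_fin]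
  omega

theorem card_not_isACG (p : ℕ) [SafePair p q] :
    Nat.card {r : TableRow q // ¬ r.IsACG} = q - 1 := by
  obtain ⟨k, hk⟩ := SafePair.odd p q
  rw [TableRow.card_subtype, Nat.card_subtype_false (fun i => by fin_cases i <;> exact not_not.2 trivial)]
  change 0 + (Nat.card {u : Fin ((q + 1) / 2) // ¬ u.val = 0} +
    Nat.card {u : Fin ((q + 1) / 2) // ¬ u.val = 0}) = _
  rw [card_fin_val_ne_zero (by omega)]
  omega

theorem card_isACG (p : ℕ) [SafePair p q] : Nat.card {r : TableRow q // r.IsACG} = 10 := by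
  obtain ⟨k, hk⟩ := SafePair.odd p q
  rw [TableRow.card_subtype, Nat.card_congr (Equiv.subtypeUnivEquiv fun i => by fin_cases i <;> exact trivial),
    Nat.card_fin]
  change 8 + (Nat.card {u : Fin ((q + 1) / 2) // u.val = 0} +
    Nat.card {u : Fin ((q + 1) / 2) // u.val = 0}) = _
  rw [card_fin_val_eq_zero (by omega)]

theorem order_eq_iff_p2q (r : TableRow q) :
    r.order p = p ^ 2 * q ↔ ∃ u, r = p2q u := by
  have h3 := SafePair.three_le p (q := q)
  have hpq := SafePair.eq (p := p) (q := q)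
  have hpos : 0 < p * q := Nat.mul_pos (by omega) (by omega)
  constructor
  · intro h
    rw [order_eq, show p ^ 2 * q = p * q * p by ring] at h
    have h1 := Nat.eq_of_mul_eq_mul_left hpos h
    cases r with
    | p2q u => exact ⟨u, rfl⟩
    | _ =>
      exfalso
      simp only [cofactor] at h1
      first | omega | nlinarith
  · rintro ⟨u, rfl⟩
    rfl

theorem order_eq_iff_two_p2q (r : TableRow q) :
    r.order p = 2 * p ^ 2 * q ↔ ∃ u, r = two_p2q u := by
  have h3 := SafePair.three_le p (q := q)
  have hpq := SafePair.eq (p := p) (q := q)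
  have hpos : 0 < p * q := Nat.mul_pos (by omega) (by omega)
  constructor
  · intro h
    rw [order_eq, show 2 * p ^ 2 * q = p * q * (2 * p) by ring] at h
    have h1 := Nat.eq_of_mul_eq_mul_left hpos h
    cases r with
    | two_p2q u => exact ⟨u, rfl⟩
    | _ =>
      exfalso
      simp only [cofactor] at h1
      first | omega | nlinarith
  · rintro ⟨u, rfl⟩
    rfl

/-- Byott's formula read off from the columns of the table: the number of structures is the product
of the two other counts divided by `|Aut(N)| = p (p - 1)`. -/
theorem numGroups_mul_numAut (r : TableRow q) :
    r.numGroups p * r.numAut p = r.numHGS p * (p * (p - 1)) := by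
  have h3 := SafePair.three_le p (q := q)
  cases r with
  | p2q u =>
    simp only [numGroups, numAut, TableRow.numHGS]
    split_ifs <;> first | omega | ring
  | two_p2q u =>
    simp only [numGroups, numAut, TableRow.numHGS]
    split_ifs <;> ring
  | pq_nonabelian => rfl
  | _ =>
    simp only [numGroups, numAut, TableRow.numHGS]
    ring

variable (E : HolEmbedding p q) {G : PermGroup (p * q)}

theorem HolEmbedding.numTypes_eq {Q : PermGroup (p * q) → Prop} {K : TableRow q → Prop}
    (h : ∀ G, Q G ↔ ∃ r, E.InRow G r ∧ K r) :
    PermGroup.numTypes (p * q) Q = Nat.card {r // K r} := by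
  choose M hM using E.exists_inRow
  refine (Nat.card_congr (Equiv.ofBijective (fun r : {r // K r} =>
    (⟨Quotient.mk _ (M r.1), M r.1, rfl, (h _).2 ⟨r.1, hM r.1, r.2⟩⟩ :
      {c : Quotient (PermGroup.isoSetoid (p * q)) //
        ∃ G, Quotient.mk (PermGroup.isoSetoid (p * q)) G = c ∧ Q G})) ⟨?_, ?_⟩)).symm
  · rintro ⟨r, hr⟩ ⟨r', hr'⟩ heq
    have h1 : (M r).Iso (M r') := Quotient.exact (congrArg Subtype.val heq)
    exact Subtype.ext ((hM r').unique ((hM r).of_iso h1))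
  · rintro ⟨_, G, rfl, hG⟩
    obtain ⟨r, hr, hK⟩ := (h G).1 hG
    exact ⟨⟨r, hK⟩, Subtype.ext (Quotient.sound ((hM r).iso hr))⟩

variable {E} {r : TableRow q}

theorem HolEmbedding.InRow.numHGS (h : E.InRow G r) {F : SeparableExtension.{u}}
    (hF : F.Realises G) : F.numHGS (CpSemi p q) = r.numHGS p := by
  obtain ⟨z, hz, hz1⟩ := exists_root p q
  have hp := (Fact.out : p.Prime).two_le
  have hpos : 0 < p * q := Nat.mul_pos (by omega) (SafePair.pos p q)
  have h1 := hF.numHGS_mul (CpSemi p q) ⟨0, hpos⟩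
  rw [h.numTransitiveInHol, h.cardAutStab, numGroups_mul_numAut, card_mulAut_semi hz hz1] at h1
  exact Nat.eq_of_mul_eq_mul_right (Nat.mul_pos (by omega) (by omega)) h1

theorem HolEmbedding.InRow.isAlmostClassicallyGalois_iff (h : E.InRow G r)
    {F : SeparableExtension.{u}} (hF : F.Realises G) :
    F.IsAlmostClassicallyGalois ↔ r.IsACG :=
  hF.isAlmostClassicallyGalois_iff.trans h.hasRegularNormal_iff

/-- Whether an extension is almost classically Galois depends only on the row, and some extension
realises `G`, so the quantifier is not vacuous. The parameter `c` allows for the property, its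
negation and the trivial condition. -/
theorem HolEmbedding.InRow.forall_realises_iff (h : E.InRow G r) {c : Prop → Prop} :
    (∀ F : SeparableExtension.{u}, F.Realises G → c F.IsAlmostClassicallyGalois) ↔ c r.IsACG := by
  constructor
  · intro h1
    obtain ⟨F, hF⟩ := G.exists_realises.{u}
      (Nat.mul_pos (Fact.out : p.Prime).pos (SafePair.pos p q))
    rw [← propext (h.isAlmostClassicallyGalois_iff hF)]
    exact h1 F hF
  · intro h1 F hF
    rw [propext (h.isAlmostClassicallyGalois_iff hF)]
    exact h1

theorem exists_realises_of_isGalois (F : SeparableExtension.{u}) [IsGalois F.K F.L]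
    {A : Type} [Group A] {n : ℕ} (hA : Nat.card A = n) (h : Nonempty ((F.L ≃ₐ[F.K] F.L) ≃* A)) :
    ∃ G : PermGroup n, F.Realises G ∧ Nonempty (G.grp ≃* A) := by
  obtain ⟨φ⟩ := h
  obtain ⟨ψ⟩ := F.exists_galEquiv
  have hn : Module.finrank F.K F.L = n := by
    rw [← IsGalois.card_aut_eq_finrank, Nat.card_congr φ.toEquiv, hA]
  obtain ⟨G, hG⟩ := F.exists_realises hn
  refine ⟨G, hG, ?_⟩
  obtain ⟨-, θ, -⟩ := hG
  exact ⟨(θ.trans ψ).trans φ⟩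

end Types

theorem theorem4p12 (p q : ℕ) (hp : p.Prime) (hq : q.Prime) (hq3 : 3 ≤ q) (hpq : p = 2 * q + 1) :
    -- the number of isomorphism types
    PermGroup.numTypes (p * q) (fun G => G.IsRealisedBy.{u} (CpSemi p q)) = q + 9 ∧
    -- the list: every realised group lies in exactly one row of the table, each row occurs,
    -- and the groups in a row form a single isomorphism type
    (∀ G : PermGroup (p * q), G.IsRealisedBy.{u} (CpSemi p q) →
      ∃! r : TableRow q, r.HasStructure p G.grp) ∧
    (∀ r : TableRow q, ∃ G : PermGroup (p * q),
      G.IsRealisedBy.{u} (CpSemi p q) ∧ r.HasStructure p G.grp) ∧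
    (∀ (r : TableRow q) (G G' : PermGroup (p * q)),
      G.IsRealisedBy.{u} (CpSemi p q) → r.HasStructure p G.grp →
      G'.IsRealisedBy.{u} (CpSemi p q) → r.HasStructure p G'.grp → G.Iso G') ∧
    -- the numerical data of each row
    (∀ (r : TableRow q) (G : PermGroup (p * q)),
      G.IsRealisedBy.{u} (CpSemi p q) → r.HasStructure p G.grp →
        Nat.card G.grp = r.order p ∧
        numTransitiveInHol (CpSemi p q) G = r.numGroups p ∧
        (∀ x : Fin (p * q), cardAutStab G.grp x = r.numAut p) ∧
        ∀ F : SeparableExtension.{u}, F.Realises G →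
          F.numHGS (CpSemi p q) = r.numHGS p ∧ (F.IsAlmostClassicallyGalois ↔ r.IsACG)) ∧
    -- both regular groups are included
    (∀ G : PermGroup (p * q), Nat.card G.grp = p * q → G.IsRealisedBy.{u} (CpSemi p q)) ∧
    (∀ F : SeparableExtension.{u}, IsGalois F.K F.L →
      (Nonempty ((F.L ≃ₐ[F.K] F.L) ≃* Multiplicative (ZMod (p * q))) →
        F.numHGS (CpSemi p q) = 2 * (q - 1)) ∧
      (Nonempty ((F.L ≃ₐ[F.K] F.L) ≃* CpSemi p q) →
        F.numHGS (CpSemi p q) = 2 * p * (q - 2) + 2)) ∧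
    -- almost classically Galois extensions
    PermGroup.numTypes (p * q) (fun G => G.IsRealisedBy.{u} (CpSemi p q) ∧
      ∀ F : SeparableExtension.{u}, F.Realises G → ¬ F.IsAlmostClassicallyGalois) = q - 1 ∧
    PermGroup.numTypes (p * q) (fun G => G.IsRealisedBy.{u} (CpSemi p q) ∧
      ∀ F : SeparableExtension.{u}, F.Realises G → F.IsAlmostClassicallyGalois) = 10 ∧
    (∀ m : ℕ, m = p ^ 2 * q ∨ m = 2 * p ^ 2 * q →
      PermGroup.numTypes (p * q) (fun G => G.IsRealisedBy.{u} (CpSemi p q) ∧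
        Nat.card G.grp = m) = (q + 1) / 2 ∧
      PermGroup.numTypes (p * q) (fun G => G.IsRealisedBy.{u} (CpSemi p q) ∧
        Nat.card G.grp = m ∧
        ∀ F : SeparableExtension.{u}, F.Realises G → F.IsAlmostClassicallyGalois) = 1 ∧
      PermGroup.numTypes (p * q) (fun G => G.IsRealisedBy.{u} (CpSemi p q) ∧
        Nat.card G.grp = m ∧
        ∀ F : SeparableExtension.{u}, F.Realises G → ¬ F.IsAlmostClassicallyGalois)
        = (q - 1) / 2) := by
  have hpf : Fact p.Prime := ⟨hp⟩
  have hsp : SafePair p q := ⟨hq, hq3, hpq⟩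
  obtain ⟨E⟩ := nonempty_holEmbedding p q
  have hodd := SafePair.odd p q
  have hreal : ∀ G : PermGroup (p * q), G.IsRealisedBy.{u} (CpSemi p q) ↔ ∃ r, E.InRow G r :=
    fun G => E.isRealisedBy_iff
  have hrow : ∀ {r : TableRow q} {G : PermGroup (p * q)}, G.IsRealisedBy.{u} (CpSemi p q) →
      r.HasStructure p G.grp → E.InRow G r := by
    intro r G hG hr
    obtain ⟨r', hr'⟩ := (hreal G).1 hG
    rw [hr'.hasStructure_iff] at hr
    exact hr ▸ hr'
  -- One statement serves all the final counts: `c` is the identity, negation or the constant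
  -- `True`, and `R` is either trivial or a condition on the order.
  have hcond : ∀ (G : PermGroup (p * q)) (c : Prop → Prop) (R : PermGroup (p * q) → Prop)
      (S : TableRow q → Prop), (∀ r, E.InRow G r → (R G ↔ S r)) →
      ((G.IsRealisedBy.{u} (CpSemi p q) ∧ R G ∧
        ∀ F : SeparableExtension.{u}, F.Realises G → c F.IsAlmostClassicallyGalois) ↔
        ∃ r, E.InRow G r ∧ S r ∧ c r.IsACG) := by
    intro G c R S hRS
    rw [hreal]
    constructor
    · rintro ⟨⟨r, hr⟩, h1, h2⟩
      exact ⟨r, hr, (hRS r hr).1 h1, hr.forall_realises_iff.1 h2⟩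
    · rintro ⟨r, hr, h1, h2⟩
      exact ⟨⟨r, hr⟩, (hRS r hr).2 h1, hr.forall_realises_iff.2 h2⟩
  have hcard : ∀ (m : ℕ) (G : PermGroup (p * q)) (r : TableRow q), E.InRow G r →
      (Nat.card G.grp = m ↔ r.order p = m) := fun m G r hr => by rw [hr.card]
  refine ⟨?_, ?_, ?_, ?_, ?_, ?_, ?_, ?_, ?_, ?_⟩
  · rw [E.numTypes_eq (K := fun _ => True) fun G => by simpa using hreal G,
      Nat.card_subtype_true, card_tableRow p]
  · intro G hG
    obtain ⟨r, hr⟩ := (hreal G).1 hG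
    exact ⟨r, hr.hasStructure, fun r' hr' => hr.hasStructure_iff.1 hr'⟩
  · intro r
    obtain ⟨G, hG⟩ := E.exists_inRow r
    exact ⟨G, (hreal G).2 ⟨r, hG⟩, hG.hasStructure⟩
  · intro r G G' hG hr hG' hr'
    exact (hrow hG hr).iso (hrow hG' hr')
  · intro r G hG hr
    have h := hrow hG hr
    exact ⟨h.card, h.numTransitiveInHol, h.cardAutStab,
      fun F hF => ⟨h.numHGS hF, h.isAlmostClassicallyGalois_iff hF⟩⟩
  · intro G hG
    exact (hreal G).2 (E.exists_inRow_of_card hG)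
  · intro F hF
    refine ⟨fun h => ?_, fun h => ?_⟩
    · obtain ⟨G, hG, h1⟩ := exists_realises_of_isGalois F
        (A := Multiplicative (ZMod (p * q))) (Nat.card_zmod (p * q)) h
      exact (E.inRow_cyclic h1).numHGS hG
    · obtain ⟨G, hG, h1⟩ := exists_realises_of_isGalois F (card_semi p q) h
      exact (E.inRow_nonabelian h1).numHGS hG
  · rw [E.numTypes_eq (K := fun r => ¬ r.IsACG) fun G => by
      simpa using hcond G Not (fun _ => True) (fun _ => True) fun _ _ => Iff.rfl]
    exact card_not_isACG p
  · rw [E.numTypes_eq (K := fun r => r.IsACG) fun G => by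
      simpa using hcond G id (fun _ => True) (fun _ => True) fun _ _ => Iff.rfl]
    exact card_isACG p
  · intro m hm
    have hf : ∃ f : Fin ((q + 1) / 2) → TableRow q, Function.Injective f ∧
        (∀ r : TableRow q, r.order p = m ↔ ∃ u, r = f u) ∧ ∀ u, (f u).IsACG = (u.val = 0) := by
      rcases hm with rfl | rfl
      · exact ⟨TableRow.p2q, fun u v h => TableRow.p2q.inj h, order_eq_iff_p2q, fun _ => rfl⟩
      · exact ⟨TableRow.two_p2q, fun u v h => TableRow.two_p2q.inj h, order_eq_iff_two_p2q,
          fun _ => rfl⟩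
    obtain ⟨f, hf, hord, hACG⟩ := hf
    have key : ∀ c : Prop → Prop, PermGroup.numTypes (p * q) (fun G =>
        G.IsRealisedBy.{u} (CpSemi p q) ∧ Nat.card G.grp = m ∧
          ∀ F : SeparableExtension.{u}, F.Realises G → c F.IsAlmostClassicallyGalois) =
        Nat.card {u : Fin ((q + 1) / 2) // c (u.val = 0)} := by
      intro c
      rw [E.numTypes_eq fun G => hcond G c (fun G => Nat.card G.grp = m)
        (fun r => ∃ u, r = f u) fun r hr => (hcard m G r hr).trans (hord r),
        Nat.card_subtype_image hf fun r => c r.IsACG]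
      simp only [hACG]
    obtain ⟨k, hk⟩ := hodd
    refine ⟨?_, ?_, ?_⟩
    · have h1 := key fun _ => True
      simp only [implies_true, and_true] at h1
      rw [h1, Nat.card_subtype_true, Nat.card_fin]
    · exact (key id).trans (card_fin_val_eq_zero (by omega))
    · refine (key Not).trans ((card_fin_val_ne_zero (by omega)).trans ?_)
      omega
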